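/- **Setting.** Fix integers $d,r,k\ge 0$. Let $\mathcal A$ be the algebra of non-commutative polynomials with complex coefficients in the letters $X_1,\dots,X_d,Z_1,\dots,Z_r,Z_1^*,\dots,Z_r^*$, with the conjugate-linear, product-reversing involution such that $X_i^*=X_i$ and which exchanges $Z_j$ and $Z_j^*$. For matrices $Y=(Y_1,\dots,Y_d)$, $A=(A_1,\dots,A_r)$ of the same size, $P(Y,A)$ is obtained by substituting $Y_i$ for $X_i$, $A_j$ for $Z_j$ and the conjugate transpose of $A_j$ for $Z_j^*$. A *Wigner matrix* is, for each size $N$, a random $N\times N$ Hermitian (possibly real symmetric) matrix $Y^N$ whose entries $(Y^N_{ij})_{i\le j}$ are independent, with $\mathbb E[Y^N_{ij}]=0$ for all $i,j$, $\mathbb E[|Y^N_{ij}|^2]=1/N$ for $i\ne j$, and $\sup_{N,i,j}\mathbb E[|\sqrt N\,Y^N_{ij}|^p]<\infty$ for every $p\in\mathbb N$. A *GUE matrix* of size $N$ is a Hermitian random matrix $X$ such that $\sqrt N X_{ii}$ ($1\le i\le N$), $\sqrt{2N}\,\mathrm{Re}\,X_{ij}$ and $\sqrt{2N}\,\mathrm{Im}\,X_{ij}$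 ($i<j$) are independent standard real Gaussian variables. A *GOE matrix* is a real symmetric random matrix $X$ such that $\sqrt{N/2}\,X_{ii}$ ($1\le i\le N$) and $\sqrt N X_{ij}$ ($i<j$) are independent standard real Gaussian variables. For each $N$, let $Y^N=(Y^N_1,\dots,Y^N_d)$ be independent Wigner matrices, let $X^N=(X^N_1,\dots,X^N_d)$ be independent GUE matrices, independent from $Y^N$, and let $A^N=(A^N_1,\dots,A^N_r)$ be deterministic $N\times N$ matrices with $\sup_{N,i}\|A^N_i\|<\infty$ (operator norm). Let $P_1,\dots,P_k,R_1,\dots,R_k\in\mathcal A$ with $P_j^*=P_j$ for every $j$. For $t=(t_1,\dots,t_k)\in\mathbb R^k$ put $\langle t\rangle=1+\max_j|t_j|$ (equal to $1$ if $k=0$) and $$Q_t(Y,A)=e^{\mathbf i t_1P_1(Y,A)}R_1(Y,A)\cdots e^{\mathbf i t_kP_k(Y,A)}R_k(Y,A).$$ **Proposition.** For all $N$, $t\in\mathbb R^k$ and $\mathbf x,\mathbf y\in\mathbb C^N$, the random variable $\langle \mathbf x,Q_t(X^N,A^N)\mathbf y\rangle$ is integrable. Moreover, for every $\varepsilon>0$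 and every $\kappa>0$ there are $C$ and $N_0$ such that for all $N\ge N_0$, all $t\in\mathbb R^k$ and all nonzero $\mathbf x,\mathbf y\in\mathbb C^N$, $$\mathbb P\Big(\big|\langle \mathbf x,Q_t(Y^N,A^N)\mathbf y\rangle-\mathbb E\langle \mathbf x,Q_t(X^N,A^N)\mathbf y\rangle\big|\ \ge\ C\,N^{\varepsilon}\frac{\langle t\rangle^{4}}{\sqrt N}\,\|\mathbf x\|_2\|\mathbf y\|_2\Big)\le N^{-\kappa}.$$ If in addition each $Y^N_s$ is a GUE or a GOE matrix, then the same holds with $\langle t\rangle^{4}$ replaced by $\langle t\rangle^{2}$. -/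

import Mathlib

open MeasureTheory ProbabilityTheory
open scoped ENNReal ComplexConjugate

namespace WignerPoly

/-! ### Non-commutative polynomials -/

/-- The `d + 2r` letters `X_1, …, X_d`, `Z_1, …, Z_r` and `Z_1^*, …, Z_r^*`. -/
inductive Letter (d r : ℕ) : Type
  | X (i : Fin d) : Letter d r
  | Z (j : Fin r) : Letter d r
  | Zstar (j : Fin r) : Letter d r

/-- The involution on letters: `X_i^* = X_i`, and `Z_j`, `Z_j^*` are exchanged. -/
def Letter.star {d r : ℕ} : Letter d r → Letter d r
  | .X i => .X i
  | .Z j => .Zstar j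
  | .Zstar j => .Z j

/-- Non-commutative polynomials with complex coefficients in the letters: the complex algebra of the
free monoid on the letters. -/
abbrev NCPoly (d r : ℕ) : Type := MonoidAlgebra ℂ (FreeMonoid (Letter d r))

/-- The involution on words: `(a_1 a_2 ⋯ a_n)^* = a_n^* ⋯ a_2^* a_1^*`. -/
def wordStar {d r : ℕ} (w : FreeMonoid (Letter d r)) : FreeMonoid (Letter d r) :=
  (FreeMonoid.map Letter.star w).reverse

/-- The conjugate-linear involution `∑ c_w w ↦ ∑ conj(c_w) w^*` on non-commutative polynomials. -/
noncomputable def NCPoly.adjoint {d r : ℕ} (p : NCPoly d r) : NCPoly d r :=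
  p.coeff.sum fun w c => MonoidAlgebra.single (wordStar w) (conj c)

/-- The matrix substituted for each letter: `X_i` becomes `Y_i`, `Z_j` becomes `A_j` and `Z_j^*`
becomes the conjugate transpose of `A_j`. -/
def letterValue {d r N : ℕ} (Y : Fin d → Matrix (Fin N) (Fin N) ℂ)
    (A : Fin r → Matrix (Fin N) (Fin N) ℂ) : Letter d r → Matrix (Fin N) (Fin N) ℂ
  | .X i => Y i
  | .Z j => A j
  | .Zstar j => (A j).conjTranspose

/-- The evaluation `P(Y, A)` of a non-commutative polynomial, an algebra homomorphism in `P`. -/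
noncomputable def NCPoly.eval {d r N : ℕ} (Y : Fin d → Matrix (Fin N) (Fin N) ℂ)
    (A : Fin r → Matrix (Fin N) (Fin N) ℂ) (p : NCPoly d r) : Matrix (Fin N) (Fin N) ℂ :=
  MonoidAlgebra.lift ℂ (Matrix (Fin N) (Fin N) ℂ) (FreeMonoid (Letter d r))
    (FreeMonoid.lift (letterValue Y A)) p

/-- The ordered product
`e^{i t_1 P_1(Y,A)} R_1(Y,A) e^{i t_2 P_2(Y,A)} R_2(Y,A) ⋯ e^{i t_k P_k(Y,A)} R_k(Y,A)`. -/
noncomputable def expProduct {d r k N : ℕ} (P R : Fin k → NCPoly d r) (t : Fin k → ℝ)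
    (Y : Fin d → Matrix (Fin N) (Fin N) ℂ) (A : Fin r → Matrix (Fin N) (Fin N) ℂ) :
    Matrix (Fin N) (Fin N) ℂ :=
  (List.ofFn fun j : Fin k =>
    NormedSpace.exp ((Complex.I * (t j : ℂ)) • (P j).eval Y A) * (R j).eval Y A).prod

/-- The sesquilinear form `⟨x, M y⟩`, conjugate-linear in `x` and linear in `y`. -/
noncomputable def quadForm {N : ℕ} (x : EuclideanSpace ℂ (Fin N)) (M : Matrix (Fin N) (Fin N) ℂ)
    (y : EuclideanSpace ℂ (Fin N)) : ℂ :=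
  inner ℂ x (Matrix.toEuclideanCLM (n := Fin N) (𝕜 := ℂ) M y)

/-! ### Random matrices -/

/-- All entries of a matrix, as one vector; it carries the product measurable structure, which is
the one used for the independence of random matrices. -/
def entries {N : ℕ} (M : Matrix (Fin N) (Fin N) ℂ) : Fin N × Fin N → ℂ := fun p => M p.1 p.2

/-- `Y` is an `N × N` random matrix that is (almost surely) Hermitian, with independent entries on
and above the diagonal, centered entries, and off-diagonal entries of variance `1/N`. Real symmetric
random matrices are the special case of almost surely real entries. (Integrability of the entries
comes from the moment bound in `IsWigner`.) -/
structure IsWignerAt {Ω : Type*} [MeasurableSpace Ω] (μ : Measure Ω) {N : ℕ}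
    (Y : Ω → Matrix (Fin N) (Fin N) ℂ) : Prop where
  measurable : ∀ i j, Measurable fun ω => Y ω i j
  hermitian : ∀ᵐ ω ∂μ, (Y ω).IsHermitian
  indep : iIndepFun (fun (p : {p : Fin N × Fin N // p.1 ≤ p.2}) ω => Y ω p.1.1 p.1.2) μ
  centered : ∀ i j, ∫ ω, Y ω i j ∂μ = 0
  variance : ∀ i j, i ≠ j → ∫ ω, ‖Y ω i j‖ ^ 2 ∂μ = 1 / (N : ℝ)

/-- A sequence of Wigner matrices, one of each size `N`, whose rescaled entries have moments of
every order bounded uniformly in the size and in the position of the entry. -/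
structure IsWigner {Ω : ℕ → Type*} [∀ N, MeasurableSpace (Ω N)] (μ : ∀ N, Measure (Ω N))
    (Y : ∀ N, Ω N → Matrix (Fin N) (Fin N) ℂ) : Prop where
  wigner : ∀ N, IsWignerAt (μ N) (Y N)
  moments : ∀ p : ℕ,
    ⨆ (N : ℕ) (i : Fin N) (j : Fin N), ∫⁻ ω, ‖(√(N : ℝ) : ℂ) * Y N ω i j‖ₑ ^ p ∂(μ N) < ∞

/-- The positions strictly above the diagonal. -/
abbrev UpperPair (N : ℕ) : Type := {p : Fin N × Fin N // p.1 < p.2}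

/-- The normalized real coordinates of a GUE matrix: `√N X_ii`, and, for `i < j`, `√(2N) Re X_ij`
and `√(2N) Im X_ij`. -/
noncomputable def gueCoord {N : ℕ} (M : Matrix (Fin N) (Fin N) ℂ) :
    Fin N ⊕ (UpperPair N ⊕ UpperPair N) → ℝ
  | .inl i => √(N : ℝ) * (M i i).re
  | .inr (.inl p) => √(2 * (N : ℝ)) * (M p.1.1 p.1.2).re
  | .inr (.inr p) => √(2 * (N : ℝ)) * (M p.1.1 p.1.2).im

/-- `X` is a GUE random matrix of size `N`. -/
structure IsGUE {Ω : Type*} [MeasurableSpace Ω] (μ : Measure Ω) {N : ℕ}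
    (X : Ω → Matrix (Fin N) (Fin N) ℂ) : Prop where
  measurable : ∀ i j, Measurable fun ω => X ω i j
  hermitian : ∀ᵐ ω ∂μ, (X ω).IsHermitian
  indep : iIndepFun (fun c ω => gueCoord (X ω) c) μ
  gaussian : ∀ c, HasLaw (fun ω => gueCoord (X ω) c) (gaussianReal 0 1) μ

/-- The normalized coordinates of a GOE matrix: `√(N/2) X_ii`, and `√N X_ij` for `i < j`. -/
noncomputable def goeCoord {N : ℕ} (M : Matrix (Fin N) (Fin N) ℂ) : Fin N ⊕ UpperPair N → ℝ
  | .inl i => √((N : ℝ) / 2) * (M i i).re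
  | .inr p => √(N : ℝ) * (M p.1.1 p.1.2).re

/-- `X` is a GOE random matrix of size `N`, seen as a complex matrix with real entries. -/
structure IsGOE {Ω : Type*} [MeasurableSpace Ω] (μ : Measure Ω) {N : ℕ}
    (X : Ω → Matrix (Fin N) (Fin N) ℂ) : Prop where
  measurable : ∀ i j, Measurable fun ω => X ω i j
  symmetric : ∀ᵐ ω ∂μ, (X ω).IsSymm ∧ ∀ i j, (X ω i j).im = 0
  indep : iIndepFun (fun c ω => goeCoord (X ω) c) μ
  gaussian : ∀ c, HasLaw (fun ω => goeCoord (X ω) c) (gaussianReal 0 1) μ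

end WignerPoly

/-! Write T = 1 + max |t_j| and f(M) = ⟨x, Q_t(M, A) y⟩ with x, y in the unit ball. Comparison and
concentration are obtained together: for independent Y and X the p-th moment of f(Y) - f(X) is
bounded for every even p ≥ 2. Jensen's inequality in X replaces f(X) by its mean
(`integral_norm_sub_integral_pow_le`), and Markov's inequality, with p large in terms of ε and κ,
gives the tail.

The moment is bounded by exchanging entries, as in Lindeberg's method. For a set S of entries let
F(S) be the p-th moment of f(Y on S, X off S) - f(X), so F(∅) = 0. Averaging F over random subsets
(`interpolation_le`) reduces the problem to Σ_e [F(S ∪ e) - F(S \ e)], followed by Grönwall. Each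
exchange is expanded to second order in |·|^p around the value with the entry e set to zero
(`moment_step_le`). The quadratic part is a sum of squared increments, at most (T²/√N)² up to
constants (`TaylorControl.sum_sq_sub_le`). The linear part only sees the mean increment
(`TaylorControl.norm_integral_replace_le`): first moments vanish and E|z|² agrees off the diagonal,
so there remain the terms in E z², those of order three, of size T³/√N and absent if third moments
agree, and those of order four or more. When T⁴ ≤ N the last ones are at most T²/√N; when T⁴ > N the
error scale exceeds 1 and crude bounds suffice. Hence an error (T² + T³)/√N in general, which lies
below T⁴/√N, and T²/√N for symmetric entries.

The sums over entries are deterministic. A derivative of f in an entry is a combination of words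
containing matrix units, which have rank one. One matrix unit gives a square sum of order 1
(`sum_sq_word_le`), two or more give a sum of order N (`sum_word_le`), and twice the same one gives
only √N, by a Hilbert–Schmidt bound (`sum_word_same_le`). The last gain makes the unmatched E z², of
size 1/N, harmless.

To work with finite words, e^{itP} is replaced by the n-th power of the Cayley transform of P with
parameter t/(2n) (`tendsto_cayleyMat_pow`). Differences are then exact through the resolvent
identity, all factors but the polynomial letters are contractions, and the coefficients of one
derivative have total mass O(T) uniformly in n. Bounds pass to the limit n → ∞ by dominated
convergence in `exists_moment_le`.

The matrices are not bounded surely; their norms enter through powers of a random envelope `env`,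
whose moments are O(N²) by counting closed walks (`EntryLaw.trace_moment`, `exists_env_moment`).
This N² is absorbed by N^{εp}. -/

namespace WignerPoly

/-! ### Evaluation of noncommutative polynomials at Hermitian tuples -/

section Words
open scoped Matrix.Norms.L2Operator

/-- A tuple of Hermitian matrices. -/
def HermTuple {d N : ℕ} (M : Fin d → Matrix (Fin N) (Fin N) ℂ) : Prop := ∀ s, (M s).IsHermitian

theorem conjTranspose_list_prod {N : ℕ} (l : List (Matrix (Fin N) (Fin N) ℂ)) :
    l.prod.conjTranspose = (l.reverse.map Matrix.conjTranspose).prod := by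
  induction l with
  | nil => simp
  | cons a l ih => simp [Matrix.conjTranspose_mul, ih]

theorem letterValue_conjTranspose {d r N : ℕ} {Y : Fin d → Matrix (Fin N) (Fin N) ℂ}
    (hY : HermTuple Y) (A : Fin r → Matrix (Fin N) (Fin N) ℂ) (l : Letter d r) :
    (letterValue Y A l).conjTranspose = letterValue Y A l.star := by
  cases l with
  | X i => exact hY i
  | Z j => rfl
  | Zstar j => simp [letterValue, Letter.star]

/-- The value of a word in the letters. -/
noncomputable def baseVal {d r N : ℕ} (A : Fin r → Matrix (Fin N) (Fin N) ℂ)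
    (Y : Fin d → Matrix (Fin N) (Fin N) ℂ) (w : List (Letter d r)) : Matrix (Fin N) (Fin N) ℂ :=
  (w.map (letterValue Y A)).prod

/-- The monomials of a polynomial with their coefficients. -/
noncomputable def polyTerms {d r : ℕ} (p : NCPoly d r) : List (ℂ × List (Letter d r)) :=
  p.coeff.support.toList.map fun w => (p.coeff w, FreeMonoid.toList w)

theorem eval_eq_sum {d r N : ℕ} (A : Fin r → Matrix (Fin N) (Fin N) ℂ)
    (Y : Fin d → Matrix (Fin N) (Fin N) ℂ) (p : NCPoly d r) :
    p.eval Y A = ((polyTerms p).map fun q => q.1 • baseVal A Y q.2).sum := by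
  unfold NCPoly.eval polyTerms
  rw [MonoidAlgebra.lift_apply, List.map_map, Finsupp.sum, ← Finset.sum_map_toList]
  refine congrArg List.sum (List.map_congr_left fun w _ => ?_)
  rw [FreeMonoid.lift_apply]; rfl

theorem eval_conjTranspose {d r N : ℕ} {Y : Fin d → Matrix (Fin N) (Fin N) ℂ}
    (hY : HermTuple Y) (A : Fin r → Matrix (Fin N) (Fin N) ℂ) (p : NCPoly d r) :
    (p.eval Y A).conjTranspose = p.adjoint.eval Y A := by
  unfold NCPoly.eval NCPoly.adjoint
  rw [MonoidAlgebra.lift_apply, Finsupp.sum, Finsupp.sum, Matrix.conjTranspose_sum, map_sum]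
  refine Finset.sum_congr rfl fun w _ => ?_
  rw [MonoidAlgebra.lift_single, Matrix.conjTranspose_smul]
  congr 1
  rw [FreeMonoid.lift_apply, FreeMonoid.lift_apply, conjTranspose_list_prod]
  congr 1
  simp only [wordStar]
  change _ = List.map _ ((FreeMonoid.toList (FreeMonoid.map Letter.star w)).reverse)
  rw [FreeMonoid.toList_map, ← List.map_reverse, List.map_map, ← List.map_reverse, List.map_map]
  refine List.map_congr_left fun l _ => ?_
  exact letterValue_conjTranspose hY A l

theorem eval_isHermitian {d r N : ℕ} {Y : Fin d → Matrix (Fin N) (Fin N) ℂ}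
    (hY : HermTuple Y) (A : Fin r → Matrix (Fin N) (Fin N) ℂ) {p : NCPoly d r}
    (hp : p.adjoint = p) : (p.eval Y A).IsHermitian := by
  have := eval_conjTranspose hY A p
  rwa [hp] at this

/-! ### Resolvents and Cayley transforms -/

theorem l2_norm_one_le {N : ℕ} : ‖(1 : Matrix (Fin N) (Fin N) ℂ)‖ ≤ 1 := by
  rw [← Matrix.diagonal_one, Matrix.l2_opNorm_diagonal]
  exact (pi_norm_le_iff_of_nonneg zero_le_one).2 fun i => by simp

theorem mulVec_norm {N : ℕ} (M : Matrix (Fin N) (Fin N) ℂ) (v : EuclideanSpace ℂ (Fin N)) :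
    ‖Matrix.toEuclideanCLM (n := Fin N) (𝕜 := ℂ) M v‖ ≤ ‖M‖ * ‖v‖ := by
  rw [Matrix.cstar_norm_def]; exact ContinuousLinearMap.le_opNorm _ _

theorem inner_hermitian_real {N : ℕ} {H : Matrix (Fin N) (Fin N) ℂ} (hH : H.IsHermitian)
    (v : EuclideanSpace ℂ (Fin N)) :
    (inner ℂ v (Matrix.toEuclideanCLM (n := Fin N) (𝕜 := ℂ) H v)).im = 0 := by
  have h1 : IsSelfAdjoint (Matrix.toEuclideanCLM (n := Fin N) (𝕜 := ℂ) H) := by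
    have h0 : IsSelfAdjoint H := hH
    exact h0.map _
  have h2 := (ContinuousLinearMap.isSelfAdjoint_iff_isSymmetric.1 h1) v v
  have h3 : conj (inner ℂ v (Matrix.toEuclideanCLM (n := Fin N) (𝕜 := ℂ) H v))
    = inner ℂ v (Matrix.toEuclideanCLM (n := Fin N) (𝕜 := ℂ) H v) := by
    rw [inner_conj_symm]; exact h2
  exact Complex.conj_eq_iff_im.1 h3

/-- For Hermitian `H` and real `a`, `‖(1 + i a H) v‖² = ‖v‖² + a² ‖H v‖²`. -/
theorem norm_one_add_I_smul {N : ℕ} {H : Matrix (Fin N) (Fin N) ℂ} (hH : H.IsHermitian) (a : ℝ)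
    (v : EuclideanSpace ℂ (Fin N)) :
    ‖Matrix.toEuclideanCLM (n := Fin N) (𝕜 := ℂ) (1 + (Complex.I * (a : ℂ)) • H) v‖ ^ 2
      = ‖v‖ ^ 2 + a ^ 2 * ‖Matrix.toEuclideanCLM (n := Fin N) (𝕜 := ℂ) H v‖ ^ 2 := by
  have h := inner_hermitian_real hH v
  simp only [map_add, map_one, map_smul, add_apply,
    one_apply_eq_self, smul_apply]
  rw [@norm_add_sq ℂ, inner_smul_right, norm_smul, mul_pow]
  have : ‖Complex.I * (a : ℂ)‖ ^ 2 = a ^ 2 := by simp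
  rw [this]
  have h2 : RCLike.re (Complex.I * (a : ℂ) *
      inner ℂ v (Matrix.toEuclideanCLM (n := Fin N) (𝕜 := ℂ) H v)) = 0 := by
    simp [h]
  rw [h2]; ring

/-- The resolvent `(1 - i a H)⁻¹`. -/
noncomputable def resolventMat {N : ℕ} (a : ℝ) (H : Matrix (Fin N) (Fin N) ℂ) :
    Matrix (Fin N) (Fin N) ℂ := (1 - (Complex.I * (a : ℂ)) • H)⁻¹

/-- By `norm_one_add_I_smul`, the matrix does not shrink any vector, so it is injective. -/
theorem isUnit_det_one_sub {N : ℕ} {H : Matrix (Fin N) (Fin N) ℂ} (hH : H.IsHermitian) (a : ℝ) :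
    IsUnit (1 - (Complex.I * (a : ℂ)) • H).det := by
  rw [← Matrix.isUnit_iff_isUnit_det, ← Matrix.mulVec_injective_iff_isUnit]
  rw [injective_iff_map_eq_zero (Matrix.mulVecLin (1 - (Complex.I * (a : ℂ)) • H)).toAddMonoidHom
    |> fun h => (h : Function.Injective (Matrix.mulVec (1 - (Complex.I * (a : ℂ)) • H)) ↔ _)]
  intro v hv
  have h1 := norm_one_add_I_smul hH (-a) (WithLp.toLp 2 v)
  have h2 : (1 + (Complex.I * ((-a : ℝ) : ℂ)) • H) = 1 - (Complex.I * (a : ℂ)) • H := by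
    push_cast; rw [mul_neg, neg_smul, sub_eq_add_neg]
  have hv' : (1 - (Complex.I * (a : ℂ)) • H).mulVec v = 0 := hv
  rw [h2, Matrix.toEuclideanCLM_toLp, hv'] at h1
  have h3 : ‖WithLp.toLp 2 v‖ ^ 2 = 0 := by
    have : ‖WithLp.toLp 2 (0 : Fin N → ℂ)‖ = 0 := by simp
    rw [this] at h1
    nlinarith [sq_nonneg ‖WithLp.toLp 2 v‖, mul_nonneg (sq_nonneg (-a)) (sq_nonneg
      ‖Matrix.toEuclideanCLM (n := Fin N) (𝕜 := ℂ) H (WithLp.toLp 2 v)‖)]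
  have h4 : WithLp.toLp 2 v = 0 := by simpa using h3
  simpa using congrArg WithLp.ofLp h4

theorem norm_le_one_of_contract {N : ℕ} {M : Matrix (Fin N) (Fin N) ℂ}
    (h : ∀ v, ‖Matrix.toEuclideanCLM (n := Fin N) (𝕜 := ℂ) M v‖ ≤ ‖v‖) : ‖M‖ ≤ 1 := by
  rw [Matrix.cstar_norm_def]
  exact ContinuousLinearMap.opNorm_le_bound _ zero_le_one fun v => by simpa using h v

theorem clm_mul_apply {N : ℕ} (M M' : Matrix (Fin N) (Fin N) ℂ) (v : EuclideanSpace ℂ (Fin N)) :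
    Matrix.toEuclideanCLM (n := Fin N) (𝕜 := ℂ) (M * M') v =
      Matrix.toEuclideanCLM (n := Fin N) (𝕜 := ℂ) M
        (Matrix.toEuclideanCLM (n := Fin N) (𝕜 := ℂ) M' v) := by
  rw [map_mul]; rfl

theorem one_sub_eq {N : ℕ} (a : ℝ) (H : Matrix (Fin N) (Fin N) ℂ) :
    1 - (Complex.I * (a : ℂ)) • H = 1 + (Complex.I * ((-a : ℝ) : ℂ)) • H := by
  push_cast; rw [mul_neg, neg_smul, sub_eq_add_neg]

theorem norm_resolventMat_le {N : ℕ} {H : Matrix (Fin N) (Fin N) ℂ} (hH : H.IsHermitian) (a : ℝ) :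
    ‖resolventMat a H‖ ≤ 1 := by
  refine norm_le_one_of_contract fun v => ?_
  have h1 := norm_one_add_I_smul hH (-a) (Matrix.toEuclideanCLM (n := Fin N) (𝕜 := ℂ)
    (resolventMat a H) v)
  rw [← one_sub_eq, ← clm_mul_apply, resolventMat,
    Matrix.mul_nonsing_inv _ (isUnit_det_one_sub hH a), map_one] at h1
  refine (sq_le_sq₀ (norm_nonneg _) (norm_nonneg _)).1 ?_
  have h2 : (1 : EuclideanSpace ℂ (Fin N) →L[ℂ] EuclideanSpace ℂ (Fin N)) v = v := rfl
  rw [h2] at h1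
  rw [h1, resolventMat]
  nlinarith [mul_nonneg (sq_nonneg (-a)) (sq_nonneg ‖Matrix.toEuclideanCLM (n := Fin N) (𝕜 := ℂ) H
    (Matrix.toEuclideanCLM (n := Fin N) (𝕜 := ℂ) (1 - (Complex.I * (a : ℂ)) • H)⁻¹ v)‖)]

/-- The Cayley transform `(1 + i a H) (1 - i a H)⁻¹ = 2 (1 - i a H)⁻¹ - 1`. -/
noncomputable def cayleyMat {N : ℕ} (a : ℝ) (H : Matrix (Fin N) (Fin N) ℂ) :
    Matrix (Fin N) (Fin N) ℂ := (2 : ℂ) • resolventMat a H - 1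

theorem cayleyMat_eq {N : ℕ} {H : Matrix (Fin N) (Fin N) ℂ} (hH : H.IsHermitian) (a : ℝ) :
    cayleyMat a H = (1 + (Complex.I * (a : ℂ)) • H) * resolventMat a H := by
  have h1 := Matrix.mul_nonsing_inv _ (isUnit_det_one_sub hH a)
  have h2 : (1 + (Complex.I * (a : ℂ)) • H) = (2 : ℂ) • 1 - (1 - (Complex.I * (a : ℂ)) • H) := by
    rw [two_smul]; abel
  rw [cayleyMat, h2, sub_mul, resolventMat, h1, smul_mul_assoc, one_mul]

/-- The factors 1 + iaH and 1 - iaH give the same norm to every vector, so the Cayley transform is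
isometric; only the inequality is needed. -/
theorem norm_cayleyMat_le {N : ℕ} {H : Matrix (Fin N) (Fin N) ℂ} (hH : H.IsHermitian) (a : ℝ) :
    ‖cayleyMat a H‖ ≤ 1 := by
  refine norm_le_one_of_contract fun v => ?_
  have h1 := norm_one_add_I_smul hH (-a) (Matrix.toEuclideanCLM (n := Fin N) (𝕜 := ℂ)
    (resolventMat a H) v)
  have h3 := norm_one_add_I_smul hH a (Matrix.toEuclideanCLM (n := Fin N) (𝕜 := ℂ)
    (resolventMat a H) v)
  rw [← one_sub_eq, ← clm_mul_apply, resolventMat,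
    Matrix.mul_nonsing_inv _ (isUnit_det_one_sub hH a), map_one] at h1
  rw [← clm_mul_apply, ← cayleyMat_eq hH] at h3
  have h2 : (1 : EuclideanSpace ℂ (Fin N) →L[ℂ] EuclideanSpace ℂ (Fin N)) v = v := rfl
  rw [h2, neg_sq] at h1
  refine (sq_le_sq₀ (norm_nonneg _) (norm_nonneg _)).1 ?_
  rw [h1, h3, resolventMat]

/-- The resolvent identity, arranged with the unperturbed matrix on the left and the perturbed one
on the right. All differences below keep this arrangement, so that an expansion can be continued in
the right factor alone. -/
theorem resolventMat_sub {N : ℕ} {H H' : Matrix (Fin N) (Fin N) ℂ} (hH : H.IsHermitian)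
    (hH' : H'.IsHermitian) (a : ℝ) :
    resolventMat a H' - resolventMat a H =
      (Complex.I * (a : ℂ)) • (resolventMat a H * (H' - H) * resolventMat a H') := by
  have h1 := Matrix.nonsing_inv_mul _ (isUnit_det_one_sub hH a)
  have h2 := Matrix.mul_nonsing_inv _ (isUnit_det_one_sub hH' a)
  have h3 : (Complex.I * (a : ℂ)) • (H' - H) =
      (1 - (Complex.I * (a : ℂ)) • H) - (1 - (Complex.I * (a : ℂ)) • H') := by
    rw [smul_sub]; abel
  rw [← smul_mul_assoc, ← mul_smul_comm, h3, mul_sub, sub_mul]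
  unfold resolventMat
  rw [h1, mul_assoc, h2, one_mul, mul_one]

end Words

/-! ### Sums over lists -/

/-- The sum of `f` over the members of a list. -/
def lsum {α β : Type*} [AddCommMonoid β] (L : List α) (f : α → β) : β := (L.map f).sum

section lsum
variable {α β γ : Type*}

@[simp] theorem lsum_nil [AddCommMonoid β] (f : α → β) : lsum [] f = 0 := by simp [lsum]

@[simp] theorem lsum_cons [AddCommMonoid β] (a : α) (L : List α) (f : α → β) :
    lsum (a :: L) f = f a + lsum L f := by simp [lsum]

theorem lsum_append [AddCommMonoid β] (L L' : List α) (f : α → β) :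
    lsum (L ++ L') f = lsum L f + lsum L' f := by simp [lsum]

theorem lsum_map [AddCommMonoid β] (L : List γ) (g : γ → α) (f : α → β) :
    lsum (L.map g) f = lsum L fun c => f (g c) := by simp [lsum, Function.comp_def]

theorem lsum_flatMap [AddCommMonoid β] (L : List γ) (g : γ → List α) (f : α → β) :
    lsum (L.flatMap g) f = lsum L fun c => lsum (g c) f := by
  induction L with
  | nil => simp
  | cons a L ih => simp [List.flatMap_cons, lsum_append, ih]

theorem lsum_congr [AddCommMonoid β] {L : List α} {f g : α → β} (h : ∀ a ∈ L, f a = g a) :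
    lsum L f = lsum L g := by
  unfold lsum; rw [List.map_congr_left h]

theorem lsum_add [AddCommMonoid β] (L : List α) (f g : α → β) :
    lsum L (fun a => f a + g a) = lsum L f + lsum L g := by
  induction L with
  | nil => simp
  | cons a L ih => simp only [lsum_cons, ih]; abel

theorem lsum_sub [AddCommGroup β] (L : List α) (f g : α → β) :
    lsum L (fun a => f a - g a) = lsum L f - lsum L g := by
  induction L with
  | nil => simp
  | cons a L ih => simp only [lsum_cons, ih]; abel

theorem map_lsum [AddCommMonoid β] [AddCommMonoid γ] {F : Type*} [FunLike F β γ]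
    [AddMonoidHomClass F β γ] (φ : F) (L : List α) (f : α → β) :
    φ (lsum L f) = lsum L fun a => φ (f a) := by
  induction L with
  | nil => simp
  | cons a L ih => simp [ih]

theorem mul_lsum [NonUnitalNonAssocSemiring β] (b : β) (L : List α) (f : α → β) :
    b * lsum L f = lsum L fun a => b * f a := map_lsum (AddMonoidHom.mulLeft b) L f

theorem lsum_mul [NonUnitalNonAssocSemiring β] (b : β) (L : List α) (f : α → β) :
    lsum L f * b = lsum L fun a => f a * b := map_lsum (AddMonoidHom.mulRight b) L f

theorem smul_lsum [AddCommMonoid β] {R : Type*} [Monoid R] [DistribMulAction R β]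
    (b : R) (L : List α) (f : α → β) :
    b • lsum L f = lsum L fun a => b • f a := map_lsum (DistribSMul.toAddMonoidHom β b) L f

theorem lsum_finset_sum [AddCommMonoid β] {ι : Type*} (L : List α) (s : Finset ι)
    (f : α → ι → β) : lsum L (fun a => ∑ i ∈ s, f a i) = ∑ i ∈ s, lsum L fun a => f a i := by
  induction L with
  | nil => simp
  | cons a L ih => simp [ih, Finset.sum_add_distrib]

theorem lsum_le {L : List α} {f g : α → ℝ} (h : ∀ a ∈ L, f a ≤ g a) : lsum L f ≤ lsum L g :=
  List.sum_le_sum h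

theorem lsum_nonneg {L : List α} {f : α → ℝ} (h : ∀ a ∈ L, 0 ≤ f a) : 0 ≤ lsum L f :=
  List.sum_nonneg (by simpa using h)

theorem norm_lsum_le [SeminormedAddCommGroup β] {L : List α} {f : α → β} {g : α → ℝ}
    (h : ∀ a ∈ L, ‖f a‖ ≤ g a) : ‖lsum L f‖ ≤ lsum L g := by
  induction L with
  | nil => simp
  | cons a L ih =>
    rw [lsum_cons, lsum_cons]
    exact (norm_add_le _ _).trans (add_le_add (h a (by simp)) (ih fun b hb => h b (by simp [hb])))

end lsum

/-- The sum of the absolute values of the coefficients of a formal combination. -/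
noncomputable def mass {α : Type*} (L : List (ℂ × α)) : ℝ := lsum L fun p => ‖p.1‖

theorem mass_nonneg {α : Type*} (L : List (ℂ × α)) : 0 ≤ mass L :=
  lsum_nonneg fun _ _ => norm_nonneg _

theorem norm_lsum_le_mass {α β : Type*} [SeminormedAddCommGroup β] [NormedSpace ℂ β]
    {L : List (ℂ × α)} {f : ℂ × α → β} {b : ℝ} (h : ∀ p ∈ L, ‖f p‖ ≤ b) :
    ‖lsum L fun p => p.1 • f p‖ ≤ mass L * b := by
  unfold mass
  rw [lsum_mul]
  refine norm_lsum_le fun p hp => ?_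
  rw [norm_smul]
  exact mul_le_mul_of_nonneg_left (h p hp) (norm_nonneg _)

/-! ### Words with resolvents, Cayley transforms and directions -/

/-- Letters of the extended alphabet: the letters of the polynomials, the resolvents and the Cayley
transforms of the `P j`, and two directions. -/
inductive WLetter (d r k : ℕ) : Type
  | base (l : Letter d r) : WLetter d r k
  | res (j : Fin k) : WLetter d r k
  | cay (j : Fin k) : WLetter d r k
  | dir (a : Bool) : WLetter d r k

abbrev Word (d r k : ℕ) : Type := List (WLetter d r k)

section Words
open scoped Matrix.Norms.L2Operator

variable {d r k N : ℕ}

/-- The matrix substituted for each letter. -/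
noncomputable def wletterVal (P : Fin k → NCPoly d r) (τ : Fin k → ℝ)
    (A : Fin r → Matrix (Fin N) (Fin N) ℂ) (E : Bool → Matrix (Fin N) (Fin N) ℂ)
    (M : Fin d → Matrix (Fin N) (Fin N) ℂ) : WLetter d r k → Matrix (Fin N) (Fin N) ℂ
  | .base l => letterValue M A l
  | .res j => resolventMat (τ j) ((P j).eval M A)
  | .cay j => cayleyMat (τ j) ((P j).eval M A)
  | .dir a => E a

/-- The value of a word. -/
noncomputable def wordVal (P : Fin k → NCPoly d r) (τ : Fin k → ℝ)
    (A : Fin r → Matrix (Fin N) (Fin N) ℂ) (E : Bool → Matrix (Fin N) (Fin N) ℂ)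
    (M : Fin d → Matrix (Fin N) (Fin N) ℂ) (w : Word d r k) : Matrix (Fin N) (Fin N) ℂ :=
  (w.map (wletterVal P τ A E M)).prod

/-- The value of a formal combination of words. -/
noncomputable def combVal (P : Fin k → NCPoly d r) (τ : Fin k → ℝ)
    (A : Fin r → Matrix (Fin N) (Fin N) ℂ) (E : Bool → Matrix (Fin N) (Fin N) ℂ)
    (M : Fin d → Matrix (Fin N) (Fin N) ℂ) (L : List (ℂ × Word d r k)) :
    Matrix (Fin N) (Fin N) ℂ :=
  lsum L fun p => p.1 • wordVal P τ A E M p.2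

/-- The degree: the number of unbounded letters. -/
def WLetter.deg : WLetter d r k → ℕ
  | .base _ => 1
  | .res _ => 0
  | .cay _ => 0
  | .dir _ => 0

def wdeg (w : Word d r k) : ℕ := lsum w WLetter.deg

/-- Number of occurrences of a direction. -/
def WLetter.dirCount (a : Bool) : WLetter d r k → ℕ
  | .base _ => 0
  | .res _ => 0
  | .cay _ => 0
  | .dir b => if b = a then 1 else 0

def wcount (a : Bool) (w : Word d r k) : ℕ := lsum w (WLetter.dirCount a)

/-- The decomposition `u X_s v` of a word with `u` empty, if there is one. -/
def headDiff (s : Fin d) (w : List (Letter d r)) :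
    Letter d r → List (List (Letter d r) × List (Letter d r))
  | .X i => if i = s then [([], w)] else []
  | .Z _ => []
  | .Zstar _ => []

/-- Decompositions `u X_s v` of a word. -/
def pdiff (s : Fin d) : List (Letter d r) → List (List (Letter d r) × List (Letter d r))
  | [] => []
  | l :: w => headDiff s w l ++ (pdiff s w).map fun t => (l :: t.1, t.2)

/-- The first difference of a resolvent. -/
noncomputable def resDiff (P : Fin k → NCPoly d r) (τ : Fin k → ℝ) (s : Fin d) (j : Fin k) :
    List (ℂ × Word d r k × Word d r k) :=
  (polyTerms (P j)).flatMap fun p => (pdiff s p.2).map fun t =>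
    (Complex.I * (τ j : ℂ) * p.1, .res j :: t.1.map .base, t.2.map .base ++ [.res j])

/-- The first difference of a letter. -/
noncomputable def letterDiff (P : Fin k → NCPoly d r) (τ : Fin k → ℝ) (s : Fin d) :
    WLetter d r k → List (ℂ × Word d r k × Word d r k)
  | .base (.X i) => if i = s then [(1, [], [])] else []
  | .res j => resDiff P τ s j
  | .cay j => (resDiff P τ s j).map fun t => (2 * t.1, t.2)
  | _ => []

/-- The first difference of a word: `w(M') - w(M) = ∑ c l(M) B r(M')` over the members
`(c, l, r)`, when `M'` is `M` with `B` added in slot `s`. -/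
noncomputable def wdiff (P : Fin k → NCPoly d r) (τ : Fin k → ℝ) (s : Fin d) :
    Word d r k → List (ℂ × Word d r k × Word d r k)
  | [] => []
  | l :: w => ((letterDiff P τ s l).map fun t => (t.1, t.2.1, t.2.2 ++ w)) ++
      (wdiff P τ s w).map fun t => (t.1, l :: t.2.1, t.2.2)

/-- The coefficient of order `β` in the expansion of a word. -/
noncomputable def tay (P : Fin k → NCPoly d r) (τ : Fin k → ℝ) (s : Fin d) :
    List Bool → Word d r k → List (ℂ × Word d r k)
  | [], w => [(1, w)]
  | a :: β, w => (wdiff P τ s w).flatMap fun t => (tay P τ s β t.2.2).map fun p =>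
      (t.1 * p.1, t.2.1 ++ .dir a :: p.2)

/-- The coefficient of order `β` in the expansion of a formal combination. -/
noncomputable def tayComb (P : Fin k → NCPoly d r) (τ : Fin k → ℝ) (s : Fin d) (β : List Bool)
    (L : List (ℂ × Word d r k)) : List (ℂ × Word d r k) :=
  L.flatMap fun p => (tay P τ s β p.2).map fun q => (p.1 * q.1, q.2)

/-- The lists of booleans of length less than `K`. -/
def boolLists : ℕ → Finset (List Bool)
  | 0 => ∅
  | K + 1 => insert [] ((boolLists K).image (List.cons false) ∪
      (boolLists K).image (List.cons true))

theorem mem_boolLists {K : ℕ} {β : List Bool} : β ∈ boolLists K ↔ β.length < K := by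
  induction K generalizing β with
  | zero => simp [boolLists]
  | succ K ih =>
    cases β with
    | nil => simp [boolLists]
    | cons a β => cases a <;> simp [boolLists, ih]

theorem sum_boolLists_succ {β : Type*} [AddCommMonoid β] (K : ℕ) (F : List Bool → β) :
    ∑ b ∈ boolLists (K + 1), F b = F [] + (∑ b ∈ boolLists K, F (false :: b) +
      ∑ b ∈ boolLists K, F (true :: b)) := by
  rw [boolLists, Finset.sum_insert (by simp), Finset.sum_union, Finset.sum_image (by simp),
    Finset.sum_image (by simp)]
  rw [Finset.disjoint_left]
  simp

theorem card_boolLists_le (K : ℕ) : (boolLists K).card ≤ 2 ^ K := by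
  have h : (boolLists K).card + 1 ≤ 2 ^ K := by
    induction K with
    | zero => simp [boolLists]
    | succ K ih =>
      have := sum_boolLists_succ K (fun _ => 1)
      simp only [Finset.sum_const, smul_eq_mul, mul_one] at this
      rw [this, pow_succ]; omega
  omega

attribute [irreducible] boolLists

/-- The monomial `∏ ζ_a` over the members of a list. -/
def zmon (ζ : Bool → ℂ) (β : List Bool) : ℂ := (β.map ζ).prod

theorem norm_zmon_le {ζ : Bool → ℂ} {z : ℝ} (h : ∀ a, ‖ζ a‖ ≤ z) (β : List Bool) :
    ‖zmon ζ β‖ ≤ z ^ β.length := by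
  induction β with
  | nil => simp [zmon]
  | cons a β ih =>
    have : zmon ζ (a :: β) = ζ a * zmon ζ β := by simp [zmon]
    rw [this, norm_mul, List.length_cons, pow_succ']
    exact mul_le_mul (h a) ih (norm_nonneg _) ((norm_nonneg _).trans (h a))

/-! #### Values -/

variable {P : Fin k → NCPoly d r} {τ : Fin k → ℝ} {A : Fin r → Matrix (Fin N) (Fin N) ℂ}
  {E : Bool → Matrix (Fin N) (Fin N) ℂ} {M M' : Fin d → Matrix (Fin N) (Fin N) ℂ} {s : Fin d}
  {B : Matrix (Fin N) (Fin N) ℂ}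

@[simp] theorem wordVal_nil : wordVal P τ A E M [] = 1 := rfl

@[simp] theorem wordVal_cons (l : WLetter d r k) (w : Word d r k) :
    wordVal P τ A E M (l :: w) = wletterVal P τ A E M l * wordVal P τ A E M w := by simp [wordVal]

@[simp] theorem wordVal_append (v w : Word d r k) :
    wordVal P τ A E M (v ++ w) = wordVal P τ A E M v * wordVal P τ A E M w := by simp [wordVal]

theorem wordVal_map_base (w : List (Letter d r)) :
    wordVal P τ A E M (w.map .base) = baseVal A M w := by
  simp [wordVal, baseVal, Function.comp_def, wletterVal]

theorem baseVal_cons (l : Letter d r) (w : List (Letter d r)) :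
    baseVal A M (l :: w) = letterValue M A l * baseVal A M w := by simp [baseVal]

/-- Telescoping along the word: letters already passed are evaluated at `M`, letters still to come
at `M'`. -/
theorem baseVal_sub (hM' : M' = Function.update M s (M s + B)) (w : List (Letter d r)) :
    baseVal A M' w - baseVal A M w =
      lsum (pdiff s w) fun t => baseVal A M t.1 * B * baseVal A M' t.2 := by
  induction w with
  | nil => simp [baseVal, pdiff]
  | cons l w ih =>
    rw [pdiff, lsum_append, lsum_map, baseVal_cons, baseVal_cons]
    have h1 : letterValue M' A l * baseVal A M' w - letterValue M A l * baseVal A M w =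
      (letterValue M' A l - letterValue M A l) * baseVal A M' w +
        letterValue M A l * (baseVal A M' w - baseVal A M w) := by noncomm_ring
    rw [h1, ih, mul_lsum]
    congr 1
    · cases l with
      | X i =>
        by_cases hi : i = s
        · subst hi; subst hM'; simp [headDiff, letterValue, baseVal]
        · simp [headDiff, letterValue, hM', hi]
      | Z j => simp [headDiff, letterValue]
      | Zstar j => simp [headDiff, letterValue]
    · refine lsum_congr fun t _ => ?_
      rw [baseVal_cons]; noncomm_ring

/-- The resolvent identity combined with the telescoping of each monomial of `P j`. It is exact, so
no smallness of `B` is required. -/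
theorem resDiff_sum (hP : ∀ j, (P j).adjoint = P j) (hM : HermTuple M) (hMh' : HermTuple M')
    (hM' : M' = Function.update M s (M s + B)) (j : Fin k) :
    resolventMat (τ j) ((P j).eval M' A) - resolventMat (τ j) ((P j).eval M A) =
      lsum (resDiff P τ s j) fun t =>
        t.1 • (wordVal P τ A E M t.2.1 * B * wordVal P τ A E M' t.2.2) := by
  rw [resolventMat_sub (eval_isHermitian hM A (hP j)) (eval_isHermitian hMh' A (hP j)),
    resDiff, lsum_flatMap]
  have h1 : (P j).eval M' A - (P j).eval M A = lsum (polyTerms (P j)) fun q =>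
      q.1 • baseVal A M' q.2 - q.1 • baseVal A M q.2 := by
    rw [lsum_sub, eval_eq_sum, eval_eq_sum]; rfl
  rw [h1, mul_lsum, lsum_mul, smul_lsum]
  refine lsum_congr fun q _ => ?_
  rw [← smul_sub, baseVal_sub hM', lsum_map, smul_lsum, mul_lsum, lsum_mul, smul_lsum]
  refine lsum_congr fun t _ => ?_
  simp only [wordVal_cons, wordVal_append, wordVal_map_base, wordVal_nil, mul_one, wletterVal]
  rw [mul_smul_comm, smul_mul_assoc, smul_smul]
  simp only [mul_assoc]

theorem letterDiff_sum (hP : ∀ j, (P j).adjoint = P j) (hM : HermTuple M) (hMh' : HermTuple M')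
    (hM' : M' = Function.update M s (M s + B)) (l : WLetter d r k) :
    wletterVal P τ A E M' l - wletterVal P τ A E M l =
      lsum (letterDiff P τ s l) fun t =>
        t.1 • (wordVal P τ A E M t.2.1 * B * wordVal P τ A E M' t.2.2) := by
  cases l with
  | base l =>
    cases l with
    | X i =>
      by_cases hi : i = s
      · subst hi; simp [letterDiff, wletterVal, letterValue, hM']
      · simp [letterDiff, wletterVal, letterValue, hM', hi]
    | Z j => simp [letterDiff, wletterVal, letterValue]
    | Zstar j => simp [letterDiff, wletterVal, letterValue]
  | res j => exact resDiff_sum hP hM hMh' hM' j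
  | cay j =>
    rw [letterDiff, lsum_map, wletterVal, wletterVal, cayleyMat, cayleyMat, sub_sub_sub_cancel_right,
      ← smul_sub, resDiff_sum (E := E) hP hM hMh' hM' j, smul_lsum]
    refine lsum_congr fun t _ => ?_
    rw [smul_smul]
  | dir a => simp [letterDiff, wletterVal]

theorem wdiff_sum (hP : ∀ j, (P j).adjoint = P j) (hM : HermTuple M) (hMh' : HermTuple M')
    (hM' : M' = Function.update M s (M s + B)) (w : Word d r k) :
    wordVal P τ A E M' w - wordVal P τ A E M w =
      lsum (wdiff P τ s w) fun t =>
        t.1 • (wordVal P τ A E M t.2.1 * B * wordVal P τ A E M' t.2.2) := by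
  induction w with
  | nil => simp [wdiff]
  | cons l w ih =>
    rw [wdiff, lsum_append, lsum_map, lsum_map, wordVal_cons, wordVal_cons]
    have h1 : wletterVal P τ A E M' l * wordVal P τ A E M' w -
        wletterVal P τ A E M l * wordVal P τ A E M w =
      (wletterVal P τ A E M' l - wletterVal P τ A E M l) * wordVal P τ A E M' w +
        wletterVal P τ A E M l * (wordVal P τ A E M' w - wordVal P τ A E M w) := by noncomm_ring
    rw [h1, ih, letterDiff_sum (E := E) hP hM hMh' hM' l, mul_lsum, lsum_mul]
    congr 1
    · refine lsum_congr fun t _ => ?_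
      simp only [wordVal_append, smul_mul_assoc, mul_assoc]
    · refine lsum_congr fun t _ => ?_
      simp only [wordVal_cons, mul_smul_comm, mul_assoc]

/-! #### Sizes -/

theorem wdeg_append (v w : Word d r k) : wdeg (v ++ w) = wdeg v + wdeg w := lsum_append _ _ _

theorem wdeg_cons (l : WLetter d r k) (w : Word d r k) : wdeg (l :: w) = l.deg + wdeg w :=
  lsum_cons _ _ _

@[simp] theorem wdeg_nil : wdeg ([] : Word d r k) = 0 := rfl

@[simp] theorem wcount_nil (a : Bool) : wcount a ([] : Word d r k) = 0 := rfl

theorem wcount_append (a : Bool) (v w : Word d r k) : wcount a (v ++ w) = wcount a v + wcount a w :=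
  lsum_append _ _ _

theorem wcount_cons (a : Bool) (l : WLetter d r k) (w : Word d r k) :
    wcount a (l :: w) = l.dirCount a + wcount a w :=
  lsum_cons _ _ _

theorem wdeg_map_base (w : List (Letter d r)) : wdeg (k := k) (w.map .base) = w.length := by
  induction w with
  | nil => rfl
  | cons l w ih => rw [List.map_cons, wdeg_cons, ih, List.length_cons, WLetter.deg, add_comm]

theorem wcount_map_base (a : Bool) (w : List (Letter d r)) :
    wcount (k := k) a (w.map .base) = 0 := by
  induction w with
  | nil => rfl
  | cons l w ih => rw [List.map_cons, wcount_cons, ih, WLetter.dirCount]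

theorem pdiff_length {w : List (Letter d r)} {t} (ht : t ∈ pdiff s w) :
    t.1.length + t.2.length ≤ w.length := by
  induction w generalizing t with
  | nil => simp [pdiff] at ht
  | cons l w ih =>
    rw [pdiff, List.mem_append] at ht
    rcases ht with ht | ht
    · cases l with
      | X i =>
        by_cases hi : i = s
        · simp [headDiff, hi] at ht; subst ht; simp
        · simp [headDiff, hi] at ht
      | Z j => simp [headDiff] at ht
      | Zstar j => simp [headDiff] at ht
    · obtain ⟨u, hu, rfl⟩ := List.mem_map.1 ht
      have := ih hu
      simp only [List.length_cons]; omega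

theorem length_pdiff_le (w : List (Letter d r)) : (pdiff s w).length ≤ w.length := by
  induction w with
  | nil => simp [pdiff]
  | cons l w ih =>
    rw [pdiff, List.length_append, List.length_map, List.length_cons]
    have : (headDiff s w l).length ≤ 1 := by
      cases l with
      | X i => by_cases hi : i = s <;> simp [headDiff, hi]
      | Z j => simp [headDiff]
      | Zstar j => simp [headDiff]
    omega

/-- The mass of the first difference of a word. -/
noncomputable def wrho (P : Fin k → NCPoly d r) (τ : Fin k → ℝ) (s : Fin d) (w : Word d r k) : ℝ :=
  lsum w fun l => mass (letterDiff P τ s l)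

theorem wrho_append (v w : Word d r k) : wrho P τ s (v ++ w) = wrho P τ s v + wrho P τ s w :=
  lsum_append _ _ _

theorem wrho_cons (l : WLetter d r k) (w : Word d r k) :
    wrho P τ s (l :: w) = mass (letterDiff P τ s l) + wrho P τ s w := lsum_cons _ _ _

@[simp] theorem wrho_nil : wrho P τ s ([] : Word d r k) = 0 := rfl

theorem wrho_nonneg (w : Word d r k) : 0 ≤ wrho P τ s w := lsum_nonneg fun _ _ => mass_nonneg _

/-- Opening one letter leaves its coefficients unchanged, so the mass is additive over letters. This
is why `wrho`, and not the length, measures the cost of a derivative: a word may contain arbitrarily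
many Cayley letters of small mass. -/
theorem mass_wdiff (w : Word d r k) : mass (wdiff P τ s w) = wrho P τ s w := by
  induction w with
  | nil => simp [wdiff, mass]
  | cons l w ih =>
    rw [wrho_cons, ← ih, mass, wdiff, lsum_append, lsum_map, lsum_map]; rfl

theorem wrho_map_base_le (w : List (Letter d r)) : wrho P τ s (w.map .base) ≤ w.length := by
  induction w with
  | nil => simp
  | cons l w ih =>
    rw [List.map_cons, wrho_cons, List.length_cons]
    have : mass (letterDiff P τ s (.base l)) ≤ 1 := by
      cases l with
      | X i => by_cases hi : i = s <;> simp [letterDiff, hi, mass]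
      | Z j => simp [letterDiff, mass]
      | Zstar j => simp [letterDiff, mass]
    push_cast; linarith

/-- The size of a polynomial that controls its differences. -/
noncomputable def polySize (p : NCPoly d r) : ℝ := lsum (polyTerms p) fun q => ‖q.1‖ * q.2.length

theorem polySize_nonneg (p : NCPoly d r) : 0 ≤ polySize p :=
  lsum_nonneg fun _ _ => by positivity

/-- The largest length of a monomial. -/
noncomputable def polyDeg (p : NCPoly d r) : ℕ := lsum (polyTerms p) fun q => q.2.length

theorem length_le_polyDeg {p : NCPoly d r} {q} (hq : q ∈ polyTerms p) : q.2.length ≤ polyDeg p :=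
  List.single_le_sum (fun _ _ => Nat.zero_le _) _ (List.mem_map_of_mem (f := fun q => q.2.length) hq)

/-- A monomial has at most as many occurrences of `X_s` as letters, and each contributes its
coefficient times |τ_j|. -/
theorem mass_resDiff_le (j : Fin k) : mass (resDiff P τ s j) ≤ |τ j| * polySize (P j) := by
  rw [mass, resDiff, lsum_flatMap, polySize, mul_lsum]
  refine lsum_le fun q _ => ?_
  rw [lsum_map]
  have : lsum (pdiff s q.2) (fun _ => ‖Complex.I * (τ j : ℂ) * q.1‖) =
      (pdiff s q.2).length * (|τ j| * ‖q.1‖) := by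
    simp [lsum]
  have h2 : ((pdiff s q.2).length : ℝ) ≤ q.2.length := by exact_mod_cast length_pdiff_le q.2
  rw [this]
  have := mul_le_mul_of_nonneg_right h2 (by positivity : 0 ≤ |τ j| * ‖q.1‖)
  linarith

theorem mass_letterDiff_cay_le (j : Fin k) :
    mass (letterDiff P τ s (.cay j)) ≤ 2 * (|τ j| * polySize (P j)) := by
  have : mass (letterDiff P τ s (.cay j)) = 2 * mass (resDiff P τ s j) := by
    rw [mass, letterDiff, lsum_map, mass, mul_lsum]
    refine lsum_congr fun t _ => ?_
    simp
  rw [this]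
  exact mul_le_mul_of_nonneg_left (mass_resDiff_le j) zero_le_two

/-- Constants that control the growth of words under differences. -/
structure DiffBound (P : Fin k → NCPoly d r) (τ : Fin k → ℝ) (D : ℕ) (ρ : ℝ) : Prop where
  deg : ∀ j, polyDeg (P j) ≤ D
  size : ∀ j, D + 2 * (|τ j| * polySize (P j)) ≤ ρ
  deg_le : (D : ℝ) ≤ ρ

/-- The difference of a resolvent leaves one copy of it on each side, of mass at most |τ_j|
`polySize` each, and a monomial with one letter removed; this accounts for both terms of
`DiffBound.size`. -/
theorem resDiff_mem {D : ℕ} {ρ : ℝ} (h : DiffBound P τ D ρ) {j : Fin k} {t}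
    (ht : t ∈ resDiff P τ s j) : wdeg t.2.1 + wdeg t.2.2 ≤ D ∧
      wrho P τ s t.2.1 + wrho P τ s t.2.2 ≤ ρ ∧ ∀ a, wcount a t.2.1 + wcount a t.2.2 = 0 := by
  obtain ⟨q, hq, ht⟩ := List.mem_flatMap.1 ht
  obtain ⟨u, hu, rfl⟩ := List.mem_map.1 ht
  have h1 := pdiff_length hu
  have h2 := length_le_polyDeg hq
  have h3 := h.deg j
  have h4 := h.size j
  have h5 : mass (letterDiff P τ s (.res j)) ≤ |τ j| * polySize (P j) := mass_resDiff_le j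
  refine ⟨?_, ?_, fun a => ?_⟩
  · simp only [wdeg_cons, wdeg_append, wdeg_map_base, WLetter.deg, wdeg_nil, add_zero]; omega
  · simp only [wrho_cons, wrho_append, wrho_nil, add_zero]
    have h6 := wrho_map_base_le (P := P) (τ := τ) (s := s) u.1
    have h7 := wrho_map_base_le (P := P) (τ := τ) (s := s) u.2
    have h8 : (u.1.length : ℝ) + u.2.length ≤ D := by exact_mod_cast h1.trans (h2.trans h3)
    linarith
  · simp [wcount_cons, wcount_append, wcount_map_base, WLetter.dirCount]

theorem letterDiff_mem {D : ℕ} {ρ : ℝ} (h : DiffBound P τ D ρ) {l : WLetter d r k} {t}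
    (ht : t ∈ letterDiff P τ s l) : wdeg t.2.1 + wdeg t.2.2 ≤ D + l.deg ∧
      wrho P τ s t.2.1 + wrho P τ s t.2.2 ≤ ρ ∧
      ∀ a, wcount a t.2.1 + wcount a t.2.2 = l.dirCount a := by
  have hρ : 0 ≤ ρ := (Nat.cast_nonneg D).trans h.deg_le
  cases l with
  | base l =>
    cases l with
    | X i =>
      by_cases hi : i = s
      · simp only [letterDiff, hi, if_true, List.mem_singleton] at ht
        subst ht
        refine ⟨?_, ?_, fun a => ?_⟩ <;> simp [hρ, WLetter.dirCount]
      · simp [letterDiff, hi] at ht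
    | Z j => simp [letterDiff] at ht
    | Zstar j => simp [letterDiff] at ht
  | res j => exact resDiff_mem h ht
  | cay j =>
    obtain ⟨u, hu, rfl⟩ := List.mem_map.1 ht
    exact resDiff_mem (t := u) h hu
  | dir a => simp [letterDiff] at ht

/-- All letters but the opened one are kept, on one side or the other, so degree and mass grow by
the contribution of a single letter. -/
theorem wdiff_mem {D : ℕ} {ρ : ℝ} (h : DiffBound P τ D ρ) {w : Word d r k} {t}
    (ht : t ∈ wdiff P τ s w) : wdeg t.2.1 + wdeg t.2.2 ≤ wdeg w + D ∧
      wrho P τ s t.2.1 + wrho P τ s t.2.2 ≤ wrho P τ s w + ρ ∧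
      ∀ a, wcount a t.2.1 + wcount a t.2.2 = wcount a w := by
  induction w generalizing t with
  | nil => simp [wdiff] at ht
  | cons l w ih =>
    rw [wdiff, List.mem_append] at ht
    rcases ht with ht | ht
    · obtain ⟨u, hu, rfl⟩ := List.mem_map.1 ht
      obtain ⟨h1, h2, h3⟩ := letterDiff_mem h hu
      have h4 : 0 ≤ mass (letterDiff P τ s l) := mass_nonneg _
      refine ⟨?_, ?_, fun a => ?_⟩
      · simp only [wdeg_append, wdeg_cons]; omega
      · simp only [wrho_append, wrho_cons]; linarith
      · have := h3 a
        simp only [wcount_append, wcount_cons]; omega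
    · obtain ⟨u, hu, rfl⟩ := List.mem_map.1 ht
      obtain ⟨h1, h2, h3⟩ := ih hu
      refine ⟨?_, ?_, fun a => ?_⟩
      · simp only [wdeg_cons]; omega
      · simp only [wrho_cons]; linarith
      · have := h3 a
        simp only [wcount_cons]; omega

theorem tay_mem {D : ℕ} {ρ : ℝ} (h : DiffBound P τ D ρ) {β : List Bool} {w : Word d r k} {p}
    (hp : p ∈ tay P τ s β w) : wdeg p.2 ≤ wdeg w + β.length * D ∧
      wrho P τ s p.2 ≤ wrho P τ s w + β.length * ρ ∧
      ∀ a, wcount a p.2 = wcount a w + β.count a := by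
  induction β generalizing w p with
  | nil => simp [tay] at hp; subst hp; simp
  | cons b β ih =>
    obtain ⟨t, ht, hp⟩ := List.mem_flatMap.1 hp
    obtain ⟨q, hq, rfl⟩ := List.mem_map.1 hp
    obtain ⟨h1, h2, h3⟩ := wdiff_mem h ht
    obtain ⟨h4, h5, h6⟩ := ih hq
    refine ⟨?_, ?_, fun a => ?_⟩
    · simp only [wdeg_append, wdeg_cons, WLetter.deg, List.length_cons]; linarith
    · simp only [wrho_append, wrho_cons, letterDiff, List.length_cons]
      have : mass ([] : List (ℂ × Word d r k × Word d r k)) = 0 := by simp [mass]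
      push_cast; linarith
    · have h7 := h3 a
      have h8 := h6 a
      simp only [wcount_append, wcount_cons, List.count_cons, WLetter.dirCount, h8]
      by_cases hb : b = a <;> simp [hb] <;> omega

/-- Each of the successive differences acts on a word whose mass exceeds the initial one by at most
ρ per previous difference. The product of these masses is bounded by the power of the largest. -/
theorem mass_tay_le {D : ℕ} {ρ : ℝ} (h : DiffBound P τ D ρ) (β : List Bool) (w : Word d r k) :
    mass (tay P τ s β w) ≤ (wrho P τ s w + β.length * ρ) ^ β.length := by
  have hρ : 0 ≤ ρ := (Nat.cast_nonneg D).trans h.deg_le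
  induction β generalizing w with
  | nil => simp [tay, mass]
  | cons b β ih =>
    rw [tay, mass, lsum_flatMap]
    have h0 := wrho_nonneg (P := P) (τ := τ) (s := s) w
    calc lsum (wdiff P τ s w) (fun t => lsum ((tay P τ s β t.2.2).map fun p =>
            (t.1 * p.1, t.2.1 ++ .dir b :: p.2)) fun p => ‖p.1‖)
        ≤ lsum (wdiff P τ s w) (fun t => ‖t.1‖ * (wrho P τ s w + (β.length + 1) * ρ) ^ β.length) := by
          refine lsum_le fun t ht => ?_
          rw [lsum_map]
          simp only [norm_mul]
          rw [← mul_lsum]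
          -- The recursion continues in the right part only, whose mass is at most `wrho w + ρ`.
          refine mul_le_mul_of_nonneg_left ((ih t.2.2).trans ?_) (norm_nonneg _)
          have h2 := (wdiff_mem h ht).2.1
          have h3 := wrho_nonneg (P := P) (τ := τ) (s := s) t.2.1
          have h4 := wrho_nonneg (P := P) (τ := τ) (s := s) t.2.2
          refine pow_le_pow_left₀ (by positivity) ?_ _
          linarith
      _ = wrho P τ s w * (wrho P τ s w + (β.length + 1) * ρ) ^ β.length := by
          rw [← lsum_mul, ← mass_wdiff]; rfl
      _ ≤ _ := by
          rw [List.length_cons, pow_succ']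
          push_cast
          refine mul_le_mul_of_nonneg_right ?_ (by positivity)
          have : 0 ≤ ((β.length : ℝ) + 1) * ρ := by positivity
          linarith

/-! #### Norms of values -/

/-- Bounds on the matrices substituted for the letters. -/
structure EnvBound (A : Fin r → Matrix (Fin N) (Fin N) ℂ) (M : Fin d → Matrix (Fin N) (Fin N) ℂ)
    (Λ : ℝ) : Prop where
  one_le : 1 ≤ Λ
  herm : HermTuple M
  norm_M : ∀ s, ‖M s‖ ≤ Λ
  norm_A : ∀ j, ‖A j‖ ≤ Λ

theorem norm_wletterVal_le (hP : ∀ j, (P j).adjoint = P j) {Λ : ℝ} (h : EnvBound A M Λ)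
    (hE : ∀ a, ‖E a‖ ≤ 1) (l : WLetter d r k) : ‖wletterVal P τ A E M l‖ ≤ Λ ^ l.deg := by
  cases l with
  | base l =>
    cases l with
    | X i => simpa [wletterVal, letterValue, WLetter.deg] using h.norm_M i
    | Z j => simpa [wletterVal, letterValue, WLetter.deg] using h.norm_A j
    | Zstar j => simpa [wletterVal, letterValue, WLetter.deg, Matrix.l2_opNorm_conjTranspose]
        using h.norm_A j
  | res j => simpa [wletterVal, WLetter.deg] using
      norm_resolventMat_le (eval_isHermitian h.herm A (hP j)) (τ j)
  | cay j => simpa [wletterVal, WLetter.deg] using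
      norm_cayleyMat_le (eval_isHermitian h.herm A (hP j)) (τ j)
  | dir a => simpa [wletterVal, WLetter.deg] using hE a

/-- Resolvents, Cayley transforms and directions are contractions, so only polynomial letters cost a
factor Λ. The bound does not depend on how many Cayley letters the word has. -/
theorem norm_wordVal_le (hP : ∀ j, (P j).adjoint = P j) {Λ : ℝ} (h : EnvBound A M Λ)
    (hE : ∀ a, ‖E a‖ ≤ 1) (w : Word d r k) : ‖wordVal P τ A E M w‖ ≤ Λ ^ wdeg w := by
  induction w with
  | nil => simpa [wdeg] using l2_norm_one_le
  | cons l w ih =>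
    rw [wordVal_cons, wdeg_cons, pow_add]
    exact (norm_mul_le _ _).trans (mul_le_mul (norm_wletterVal_le hP h hE l) ih (norm_nonneg _)
      (pow_nonneg (zero_le_one.trans h.one_le) _))

theorem combVal_tay_cons (a : Bool) (β : List Bool) (w : Word d r k) :
    combVal P τ A E M (tay P τ s (a :: β) w) = lsum (wdiff P τ s w) fun t =>
      t.1 • (wordVal P τ A E M t.2.1 * E a * combVal P τ A E M (tay P τ s β t.2.2)) := by
  rw [combVal, tay, lsum_flatMap]
  refine lsum_congr fun t _ => ?_
  rw [combVal, lsum_map, mul_lsum, smul_lsum]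
  refine lsum_congr fun p _ => ?_
  rw [wordVal_append, wordVal_cons, mul_smul_comm, smul_smul, wletterVal, mul_assoc]

theorem zmon_cons (ζ : Bool → ℂ) (a : Bool) (β : List Bool) :
    zmon ζ (a :: β) = ζ a * zmon ζ β := by simp [zmon]

/-- Taylor expansion of words with explicit remainder bound. -/
theorem norm_word_taylor_le (hP : ∀ j, (P j).adjoint = P j) {Λ : ℝ} (h : EnvBound A M Λ)
    (h' : EnvBound A M' Λ) (hE : ∀ a, ‖E a‖ ≤ 1) {ζ : Bool → ℂ} {z : ℝ} (hz : ∀ a, ‖ζ a‖ ≤ z)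
    (hM' : M' = Function.update M s (M s + (ζ false • E false + ζ true • E true)))
    {D : ℕ} {ρ : ℝ} (hD : DiffBound P τ D ρ) (K : ℕ) (w : Word d r k) :
    ‖wordVal P τ A E M' w - ∑ β ∈ boolLists K, zmon ζ β • combVal P τ A E M (tay P τ s β w)‖ ≤
      (2 * z) ^ K * (wrho P τ s w + K * ρ) ^ K * Λ ^ (wdeg w + K * D) := by
  have hΛ : 0 ≤ Λ := zero_le_one.trans h.one_le
  have hz0 : 0 ≤ z := (norm_nonneg _).trans (hz true)
  have hρ : 0 ≤ ρ := (Nat.cast_nonneg D).trans hD.deg_le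
  induction K generalizing w with
  | zero => simpa [boolLists] using norm_wordVal_le hP h' hE w
  | succ K ih =>
    set B := ζ false • E false + ζ true • E true with hB
    have hBn : ‖B‖ ≤ 2 * z := by
      have : ∀ a, ‖ζ a • E a‖ ≤ z := fun a => by
        rw [norm_smul]
        exact (mul_le_mul (hz a) (hE a) (norm_nonneg _) hz0).trans (mul_one z).le
      rw [hB]
      exact (norm_add_le _ _).trans (by linarith [this false, this true])
    -- In the exact difference only the right factor is taken at `M'`. Subtracting its expansion of
    -- order K leaves the remainder of order K + 1.
    have h1 : wordVal P τ A E M' w - ∑ β ∈ boolLists (K + 1),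
        zmon ζ β • combVal P τ A E M (tay P τ s β w) =
        lsum (wdiff P τ s w) fun t => t.1 • (wordVal P τ A E M t.2.1 * B *
          (wordVal P τ A E M' t.2.2 -
            ∑ β ∈ boolLists K, zmon ζ β • combVal P τ A E M (tay P τ s β t.2.2))) := by
      have e1 : ∀ a, ∑ β ∈ boolLists K, zmon ζ (a :: β) •
          combVal P τ A E M (tay P τ s (a :: β) w) = lsum (wdiff P τ s w) fun t =>
            t.1 • (wordVal P τ A E M t.2.1 * (ζ a • E a) *
              ∑ β ∈ boolLists K, zmon ζ β • combVal P τ A E M (tay P τ s β t.2.2)) := by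
        intro a
        simp_rw [Finset.mul_sum, Finset.smul_sum]
        rw [lsum_finset_sum]
        refine Finset.sum_congr rfl fun β _ => ?_
        rw [combVal_tay_cons, smul_lsum]
        refine lsum_congr fun t _ => ?_
        rw [zmon_cons]
        simp only [mul_smul_comm, smul_mul_assoc, smul_smul]
        congr 1; ring
      rw [sum_boolLists_succ, e1, e1, ← lsum_add]
      have e2 : combVal P τ A E M (tay P τ s [] w) = wordVal P τ A E M w := by
        simp [combVal, tay]
      rw [e2, ← sub_sub]
      have e3 : zmon ζ [] = 1 := by simp [zmon]
      rw [e3, one_smul, wdiff_sum (E := E) hP h.herm h'.herm hM' w, ← lsum_sub]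
      refine lsum_congr fun t _ => ?_
      rw [mul_sub, smul_sub, ← smul_add, ← add_mul, ← mul_add]
    rw [h1]
    have h0 := wrho_nonneg (P := P) (τ := τ) (s := s) w
    refine (norm_lsum_le_mass (b := (2 * z) ^ (K + 1) *
      (wrho P τ s w + (K + 1 : ℕ) * ρ) ^ K * Λ ^ (wdeg w + (K + 1) * D)) fun t ht => ?_).trans ?_
    · obtain ⟨d1, d2, -⟩ := wdiff_mem hD ht
      have h3 := wrho_nonneg (P := P) (τ := τ) (s := s) t.2.1
      have h4 := wrho_nonneg (P := P) (τ := τ) (s := s) t.2.2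
      calc ‖_‖ ≤ ‖wordVal P τ A E M t.2.1‖ * ‖B‖ * _ :=
            (norm_mul_le _ _).trans (mul_le_mul_of_nonneg_right (norm_mul_le _ _) (norm_nonneg _))
        _ ≤ Λ ^ wdeg t.2.1 * (2 * z) * ((2 * z) ^ K * (wrho P τ s t.2.2 + K * ρ) ^ K *
            Λ ^ (wdeg t.2.2 + K * D)) := by
            refine mul_le_mul (mul_le_mul (norm_wordVal_le hP h hE _) hBn (norm_nonneg _)
              (by positivity)) (ih _) (norm_nonneg _) (by positivity)
        _ = (2 * z) ^ (K + 1) * (wrho P τ s t.2.2 + K * ρ) ^ K *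
            Λ ^ (wdeg t.2.1 + wdeg t.2.2 + K * D) := by ring
        _ ≤ _ := by
            refine mul_le_mul (mul_le_mul_of_nonneg_left (pow_le_pow_left₀ (by positivity) ?_ _)
              (by positivity)) (pow_le_pow_right₀ h.one_le ?_) (by positivity) (by positivity)
            · push_cast; linarith
            · rw [add_mul]; omega
    · rw [mass_wdiff]
      have h5 : wrho P τ s w ≤ wrho P τ s w + (K + 1 : ℕ) * ρ := by
        have : 0 ≤ ((K + 1 : ℕ) : ℝ) * ρ := by positivity
        linarith
      calc _ = (2 * z) ^ (K + 1) * (wrho P τ s w * (wrho P τ s w + (K + 1 : ℕ) * ρ) ^ K) *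
          Λ ^ (wdeg w + (K + 1) * D) := by ring
        _ ≤ _ := by
          rw [pow_succ' (wrho P τ s w + (K + 1 : ℕ) * ρ) K]
          gcongr

end Words

section Words
open scoped Matrix.Norms.L2Operator

variable {d r k N : ℕ}

/-! ### Quadratic forms of words -/

theorem quadForm_add (x y : EuclideanSpace ℂ (Fin N)) (M M' : Matrix (Fin N) (Fin N) ℂ) :
    quadForm x (M + M') y = quadForm x M y + quadForm x M' y := by
  simp [quadForm]

/-- The quadratic form as a linear map in the matrix. -/
noncomputable def quadFormLin (x y : EuclideanSpace ℂ (Fin N)) :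
    Matrix (Fin N) (Fin N) ℂ →ₗ[ℂ] ℂ where
  toFun M := quadForm x M y
  map_add' := quadForm_add x y
  map_smul' c M := by simp [quadForm]

theorem quadFormLin_apply (x y : EuclideanSpace ℂ (Fin N)) (M : Matrix (Fin N) (Fin N) ℂ) :
    quadFormLin x y M = quadForm x M y := rfl

theorem norm_quadForm_le (x y : EuclideanSpace ℂ (Fin N)) (M : Matrix (Fin N) (Fin N) ℂ) :
    ‖quadForm x M y‖ ≤ ‖M‖ * (‖x‖ * ‖y‖) := by
  refine (norm_inner_le_norm _ _).trans ?_
  have := mul_le_mul_of_nonneg_left (mulVec_norm M y) (norm_nonneg x)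
  linarith

theorem norm_quadForm_le_of_unit {x y : EuclideanSpace ℂ (Fin N)} (hx : ‖x‖ ≤ 1) (hy : ‖y‖ ≤ 1)
    (M : Matrix (Fin N) (Fin N) ℂ) : ‖quadForm x M y‖ ≤ ‖M‖ := by
  refine (norm_quadForm_le x y M).trans ?_
  have : ‖x‖ * ‖y‖ ≤ 1 := mul_le_one₀ hx (norm_nonneg _) hy
  nlinarith [norm_nonneg M]

/-- The matrix `x^* L` as a family of coordinates. -/
noncomputable def rowCoord (x : EuclideanSpace ℂ (Fin N)) (L : Matrix (Fin N) (Fin N) ℂ)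
    (i : Fin N) : ℂ := quadForm x L (EuclideanSpace.single i 1)

/-- The coordinates of `R y`. -/
noncomputable def colCoord (R : Matrix (Fin N) (Fin N) ℂ) (y : EuclideanSpace ℂ (Fin N))
    (j : Fin N) : ℂ := Matrix.toEuclideanCLM (n := Fin N) (𝕜 := ℂ) R y j

theorem clm_single_apply (i j : Fin N) (v : EuclideanSpace ℂ (Fin N)) :
    Matrix.toEuclideanCLM (n := Fin N) (𝕜 := ℂ) (Matrix.single i j 1) v =
      v j • EuclideanSpace.single i (1 : ℂ) := by
  ext a
  rw [Matrix.ofLp_toEuclideanCLM]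
  simp [Matrix.single_mulVec, Function.update_apply]

theorem norm_single_le (i j : Fin N) : ‖(Matrix.single i j 1 : Matrix (Fin N) (Fin N) ℂ)‖ ≤ 1 := by
  refine norm_le_one_of_contract fun v => ?_
  rw [clm_single_apply, norm_smul, PiLp.norm_single, norm_one, mul_one]
  exact PiLp.norm_apply_le v j

/-- A matrix unit has rank one, so a quadratic form splits into a row factor and a column factor at
each occurrence of a direction. -/
theorem quadForm_mul_single_mul (x y : EuclideanSpace ℂ (Fin N))
    (L R : Matrix (Fin N) (Fin N) ℂ) (i j : Fin N) :
    quadForm x (L * (Matrix.single i j 1 * R)) y = rowCoord x L i * colCoord R y j := by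
  unfold quadForm rowCoord colCoord quadForm
  rw [clm_mul_apply, clm_mul_apply, clm_single_apply, map_smul, inner_smul_right, mul_comm]

theorem sum_sq_colCoord_le (R : Matrix (Fin N) (Fin N) ℂ) {y : EuclideanSpace ℂ (Fin N)}
    (hy : ‖y‖ ≤ 1) : ∑ j, ‖colCoord R y j‖ ^ 2 ≤ ‖R‖ ^ 2 := by
  unfold colCoord
  rw [← EuclideanSpace.norm_sq_eq]
  refine pow_le_pow_left₀ (norm_nonneg _) ((mulVec_norm R y).trans ?_) 2
  nlinarith [norm_nonneg R]

theorem rowCoord_eq (x : EuclideanSpace ℂ (Fin N)) (L : Matrix (Fin N) (Fin N) ℂ) (i : Fin N) :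
    rowCoord x L i = conj (colCoord L.conjTranspose x i) := by
  have h : Matrix.toEuclideanCLM (n := Fin N) (𝕜 := ℂ) L.conjTranspose =
      ContinuousLinearMap.adjoint (Matrix.toEuclideanCLM (n := Fin N) (𝕜 := ℂ) L) := by
    rw [← ContinuousLinearMap.star_eq_adjoint, ← map_star]; rfl
  unfold rowCoord quadForm colCoord
  rw [h, ← ContinuousLinearMap.adjoint_inner_left, EuclideanSpace.inner_single_right]
  simp

theorem sum_sq_rowCoord_le (L : Matrix (Fin N) (Fin N) ℂ) {x : EuclideanSpace ℂ (Fin N)}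
    (hx : ‖x‖ ≤ 1) : ∑ j, ‖rowCoord x L j‖ ^ 2 ≤ ‖L‖ ^ 2 := by
  simp_rw [rowCoord_eq, RCLike.norm_conj]
  rw [← Matrix.l2_opNorm_conjTranspose L]
  exact sum_sq_colCoord_le _ hx

theorem rowCoord_mul_single (x : EuclideanSpace ℂ (Fin N)) (L M : Matrix (Fin N) (Fin N) ℂ)
    (i j m : Fin N) :
    rowCoord x (L * (Matrix.single i j 1 * M)) m = rowCoord x L i * M j m := by
  rw [rowCoord, quadForm_mul_single_mul]
  congr 1
  unfold colCoord
  rw [Matrix.ofLp_toEuclideanCLM]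
  simp

theorem norm_apply_le_norm (M : Matrix (Fin N) (Fin N) ℂ) (i j : Fin N) : ‖M i j‖ ≤ ‖M‖ := by
  have h := norm_quadForm_le_of_unit (x := EuclideanSpace.single i (1 : ℂ))
    (y := EuclideanSpace.single j (1 : ℂ)) (by simp) (by simp) M
  have h2 : quadForm (EuclideanSpace.single i (1 : ℂ)) M (EuclideanSpace.single j (1 : ℂ)) = M i j := by
    unfold quadForm
    rw [EuclideanSpace.inner_single_left, Matrix.ofLp_toEuclideanCLM]
    simp
  rwa [h2] at h

/-- Each of the N columns has Euclidean norm at most the operator norm. -/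
theorem sum_sq_apply_le (M : Matrix (Fin N) (Fin N) ℂ) :
    ∑ i, ∑ j, ‖M i j‖ ^ 2 ≤ N * ‖M‖ ^ 2 := by
  rw [Finset.sum_comm]
  have h : ∀ j, ∑ i, ‖M i j‖ ^ 2 ≤ ‖M‖ ^ 2 := fun j => by
    have := sum_sq_colCoord_le M (y := EuclideanSpace.single j (1 : ℂ)) (by simp)
    refine le_trans (le_of_eq (Finset.sum_congr rfl fun i _ => ?_)) this
    unfold colCoord
    rw [Matrix.ofLp_toEuclideanCLM]
    simp
  calc _ ≤ ∑ _j : Fin N, ‖M‖ ^ 2 := Finset.sum_le_sum fun j _ => h j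
    _ = _ := by simp

/-- The directions attached to a pair of indices. -/
noncomputable def dirMat (p : Fin N × Fin N) : Bool → Matrix (Fin N) (Fin N) ℂ
  | false => Matrix.single p.1 p.2 1
  | true => Matrix.single p.2 p.1 1

/-- The row index of a direction. -/
def dirSrc (a : Bool) (p : Fin N × Fin N) : Fin N := if a then p.2 else p.1

/-- The column index of a direction. -/
def dirTgt (a : Bool) (p : Fin N × Fin N) : Fin N := if a then p.1 else p.2

theorem dirMat_eq (a : Bool) (p : Fin N × Fin N) :
    dirMat p a = Matrix.single (dirSrc a p) (dirTgt a p) 1 := by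
  cases a <;> rfl

theorem norm_dirMat_le (p : Fin N × Fin N) (a : Bool) : ‖dirMat p a‖ ≤ 1 := by
  rw [dirMat_eq]; exact norm_single_le _ _

theorem sum_dirSrc (a : Bool) (f : Fin N → ℝ) :
    ∑ p : Fin N × Fin N, f (dirSrc a p) = N * ∑ i, f i := by
  rw [Fintype.sum_prod_type]
  cases a <;> simp [dirSrc, Finset.mul_sum]

theorem sum_dirTgt (a : Bool) (f : Fin N → ℝ) :
    ∑ p : Fin N × Fin N, f (dirTgt a p) = N * ∑ i, f i := by
  rw [Fintype.sum_prod_type]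
  cases a <;> simp [dirTgt, Finset.mul_sum]

theorem sum_dirSrc_dirTgt (a : Bool) (f : Fin N → Fin N → ℝ) :
    ∑ p : Fin N × Fin N, f (dirSrc a p) (dirTgt a p) = ∑ i, ∑ j, f i j := by
  rw [Fintype.sum_prod_type]
  cases a
  · simp [dirTgt, dirSrc]
  · simp only [dirTgt, dirSrc, if_true]; rw [Finset.sum_comm]

/-! #### Splitting words at directions -/

theorem exists_first_dir {w : Word d r k} (h : 0 < wcount false w + wcount true w) :
    ∃ (u : Word d r k) (a : Bool) (v : Word d r k), w = u ++ .dir a :: v ∧ ∀ b, wcount b u = 0 := by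
  induction w with
  | nil => simp at h
  | cons l w ih =>
    cases l with
    | dir a => exact ⟨[], a, w, rfl, fun b => rfl⟩
    | base l =>
      obtain ⟨u, a, v, rfl, hu⟩ := ih (by simpa [wcount_cons, WLetter.dirCount] using h)
      exact ⟨.base l :: u, a, v, rfl, fun b => by simp [wcount_cons, WLetter.dirCount, hu]⟩
    | res l =>
      obtain ⟨u, a, v, rfl, hu⟩ := ih (by simpa [wcount_cons, WLetter.dirCount] using h)
      exact ⟨.res l :: u, a, v, rfl, fun b => by simp [wcount_cons, WLetter.dirCount, hu]⟩
    | cay l =>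
      obtain ⟨u, a, v, rfl, hu⟩ := ih (by simpa [wcount_cons, WLetter.dirCount] using h)
      exact ⟨.cay l :: u, a, v, rfl, fun b => by simp [wcount_cons, WLetter.dirCount, hu]⟩

theorem exists_last_dir {w : Word d r k} (h : 0 < wcount false w + wcount true w) :
    ∃ (u : Word d r k) (a : Bool) (v : Word d r k), w = u ++ .dir a :: v ∧ ∀ b, wcount b v = 0 := by
  induction w with
  | nil => simp at h
  | cons l w ih =>
    by_cases h0 : 0 < wcount false w + wcount true w
    · obtain ⟨u, a, v, rfl, hv⟩ := ih h0
      exact ⟨l :: u, a, v, rfl, hv⟩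
    · have hw : ∀ b, wcount b w = 0 := fun b => by cases b <;> omega
      cases l with
      | dir a => exact ⟨[], a, w, rfl, hw⟩
      | base l => simp [wcount_cons, WLetter.dirCount, hw] at h
      | res l => simp [wcount_cons, WLetter.dirCount, hw] at h
      | cay l => simp [wcount_cons, WLetter.dirCount, hw] at h

variable {P : Fin k → NCPoly d r} {τ : Fin k → ℝ} {A : Fin r → Matrix (Fin N) (Fin N) ℂ}
  {M : Fin d → Matrix (Fin N) (Fin N) ℂ} {s : Fin d}

/-- Factors without directions can be written with zero directions, hence do not depend on the pair
of indices; sums over pairs then act on fixed rows and columns. -/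
theorem wordVal_congr_dir {E E' : Bool → Matrix (Fin N) (Fin N) ℂ} {w : Word d r k}
    (h : ∀ b, wcount b w = 0) : wordVal P τ A E M w = wordVal P τ A E' M w := by
  induction w with
  | nil => rfl
  | cons l w ih =>
    rw [wordVal_cons, wordVal_cons, ih fun b => by have := h b; rw [wcount_cons] at this; omega]
    cases l with
    | dir a => have := h a; simp [wcount_cons, WLetter.dirCount] at this
    | base l => rfl
    | res l => rfl
    | cay l => rfl

variable {x y : EuclideanSpace ℂ (Fin N)} {Λ : ℝ}

/-- A word with one direction: the sum of the squares over all pairs. -/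
theorem sum_sq_word_le (hP : ∀ j, (P j).adjoint = P j) (h : EnvBound A M Λ) (hx : ‖x‖ ≤ 1)
    (hy : ‖y‖ ≤ 1) {w : Word d r k} (hw : wcount false w + wcount true w = 1) :
    ∑ p, ‖quadForm x (wordVal P τ A (dirMat p) M w) y‖ ^ 2 ≤ (Λ ^ wdeg w) ^ 2 := by
  obtain ⟨u, a, v, rfl, hu⟩ := exists_first_dir (w := w) (by omega)
  have hv : ∀ b, wcount b v = 0 := by
    intro b
    simp only [wcount_append, wcount_cons, hu, WLetter.dirCount] at hw
    cases a <;> cases b <;> simp at hw ⊢ <;> omega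
  set L := wordVal P τ A (fun _ => 0) M u with hL
  set R := wordVal P τ A (fun _ => 0) M v with hR
  have h0 : ∀ a, ‖(fun _ => 0 : Bool → Matrix (Fin N) (Fin N) ℂ) a‖ ≤ 1 := by simp
  have e : ∀ p, ‖quadForm x (wordVal P τ A (dirMat p) M (u ++ .dir a :: v)) y‖ ^ 2 =
      ‖rowCoord x L (dirSrc a p)‖ ^ 2 * ‖colCoord R y (dirTgt a p)‖ ^ 2 := fun p => by
    rw [wordVal_append, wordVal_cons, wletterVal, dirMat_eq, quadForm_mul_single_mul, norm_mul,
      mul_pow, wordVal_congr_dir (E' := fun _ => 0) hu, wordVal_congr_dir (E' := fun _ => 0) hv]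
  simp_rw [e]
  rw [sum_dirSrc_dirTgt a fun i j => ‖rowCoord x L i‖ ^ 2 * ‖colCoord R y j‖ ^ 2,
    ← Finset.sum_mul_sum]
  have h1 : ‖L‖ ≤ Λ ^ wdeg u := norm_wordVal_le hP h h0 u
  have h2 : ‖R‖ ≤ Λ ^ wdeg v := norm_wordVal_le hP h h0 v
  have h3 : wdeg (u ++ WLetter.dir a :: v) = wdeg u + wdeg v := by
    rw [wdeg_append, wdeg_cons, WLetter.deg, zero_add]
  rw [h3, pow_add, mul_pow]
  have hΛ : 0 ≤ Λ := zero_le_one.trans h.one_le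
  exact mul_le_mul ((sum_sq_rowCoord_le L hx).trans (pow_le_pow_left₀ (norm_nonneg _) h1 2))
    ((sum_sq_colCoord_le R hy).trans (pow_le_pow_left₀ (norm_nonneg _) h2 2))
    (Finset.sum_nonneg fun _ _ => sq_nonneg _) (by positivity)

/-- A word with two directions or more: the sum over all pairs. -/
theorem sum_word_le (hP : ∀ j, (P j).adjoint = P j) (h : EnvBound A M Λ) (hx : ‖x‖ ≤ 1)
    (hy : ‖y‖ ≤ 1) {w : Word d r k} (hw : 2 ≤ wcount false w + wcount true w) :
    ∑ p, ‖quadForm x (wordVal P τ A (dirMat p) M w) y‖ ≤ Λ ^ (2 * wdeg w) * N := by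
  obtain ⟨u, a, v', rfl, hu⟩ := exists_first_dir (w := w) (by omega)
  have hv' : 0 < wcount false v' + wcount true v' := by
    simp only [wcount_append, wcount_cons, hu, WLetter.dirCount] at hw
    cases a <;> simp at hw <;> omega
  obtain ⟨m, b, v, rfl, hv⟩ := exists_last_dir hv'
  have hΛ : 0 ≤ Λ := zero_le_one.trans h.one_le
  set L := wordVal P τ A (fun _ => 0) M u with hL
  set R := wordVal P τ A (fun _ => 0) M v with hR
  have h0 : ∀ a, ‖(fun _ => 0 : Bool → Matrix (Fin N) (Fin N) ℂ) a‖ ≤ 1 := by simp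
  -- The word is cut at its first and last directions. The middle part may contain further
  -- directions, but enters through a single entry, bounded by its operator norm. The two outer
  -- factors are separated by the arithmetic–geometric inequality; each then depends on one index,
  -- and the free index gives the factor N.
  have e : ∀ p, ‖quadForm x (wordVal P τ A (dirMat p) M (u ++ .dir a :: (m ++ .dir b :: v))) y‖ ≤
      Λ ^ wdeg m * ((‖rowCoord x L (dirSrc a p)‖ ^ 2 + ‖colCoord R y (dirTgt b p)‖ ^ 2) / 2) := by
    intro p
    have e1 : wordVal P τ A (dirMat p) M (u ++ .dir a :: (m ++ .dir b :: v)) =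
      (L * (Matrix.single (dirSrc a p) (dirTgt a p) 1 * wordVal P τ A (dirMat p) M m)) *
        (Matrix.single (dirSrc b p) (dirTgt b p) 1 * R) := by
      simp only [wordVal_append, wordVal_cons, wletterVal, dirMat_eq, mul_assoc]
      rw [wordVal_congr_dir (E' := fun _ => 0) hu, wordVal_congr_dir (E' := fun _ => 0) hv]
    rw [e1, quadForm_mul_single_mul, rowCoord_mul_single, norm_mul, norm_mul]
    have h1 := (norm_apply_le_norm (wordVal P τ A (dirMat p) M m) (dirTgt a p) (dirSrc b p)).trans
      (norm_wordVal_le hP h (norm_dirMat_le p) m)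
    have h2 : ‖rowCoord x L (dirSrc a p)‖ * ‖colCoord R y (dirTgt b p)‖ ≤
      (‖rowCoord x L (dirSrc a p)‖ ^ 2 + ‖colCoord R y (dirTgt b p)‖ ^ 2) / 2 := by
      nlinarith [sq_nonneg (‖rowCoord x L (dirSrc a p)‖ - ‖colCoord R y (dirTgt b p)‖)]
    calc _ = ‖wordVal P τ A (dirMat p) M m (dirTgt a p) (dirSrc b p)‖ *
          (‖rowCoord x L (dirSrc a p)‖ * ‖colCoord R y (dirTgt b p)‖) := by ring
      _ ≤ _ := mul_le_mul h1 h2 (by positivity) (by positivity)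
  refine (Finset.sum_le_sum fun p _ => e p).trans ?_
  rw [← Finset.mul_sum, ← Finset.sum_div, Finset.sum_add_distrib,
    sum_dirSrc a fun i => ‖rowCoord x L i‖ ^ 2, sum_dirTgt b fun i => ‖colCoord R y i‖ ^ 2]
  have h1 : ‖L‖ ≤ Λ ^ wdeg u := norm_wordVal_le hP h h0 u
  have h2 : ‖R‖ ≤ Λ ^ wdeg v := norm_wordVal_le hP h h0 v
  have h3 : wdeg (u ++ WLetter.dir a :: (m ++ WLetter.dir b :: v)) = wdeg u + wdeg m + wdeg v := by
    simp only [wdeg_append, wdeg_cons, WLetter.deg]; omega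
  have h4 : ∑ j, ‖rowCoord x L j‖ ^ 2 ≤ Λ ^ (2 * (wdeg u + wdeg v)) := by
    refine (sum_sq_rowCoord_le L hx).trans ((pow_le_pow_left₀ (norm_nonneg _) h1 2).trans ?_)
    rw [← pow_mul]
    exact pow_le_pow_right₀ h.one_le (by omega)
  have h5 : ∑ j, ‖colCoord R y j‖ ^ 2 ≤ Λ ^ (2 * (wdeg u + wdeg v)) := by
    refine (sum_sq_colCoord_le R hy).trans ((pow_le_pow_left₀ (norm_nonneg _) h2 2).trans ?_)
    rw [← pow_mul]
    exact pow_le_pow_right₀ h.one_le (by omega)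
  rw [h3]
  have h6 : (0 : ℝ) ≤ N := Nat.cast_nonneg N
  calc _ ≤ Λ ^ wdeg m * ((N * Λ ^ (2 * (wdeg u + wdeg v)) + N * Λ ^ (2 * (wdeg u + wdeg v))) / 2) := by
        gcongr
    _ = Λ ^ (wdeg m + 2 * (wdeg u + wdeg v)) * N := by rw [pow_add]; ring
    _ ≤ _ := by
        refine mul_le_mul_of_nonneg_right (pow_le_pow_right₀ h.one_le (by omega)) h6

/-- A word with twice the same direction: the sum over all pairs. -/
theorem sum_word_same_le (hP : ∀ j, (P j).adjoint = P j) (h : EnvBound A M Λ) (hx : ‖x‖ ≤ 1)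
    (hy : ‖y‖ ≤ 1) {w : Word d r k} {a : Bool} (hw : ∀ b, wcount b w = if b = a then 2 else 0) :
    ∑ p, ‖quadForm x (wordVal P τ A (dirMat p) M w) y‖ ≤ Λ ^ wdeg w * √N := by
  have hw2 : wcount false w + wcount true w = 2 := by cases a <;> simp [hw]
  obtain ⟨u, a', v', rfl, hu⟩ := exists_first_dir (w := w) (by omega)
  have ha' : a' = a := by
    have := hw a'
    by_contra hne
    simp [wcount_append, wcount_cons, WLetter.dirCount, hne] at this
  subst ha'
  have hv' : ∀ b, wcount b v' = if b = a' then 1 else 0 := by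
    intro b
    have := hw b
    simp only [wcount_append, wcount_cons, WLetter.dirCount, hu] at this
    by_cases hb : b = a'
    · subst hb; simp at this ⊢; omega
    · have hb' : ¬ a' = b := fun h => hb h.symm
      simp [hb, hb'] at this ⊢; omega
  have hv2 : wcount false v' + wcount true v' = 1 := by cases a' <;> simp [hv']
  obtain ⟨m, b, v, rfl, hv⟩ := exists_last_dir (w := v') (by omega)
  have hb : b = a' := by
    have := hv' b
    by_contra hne
    simp [wcount_append, wcount_cons, WLetter.dirCount, hne] at this
  subst hb
  have hm : ∀ c, wcount c m = 0 := by
    intro c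
    simp only [wcount_append, wcount_cons, hv, WLetter.dirCount] at hv2
    cases b <;> cases c <;> simp at hv2 ⊢ <;> omega
  have hΛ : 0 ≤ Λ := zero_le_one.trans h.one_le
  set L := wordVal P τ A (fun _ => 0) M u with hL
  set Q := wordVal P τ A (fun _ => 0) M m with hQ
  set R := wordVal P τ A (fun _ => 0) M v with hR
  have h0 : ∀ a, ‖(fun _ => 0 : Bool → Matrix (Fin N) (Fin N) ℂ) a‖ ≤ 1 := by simp
  -- With the same direction (i, j) twice, the middle factor contributes its entry (j, i), while the
  -- row and column factors depend on i and j respectively.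
  have e : ∀ p, ‖quadForm x (wordVal P τ A (dirMat p) M (u ++ .dir b :: (m ++ .dir b :: v))) y‖ =
      ‖rowCoord x L (dirSrc b p)‖ * ‖Q (dirTgt b p) (dirSrc b p)‖ *
        ‖colCoord R y (dirTgt b p)‖ := by
    intro p
    have e1 : wordVal P τ A (dirMat p) M (u ++ .dir b :: (m ++ .dir b :: v)) =
      (L * (Matrix.single (dirSrc b p) (dirTgt b p) 1 * Q)) *
        (Matrix.single (dirSrc b p) (dirTgt b p) 1 * R) := by
      simp only [wordVal_append, wordVal_cons, wletterVal, dirMat_eq, mul_assoc]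
      rw [wordVal_congr_dir (E' := fun _ => 0) hu, wordVal_congr_dir (E' := fun _ => 0) hv,
        wordVal_congr_dir (E' := fun _ => 0) hm]
    rw [e1, quadForm_mul_single_mul, rowCoord_mul_single, norm_mul, norm_mul]
  simp_rw [e]
  rw [sum_dirSrc_dirTgt b fun i j => ‖rowCoord x L i‖ * ‖Q j i‖ * ‖colCoord R y j‖]
  have h1 : ‖L‖ ≤ Λ ^ wdeg u := norm_wordVal_le hP h h0 u
  have h2 : ‖R‖ ≤ Λ ^ wdeg v := norm_wordVal_le hP h h0 v
  have h3 : wdeg (u ++ WLetter.dir b :: (m ++ WLetter.dir b :: v)) = wdeg u + wdeg m + wdeg v := by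
    simp only [wdeg_append, wdeg_cons, WLetter.deg]; omega
  have h4 : ‖Q‖ ≤ Λ ^ wdeg m := norm_wordVal_le hP h h0 m
  -- Cauchy–Schwarz over pairs: the outer factors have square sum of order 1, and the
  -- Hilbert–Schmidt norm of `Q` costs only √N. Here `Q` must be free of directions, hence the same
  -- for all pairs.
  have hcs : (∑ i, ∑ j, ‖rowCoord x L i‖ * ‖Q j i‖ * ‖colCoord R y j‖) ^ 2 ≤
      (∑ i, ∑ j, ‖rowCoord x L i‖ ^ 2 * ‖colCoord R y j‖ ^ 2) * ∑ i, ∑ j, ‖Q j i‖ ^ 2 := by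
    have := Finset.sum_mul_sq_le_sq_mul_sq (Finset.univ : Finset (Fin N × Fin N))
      (fun p => ‖rowCoord x L p.1‖ * ‖colCoord R y p.2‖) (fun p => ‖Q p.2 p.1‖)
    simp only [Fintype.sum_prod_type, mul_pow] at this
    refine le_trans (le_of_eq ?_) this
    congr 1
    refine Finset.sum_congr rfl fun i _ => Finset.sum_congr rfl fun j _ => by ring
  have hb1 : ∑ i, ∑ j, ‖Q j i‖ ^ 2 ≤ N * ‖Q‖ ^ 2 := by
    rw [Finset.sum_comm]; exact sum_sq_apply_le Q
  rw [← Finset.sum_mul_sum] at hcs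
  rw [h3]
  refine abs_le_of_sq_le_sq' ?_ (by positivity) |>.2
  refine hcs.trans ?_
  rw [mul_pow, Real.sq_sqrt (Nat.cast_nonneg N)]
  calc _ ≤ ((Λ ^ wdeg u) ^ 2 * (Λ ^ wdeg v) ^ 2) * (N * (Λ ^ wdeg m) ^ 2) := by
        refine mul_le_mul (mul_le_mul
          ((sum_sq_rowCoord_le L hx).trans (pow_le_pow_left₀ (norm_nonneg _) h1 2))
          ((sum_sq_colCoord_le R hy).trans (pow_le_pow_left₀ (norm_nonneg _) h2 2)) ?_ ?_)
          (hb1.trans ?_) ?_ ?_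
        · positivity
        · positivity
        · gcongr
        · positivity
        · positivity
    _ = _ := by rw [pow_add, pow_add]; ring

/-! #### Combinations of words -/

theorem quadForm_combVal (E : Bool → Matrix (Fin N) (Fin N) ℂ) (L : List (ℂ × Word d r k)) :
    quadForm x (combVal P τ A E M L) y =
      lsum L fun p => p.1 • quadForm x (wordVal P τ A E M p.2) y := by
  rw [← quadFormLin_apply, combVal, map_lsum]
  refine lsum_congr fun p _ => ?_
  rw [map_smul, quadFormLin_apply]

theorem norm_quadForm_combVal_le (hP : ∀ j, (P j).adjoint = P j) (h : EnvBound A M Λ)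
    (hx : ‖x‖ ≤ 1) (hy : ‖y‖ ≤ 1) {E : Bool → Matrix (Fin N) (Fin N) ℂ} (hE : ∀ a, ‖E a‖ ≤ 1)
    {L : List (ℂ × Word d r k)} {D : ℕ} (hL : ∀ p ∈ L, wdeg p.2 ≤ D) :
    ‖quadForm x (combVal P τ A E M L) y‖ ≤ mass L * Λ ^ D := by
  rw [quadForm_combVal]
  refine norm_lsum_le_mass (f := fun p => quadForm x (wordVal P τ A E M p.2) y) fun p hp => ?_
  exact (norm_quadForm_le_of_unit hx hy _).trans ((norm_wordVal_le hP h hE _).trans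
    (pow_le_pow_right₀ h.one_le (hL p hp)))

theorem sum_norm_lsum_le {ι : Type*} [Fintype ι] {L : List (ℂ × Word d r k)}
    {f : ι → Word d r k → ℂ} {b : ℝ} (h : ∀ p ∈ L, ∑ i, ‖f i p.2‖ ≤ b) :
    ∑ i, ‖lsum L fun p => p.1 • f i p.2‖ ≤ mass L * b := by
  calc _ ≤ ∑ i, lsum L fun p => ‖p.1‖ * ‖f i p.2‖ :=
        Finset.sum_le_sum fun i _ => norm_lsum_le fun p _ => (norm_smul _ _).le
    _ = lsum L fun p => ‖p.1‖ * ∑ i, ‖f i p.2‖ := by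
        rw [← lsum_finset_sum]; simp_rw [Finset.mul_sum]
    _ ≤ _ := by
        rw [mass, lsum_mul]
        exact lsum_le fun p hp => mul_le_mul_of_nonneg_left (h p hp) (norm_nonneg _)

/-- Cauchy–Schwarz for the weights given by the absolute values of the coefficients. -/
theorem norm_lsum_sq_le (L : List (ℂ × Word d r k)) (f : Word d r k → ℂ) :
    ‖lsum L fun p => p.1 • f p.2‖ ^ 2 ≤ mass L * lsum L fun p => ‖p.1‖ * ‖f p.2‖ ^ 2 := by
  have h : (lsum L fun p => ‖p.1‖ * ‖f p.2‖) ^ 2 ≤ mass L * lsum L fun p => ‖p.1‖ * ‖f p.2‖ ^ 2 := by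
    induction L with
    | nil => simp [mass]
    | cons p L ih =>
      have e : mass (p :: L) = ‖p.1‖ + mass L := lsum_cons _ _ _
      rw [lsum_cons, lsum_cons, e]
      set S := lsum L fun p => ‖p.1‖ * ‖f p.2‖
      set R := lsum L fun p => ‖p.1‖ * ‖f p.2‖ ^ 2
      have hR : 0 ≤ R := lsum_nonneg fun _ _ => by positivity
      have hm := mass_nonneg L
      have hc := norm_nonneg p.1
      have hq := norm_nonneg (f p.2)
      set c := ‖p.1‖
      set q := ‖f p.2‖
      -- From S² ≤ mass · R, the induction hypothesis, and 4 · mass · q² · R ≤ (R + mass · q²)².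
      have key : 2 * q * S ≤ R + mass L * q ^ 2 := by
        refine (abs_le_of_sq_le_sq' ?_ (by positivity)).2
        nlinarith [mul_le_mul_of_nonneg_left ih (sq_nonneg q), sq_nonneg (R - mass L * q ^ 2)]
      nlinarith [mul_le_mul_of_nonneg_left key hc]
  refine le_trans (pow_le_pow_left₀ (norm_nonneg _) ?_ 2) h
  exact norm_lsum_le fun p _ => (norm_smul _ _).le

theorem sum_sq_lsum_le {ι : Type*} [Fintype ι] {L : List (ℂ × Word d r k)}
    {f : ι → Word d r k → ℂ} {b : ℝ} (h : ∀ p ∈ L, ∑ i, ‖f i p.2‖ ^ 2 ≤ b) :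
    ∑ i, ‖lsum L fun p => p.1 • f i p.2‖ ^ 2 ≤ mass L ^ 2 * b := by
  calc _ ≤ ∑ i, mass L * lsum L fun p => ‖p.1‖ * ‖f i p.2‖ ^ 2 :=
        Finset.sum_le_sum fun i _ => norm_lsum_sq_le L (f i)
    _ = mass L * lsum L fun p => ‖p.1‖ * ∑ i, ‖f i p.2‖ ^ 2 := by
        rw [← Finset.mul_sum, ← lsum_finset_sum]; simp_rw [Finset.mul_sum]
    _ ≤ mass L * (mass L * b) := by
        refine mul_le_mul_of_nonneg_left ?_ (mass_nonneg L)
        conv_rhs => rw [mass, lsum_mul]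
        exact lsum_le fun p hp => mul_le_mul_of_nonneg_left (h p hp) (norm_nonneg _)
    _ = _ := by ring

end Words

/-- The independent entries of `d` Hermitian matrices of size `N`. -/
abbrev Entry (d N : ℕ) : Type := Fin d × {p : Fin N × Fin N // p.1 ≤ p.2}

/-! ### Taylor control of quadratic forms along single entries -/

section Words
open scoped Matrix.Norms.L2Operator

/-- The matrices `M` with `ζ false` and `ζ true` added at the two positions of an entry. -/
noncomputable def bump {d N : ℕ} (e : Entry d N) (ζ : Bool → ℂ)
    (M : Fin d → Matrix (Fin N) (Fin N) ℂ) : Fin d → Matrix (Fin N) (Fin N) ℂ :=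
  Function.update M e.1 (M e.1 + (ζ false • dirMat e.2.1 false + ζ true • dirMat e.2.1 true))

/-- Quantitative Taylor expansions of order ten of a function of Hermitian matrices in the
direction of each of the entries, where each derivative costs a factor `T`. -/
structure TaylorControl {d r N : ℕ} (A : Fin r → Matrix (Fin N) (Fin N) ℂ)
    (f : (Fin d → Matrix (Fin N) (Fin N) ℂ) → ℂ) (C : ℝ) (q : ℕ) (T : ℝ)
    (g : List Bool → Entry d N → (Fin d → Matrix (Fin N) (Fin N) ℂ) → ℂ)
    (g2 : Bool → List Bool → Entry d N → (Fin d → Matrix (Fin N) (Fin N) ℂ) → ℂ) : Prop where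
  nil : ∀ e M, g [] e M = f M
  nil2 : ∀ a e M, g2 a [] e M = g [a, a] e M
  taylor : ∀ e M ζ z Λ, EnvBound A M Λ → EnvBound A (bump e ζ M) Λ → (∀ a, ‖ζ a‖ ≤ z) →
    ‖f (bump e ζ M) - ∑ β ∈ boolLists 10, zmon ζ β * g β e M‖ ≤ C * (T * z) ^ 10 * Λ ^ q
  taylor2 : ∀ a e M ζ z Λ, EnvBound A M Λ → EnvBound A (bump e ζ M) Λ → (∀ a, ‖ζ a‖ ≤ z) →
    ‖g [a, a] e (bump e ζ M) - ∑ β ∈ boolLists 10, zmon ζ β * g2 a β e M‖ ≤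
      C * T ^ 2 * (T * z) ^ 10 * Λ ^ q
  sup : ∀ β e M Λ, β.length < 10 → EnvBound A M Λ → ‖g β e M‖ ≤ C * T ^ β.length * Λ ^ q
  sum_sq : ∀ a M Λ, EnvBound A M Λ → ∑ e, ‖g [a] e M‖ ^ 2 ≤ C * T ^ 2 * Λ ^ q
  sum_same : ∀ a M Λ, EnvBound A M Λ → ∑ e, ‖g [a, a] e M‖ ≤ C * T ^ 2 * √N * Λ ^ q
  stable : ∀ β M Λ (ζ : Entry d N → Bool → ℂ), 2 ≤ β.length → β.length < 10 → EnvBound A M Λ →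
    (∀ e, EnvBound A (bump e (ζ e) M) Λ) → (∀ e a, ‖ζ e a‖ ≤ Λ / √N) →
    ∑ e, ‖g β e (bump e (ζ e) M)‖ ≤ C * T ^ β.length * N * Λ ^ q
  stable2 : ∀ a β M Λ (ζ : Entry d N → Bool → ℂ), β.length < 10 → EnvBound A M Λ →
    (∀ e, EnvBound A (bump e (ζ e) M) Λ) → (∀ e a, ‖ζ e a‖ ≤ Λ / √N) →
    ∑ e, ‖g2 a β e (bump e (ζ e) M)‖ ≤ C * T ^ (2 + β.length) * N * Λ ^ q

variable {d r k N : ℕ}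

theorem sum_subtype_le {ι : Type*} [Fintype ι] (q : ι → Prop) [DecidablePred q] {f : ι → ℝ}
    (h : ∀ i, 0 ≤ f i) : ∑ i : {i // q i}, f i ≤ ∑ i, f i := by
  rw [← Finset.sum_subtype (Finset.univ.filter q) (by simp) f]
  exact Finset.sum_le_univ_sum_of_nonneg h

/-- A formal combination whose words have degree at most `D`, difference mass at most `R`, and
prescribed numbers of directions. -/
def InClass (P : Fin k → NCPoly d r) (τ : Fin k → ℝ) (s : Fin d) (D : ℕ) (R : ℝ) (n : Bool → ℕ)
    (L : List (ℂ × Word d r k)) : Prop :=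
  ∀ p ∈ L, wdeg p.2 ≤ D ∧ wrho P τ s p.2 ≤ R ∧ ∀ a, wcount a p.2 = n a

variable {P : Fin k → NCPoly d r} {τ : Fin k → ℝ} {A : Fin r → Matrix (Fin N) (Fin N) ℂ}
  {M M' : Fin d → Matrix (Fin N) (Fin N) ℂ} {s : Fin d} {D D' : ℕ} {ρ R : ℝ} {n : Bool → ℕ}
  {L : List (ℂ × Word d r k)}

theorem InClass.expand (hD : DiffBound P τ D ρ) (hL : InClass P τ s D' R n L) (β : List Bool) :
    InClass P τ s (D' + β.length * D) (R + β.length * ρ) (fun a => n a + β.count a)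
      (tayComb P τ s β L) := by
  intro p hp
  obtain ⟨q, hq, hp⟩ := List.mem_flatMap.1 hp
  obtain ⟨u, hu, rfl⟩ := List.mem_map.1 hp
  obtain ⟨h1, h2, h3⟩ := tay_mem hD hu
  obtain ⟨h4, h5, h6⟩ := hL q hq
  refine ⟨by dsimp only; omega, by dsimp only; linarith, fun a => ?_⟩
  dsimp only
  rw [h3, h6]

theorem mass_tayComb_le (hD : DiffBound P τ D ρ) (hL : InClass P τ s D' R n L) (β : List Bool) :
    mass (tayComb P τ s β L) ≤ mass L * (R + β.length * ρ) ^ β.length := by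
  have hρ : 0 ≤ ρ := (Nat.cast_nonneg D).trans hD.deg_le
  rw [mass, tayComb, lsum_flatMap, mass, lsum_mul]
  refine lsum_le fun p hp => ?_
  rw [lsum_map]
  simp only [norm_mul]
  rw [← mul_lsum]
  refine mul_le_mul_of_nonneg_left ((mass_tay_le hD β p.2).trans ?_) (norm_nonneg _)
  have := (hL p hp).2.1
  have h0 := wrho_nonneg (P := P) (τ := τ) (s := s) p.2
  exact pow_le_pow_left₀ (by positivity) (by linarith) _

theorem combVal_tayComb (E : Bool → Matrix (Fin N) (Fin N) ℂ) (β : List Bool) :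
    combVal P τ A E M (tayComb P τ s β L) =
      lsum L fun p => p.1 • combVal P τ A E M (tay P τ s β p.2) := by
  rw [combVal, tayComb, lsum_flatMap]
  refine lsum_congr fun p _ => ?_
  rw [lsum_map, combVal, smul_lsum]
  refine lsum_congr fun q _ => ?_
  rw [smul_smul]

theorem norm_comb_taylor_le (hP : ∀ j, (P j).adjoint = P j) {Λ : ℝ} (h : EnvBound A M Λ)
    (h' : EnvBound A M' Λ) {E : Bool → Matrix (Fin N) (Fin N) ℂ} (hE : ∀ a, ‖E a‖ ≤ 1)
    {ζ : Bool → ℂ} {z : ℝ} (hz : ∀ a, ‖ζ a‖ ≤ z)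
    (hM' : M' = Function.update M s (M s + (ζ false • E false + ζ true • E true)))
    (hD : DiffBound P τ D ρ) (hL : InClass P τ s D' R n L) (K : ℕ) :
    ‖combVal P τ A E M' L - ∑ β ∈ boolLists K, zmon ζ β • combVal P τ A E M (tayComb P τ s β L)‖ ≤
      mass L * ((2 * z) ^ K * (R + K * ρ) ^ K * Λ ^ (D' + K * D)) := by
  have hz0 : 0 ≤ z := (norm_nonneg _).trans (hz true)
  have hρ : 0 ≤ ρ := (Nat.cast_nonneg D).trans hD.deg_le
  have hΛ : 0 ≤ Λ := zero_le_one.trans h.one_le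
  have e : combVal P τ A E M' L - ∑ β ∈ boolLists K, zmon ζ β •
      combVal P τ A E M (tayComb P τ s β L) = lsum L fun p => p.1 • (wordVal P τ A E M' p.2 -
        ∑ β ∈ boolLists K, zmon ζ β • combVal P τ A E M (tay P τ s β p.2)) := by
    simp_rw [combVal_tayComb, smul_sub, Finset.smul_sum]
    rw [lsum_sub, lsum_finset_sum]
    congr 1
    refine Finset.sum_congr rfl fun β _ => ?_
    rw [smul_lsum]
    refine lsum_congr fun p _ => ?_
    rw [smul_comm]
  rw [e]
  refine norm_lsum_le_mass (f := fun p => wordVal P τ A E M' p.2 -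
        ∑ β ∈ boolLists K, zmon ζ β • combVal P τ A E M (tay P τ s β p.2)) fun p hp => ?_
  obtain ⟨h1, h2, -⟩ := hL p hp
  have h0 := wrho_nonneg (P := P) (τ := τ) (s := s) p.2
  refine (norm_word_taylor_le hP h h' hE hz hM' hD K p.2).trans ?_
  refine mul_le_mul (mul_le_mul_of_nonneg_left (pow_le_pow_left₀ (by positivity) (by linarith) _)
    (by positivity)) (pow_le_pow_right₀ h.one_le (by omega)) (by positivity) ?_
  have : 0 ≤ R + K * ρ := by
    have : 0 ≤ (K : ℝ) * ρ := by positivity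
    linarith
  positivity

variable {x y : EuclideanSpace ℂ (Fin N)} {Λ T c : ℝ}

/-- The ratio T/√N is the cost of one derivative times the size of one entry. The regime T⁴ ≤ N is
the one where fourth order terms, summed with a weight N, stay bounded. -/
theorem sqrt_scale (hT : 1 ≤ T) (hTN : T ^ 4 ≤ N) :
    0 < (N : ℝ) ∧ 0 ≤ T / √N ∧ T / √N ≤ 1 ∧ N * (T / √N) ^ 4 ≤ 1 := by
  have hN : (1 : ℝ) ≤ N := (one_le_pow₀ hT).trans hTN
  have hN0 : (0 : ℝ) < N := by linarith
  have hT0 : 0 < T := by linarith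
  have h4 : (√(N : ℝ)) ^ 4 = N ^ 2 := by
    rw [show 4 = 2 * 2 from rfl, pow_mul, Real.sq_sqrt hN0.le]
  refine ⟨hN0, by positivity, ?_, ?_⟩
  · rw [div_le_one (Real.sqrt_pos.2 hN0)]
    refine Real.le_sqrt_of_sq_le ?_
    exact (pow_le_pow_right₀ hT (by norm_num)).trans hTN
  · rw [div_pow, h4, ← mul_div_assoc, div_le_one (by positivity)]
    nlinarith

/-- Stability under a change of the entry at hand of the sum over the entries of a word with at
least two directions. -/
theorem sum_word_stable_le (hP : ∀ j, (P j).adjoint = P j) (h : EnvBound A M Λ) (hx : ‖x‖ ≤ 1)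
    (hy : ‖y‖ ≤ 1) (hT : 1 ≤ T) (hTN : T ^ 4 ≤ N) (hc : 1 ≤ c) (hD : DiffBound P τ D (c * T))
    {w : Word d r k} (hw : 2 ≤ wcount false w + wcount true w) (hwd : wdeg w ≤ D')
    (hwr : wrho P τ s w ≤ c * T) {ζ : {p : Fin N × Fin N // p.1 ≤ p.2} → Bool → ℂ}
    (hζ : ∀ p a, ‖ζ p a‖ ≤ Λ / √N) (h' : ∀ p, EnvBound A (bump (s, p) (ζ p) M) Λ) :
    ∑ p : {p : Fin N × Fin N // p.1 ≤ p.2},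
      ‖quadForm x (wordVal P τ A (dirMat p.1) (bump (s, p) (ζ p) M) w) y‖ ≤
      (2 ^ 11 * (22 * c) ^ 10) * N * Λ ^ (10 + 2 * (D' + 10 * D)) := by
  obtain ⟨hN0, hx0, hx1, hx4⟩ := sqrt_scale hT hTN
  have hΛ1 := h.one_le
  have hΛ : 0 ≤ Λ := zero_le_one.trans h.one_le
  have hN1 : (1 : ℝ) ≤ N := (one_le_pow₀ hT).trans hTN
  set z := Λ / √N with hz
  have hz0 : 0 ≤ z := by positivity
  have hzT : z * T = Λ * (T / √N) := by rw [hz]; ring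
  have hzT1 : z * T ≤ Λ := by rw [hzT]; exact mul_le_of_le_one_right hΛ hx1
  have hw0 := wrho_nonneg (P := P) (τ := τ) (s := s) w
  -- The constant 22 is 2 · (1 + 10): the increment has norm at most 2z, and after ten differences
  -- the mass is at most (1 + 10) cT.
  set Rem : ℝ := (22 * c) ^ 10 * (z * T) ^ 10 * Λ ^ (2 * (D' + 10 * D)) with hRem
  have hpt : ∀ p : {p : Fin N × Fin N // p.1 ≤ p.2},
      ‖quadForm x (wordVal P τ A (dirMat p.1) (bump (s, p) (ζ p) M) w) y‖ ≤
      ∑ β ∈ boolLists 10, z ^ β.length *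
        ‖quadForm x (combVal P τ A (dirMat p.1) M (tay P τ s β w)) y‖ + Rem := by
    intro p
    have h1 := norm_word_taylor_le hP h (h' p) (norm_dirMat_le p.1) (hζ p) rfl hD 10 w
    have h2 := (norm_quadForm_le_of_unit hx hy _).trans h1
    rw [← quadFormLin_apply, map_sub, map_sum] at h2
    have h3 : (2 * z) ^ 10 * (wrho P τ s w + (10 : ℕ) * (c * T)) ^ 10 * Λ ^ (wdeg w + 10 * D) ≤
        Rem := by
      rw [hRem, ← mul_pow, ← mul_pow]
      refine mul_le_mul (pow_le_pow_left₀ (by positivity) ?_ _)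
        (pow_le_pow_right₀ hΛ1 (by omega)) (by positivity) (by positivity)
      push_cast
      nlinarith
    have h4 := (norm_sub_norm_le _ _).trans (h2.trans h3)
    rw [quadFormLin_apply] at h4
    have h5 : ‖∑ β ∈ boolLists 10, quadFormLin x y (zmon (ζ p) β •
        combVal P τ A (dirMat p.1) M (tay P τ s β w))‖ ≤ ∑ β ∈ boolLists 10, z ^ β.length *
        ‖quadForm x (combVal P τ A (dirMat p.1) M (tay P τ s β w)) y‖ := by
      refine (norm_sum_le _ _).trans (Finset.sum_le_sum fun β _ => ?_)
      rw [map_smul, norm_smul, quadFormLin_apply]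
      exact mul_le_mul_of_nonneg_right (norm_zmon_le (hζ p) β) (norm_nonneg _)
    linarith
  refine (Finset.sum_le_sum fun p _ => hpt p).trans ?_
  refine (sum_subtype_le (fun p : Fin N × Fin N => p.1 ≤ p.2) (f := fun p =>
    ∑ β ∈ boolLists 10, z ^ β.length *
        ‖quadForm x (combVal P τ A (dirMat p) M (tay P τ s β w)) y‖ + Rem) fun p => ?_).trans ?_
  · have : 0 ≤ Rem := by positivity
    have : 0 ≤ ∑ β ∈ boolLists 10, z ^ β.length *
        ‖quadForm x (combVal P τ A (dirMat p) M (tay P τ s β w)) y‖ :=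
      Finset.sum_nonneg fun _ _ => by positivity
    linarith
  rw [Finset.sum_add_distrib, Finset.sum_comm]
  -- Differentiating only adds directions, so every term of the expansion at the fixed matrix `M`
  -- still has at least two of them and `sum_word_le` applies; the factor (zT)^|β| is at most a
  -- power of Λ.
  have hmain : ∀ β ∈ boolLists 10, ∑ p : Fin N × Fin N, z ^ β.length *
      ‖quadForm x (combVal P τ A (dirMat p) M (tay P τ s β w)) y‖ ≤
      (22 * c) ^ 10 * N * Λ ^ (10 + 2 * (D' + 10 * D)) := by
    intro β hβ
    have hβl : β.length < 10 := mem_boolLists.1 hβ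
    have hβ10 : (β.length : ℝ) ≤ 10 := by exact_mod_cast hβl.le
    rw [← Finset.mul_sum]
    simp_rw [quadForm_combVal]
    have h1 := sum_norm_lsum_le (L := tay P τ s β w)
      (f := fun (p : Fin N × Fin N) v => quadForm x (wordVal P τ A (dirMat p) M v) y)
      (b := Λ ^ (2 * (D' + 10 * D)) * N) fun v hv => by
        obtain ⟨h1, h2, h3⟩ := tay_mem hD hv
        refine (sum_word_le hP h hx hy ?_).trans ?_
        · rw [h3, h3]; omega
        · refine mul_le_mul_of_nonneg_right (pow_le_pow_right₀ hΛ1 ?_) hN0.le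
          have : β.length * D ≤ 10 * D := Nat.mul_le_mul_right D hβl.le
          omega
    have h2 : mass (tay P τ s β w) ≤ (22 * c * T) ^ β.length := by
      refine (mass_tay_le hD β w).trans (pow_le_pow_left₀ (by positivity) ?_ _)
      nlinarith
    calc _ ≤ z ^ β.length * ((22 * c * T) ^ β.length * (Λ ^ (2 * (D' + 10 * D)) * N)) := by
          refine mul_le_mul_of_nonneg_left (h1.trans ?_) (by positivity)
          exact mul_le_mul_of_nonneg_right h2 (by positivity)
      _ = (22 * c) ^ β.length * (z * T) ^ β.length * (Λ ^ (2 * (D' + 10 * D)) * N) := by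
          rw [mul_pow (22 * c) T, mul_pow z T]; ring
      _ ≤ (22 * c) ^ 10 * Λ ^ 10 * (Λ ^ (2 * (D' + 10 * D)) * N) := by
          refine mul_le_mul_of_nonneg_right (mul_le_mul ?_ ?_ (by positivity) (by positivity))
            (by positivity)
          · exact pow_le_pow_right₀ (by linarith) hβl.le
          · exact (pow_le_pow_left₀ (by positivity) hzT1 _).trans (pow_le_pow_right₀ hΛ1 hβl.le)
      _ = _ := by rw [pow_add]; ring
  -- The remainder is bounded pair by pair, so all N² pairs are counted; (T/√N)^10 pays for one
  -- factor N.
  have hrem : ∑ _p : Fin N × Fin N, Rem ≤ (22 * c) ^ 10 * N * Λ ^ (10 + 2 * (D' + 10 * D)) := by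
    have hcard : ∑ _p : Fin N × Fin N, Rem = N * (N * Rem) := by
      simp [Finset.sum_const, mul_assoc]
    rw [hcard, hRem, hzT, mul_pow Λ]
    have hx10 : N * (T / √N) ^ 10 ≤ 1 := by
      have : (T / √N) ^ 10 ≤ (T / √N) ^ 4 := pow_le_pow_of_le_one hx0 hx1 (by norm_num)
      nlinarith
    calc _ = (N * (T / √N) ^ 10) * ((22 * c) ^ 10 * N * Λ ^ (10 + 2 * (D' + 10 * D))) := by
          rw [pow_add Λ 10]; ring
      _ ≤ _ := mul_le_of_le_one_left (by positivity) hx10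
  have hsum := Finset.sum_le_sum hmain
  rw [Finset.sum_const, nsmul_eq_mul] at hsum
  have hcard : ((boolLists 10).card : ℝ) ≤ 2 ^ 10 := by exact_mod_cast card_boolLists_le 10
  have hpos : 0 ≤ (22 * c) ^ 10 * (N : ℝ) * Λ ^ (10 + 2 * (D' + 10 * D)) := by positivity
  nlinarith [mul_le_mul_of_nonneg_right hcard hpos]

end Words

/-! ### Uniform constants in the Taylor control -/

section Words
open scoped Matrix.Norms.L2Operator

variable {d r k N : ℕ} {P : Fin k → NCPoly d r} {τ : Fin k → ℝ}
  {A : Fin r → Matrix (Fin N) (Fin N) ℂ} {M M' : Fin d → Matrix (Fin N) (Fin N) ℂ} {s : Fin d}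
  {D D' : ℕ} {ρ R : ℝ} {n : Bool → ℕ} {L : List (ℂ × Word d r k)}
  {x y : EuclideanSpace ℂ (Fin N)} {Λ T c : ℝ}

theorem InClass.mono (hL : InClass P τ s D R n L) {D₁ : ℕ} {R₁ : ℝ} (hD : D ≤ D₁) (hR : R ≤ R₁) :
    InClass P τ s D₁ R₁ n L := fun p hp =>
  ⟨(hL p hp).1.trans hD, (hL p hp).2.1.trans hR, (hL p hp).2.2⟩

theorem DiffBound.mono (hD : DiffBound P τ D ρ) {ρ₁ : ℝ} (h : ρ ≤ ρ₁) : DiffBound P τ D ρ₁ :=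
  ⟨hD.deg, fun j => (hD.size j).trans h, hD.deg_le.trans h⟩

theorem combVal_tayComb_nil (E : Bool → Matrix (Fin N) (Fin N) ℂ) :
    combVal P τ A E M (tayComb P τ s [] L) = combVal P τ A E M L := by
  rw [combVal_tayComb]
  refine lsum_congr fun p _ => ?_
  simp [tay, combVal]

theorem combVal_congr_dir (hL : InClass P τ s D R (fun _ => 0) L)
    (E E' : Bool → Matrix (Fin N) (Fin N) ℂ) : combVal P τ A E M L = combVal P τ A E' M L :=
  lsum_congr fun p hp => by rw [wordVal_congr_dir (hL p hp).2.2]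

/-- The mass allowed at the start is 3cT, so that the statement also applies after two differences.
Fewer than ten more raise it by at most 10cT, and 31 leaves room. -/
theorem InClass.expand_scaled (hT : 1 ≤ T) (hc : 1 ≤ c) (hD : DiffBound P τ D (c * T))
    (hL : InClass P τ s D' (3 * c * T) n L) {β : List Bool} (hβ : β.length < 10) :
    InClass P τ s (D' + 10 * D) (31 * c * T) (fun a => n a + β.count a) (tayComb P τ s β L) ∧
      mass (tayComb P τ s β L) ≤ mass L * (31 * c) ^ 10 * T ^ β.length := by
  have hβ10 : (β.length : ℝ) ≤ 10 := by exact_mod_cast hβ.le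
  have hcT : 0 ≤ c * T := by positivity
  have h1 : 3 * c * T + β.length * (c * T) ≤ 31 * c * T := by nlinarith
  constructor
  · refine (hL.expand hD β).mono ?_ h1
    have : β.length * D ≤ 10 * D := Nat.mul_le_mul_right D hβ.le
    omega
  · refine (mass_tayComb_le hD hL β).trans ?_
    rw [mul_assoc (mass L)]
    refine mul_le_mul_of_nonneg_left ?_ (mass_nonneg L)
    calc _ ≤ (31 * c * T) ^ β.length := pow_le_pow_left₀ (by positivity) h1 _
      _ = (31 * c) ^ β.length * T ^ β.length := by rw [mul_pow]
      _ ≤ _ := mul_le_mul_of_nonneg_right (pow_le_pow_right₀ (by linarith) hβ.le) (by positivity)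

theorem sum_entry_le {F : Entry d N → ℝ} {b : ℝ} (h : ∀ s, ∑ p, F (s, p) ≤ b) :
    ∑ e, F e ≤ d * b := by
  rw [Fintype.sum_prod_type]
  calc _ ≤ ∑ _s : Fin d, b := Finset.sum_le_sum fun s _ => h s
    _ = _ := by simp

theorem bump_herm_eq (e : Entry d N) (ζ : Bool → ℂ) :
    bump e ζ M = Function.update M e.1
      (M e.1 + (ζ false • dirMat e.2.1 false + ζ true • dirMat e.2.1 true)) := rfl

theorem sum_comb_stable_le (hP : ∀ j, (P j).adjoint = P j) (h : EnvBound A M Λ) (hx : ‖x‖ ≤ 1)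
    (hy : ‖y‖ ≤ 1) (hT : 1 ≤ T) (hTN : T ^ 4 ≤ N) (hc : 1 ≤ c) (hD : DiffBound P τ D (c * T))
    (hL : InClass P τ s D' (31 * c * T) n L) (hn : 2 ≤ n false + n true)
    {ζ : Entry d N → Bool → ℂ} (hζ : ∀ e a, ‖ζ e a‖ ≤ Λ / √N)
    (h' : ∀ e, EnvBound A (bump e (ζ e) M) Λ) :
    ∑ p : {p : Fin N × Fin N // p.1 ≤ p.2},
      ‖quadForm x (combVal P τ A (dirMat p.1) (bump (s, p) (ζ (s, p)) M) L) y‖ ≤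
      mass L * ((2 ^ 11 * (22 * (31 * c)) ^ 10) * N * Λ ^ (10 + 2 * (D' + 10 * D))) := by
  simp_rw [quadForm_combVal]
  refine sum_norm_lsum_le (f := fun (p : {p : Fin N × Fin N // p.1 ≤ p.2}) v =>
    quadForm x (wordVal P τ A (dirMat p.1) (bump (s, p) (ζ (s, p)) M) v) y) fun v hv => ?_
  obtain ⟨h1, h2, h3⟩ := hL v hv
  refine sum_word_stable_le (c := 31 * c) hP h hx hy hT hTN (by linarith) (hD.mono ?_) ?_ h1 h2
    (fun p a => hζ (s, p) a) fun p => h' (s, p)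
  · nlinarith [mul_nonneg (zero_le_one.trans hc) (zero_le_one.trans hT)]
  · rw [h3, h3]; exact hn

/-- Taylor control of quadratic forms of combinations of words, with constants that do not depend
on the size, on the vectors and on the parameter `T`. -/
theorem exists_taylorControl (d : ℕ) (D D₀ : ℕ) (c m₀ : ℝ) (hc : 1 ≤ c) (hm₀ : 0 ≤ m₀) :
    ∃ (C : ℝ) (q : ℕ), 1 ≤ C ∧ ∀ {r k N : ℕ} {P : Fin k → NCPoly d r} {τ : Fin k → ℝ}
      {A : Fin r → Matrix (Fin N) (Fin N) ℂ} {x y : EuclideanSpace ℂ (Fin N)} {T : ℝ}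
      {L : List (ℂ × Word d r k)}, (∀ j, (P j).adjoint = P j) → ‖x‖ ≤ 1 → ‖y‖ ≤ 1 → 1 ≤ T →
      T ^ 4 ≤ N → DiffBound P τ D (c * T) → (∀ s, InClass P τ s D₀ (c * T) (fun _ => 0) L) →
      mass L ≤ m₀ →
      TaylorControl A (fun M : Fin d → Matrix (Fin N) (Fin N) ℂ =>
        quadForm x (combVal P τ A (fun _ => 0) M L) y) C q T
        (fun β e M => quadForm x (combVal P τ A (dirMat e.2.1) M (tayComb P τ e.1 β L)) y)
        (fun a β e M => quadForm x (combVal P τ A (dirMat e.2.1) M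
          (tayComb P τ e.1 β (tayComb P τ e.1 [a, a] L))) y) := by
  -- This is 22 · 31 · c, the base of the power in `sum_comb_stable_le`; all other powers of c are
  -- dominated by powers of it.
  set B := 682 * c with hB
  have hB1 : 1 ≤ B := by linarith
  set K₀ := m₀ + 1 with hK₀
  have hK1 : 1 ≤ K₀ := by linarith
  -- Room for two differences followed by fewer than ten others; q is then the exponent produced by
  -- `sum_comb_stable_le`.
  set D₁ := D₀ + 20 * D with hD₁
  set q := 10 + 2 * (D₁ + 10 * D) with hq
  set C := (d + 1 : ℝ) * K₀ ^ 2 * 2 ^ 11 * B ^ 40 with hC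
  have hd : (0 : ℝ) ≤ d := Nat.cast_nonneg d
  have hBp : ∀ m ≤ 40, B ^ m ≤ B ^ 40 := fun m hm => pow_le_pow_right₀ hB1 hm
  have hCge : ∀ a b u : ℝ, ∀ m, 0 ≤ a → 0 ≤ b → 0 ≤ u → a ≤ d + 1 → b ≤ K₀ ^ 2 → u ≤ 2 ^ 11 →
      m ≤ 40 → a * b * u * B ^ m ≤ C := by
    intro a b u m ha hb hu h1 h2 h3 h4
    rw [hC]
    exact mul_le_mul (mul_le_mul (mul_le_mul h1 h2 hb (by positivity)) h3 hu (by positivity))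
      (hBp m h4) (by positivity) (by positivity)
  have hKK : K₀ ≤ K₀ ^ 2 := by nlinarith
  refine ⟨C, q, ?_, ?_⟩
  · have := hCge 1 1 1 0 (by simp) (by simp) (by simp) (by linarith) (by nlinarith) (by norm_num)
      (by norm_num)
    simpa using this
  intro r k N P τ A x y T L hP hx hy hT hTN hD hL hm
  have hT0 : 0 ≤ T := by linarith
  obtain ⟨hN0, hx0, hx1, hx4⟩ := sqrt_scale hT hTN
  have hmL := mass_nonneg L
  -- first level
  have hL3 : ∀ s, InClass P τ s D₀ (3 * c * T) (fun _ => 0) L := fun s =>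
    (hL s).mono le_rfl (by nlinarith [mul_nonneg (zero_le_one.trans hc) hT0])
  have h1 : ∀ (s) (β : List Bool), β.length < 10 →
      InClass P τ s D₁ (31 * c * T) (fun a => 0 + β.count a) (tayComb P τ s β L) ∧
      mass (tayComb P τ s β L) ≤ K₀ * B ^ 12 * T ^ β.length := by
    intro s β hβ
    obtain ⟨h1, h2⟩ := (hL3 s).expand_scaled hT hc hD hβ
    refine ⟨h1.mono (by omega) le_rfl, h2.trans (mul_le_mul_of_nonneg_right ?_ (by positivity))⟩
    refine mul_le_mul (by linarith) ?_ (by positivity) (by positivity)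
    exact (pow_le_pow_left₀ (by positivity) (by linarith) 10).trans
      (pow_le_pow_right₀ hB1 (by norm_num))
  -- second level
  have haa : ∀ (s) (a : Bool), InClass P τ s (D₀ + 2 * D) (3 * c * T)
      (fun b => 0 + [a, a].count b) (tayComb P τ s [a, a] L) ∧
      mass (tayComb P τ s [a, a] L) ≤ K₀ * (3 * c) ^ 2 * T ^ 2 := by
    intro s a
    have e1 : c * T + ([a, a].length : ℝ) * (c * T) = 3 * c * T := by simp; ring
    constructor
    · have := (hL s).expand hD [a, a]
      rw [e1] at this
      exact this
    · have := mass_tayComb_le hD (hL s) [a, a]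
      rw [e1] at this
      refine this.trans ?_
      have e2 : (3 * c * T) ^ [a, a].length = (3 * c) ^ 2 * T ^ 2 := by simp [mul_pow]
      rw [e2, mul_assoc]
      exact mul_le_mul_of_nonneg_right (by linarith) (by positivity)
  have h2 : ∀ (s) (a : Bool) (β : List Bool), β.length < 10 →
      InClass P τ s D₁ (31 * c * T) (fun b => (0 + [a, a].count b) + β.count b)
        (tayComb P τ s β (tayComb P τ s [a, a] L)) ∧
      mass (tayComb P τ s β (tayComb P τ s [a, a] L)) ≤ K₀ * B ^ 12 * T ^ (2 + β.length) := by
    intro s a β hβ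
    obtain ⟨h1, h2⟩ := (haa s a).1.expand_scaled hT hc hD hβ
    refine ⟨h1.mono (by omega) le_rfl, h2.trans ?_⟩
    calc _ ≤ (K₀ * (3 * c) ^ 2 * T ^ 2) * (31 * c) ^ 10 * T ^ β.length := by
          refine mul_le_mul_of_nonneg_right (mul_le_mul_of_nonneg_right (haa s a).2
            (by positivity)) (by positivity)
      _ = K₀ * ((3 * c) ^ 2 * (31 * c) ^ 10) * T ^ (2 + β.length) := by rw [pow_add]; ring
      _ ≤ _ := by
          refine mul_le_mul_of_nonneg_right (mul_le_mul_of_nonneg_left ?_ (by linarith))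
            (by positivity)
          rw [show 12 = 2 + 10 from rfl, pow_add B]
          refine mul_le_mul (pow_le_pow_left₀ (by positivity) (by linarith) 2)
            (pow_le_pow_left₀ (by positivity) (by linarith) 10) (by positivity) (by positivity)
  have hcount : ∀ β : List Bool, β.count false + β.count true = β.length := fun β => by
    induction β with
    | nil => rfl
    | cons a β ih => cases a <;> simp <;> omega
  have hΛq : ∀ {Λ : ℝ} {m : ℕ}, 1 ≤ Λ → m ≤ q → Λ ^ m ≤ Λ ^ q := fun h h' => pow_le_pow_right₀ h h'
  refine ⟨?_, ?_, ?_, ?_, ?_, ?_, ?_, ?_, ?_⟩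
  · intro e M
    rw [combVal_tayComb_nil, combVal_congr_dir (hL e.1)]
  · intro a e M
    rw [combVal_tayComb_nil]
  · intro e M ζ z Λ h h' hz
    have hz0 : 0 ≤ z := (norm_nonneg _).trans (hz true)
    have hΛ : 0 ≤ Λ := zero_le_one.trans h.one_le
    have key := norm_comb_taylor_le hP h h' (norm_dirMat_le e.2.1) hz (bump_herm_eq e ζ) hD (hL e.1) 10
    have key2 := (norm_quadForm_le_of_unit hx hy _).trans key
    rw [← quadFormLin_apply, map_sub, map_sum] at key2
    simp_rw [map_smul, smul_eq_mul, quadFormLin_apply] at key2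
    rw [combVal_congr_dir (hL e.1) (fun _ => 0) (dirMat e.2.1)]
    refine key2.trans ?_
    have e1 : c * T + ((10 : ℕ) : ℝ) * (c * T) = 11 * c * T := by push_cast; ring
    rw [e1]
    calc _ = (1 * mass L * 1 * (22 * c) ^ 10) * (T * z) ^ 10 * Λ ^ (D₀ + 10 * D) := by ring
      _ ≤ (1 * mass L * 1 * B ^ 10) * (T * z) ^ 10 * Λ ^ q := by
          refine mul_le_mul (mul_le_mul_of_nonneg_right (mul_le_mul_of_nonneg_left
            (pow_le_pow_left₀ (by positivity) (by linarith) _) (by linarith)) (by positivity))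
            (hΛq h.one_le (by omega)) (by positivity) (by positivity)
      _ ≤ _ := by
          refine mul_le_mul_of_nonneg_right (mul_le_mul_of_nonneg_right ?_ (by positivity))
            (by positivity)
          exact hCge _ _ _ _ (by simp) hmL (by simp) (by linarith) (by linarith) (by norm_num)
            (by norm_num)
  · intro a e M ζ z Λ h h' hz
    have hz0 : 0 ≤ z := (norm_nonneg _).trans (hz true)
    have hΛ : 0 ≤ Λ := zero_le_one.trans h.one_le
    have key := norm_comb_taylor_le hP h h' (norm_dirMat_le e.2.1) hz (bump_herm_eq e ζ) hD
      (haa e.1 a).1 10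
    have key2 := (norm_quadForm_le_of_unit hx hy _).trans key
    rw [← quadFormLin_apply, map_sub, map_sum] at key2
    simp_rw [map_smul, smul_eq_mul, quadFormLin_apply] at key2
    refine key2.trans ?_
    have e1 : 3 * c * T + ((10 : ℕ) : ℝ) * (c * T) = 13 * c * T := by push_cast; ring
    rw [e1]
    calc _ ≤ (K₀ * (3 * c) ^ 2 * T ^ 2) * ((2 * z) ^ 10 * (13 * c * T) ^ 10 *
          Λ ^ (D₀ + 2 * D + 10 * D)) := mul_le_mul_of_nonneg_right (haa e.1 a).2 (by positivity)
      _ = (1 * K₀ * 1 * ((3 * c) ^ 2 * (26 * c) ^ 10)) * T ^ 2 * (T * z) ^ 10 *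
          Λ ^ (D₀ + 2 * D + 10 * D) := by ring
      _ ≤ (1 * K₀ * 1 * B ^ 12) * T ^ 2 * (T * z) ^ 10 * Λ ^ q := by
          refine mul_le_mul (mul_le_mul_of_nonneg_right (mul_le_mul_of_nonneg_right
            (mul_le_mul_of_nonneg_left ?_ (by linarith)) (by positivity)) (by positivity))
            (hΛq h.one_le (by omega)) (by positivity) (by positivity)
          rw [show 12 = 2 + 10 from rfl, pow_add B]
          refine mul_le_mul (pow_le_pow_left₀ (by positivity) (by linarith) 2)
            (pow_le_pow_left₀ (by positivity) (by linarith) 10) (by positivity) (by positivity)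
      _ ≤ _ := by
          refine mul_le_mul_of_nonneg_right (mul_le_mul_of_nonneg_right
            (mul_le_mul_of_nonneg_right ?_ (by positivity)) (by positivity)) (by positivity)
          exact hCge _ _ _ _ (by simp) (by linarith) (by simp) (by linarith) hKK (by norm_num)
            (by norm_num)
  · intro β e M Λ hβ h
    have hΛ : 0 ≤ Λ := zero_le_one.trans h.one_le
    obtain ⟨g1, g2⟩ := h1 e.1 β hβ
    refine (norm_quadForm_combVal_le hP h hx hy (norm_dirMat_le e.2.1) (D := D₁)
      fun p hp => (g1 p hp).1).trans ?_
    refine mul_le_mul (g2.trans (mul_le_mul_of_nonneg_right ?_ (by positivity)))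
      (hΛq h.one_le (by omega)) (by positivity) (by positivity)
    have := hCge 1 K₀ 1 12 (by simp) (by linarith) (by simp) (by linarith) hKK (by norm_num)
            (by norm_num)
    linarith
  · intro a M Λ h
    have hΛ : 0 ≤ Λ := zero_le_one.trans h.one_le
    have hs : ∀ s, ∑ p : {p : Fin N × Fin N // p.1 ≤ p.2},
        ‖quadForm x (combVal P τ A (dirMat p.1) M (tayComb P τ s [a] L)) y‖ ^ 2 ≤
        (K₀ * B ^ 12 * T) ^ 2 * (Λ ^ D₁) ^ 2 := by
      intro s
      obtain ⟨g1, g2⟩ := h1 s [a] (by simp)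
      refine (sum_subtype_le (fun p : Fin N × Fin N => p.1 ≤ p.2) (f := fun p =>
        ‖quadForm x (combVal P τ A (dirMat p) M (tayComb P τ s [a] L)) y‖ ^ 2)
        fun p => sq_nonneg _).trans ?_
      simp_rw [quadForm_combVal]
      refine (sum_sq_lsum_le (f := fun (p : Fin N × Fin N) v =>
        quadForm x (wordVal P τ A (dirMat p) M v) y) (b := (Λ ^ D₁) ^ 2) fun v hv => ?_).trans ?_
      · obtain ⟨u1, u2, u3⟩ := g1 v hv
        refine (sum_sq_word_le hP h hx hy ?_).trans (pow_le_pow_left₀ (by positivity)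
          (pow_le_pow_right₀ h.one_le u1) 2)
        rw [u3, u3]
        cases a <;> simp
      · refine mul_le_mul_of_nonneg_right (pow_le_pow_left₀ (mass_nonneg _) ?_ 2) (by positivity)
        simpa using g2
    refine (sum_entry_le (b := (K₀ * B ^ 12 * T) ^ 2 * (Λ ^ D₁) ^ 2) hs).trans ?_
    calc _ = (d * K₀ ^ 2 * 1 * B ^ 24) * T ^ 2 * Λ ^ (2 * D₁) := by ring
      _ ≤ _ := by
        refine mul_le_mul (mul_le_mul_of_nonneg_right ?_ (by positivity))
          (hΛq h.one_le (by omega)) (by positivity) (by positivity)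
        exact hCge _ _ _ _ hd (by positivity) (by simp) (by linarith) le_rfl (by norm_num)
            (by norm_num)
  · intro a M Λ h
    have hΛ : 0 ≤ Λ := zero_le_one.trans h.one_le
    have hs : ∀ s, ∑ p : {p : Fin N × Fin N // p.1 ≤ p.2},
        ‖quadForm x (combVal P τ A (dirMat p.1) M (tayComb P τ s [a, a] L)) y‖ ≤
        (K₀ * B ^ 12 * T ^ 2) * (Λ ^ D₁ * √N) := by
      intro s
      obtain ⟨g1, g2⟩ := h1 s [a, a] (by simp)
      refine (sum_subtype_le (fun p : Fin N × Fin N => p.1 ≤ p.2) (f := fun p =>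
        ‖quadForm x (combVal P τ A (dirMat p) M (tayComb P τ s [a, a] L)) y‖)
        fun p => norm_nonneg _).trans ?_
      simp_rw [quadForm_combVal]
      refine (sum_norm_lsum_le (f := fun (p : Fin N × Fin N) v =>
        quadForm x (wordVal P τ A (dirMat p) M v) y) (b := Λ ^ D₁ * √N) fun v hv => ?_).trans ?_
      · obtain ⟨u1, u2, u3⟩ := g1 v hv
        -- The words of `L` have no directions, so those of its coefficient `[a, a]` contain exactly
        -- twice the direction `a`.
        refine (sum_word_same_le (a := a) hP h hx hy ?_).trans (mul_le_mul_of_nonneg_right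
          (pow_le_pow_right₀ h.one_le u1) (Real.sqrt_nonneg _))
        intro b
        rw [u3]
        cases a <;> cases b <;> simp
      · exact mul_le_mul_of_nonneg_right (by simpa using g2) (by positivity)
    refine (sum_entry_le (b := (K₀ * B ^ 12 * T ^ 2) * (Λ ^ D₁ * √N)) hs).trans ?_
    calc _ = (d * K₀ * 1 * B ^ 12) * T ^ 2 * √N * Λ ^ D₁ := by ring
      _ ≤ _ := by
        refine mul_le_mul (mul_le_mul_of_nonneg_right (mul_le_mul_of_nonneg_right ?_
          (by positivity)) (by positivity)) (hΛq h.one_le (by omega)) (by positivity) (by positivity)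
        exact hCge _ _ _ _ hd (by positivity) (by simp) (by linarith) hKK (by norm_num)
            (by norm_num)
  · intro β M Λ ζ hβ2 hβ h h' hζ
    have hΛ : 0 ≤ Λ := zero_le_one.trans h.one_le
    have hs : ∀ s, ∑ p : {p : Fin N × Fin N // p.1 ≤ p.2},
        ‖quadForm x (combVal P τ A (dirMat p.1) (bump (s, p) (ζ (s, p)) M)
          (tayComb P τ s β L)) y‖ ≤
        (K₀ * B ^ 12 * T ^ β.length) * ((2 ^ 11 * B ^ 10) * N * Λ ^ q) := by
      intro s
      obtain ⟨g1, g2⟩ := h1 s β hβ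
      refine (sum_comb_stable_le hP h hx hy hT hTN hc hD g1 (by have := hcount β; omega) hζ h').trans ?_
      rw [show 22 * (31 * c) = B by rw [hB]; ring]
      exact mul_le_mul_of_nonneg_right g2 (by positivity)
    refine (sum_entry_le (b := (K₀ * B ^ 12 * T ^ β.length) *
      ((2 ^ 11 * B ^ 10) * N * Λ ^ q)) hs).trans ?_
    calc _ = (d * K₀ * 2 ^ 11 * B ^ 22) * T ^ β.length * N * Λ ^ q := by ring
      _ ≤ _ := by
        refine mul_le_mul_of_nonneg_right (mul_le_mul_of_nonneg_right (mul_le_mul_of_nonneg_right ?_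
          (by positivity)) (by positivity)) (by positivity)
        exact hCge _ _ _ _ hd (by positivity) (by norm_num) (by linarith) hKK (by norm_num)
            (by norm_num)
  · intro a β M Λ ζ hβ h h' hζ
    have hΛ : 0 ≤ Λ := zero_le_one.trans h.one_le
    have hs : ∀ s, ∑ p : {p : Fin N × Fin N // p.1 ≤ p.2},
        ‖quadForm x (combVal P τ A (dirMat p.1) (bump (s, p) (ζ (s, p)) M)
          (tayComb P τ s β (tayComb P τ s [a, a] L))) y‖ ≤
        (K₀ * B ^ 12 * T ^ (2 + β.length)) * ((2 ^ 11 * B ^ 10) * N * Λ ^ q) := by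
      intro s
      obtain ⟨g1, g2⟩ := h2 s a β hβ
      refine (sum_comb_stable_le hP h hx hy hT hTN hc hD g1
        (by have := hcount [a, a]; simp only [List.length_cons, List.length_nil] at this; omega)
        hζ h').trans ?_
      rw [show 22 * (31 * c) = B by rw [hB]; ring]
      exact mul_le_mul_of_nonneg_right g2 (by positivity)
    refine (sum_entry_le (b := (K₀ * B ^ 12 * T ^ (2 + β.length)) *
      ((2 ^ 11 * B ^ 10) * N * Λ ^ q)) hs).trans ?_
    calc _ = (d * K₀ * 2 ^ 11 * B ^ 22) * T ^ (2 + β.length) * N * Λ ^ q := by ring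
      _ ≤ _ := by
        refine mul_le_mul_of_nonneg_right (mul_le_mul_of_nonneg_right (mul_le_mul_of_nonneg_right ?_
          (by positivity)) (by positivity)) (by positivity)
        exact hCge _ _ _ _ hd (by positivity) (by norm_num) (by linarith) hKK (by norm_num)
            (by norm_num)

end Words

/-! ### Interpolation over subsets -/

section Interpolation
variable {ι : Type*} [Fintype ι] [DecidableEq ι]

/-- The product weight of a subset. -/
noncomputable def subsetWeight (t : ℝ) (S : Finset ι) : ℝ := ∏ e, if e ∈ S then t else 1 - t

theorem subsetWeight_nonneg {t : ℝ} (h0 : 0 ≤ t) (h1 : t ≤ 1) (S : Finset ι) :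
    0 ≤ subsetWeight t S :=
  Finset.prod_nonneg fun e _ => by split_ifs <;> linarith

theorem hasDerivAt_subsetWeight (t : ℝ) (S : Finset ι) :
    HasDerivAt (fun t => subsetWeight t S)
      (∑ e, (∏ j ∈ Finset.univ.erase e, if j ∈ S then t else 1 - t) *
        (if e ∈ S then 1 else -1)) t := by
  have := HasDerivAt.fun_finsetProd (u := Finset.univ) (f := fun (e : ι) (t : ℝ) =>
    if e ∈ S then t else 1 - t) (f' := fun e => if e ∈ S then 1 else -1) (x := t) fun e _ => by
      by_cases h : e ∈ S
      · simp only [h, if_true]; exact hasDerivAt_id' t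
      · simp only [h, if_false]; exact (hasDerivAt_id' t).const_sub 1
  simpa only [smul_eq_mul, subsetWeight] using this

theorem sum_subsets_split (e : ι) (f : Finset ι → ℝ) :
    ∑ S, f S = ∑ S ∈ (Finset.univ.erase e).powerset, (f S + f (insert e S)) := by
  have h : (Finset.univ : Finset (Finset ι)) = (insert e (Finset.univ.erase e)).powerset := by
    rw [Finset.insert_erase (Finset.mem_univ e)]; simp
  rw [h, Finset.sum_powerset_insert (Finset.notMem_erase e _), Finset.sum_add_distrib]

/-- Pairing S with `insert e S` for e outside S, both members give the same difference of F, with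
weights t and 1 - t summing to 1. The derivative in the inclusion probability of e is thus a mean
over the same random set. -/
theorem sum_deriv_subsetWeight (t : ℝ) (F : Finset ι → ℝ) (e : ι) :
    ∑ S, (∏ j ∈ Finset.univ.erase e, if j ∈ S then t else 1 - t) * (if e ∈ S then 1 else -1) * F S =
      ∑ S, subsetWeight t S * (F (insert e S) - F (S.erase e)) := by
  rw [sum_subsets_split e, sum_subsets_split e]
  refine Finset.sum_congr rfl fun S hS => ?_
  have heS : e ∉ S := fun h => by simpa using Finset.mem_powerset.1 hS h
  have h1 : ∏ j ∈ Finset.univ.erase e, (if j ∈ insert e S then t else 1 - t) =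
      ∏ j ∈ Finset.univ.erase e, if j ∈ S then t else 1 - t := by
    refine Finset.prod_congr rfl fun j hj => ?_
    have : j ≠ e := (Finset.mem_erase.1 hj).1
    simp [this]
  have h2 : subsetWeight t S = (1 - t) * ∏ j ∈ Finset.univ.erase e, if j ∈ S then t else 1 - t := by
    rw [subsetWeight, ← Finset.mul_prod_erase _ _ (Finset.mem_univ e)]; simp [heS]
  have h3 : subsetWeight t (insert e S) =
      t * ∏ j ∈ Finset.univ.erase e, if j ∈ S then t else 1 - t := by
    rw [subsetWeight, ← Finset.mul_prod_erase _ _ (Finset.mem_univ e), h1]; simp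
  rw [h1, h2, h3, Finset.erase_eq_of_notMem heS, Finset.insert_idem, Finset.erase_insert heS]
  simp [heS]
  ring

/-- If at every subset the sum of the discrete derivatives is at most `C` times the value, then
the value at the whole set is at most `e^C` times the value at the empty set. -/
theorem interpolation_le {F : Finset ι → ℝ} {C : ℝ}
    (h : ∀ S, ∑ e, (F (insert e S) - F (S.erase e)) ≤ C * F S) :
    F Finset.univ ≤ Real.exp C * F ∅ := by
  -- The mean of F over a random set that contains each index independently with probability t. It
  -- runs from F ∅ at t = 0 to F univ at t = 1.
  set b : ℝ → ℝ := fun t => ∑ S, subsetWeight t S * F S with hb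
  set b' : ℝ → ℝ := fun t => ∑ S, subsetWeight t S * ∑ e, (F (insert e S) - F (S.erase e)) with hb'
  have hder : ∀ t, HasDerivAt b (b' t) t := by
    intro t
    have h1 : HasDerivAt b (∑ S, (∑ e, (∏ j ∈ Finset.univ.erase e, if j ∈ S then t else 1 - t) *
        (if e ∈ S then 1 else -1)) * F S) t :=
      HasDerivAt.fun_sum fun S _ => (hasDerivAt_subsetWeight t S).mul_const _
    convert h1 using 1
    simp_rw [hb', Finset.mul_sum, Finset.sum_mul]
    rw [Finset.sum_comm]
    conv_rhs => rw [Finset.sum_comm]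
    exact Finset.sum_congr rfl fun e _ => (sum_deriv_subsetWeight t F e).symm
  have hle : ∀ t ∈ Set.Icc (0 : ℝ) 1, b' t ≤ C * b t := by
    intro t ht
    simp only [hb, hb']
    rw [Finset.mul_sum]
    refine Finset.sum_le_sum fun S _ => ?_
    have := mul_le_mul_of_nonneg_left (h S) (subsetWeight_nonneg ht.1 ht.2 S)
    linarith
  have hder2 : ∀ t, HasDerivAt (fun t => Real.exp (-C * t) * b t)
      (Real.exp (-C * t) * (-C) * b t + Real.exp (-C * t) * b' t) t := by
    intro t
    have h1 : HasDerivAt (fun t : ℝ => -C * t) (-C) t := by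
      simpa using (hasDerivAt_id t).const_mul (-C)
    exact h1.exp.mul (hder t)
  -- Grönwall: `b' ≤ C b` makes e^{-Ct} b(t) nonincreasing.
  have hanti : AntitoneOn (fun t => Real.exp (-C * t) * b t) (Set.Icc 0 1) := by
    refine antitoneOn_of_deriv_nonpos (convex_Icc 0 1)
      (fun t _ => (hder2 t).continuousAt.continuousWithinAt)
      (fun t _ => (hder2 t).differentiableAt.differentiableWithinAt) fun t ht => ?_
    rw [(hder2 t).deriv]
    have h1 := hle t (interior_subset ht)
    have h2 := Real.exp_pos (-C * t)
    nlinarith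
  have key := hanti (Set.left_mem_Icc.2 zero_le_one) (Set.right_mem_Icc.2 zero_le_one) zero_le_one
  have h0 : b 0 = F ∅ := by
    simp only [hb]
    rw [Finset.sum_eq_single ∅]
    · simp [subsetWeight]
    · intro S _ hS
      obtain ⟨e, he⟩ := Finset.nonempty_iff_ne_empty.2 hS
      have : subsetWeight (0 : ℝ) S = 0 := Finset.prod_eq_zero (Finset.mem_univ e) (by simp [he])
      rw [this, zero_mul]
    · simp
  have h1 : b 1 = F Finset.univ := by
    simp only [hb]
    rw [Finset.sum_eq_single Finset.univ]
    · simp [subsetWeight]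
    · intro S _ hS
      obtain ⟨e, he⟩ : ∃ e, e ∉ S := by
        by_contra hcon
        push Not at hcon
        exact hS (Finset.eq_univ_iff_forall.2 hcon)
      have : subsetWeight (1 : ℝ) S = 0 := Finset.prod_eq_zero (Finset.mem_univ e) (by simp [he])
      rw [this, zero_mul]
    · simp
  simp only [h0, h1, mul_zero, Real.exp_zero, one_mul, mul_one] at key
  have h2 : Real.exp C * Real.exp (-C) = 1 := by rw [← Real.exp_add]; simp
  calc F Finset.univ = Real.exp C * (Real.exp (-C) * F Finset.univ) := by
        rw [← mul_assoc, h2, one_mul]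
    _ ≤ _ := mul_le_mul_of_nonneg_left key (Real.exp_pos C).le

end Interpolation

/-! ### Second order expansion of powers of the absolute value -/

/-- By induction on the exponent: the error is multiplied by s + v ≤ R, and a new term s^m v² ≤ R^m
· R b appears. Assuming only v² ≤ R b fits the case where s and s + v are squares and b is the
square of the increment. -/
theorem pow_second_order {s v R b : ℝ} (hs : 0 ≤ s) (hsR : s ≤ R) (hv : 0 ≤ s + v)
    (hvR : s + v ≤ R) (hb : 0 ≤ b) (hvb : v ^ 2 ≤ R * b) (m : ℕ) :
    |(s + v) ^ (m + 1) - s ^ (m + 1) - (m + 1) * s ^ m * v| ≤ (m + 1) ^ 2 * R ^ m * b := by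
  have hR : 0 ≤ R := hs.trans hsR
  induction m with
  | zero => simp; linarith [hb]
  | succ m ih =>
    have e : (s + v) ^ (m + 1 + 1) - s ^ (m + 1 + 1) - ((m + 1 : ℕ) + 1) * s ^ (m + 1) * v =
        (s + v) * ((s + v) ^ (m + 1) - s ^ (m + 1) - (m + 1) * s ^ m * v) +
          (m + 1) * s ^ m * v ^ 2 := by push_cast; ring
    rw [e]
    refine (abs_add_le _ _).trans ?_
    rw [abs_mul, abs_of_nonneg hv]
    have h1 : (s + v) * |(s + v) ^ (m + 1) - s ^ (m + 1) - (m + 1) * s ^ m * v| ≤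
        R * ((m + 1) ^ 2 * R ^ m * b) := mul_le_mul hvR ih (abs_nonneg _) hR
    have h2 : |(m + 1) * s ^ m * v ^ 2| ≤ (m + 1) * R ^ m * (R * b) := by
      rw [abs_of_nonneg (by positivity)]
      refine mul_le_mul (mul_le_mul_of_nonneg_left (pow_le_pow_left₀ hs hsR _) (by positivity))
        hvb (sq_nonneg v) (by positivity)
    have h3 : 0 ≤ R ^ (m + 1) * b := by positivity
    push_cast
    have e2 : R * ((m + 1) ^ 2 * R ^ m * b) + (m + 1) * R ^ m * (R * b) =
      ((m + 1 : ℝ) ^ 2 + (m + 1)) * (R ^ (m + 1) * b) := by ring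
    have h4 : ((m + 1 : ℝ) ^ 2 + (m + 1)) ≤ (m + 1 + 1 : ℝ) ^ 2 := by
      nlinarith [(Nat.cast_nonneg m : (0 : ℝ) ≤ m)]
    have := mul_le_mul_of_nonneg_right h4 h3
    linarith

/-- `pow_second_order` applied to |a|² and its increment 2 Re(ā z) + |z|². The part |z|² of the
increment is then moved to the error, which turns the constant 9 into 10. -/
theorem norm_pow_second_order (a z : ℂ) (m : ℕ) :
    |‖a + z‖ ^ (2 * (m + 1)) - ‖a‖ ^ (2 * (m + 1)) -
        2 * (m + 1) * (‖a‖ ^ (2 * m) * (conj a * z).re)| ≤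
      10 * (m + 1) ^ 2 * (‖a‖ + ‖z‖) ^ (2 * m) * ‖z‖ ^ 2 := by
  have e : ‖a + z‖ ^ 2 = ‖a‖ ^ 2 + (2 * (conj a * z).re + ‖z‖ ^ 2) := by
    simp only [← Complex.normSq_eq_norm_sq, Complex.normSq_apply, Complex.add_re, Complex.add_im,
      Complex.mul_re, Complex.conj_re, Complex.conj_im]
    ring
  have hre : |(conj a * z).re| ≤ ‖a‖ * ‖z‖ := by
    refine (Complex.abs_re_le_norm _).trans ?_
    rw [norm_mul, RCLike.norm_conj]
  have ha := norm_nonneg a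
  have hz := norm_nonneg z
  have haz := norm_add_le a z
  have h := pow_second_order (s := ‖a‖ ^ 2) (v := 2 * (conj a * z).re + ‖z‖ ^ 2)
    (R := (‖a‖ + ‖z‖) ^ 2) (b := 9 * ‖z‖ ^ 2) (sq_nonneg _) (by gcongr; linarith)
    (by rw [← e]; positivity) (by rw [← e]; gcongr) (by positivity) ?_ m
  · rw [← e, ← pow_mul, ← pow_mul, ← pow_mul, ← pow_mul] at h
    have h2 : |((m : ℝ) + 1) * ‖a‖ ^ (2 * m) * ‖z‖ ^ 2| ≤
        (m + 1) ^ 2 * (‖a‖ + ‖z‖) ^ (2 * m) * ‖z‖ ^ 2 := by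
      rw [abs_of_nonneg (by positivity)]
      have : (m : ℝ) + 1 ≤ (m + 1) ^ 2 := by nlinarith [(Nat.cast_nonneg m : (0 : ℝ) ≤ m)]
      gcongr
      linarith
    have e2 : ‖a + z‖ ^ (2 * (m + 1)) - ‖a‖ ^ (2 * (m + 1)) -
        2 * (m + 1) * (‖a‖ ^ (2 * m) * (conj a * z).re) =
        (‖a + z‖ ^ (2 * (m + 1)) - ‖a‖ ^ (2 * (m + 1)) -
          (m + 1) * ‖a‖ ^ (2 * m) * (2 * (conj a * z).re + ‖z‖ ^ 2)) +
        (m + 1) * ‖a‖ ^ (2 * m) * ‖z‖ ^ 2 := by ring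
    rw [e2]
    refine (abs_add_le _ _).trans ((add_le_add h h2).trans (le_of_eq ?_))
    ring
  -- The increment is at most 2|a||z| + |z|², whence b = (3|z|)².
  · have h1 : |2 * (conj a * z).re + ‖z‖ ^ 2| ≤ (‖a‖ + ‖z‖) * (3 * ‖z‖) := by
      refine (abs_add_le _ _).trans ?_
      rw [abs_mul, abs_two, abs_of_nonneg (sq_nonneg ‖z‖)]
      nlinarith
    calc _ = |2 * (conj a * z).re + ‖z‖ ^ 2| ^ 2 := (sq_abs _).symm
      _ ≤ ((‖a‖ + ‖z‖) * (3 * ‖z‖)) ^ 2 := pow_le_pow_left₀ (abs_nonneg _) h1 2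
      _ = _ := by ring


section Words
open scoped Matrix.Norms.L2Operator

variable {d r N : ℕ}

/-! ### Hermitian matrices as functions of their independent entries -/

/-- The Hermitian matrices with given entries on and above the diagonal (of which only the real
part is used on the diagonal). -/
noncomputable def hermOf (z : Entry d N → ℂ) : Fin d → Matrix (Fin N) (Fin N) ℂ := fun s i j =>
  if h : i < j then z (s, ⟨(i, j), h.le⟩)
  else if h' : j < i then conj (z (s, ⟨(j, i), h'.le⟩))
  else ((z (s, ⟨(i, i), le_rfl⟩)).re : ℂ)

theorem hermTuple_hermOf (z : Entry d N → ℂ) : HermTuple (hermOf z) := by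
  intro s
  ext i j
  rw [Matrix.conjTranspose_apply]
  rcases lt_trichotomy i j with h | rfl | h
  · simp [hermOf, h, h.not_gt]
  · simp [hermOf]
  · simp [hermOf, h, h.not_gt]

/-- The contributions of an entry to its position and to the transposed one. -/
noncomputable def entryCoeff (e : Entry d N) (w : ℂ) : Bool → ℂ := fun a =>
  if e.2.1.1 = e.2.1.2 then (if a then 0 else (w.re : ℂ)) else (if a then conj w else w)

theorem norm_entryCoeff_le (e : Entry d N) (w : ℂ) (a : Bool) : ‖entryCoeff e w a‖ ≤ ‖w‖ := by
  unfold entryCoeff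
  split_ifs
  · simp
  · simpa using Complex.abs_re_le_norm w
  · simp
  · simp

/-- Changing one independent entry moves the matrix along the two matrix units of its position, with
conjugate coefficients. On the diagonal both units coincide, and `entryCoeff` puts everything on the
first so that it is not counted twice. -/
theorem hermOf_update (z : Entry d N → ℂ) (e : Entry d N) (c : ℂ) :
    hermOf (Function.update z e c) = bump e (entryCoeff e (c - z e)) (hermOf z) := by
  obtain ⟨s, ⟨⟨a, b⟩, hab⟩⟩ := e
  dsimp only at hab
  funext s'
  unfold bump
  by_cases hs : s' = s
  swap
  · rw [Function.update_of_ne hs]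
    ext i j
    have : ∀ p, ((s', p) : Entry d N) ≠ (s, ⟨(a, b), hab⟩) := fun p h => hs (Prod.ext_iff.1 h).1
    simp [hermOf, Function.update_of_ne (this _)]
  subst hs
  rw [Function.update_self]
  ext i j
  have key : ∀ (i j : Fin N) (h : i ≤ j), Function.update z (s', ⟨(a, b), hab⟩) c (s', ⟨(i, j), h⟩) =
      z (s', ⟨(i, j), h⟩) + if i = a ∧ j = b then c - z (s', ⟨(a, b), hab⟩) else 0 := by
    intro i j h
    by_cases h2 : i = a ∧ j = b
    · obtain ⟨rfl, rfl⟩ := h2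
      simp
    · rw [Function.update_of_ne, if_neg h2, add_zero]
      intro h3
      apply h2
      simpa using h3
  simp only [hermOf, key, Matrix.add_apply, Matrix.smul_apply, dirMat, Matrix.single_apply,
    entryCoeff, smul_eq_mul]
  rcases lt_trichotomy i j with h | rfl | h
  · simp only [h, dif_pos]
    by_cases h1 : a = b
    · have : ¬(i = a ∧ j = b) := by rintro ⟨rfl, rfl⟩; exact h.ne h1
      have h3 : ¬(a = i ∧ b = j) := by rintro ⟨rfl, rfl⟩; exact h.ne h1
      subst h1
      simp [this, h3]
    · have h4 : ¬(b = i ∧ a = j) := by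
        rintro ⟨rfl, rfl⟩; exact absurd h (not_lt.2 hab)
      by_cases h5 : i = a ∧ j = b
      · obtain ⟨rfl, rfl⟩ := h5
        simp [h1]
      · have h3 : ¬(a = i ∧ b = j) := fun h => h5 ⟨h.1.symm, h.2.symm⟩
        simp [h1, h3, h4, h5]
  · by_cases h1 : a = b
    · subst h1
      by_cases h5 : i = a
      · subst h5; simp
      · have : ¬ a = i := fun h => h5 h.symm
        simp [h5, this]
    · have h3 : ¬(a = i ∧ b = i) := fun h => h1 (h.1.trans h.2.symm)
      have h4 : ¬(b = i ∧ a = i) := fun h => h1 (h.2.trans h.1.symm)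
      have h5 : ¬(i = a ∧ i = b) := fun h => h1 (h.1.symm.trans h.2)
      simp [h1, h3, h4, h5]
  · have hn := h.not_gt
    simp only [h, hn, dif_pos, dif_neg, not_false_eq_true]
    by_cases h1 : a = b
    · subst h1
      have : ¬(j = a ∧ i = a) := by rintro ⟨rfl, rfl⟩; exact h.ne rfl
      have h3 : ¬(a = i ∧ a = j) := by rintro ⟨rfl, rfl⟩; exact h.ne rfl
      simp [this, h3]
    · have h4 : ¬(a = i ∧ b = j) := by
        rintro ⟨rfl, rfl⟩; exact absurd h (not_lt.2 hab)
      by_cases h5 : j = a ∧ i = b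
      · obtain ⟨rfl, rfl⟩ := h5
        simp [h1]
      · have h3 : ¬(b = i ∧ a = j) := fun h => h5 ⟨h.2.symm, h.1.symm⟩
        simp [h1, h3, h4, h5]

theorem continuous_hermOf : Continuous (hermOf : (Entry d N → ℂ) → _) := by
  refine continuous_pi fun s => continuous_matrix fun i j => ?_
  unfold hermOf
  split_ifs
  · exact continuous_apply _
  · exact Complex.continuous_conj.comp (continuous_apply _)
  · exact Complex.continuous_ofReal.comp (Complex.continuous_re.comp (continuous_apply _))

theorem norm_bump_le (e : Entry d N) (w : ℂ) (M : Fin d → Matrix (Fin N) (Fin N) ℂ) :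
    ‖bump e (entryCoeff e w) M‖ ≤ ‖M‖ + 2 * ‖w‖ := by
  refine (pi_norm_le_iff_of_nonneg (by positivity)).2 fun s => ?_
  unfold bump
  by_cases hs : s = e.1
  · subst hs
    rw [Function.update_self]
    refine (norm_add_le _ _).trans (add_le_add (norm_le_pi_norm M _) ?_)
    refine (norm_add_le _ _).trans ?_
    rw [two_mul]
    have : ∀ a, ‖entryCoeff e w a • dirMat e.2.1 a‖ ≤ ‖w‖ := fun a => by
      rw [norm_smul]
      have h1 := norm_entryCoeff_le e w a
      have h2 := norm_dirMat_le e.2.1 a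
      nlinarith [norm_nonneg (entryCoeff e w a), norm_nonneg (dirMat e.2.1 a)]
    exact add_le_add (this _) (this _)
  · rw [Function.update_of_ne hs]
    exact (norm_le_pi_norm M s).trans (by linarith [norm_nonneg w])

theorem norm_hermOf_update_le (z : Entry d N → ℂ) (e : Entry d N) (c : ℂ) :
    ‖hermOf (Function.update z e c)‖ ≤ ‖hermOf z‖ + 2 * (‖c‖ + ‖z e‖) := by
  rw [hermOf_update]
  refine (norm_bump_le _ _ _).trans ?_
  linarith [norm_sub_le c (z e)]

/-- The first components on a set of entries, and the second ones off it. -/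
def pick (S : Finset (Entry d N)) (ξ : Entry d N → ℂ × ℂ) : Entry d N → ℂ := fun e =>
  if e ∈ S then (ξ e).1 else (ξ e).2

theorem norm_pick_le (S : Finset (Entry d N)) (ξ : Entry d N → ℂ × ℂ) (e : Entry d N) :
    ‖pick S ξ e‖ ≤ ‖ξ e‖ := by
  unfold pick
  split_ifs
  · exact norm_fst_le _
  · exact norm_snd_le _

theorem continuous_pick (S : Finset (Entry d N)) : Continuous (pick S) := by
  refine continuous_pi fun e => ?_
  unfold pick
  split_ifs
  · exact continuous_fst.comp (continuous_apply _)
  · exact continuous_snd.comp (continuous_apply _)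

theorem pick_update_self (S : Finset (Entry d N)) (ξ : Entry d N → ℂ × ℂ) (e : Entry d N)
    (w : ℂ × ℂ) : pick S (Function.update ξ e w) =
      Function.update (pick S ξ) e (if e ∈ S then w.1 else w.2) := by
  funext e'
  by_cases h : e' = e
  · subst h; simp [pick]
  · simp [pick, h]

theorem pick_insert (S : Finset (Entry d N)) (ξ : Entry d N → ℂ × ℂ) (e : Entry d N) :
    pick (insert e S) ξ = Function.update (pick S ξ) e (ξ e).1 := by
  funext e'
  by_cases h : e' = e
  · subst h; simp [pick]
  · simp [pick, h]

theorem pick_erase (S : Finset (Entry d N)) (ξ : Entry d N → ℂ × ℂ) (e : Entry d N) :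
    pick (S.erase e) ξ = Function.update (pick S ξ) e (ξ e).2 := by
  funext e'
  by_cases h : e' = e
  · subst h; simp [pick]
  · simp [pick, h]

/-- The envelope controlling all the matrices involved in the replacement of one entry. -/
noncomputable def env (K : ℝ) (S : Finset (Entry d N)) (ξ : Entry d N → ℂ × ℂ) : ℝ :=
  5 * (K + ‖hermOf (pick S ξ)‖ + ‖hermOf (pick ∅ ξ)‖ + √N * ‖ξ‖)

theorem continuous_env (K : ℝ) (S : Finset (Entry d N)) : Continuous (env K S) := by
  unfold env
  have h : ∀ S : Finset (Entry d N), Continuous fun ξ => ‖hermOf (pick S ξ)‖ := fun S =>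
    (continuous_hermOf.comp (continuous_pick S)).norm
  exact ((((continuous_const.add (h S)).add (h ∅)).add (continuous_const.mul continuous_norm))).const_mul 5

variable {A : Fin r → Matrix (Fin N) (Fin N) ℂ} {K : ℝ} {S : Finset (Entry d N)}
  {ξ : Entry d N → ℂ × ℂ} {e : Entry d N}

theorem one_le_env (hK : 1 ≤ K) : 1 ≤ env K S ξ := by
  unfold env
  have : 0 ≤ √N * ‖ξ‖ := by positivity
  linarith [norm_nonneg (hermOf (pick S ξ)), norm_nonneg (hermOf (pick ∅ ξ))]

theorem one_le_sqrt_nat (e : Entry d N) : 1 ≤ √(N : ℝ) := by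
  have : 0 < N := (Nat.zero_le _).trans_lt e.2.1.1.2
  rw [Real.one_le_sqrt]
  exact_mod_cast this

/-- Replacing an entry costs 2(‖c‖ + ‖z e‖) ≤ 4‖ξ‖ in norm, which explains the factor 5 in `env`. -/
theorem norm_hermOf_update_le_env (hK : 1 ≤ K) {S' : Finset (Entry d N)} (hS' : S' = S ∨ S' = ∅)
    {c : ℂ} (hc : ‖c‖ ≤ ‖ξ‖) : ‖hermOf (Function.update (pick S' ξ) e c)‖ ≤ env K S ξ := by
  refine (norm_hermOf_update_le _ _ _).trans ?_
  have h1 := (norm_pick_le S' ξ e).trans (norm_le_pi_norm ξ e)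
  have h2 : ‖ξ‖ ≤ √N * ‖ξ‖ := le_mul_of_one_le_left (norm_nonneg _) (one_le_sqrt_nat e)
  have h3 : ‖hermOf (pick S' ξ)‖ ≤ ‖hermOf (pick S ξ)‖ + ‖hermOf (pick ∅ ξ)‖ := by
    rcases hS' with h | h <;> rw [h] <;>
    linarith [norm_nonneg (hermOf (pick ∅ ξ)), norm_nonneg (hermOf (pick S ξ))]
  unfold env
  have : 0 ≤ √N * ‖ξ‖ := by positivity
  linarith [norm_nonneg (hermOf (pick S ξ)), norm_nonneg (hermOf (pick ∅ ξ))]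

theorem envBound_of_norm_le {Λ : ℝ} (hK : 1 ≤ K) (hA : ∀ j, ‖A j‖ ≤ K) (hKΛ : K ≤ Λ)
    {z : Entry d N → ℂ} (hz : ‖hermOf z‖ ≤ Λ) : EnvBound A (hermOf z) Λ :=
  ⟨hK.trans hKΛ, hermTuple_hermOf z, fun s => (norm_le_pi_norm _ s).trans hz,
    fun j => (hA j).trans hKΛ⟩

theorem le_env : K ≤ env K S ξ ∨ K < 0 := by
  rcases lt_or_ge K 0 with h | h
  · exact Or.inr h
  · left
    unfold env
    have : 0 ≤ √N * ‖ξ‖ := by positivity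
    linarith [norm_nonneg (hermOf (pick S ξ)), norm_nonneg (hermOf (pick ∅ ξ))]

theorem envBound_update (hK : 1 ≤ K) (hA : ∀ j, ‖A j‖ ≤ K) {S' : Finset (Entry d N)}
    (hS' : S' = S ∨ S' = ∅) {c : ℂ} (hc : ‖c‖ ≤ ‖ξ‖) :
    EnvBound A (hermOf (Function.update (pick S' ξ) e c)) (env K S ξ) :=
  envBound_of_norm_le hK hA (le_env.resolve_right (by linarith)) (norm_hermOf_update_le_env hK hS' hc)

theorem envBound_pick (hK : 1 ≤ K) (hA : ∀ j, ‖A j‖ ≤ K) {S' : Finset (Entry d N)}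
    (hS' : S' = S ∨ S' = ∅) : EnvBound A (hermOf (pick S' ξ)) (env K S ξ) := by
  refine envBound_of_norm_le hK hA (le_env.resolve_right (by linarith)) ?_
  unfold env
  have : 0 ≤ √N * ‖ξ‖ := by positivity
  rcases hS' with h | h <;> rw [h] <;>
    linarith [norm_nonneg (hermOf (pick ∅ ξ)), norm_nonneg (hermOf (pick S ξ))]

/-- The term √N ‖ξ‖ of the envelope serves here: it makes a change of one entry at most Λ/√N, the
size required by the stability clauses of `TaylorControl`. -/
theorem norm_entryCoeff_sub_le_env (hK : 1 ≤ K) {S' : Finset (Entry d N)} {c : ℂ}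
    (hc : ‖c‖ ≤ ‖ξ‖) (a : Bool) :
    ‖entryCoeff e (c - pick S' ξ e) a‖ ≤ env K S ξ / √N := by
  have h0 := one_le_sqrt_nat e
  rw [le_div_iff₀ (by linarith)]
  have h1 := (norm_pick_le S' ξ e).trans (norm_le_pi_norm ξ e)
  have h2 : ‖entryCoeff e (c - pick S' ξ e) a‖ ≤ 2 * ‖ξ‖ := by
    refine (norm_entryCoeff_le _ _ _).trans ((norm_sub_le _ _).trans (by linarith))
  have h3 : ‖entryCoeff e (c - pick S' ξ e) a‖ * √N ≤ 2 * ‖ξ‖ * √N :=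
    mul_le_mul_of_nonneg_right h2 (by linarith)
  unfold env
  have : 0 ≤ √N * ‖ξ‖ := by positivity
  linarith [norm_nonneg (hermOf (pick S ξ)), norm_nonneg (hermOf (pick ∅ ξ))]

/-- Separates the resampled coordinate from the rest. With `ξ` taken at a zero coordinate, the
envelope becomes a quantity independent of that coordinate times a factor that can be integrated
against its law. -/
theorem env_update_le (hK : 1 ≤ K) (w : ℂ × ℂ) :
    env K S (Function.update ξ e w) ≤ 30 * env K S ξ * (1 + √N * ‖w‖) := by
  have h0 := one_le_sqrt_nat e
  have hw := norm_nonneg w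
  have hξ := norm_nonneg ξ
  have hm : ∀ S' : Finset (Entry d N), ‖hermOf (pick S' (Function.update ξ e w))‖ ≤
      ‖hermOf (pick S' ξ)‖ + 2 * (‖w‖ + ‖ξ‖) := by
    intro S'
    rw [pick_update_self]
    refine (norm_hermOf_update_le _ _ _).trans ?_
    have h1 := (norm_pick_le S' ξ e).trans (norm_le_pi_norm ξ e)
    have h2 : ‖if e ∈ S' then w.1 else w.2‖ ≤ ‖w‖ := by
      split_ifs
      exacts [norm_fst_le _, norm_snd_le _]
    linarith
  have hu : ‖Function.update ξ e w‖ ≤ ‖ξ‖ + ‖w‖ := by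
    refine (pi_norm_le_iff_of_nonneg (by positivity)).2 fun e' => ?_
    by_cases h : e' = e
    · subst h; simp
    · rw [Function.update_of_ne h]
      linarith [norm_le_pi_norm ξ e']
  have hu2 := mul_le_mul_of_nonneg_left hu (Real.sqrt_nonneg N)
  have h1 := hm S
  have h2 := hm ∅
  have h3 : ‖ξ‖ ≤ √N * ‖ξ‖ := le_mul_of_one_le_left hξ h0
  have h4 : ‖w‖ ≤ √N * ‖w‖ := le_mul_of_one_le_left hw h0
  have h5 := one_le_env (S := S) (ξ := ξ) hK
  have h6 : 0 ≤ √N * ‖w‖ := by positivity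
  have h7 : 0 ≤ √N * ‖ξ‖ := by positivity
  have h8 : env K S (Function.update ξ e w) ≤ 5 * env K S ξ + 25 * (√N * ‖w‖) := by
    unfold env
    nlinarith [norm_nonneg (hermOf (pick S ξ)), norm_nonneg (hermOf (pick ∅ ξ))]
  nlinarith

end Words

section Words
open scoped Matrix.Norms.L2Operator

variable {d r N : ℕ}

/-! ### Increments of functions with Taylor control -/

/-- T²/√N is the final error scale; N (T/√N)⁴ is its square, so terms of order at least four fit in
it with room to spare. -/
theorem scale_facts {T : ℝ} (hT : 1 ≤ T) (hTN : T ^ 4 ≤ N) :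
    T / √N ≤ T ^ 2 / √N ∧ N * (T / √N) ^ 4 = (T ^ 2 / √N) ^ 2 ∧ T ^ 2 / √N ≤ 1 := by
  obtain ⟨hN, hx, hx1, hx4⟩ := sqrt_scale hT hTN
  have hs : 0 < √(N : ℝ) := Real.sqrt_pos.2 hN
  have e : N * (T / √N) ^ 4 = (T ^ 2 / √N) ^ 2 := by
    have h2 : (N : ℝ) = √N ^ 2 := (Real.sq_sqrt hN.le).symm
    rw [div_pow, div_pow]
    conv_lhs => rw [h2, Real.sqrt_sq hs.le]
    field_simp
  refine ⟨?_, e, ?_⟩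
  · gcongr
    nlinarith
  · rw [e] at hx4
    have : 0 ≤ T ^ 2 / √N := by positivity
    nlinarith

theorem card_entry_le : (Fintype.card (Entry d N) : ℝ) ≤ d * N ^ 2 := by
  rw [Fintype.card_prod, Fintype.card_fin]
  have := Fintype.card_subtype_le fun p : Fin N × Fin N => p.1 ≤ p.2
  rw [Fintype.card_prod, Fintype.card_fin] at this
  push_cast
  refine mul_le_mul_of_nonneg_left ?_ (by positivity)
  rw [sq]
  exact_mod_cast this

theorem bump_zero (e : Entry d N) (M : Fin d → Matrix (Fin N) (Fin N) ℂ) : bump e 0 M = M := by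
  simp [bump]

variable {A : Fin r → Matrix (Fin N) (Fin N) ℂ} {f : (Fin d → Matrix (Fin N) (Fin N) ℂ) → ℂ}
  {C T Λ : ℝ} {q : ℕ} {g : List Bool → Entry d N → (Fin d → Matrix (Fin N) (Fin N) ℂ) → ℂ}
  {g2 : Bool → List Bool → Entry d N → (Fin d → Matrix (Fin N) (Fin N) ℂ) → ℂ}
  {M : Fin d → Matrix (Fin N) (Fin N) ℂ}

theorem TaylorControl.nonneg (h : TaylorControl A f C q T g g2) (hT : 0 < T) (e : Entry d N)
    (hM : EnvBound A M Λ) : 0 ≤ C := by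
  have := (norm_nonneg _).trans (h.sup [false] e M Λ (by simp) hM)
  have h2 : 0 < T ^ [false].length * Λ ^ q := by
    have := hM.one_le
    positivity
  rw [mul_assoc] at this
  exact nonneg_of_mul_nonneg_left this h2

theorem norm_zmon_scaled_le {ζ : Bool → ℂ} {s : ℝ} (hs : 0 < s) (hΛ : 1 ≤ Λ)
    (hζ : ∀ a, ‖ζ a‖ ≤ Λ / s) {β : List Bool} (hβ : β.length < 10) :
    ‖zmon ζ β‖ ≤ Λ ^ 10 * (1 / s) ^ β.length := by
  refine (norm_zmon_le hζ β).trans ?_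
  rw [div_eq_mul_one_div, mul_pow]
  exact mul_le_mul_of_nonneg_right (pow_le_pow_right₀ hΛ hβ.le) (by positivity)

theorem TaylorControl.sub_eq (h : TaylorControl A f C q T g g2) (e : Entry d N) (ζ : Bool → ℂ) :
    f (bump e ζ M) - f M = (f (bump e ζ M) - ∑ β ∈ boolLists 10, zmon ζ β * g β e M) +
      ∑ β ∈ (boolLists 10).erase [], zmon ζ β * g β e M := by
  have : [] ∈ boolLists 10 := mem_boolLists.2 (by simp)
  rw [← Finset.add_sum_erase _ _ this, h.nil]
  simp only [zmon, List.map_nil, List.prod_nil, one_mul]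
  abel

/-- The increment due to one entry. -/
theorem TaylorControl.norm_increment_le (h : TaylorControl A f C q T g g2) (hT : 1 ≤ T) (hTN : T ^ 4 ≤ N)
    {e : Entry d N} {ζ : Bool → ℂ} (hM : EnvBound A M Λ) (hM' : EnvBound A (bump e ζ M) Λ)
    (hζ : ∀ a, ‖ζ a‖ ≤ Λ / √N) :
    ‖f (bump e ζ M) - f M‖ ≤ 2 ^ 11 * C * Λ ^ (q + 10) * (T / √N) := by
  obtain ⟨hN, hx, hx1, hx4⟩ := sqrt_scale hT hTN
  have hs : 0 < √(N : ℝ) := Real.sqrt_pos.2 hN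
  have hC := h.nonneg (by linarith) e hM
  have hΛ := hM.one_le
  rw [h.sub_eq]
  have h1 : ‖f (bump e ζ M) - ∑ β ∈ boolLists 10, zmon ζ β * g β e M‖ ≤
      C * Λ ^ (q + 10) * (T / √N) := by
    refine (h.taylor e M ζ (Λ / √N) Λ hM hM' hζ).trans ?_
    have : C * (T * (Λ / √N)) ^ 10 * Λ ^ q = C * Λ ^ (q + 10) * (T / √N) ^ 10 := by
      rw [div_pow, mul_pow, div_pow, pow_add]; ring
    rw [this]
    gcongr
    exact pow_le_of_le_one hx hx1 (by norm_num)
  have h2 : ‖∑ β ∈ (boolLists 10).erase [], zmon ζ β * g β e M‖ ≤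
      2 ^ 10 * (C * Λ ^ (q + 10) * (T / √N)) := by
    refine (norm_sum_le _ _).trans ?_
    have hcard : (((boolLists 10).erase []).card : ℝ) ≤ 2 ^ 10 := by
      exact_mod_cast (Finset.card_erase_le).trans (card_boolLists_le 10)
    refine (Finset.sum_le_card_nsmul _ _ (C * Λ ^ (q + 10) * (T / √N)) fun β hβ => ?_).trans ?_
    · obtain ⟨hβ0, hβ⟩ := Finset.mem_erase.1 hβ
      rw [mem_boolLists] at hβ
      rw [norm_mul]
      calc _ ≤ Λ ^ 10 * (1 / √N) ^ β.length * (C * T ^ β.length * Λ ^ q) :=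
            mul_le_mul (norm_zmon_scaled_le hs hΛ hζ hβ) (h.sup β e M Λ hβ hM) (norm_nonneg _)
              (by positivity)
        _ = C * Λ ^ (q + 10) * (T / √N) ^ β.length := by
            rw [div_pow, div_pow, pow_add, one_pow]; ring
        _ ≤ _ := by
            gcongr
            exact pow_le_of_le_one hx hx1 (by simpa using hβ0)
    · rw [nsmul_eq_mul]
      gcongr
  refine (norm_add_le _ _).trans ((add_le_add h1 h2).trans (le_of_eq_of_le ?_ le_rfl |>.trans
    (show (1 + 2 ^ 10) * (C * Λ ^ (q + 10) * (T / √N)) ≤ _ from ?_)))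
  · ring
  · have : 0 ≤ C * Λ ^ (q + 10) * (T / √N) := by positivity
    nlinarith

/-- The sum of the squares of the increments due to the entries. -/
theorem TaylorControl.sum_sq_sub_le (h : TaylorControl A f C q T g g2) (hC : 1 ≤ C) (hT : 1 ≤ T)
    (hTN : T ^ 4 ≤ N) {ζ : Entry d N → Bool → ℂ} (hM : EnvBound A M Λ)
    (hM' : ∀ e, EnvBound A (bump e (ζ e) M) Λ) (hζ : ∀ e a, ‖ζ e a‖ ≤ Λ / √N) :
    ∑ e, ‖f (bump e (ζ e) M) - f M‖ ^ 2 ≤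
      (d + 1) * 2 ^ 22 * C ^ 2 * Λ ^ (2 * q + 20) * (T ^ 2 / √N) ^ 2 := by
  obtain ⟨hN, hx, hx1, hx4⟩ := sqrt_scale hT hTN
  obtain ⟨hxy, hy4, hy1⟩ := scale_facts hT hTN
  have hs : 0 < √(N : ℝ) := Real.sqrt_pos.2 hN
  have hΛ := hM.one_le
  have hT0 : 0 < T := by linarith
  set x := T / √N with hxdef
  set y := T ^ 2 / √N with hydef
  have hy0 : 0 ≤ y := by positivity
  set B := C ^ 2 * Λ ^ (2 * q + 20) * y ^ 2 with hB
  have hB0 : 0 ≤ B := by positivity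
  have hCC : C ≤ C ^ 2 := by nlinarith
  have hxpow : ∀ m, 4 ≤ m → N * x ^ m ≤ y ^ 2 := by
    intro m hm
    rw [← hy4]
    gcongr ?_ * ?_
    exact pow_le_pow_of_le_one hx hx1 hm
  -- Order one uses the bound on the sum of squares and gives (T/√N)². Order m ≥ 2 uses supremum
  -- times sum and gives N (T/√N)^{2m}, at most N (T/√N)⁴.
  have hterm : ∀ β ∈ (boolLists 10).erase [], ∑ e, ‖zmon (ζ e) β * g β e M‖ ^ 2 ≤ B := by
    intro β hβ
    obtain ⟨hβ0, hβ⟩ := Finset.mem_erase.1 hβ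
    rw [mem_boolLists] at hβ
    have hz : ∀ e, ‖zmon (ζ e) β‖ ^ 2 ≤ Λ ^ 20 * (1 / √N) ^ (2 * β.length) := by
      intro e
      refine (pow_le_pow_left₀ (norm_nonneg _) (norm_zmon_scaled_le hs hΛ (hζ e) hβ) 2).trans
        (le_of_eq ?_)
      rw [mul_pow, ← pow_mul, ← pow_mul, mul_comm β.length]
    simp_rw [norm_mul, mul_pow]
    refine (Finset.sum_le_sum fun e _ => mul_le_mul_of_nonneg_right (hz e) (sq_nonneg _)).trans ?_
    rw [← Finset.mul_sum]
    by_cases h1 : β.length = 1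
    · obtain ⟨a, rfl⟩ := List.length_eq_one_iff.1 h1
      calc _ ≤ Λ ^ 20 * (1 / √N) ^ (2 * [a].length) * (C * T ^ 2 * Λ ^ q) :=
            mul_le_mul_of_nonneg_left (h.sum_sq a M Λ hM) (by positivity)
        _ = C * Λ ^ (q + 20) * x ^ 2 := by
            rw [hxdef, div_pow, pow_add, List.length_singleton, mul_one, div_pow, one_pow]; ring
        _ ≤ B := by
            rw [hB]
            gcongr
            omega
    · have h2 : 2 ≤ β.length := by
        have : β.length ≠ 0 := by simpa using hβ0
        omega
      -- With a zero bump, the stability clause is just a bound on the sum at `M`.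
      have hst := h.stable β M Λ (fun _ => 0) h2 hβ hM (fun e => by
          show EnvBound A (bump e 0 M) Λ; rwa [bump_zero]) (fun e a => by simp; positivity)
      have hb : ∀ e : Entry d N, bump e (fun _ => 0) M = M := fun e => bump_zero e M
      replace hst : ∑ e, ‖g β e M‖ ≤ C * T ^ β.length * N * Λ ^ q := by
        refine le_trans (le_of_eq (Finset.sum_congr rfl fun e _ => ?_)) hst
        exact congrArg _ (congrArg _ (hb e).symm)
      have : ∑ e, ‖g β e M‖ ^ 2 ≤ C * T ^ β.length * Λ ^ q * (C * T ^ β.length * N * Λ ^ q) := by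
        refine le_trans ?_ (mul_le_mul_of_nonneg_left hst (by positivity))
        rw [Finset.mul_sum]
        refine Finset.sum_le_sum fun e _ => ?_
        rw [sq]
        exact mul_le_mul_of_nonneg_right (h.sup β e M Λ hβ hM) (norm_nonneg _)
      calc _ ≤ Λ ^ 20 * (1 / √N) ^ (2 * β.length) *
            (C * T ^ β.length * Λ ^ q * (C * T ^ β.length * N * Λ ^ q)) :=
            mul_le_mul_of_nonneg_left this (by positivity)
        _ = C ^ 2 * Λ ^ (2 * q + 20) * (N * x ^ (2 * β.length)) := by
            rw [hxdef, div_pow, div_pow, pow_add, one_pow, two_mul q, pow_add, two_mul β.length,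
              pow_add, pow_add]
            ring
        _ ≤ B := by
            rw [hB]
            gcongr
            exact hxpow _ (by omega)
  have hrem : ∀ e, ‖f (bump e (ζ e) M) - ∑ β ∈ boolLists 10, zmon (ζ e) β * g β e M‖ ^ 2 ≤
      C ^ 2 * Λ ^ (2 * q + 20) * x ^ 20 := by
    intro e
    refine (pow_le_pow_left₀ (norm_nonneg _) (h.taylor e M (ζ e) (Λ / √N) Λ hM (hM' e) (hζ e)) 2).trans
      (le_of_eq ?_)
    rw [hxdef, two_mul q, pow_add, pow_add]; ring
  have hpt : ∀ e, ‖f (bump e (ζ e) M) - f M‖ ^ 2 ≤ 2 * (C ^ 2 * Λ ^ (2 * q + 20) * x ^ 20) +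
      2 * (2 ^ 10 * ∑ β ∈ (boolLists 10).erase [], ‖zmon (ζ e) β * g β e M‖ ^ 2) := by
    intro e
    rw [h.sub_eq]
    have h1 : ‖∑ β ∈ (boolLists 10).erase [], zmon (ζ e) β * g β e M‖ ^ 2 ≤
        2 ^ 10 * ∑ β ∈ (boolLists 10).erase [], ‖zmon (ζ e) β * g β e M‖ ^ 2 := by
      have hcard : (((boolLists 10).erase []).card : ℝ) ≤ 2 ^ 10 := by
        exact_mod_cast (Finset.card_erase_le).trans (card_boolLists_le 10)
      refine (pow_le_pow_left₀ (norm_nonneg _) (norm_sum_le _ _) 2).trans ?_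
      exact (sq_sum_le_card_mul_sum_sq).trans
        (mul_le_mul_of_nonneg_right hcard (Finset.sum_nonneg fun _ _ => sq_nonneg _))
    have h2 := pow_le_pow_left₀ (norm_nonneg _) (norm_add_le
      (f (bump e (ζ e) M) - ∑ β ∈ boolLists 10, zmon (ζ e) β * g β e M)
      (∑ β ∈ (boolLists 10).erase [], zmon (ζ e) β * g β e M)) 2
    have h3 := hrem e
    refine h2.trans ((add_sq_le).trans ?_)
    linarith
  refine (Finset.sum_le_sum fun e _ => hpt e).trans ?_
  rw [Finset.sum_add_distrib, ← Finset.mul_sum, ← Finset.mul_sum, ← Finset.mul_sum, ← Finset.mul_sum]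
  have h1 : ∑ e, ∑ β ∈ (boolLists 10).erase [], ‖zmon (ζ e) β * g β e M‖ ^ 2 ≤ 2 ^ 10 * B := by
    rw [Finset.sum_comm]
    have hcard : (((boolLists 10).erase []).card : ℝ) ≤ 2 ^ 10 := by
      exact_mod_cast (Finset.card_erase_le).trans (card_boolLists_le 10)
    refine (Finset.sum_le_card_nsmul _ _ _ hterm).trans ?_
    rw [nsmul_eq_mul]
    gcongr
  -- The remainders are bounded entry by entry; N² x^20 splits as N x⁴ ≤ 1 times N x^16 ≤ y².
  have h2 : C ^ 2 * Λ ^ (2 * q + 20) * ∑ _e : Entry d N, x ^ 20 ≤ d * B := by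
    rw [Finset.mul_sum, Finset.sum_const, nsmul_eq_mul, Finset.card_univ]
    calc _ ≤ (d * N ^ 2 : ℝ) * (C ^ 2 * Λ ^ (2 * q + 20) * x ^ 20) :=
          mul_le_mul_of_nonneg_right card_entry_le (by positivity)
      _ = d * (C ^ 2 * Λ ^ (2 * q + 20) * ((N * x ^ 4) * (N * x ^ 16))) := by ring
      _ ≤ d * (C ^ 2 * Λ ^ (2 * q + 20) * (1 * y ^ 2)) := by
          gcongr
          exact hxpow _ (by norm_num)
      _ = d * B := by rw [one_mul]
  have e3 : (d + 1 : ℝ) * 2 ^ 22 * C ^ 2 * Λ ^ (2 * q + 20) * y ^ 2 = (d + 1) * 2 ^ 22 * B := by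
    rw [hB]; ring
  rw [e3]
  have hd : (0 : ℝ) ≤ d * B := by positivity
  nlinarith

end Words

/-! ### Resampling one coordinate of a product measure, and exchange of moments -/

section Resampling
variable {ι W : Type*} [DecidableEq ι] [MeasurableSpace W]

theorem measurable_update_pair (e : ι) :
    Measurable fun p : (ι → W) × W => Function.update p.1 e p.2 := by
  refine measurable_pi_iff.2 fun i => ?_
  by_cases h : i = e
  · subst h; simpa using measurable_snd
  · simp only [Function.update_of_ne h]; exact (measurable_pi_apply i).comp measurable_fst

variable [Fintype ι] {ρ : ι → Measure W} [∀ e, IsProbabilityMeasure (ρ e)]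

/-- Resampling one coordinate preserves a product measure. -/
theorem measurePreserving_update (e : ι) :
    MeasurePreserving (fun p : (ι → W) × W => Function.update p.1 e p.2)
      ((Measure.pi ρ).prod (ρ e)) (Measure.pi ρ) := by
  refine ⟨measurable_update_pair e, (Measure.pi_eq fun s hs => ?_).symm⟩
  rw [Measure.map_apply (measurable_update_pair e) (MeasurableSet.univ_pi hs)]
  have : (fun p : (ι → W) × W => Function.update p.1 e p.2) ⁻¹' Set.univ.pi s =
      Set.univ.pi (Function.update s e Set.univ) ×ˢ s e := by
    ext p
    simp only [Set.mem_preimage, Set.mem_pi, Set.mem_univ, true_imp_iff, Set.mem_prod]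
    constructor
    · intro h
      refine ⟨fun i => ?_, by simpa using h e⟩
      by_cases hi : i = e
      · subst hi; simp
      · simpa [hi] using h i
    · rintro ⟨h1, h2⟩ i
      by_cases hi : i = e
      · subst hi; simpa using h2
      · simpa [hi] using h1 i
  rw [this, Measure.prod_prod, Measure.pi_pi, ← Finset.mul_prod_erase _ _ (Finset.mem_univ e),
    ← Finset.mul_prod_erase _ (fun i => ρ i (s i)) (Finset.mem_univ e)]
  simp only [Function.update_self, measure_univ, one_mul]
  rw [mul_comm]
  congr 1
  refine Finset.prod_congr rfl fun i hi => ?_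
  rw [Function.update_of_ne (Finset.mem_erase.1 hi).1]

variable {E : Type*} [NormedAddCommGroup E]

theorem integrable_update {h : (ι → W) → E} (e : ι) (hh : Integrable h (Measure.pi ρ)) :
    Integrable (fun p : (ι → W) × W => h (Function.update p.1 e p.2))
      ((Measure.pi ρ).prod (ρ e)) :=
  (measurePreserving_update e).integrable_comp_of_integrable hh

/-- Fubini for the resampled coordinate: it plays the role of conditioning on all the other
coordinates. -/
theorem integral_update [NormedSpace ℝ E] {h : (ι → W) → E} (e : ι) (hh : Integrable h (Measure.pi ρ)) :
    ∫ ξ, ∫ w, h (Function.update ξ e w) ∂ρ e ∂Measure.pi ρ = ∫ ξ, h ξ ∂Measure.pi ρ := by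
  have h1 := integral_prod _ (integrable_update e hh)
  rw [← h1]
  have h2 := (measurePreserving_update (ρ := ρ) e).map_eq
  conv_rhs => rw [← h2]
  rw [integral_map (measurable_update_pair e).aemeasurable]
  rw [h2]
  exact hh.aestronglyMeasurable

/-- Measurable functions dominated by a power of a given one. -/
structure PolyDom {Ξ F : Type*} [MeasurableSpace Ξ] [NormedAddCommGroup F] [MeasurableSpace F]
    (Λ : Ξ → ℝ) (h : Ξ → F) : Prop where
  meas : Measurable h
  bound : ∃ (C : ℝ) (q : ℕ), ∀ ξ, ‖h ξ‖ ≤ C * Λ ξ ^ q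

namespace PolyDom
variable {Ξ : Type*} [MeasurableSpace Ξ] {Λ : Ξ → ℝ} {π : Measure Ξ}

theorem exists_bound {F : Type*} [NormedAddCommGroup F] [MeasurableSpace F] {h : Ξ → F}
    (hh : PolyDom Λ h) (hΛ : ∀ ξ, 1 ≤ Λ ξ) :
    ∃ (C : ℝ) (q : ℕ), 0 ≤ C ∧ ∀ ξ, ‖h ξ‖ ≤ C * Λ ξ ^ q := by
  obtain ⟨C, q, h1⟩ := hh.bound
  refine ⟨|C|, q, abs_nonneg _, fun ξ => (h1 ξ).trans ?_⟩
  have := (zero_le_one.trans (hΛ ξ))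
  gcongr
  exact le_abs_self C

theorem integrable {F : Type*} [NormedAddCommGroup F] [MeasurableSpace F] [BorelSpace F]
    [SecondCountableTopology F] {h : Ξ → F} (hh : PolyDom Λ h)
    (hΛ : ∀ q : ℕ, Integrable (fun ξ => Λ ξ ^ q) π) : Integrable h π := by
  obtain ⟨C, q, h1⟩ := hh.bound
  exact ((hΛ q).const_mul C).mono' hh.meas.aestronglyMeasurable (.of_forall h1)

theorem norm {F : Type*} [NormedAddCommGroup F] [MeasurableSpace F] [BorelSpace F]
    {h : Ξ → F} (hh : PolyDom Λ h) : PolyDom Λ fun ξ => ‖h ξ‖ :=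
  ⟨hh.meas.norm, hh.bound.imp fun _ => Exists.imp fun _ h ξ => by simpa using h ξ⟩

theorem sub {h h' : Ξ → ℂ} (hh : PolyDom Λ h) (hh' : PolyDom Λ h') (hΛ : ∀ ξ, 1 ≤ Λ ξ) :
    PolyDom Λ fun ξ => h ξ - h' ξ := by
  refine ⟨hh.meas.sub hh'.meas, ?_⟩
  obtain ⟨C, q, h0, h1⟩ := hh.exists_bound hΛ
  obtain ⟨C', q', h0', h1'⟩ := hh'.exists_bound hΛ
  refine ⟨C + C', q + q', fun ξ => (norm_sub_le _ _).trans ?_⟩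
  have e1 : Λ ξ ^ q ≤ Λ ξ ^ (q + q') := pow_le_pow_right₀ (hΛ ξ) (by omega)
  have e2 : Λ ξ ^ q' ≤ Λ ξ ^ (q + q') := pow_le_pow_right₀ (hΛ ξ) (by omega)
  have := mul_le_mul_of_nonneg_left e1 h0
  have := mul_le_mul_of_nonneg_left e2 h0'
  linarith [h1 ξ, h1' ξ]

variable {R : Type*} [NormedField R] [MeasurableSpace R]

theorem add {h h' : Ξ → R} [MeasurableAdd₂ R] (hh : PolyDom Λ h) (hh' : PolyDom Λ h')
    (hΛ : ∀ ξ, 1 ≤ Λ ξ) : PolyDom Λ fun ξ => h ξ + h' ξ := by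
  refine ⟨hh.meas.add hh'.meas, ?_⟩
  obtain ⟨C, q, h0, h1⟩ := hh.exists_bound hΛ
  obtain ⟨C', q', h0', h1'⟩ := hh'.exists_bound hΛ
  refine ⟨C + C', q + q', fun ξ => (norm_add_le _ _).trans ?_⟩
  have e1 : Λ ξ ^ q ≤ Λ ξ ^ (q + q') := pow_le_pow_right₀ (hΛ ξ) (by omega)
  have e2 : Λ ξ ^ q' ≤ Λ ξ ^ (q + q') := pow_le_pow_right₀ (hΛ ξ) (by omega)
  have := mul_le_mul_of_nonneg_left e1 h0
  have := mul_le_mul_of_nonneg_left e2 h0'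
  linarith [h1 ξ, h1' ξ]

theorem mul {h h' : Ξ → R} [MeasurableMul₂ R] (hh : PolyDom Λ h) (hh' : PolyDom Λ h')
    (hΛ : ∀ ξ, 1 ≤ Λ ξ) : PolyDom Λ fun ξ => h ξ * h' ξ := by
  refine ⟨hh.meas.mul hh'.meas, ?_⟩
  obtain ⟨C, q, h0, h1⟩ := hh.exists_bound hΛ
  obtain ⟨C', q', h0', h1'⟩ := hh'.exists_bound hΛ
  refine ⟨C * C', q + q', fun ξ => ?_⟩
  rw [norm_mul, pow_add, mul_mul_mul_comm]
  have := zero_le_one.trans (hΛ ξ)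
  exact mul_le_mul (h1 ξ) (h1' ξ) (norm_nonneg _) (by positivity)

theorem const (c : R) : PolyDom Λ fun _ => c :=
  ⟨measurable_const, ‖c‖, 0, fun _ => by simp⟩

theorem pow {h : Ξ → R} [MeasurableMul₂ R] (hh : PolyDom Λ h) (hΛ : ∀ ξ, 1 ≤ Λ ξ) (m : ℕ) :
    PolyDom Λ fun ξ => h ξ ^ m := by
  induction m with
  | zero => simpa using const 1
  | succ m ih => simpa only [pow_succ] using ih.mul hh hΛ

theorem self (h : Measurable Λ) (hΛ : ∀ ξ, 1 ≤ Λ ξ) : PolyDom Λ Λ :=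
  ⟨h, 1, 1, fun ξ => by rw [Real.norm_of_nonneg (zero_le_one.trans (hΛ ξ))]; simp⟩

theorem star {h : Ξ → ℂ} (hh : PolyDom Λ h) : PolyDom Λ fun ξ => (starRingEnd ℂ) (h ξ) :=
  ⟨Complex.continuous_conj.measurable.comp hh.meas,
    hh.bound.imp fun _ => Exists.imp fun _ h ξ => by simpa using h ξ⟩

theorem re {h : Ξ → ℂ} (hh : PolyDom Λ h) : PolyDom Λ fun ξ => (h ξ).re :=
  ⟨Complex.measurable_re.comp hh.meas,
    hh.bound.imp fun _ => Exists.imp fun _ h ξ => (Complex.abs_re_le_norm _).trans (h ξ)⟩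

theorem ofReal {h : Ξ → ℝ} (hh : PolyDom Λ h) : PolyDom Λ fun ξ => (h ξ : ℂ) :=
  ⟨Complex.measurable_ofReal.comp hh.meas,
    hh.bound.imp fun _ => Exists.imp fun _ h ξ => by simpa using h ξ⟩

end PolyDom

variable {Λ : (ι → W) → ℝ}

/-- Comparison of the moments of two random variables that are perturbations of a third one that
does not depend on the coordinate at hand. -/
theorem moment_step_le (hΛ1 : ∀ ξ, 1 ≤ Λ ξ)
    (hΛ : ∀ q : ℕ, Integrable (fun ξ => Λ ξ ^ q) (Measure.pi ρ)) (m : ℕ) (e : ι)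
    {U U' u : (ι → W) → ℂ} {B : (ι → W) → ℝ} (hU : PolyDom Λ U) (hU' : PolyDom Λ U')
    (hu : PolyDom Λ u) (hB : PolyDom Λ B) (hue : ∀ ξ w, u (Function.update ξ e w) = u ξ)
    (hD : ∀ ξ, ‖∫ w, (U (Function.update ξ e w) - U' (Function.update ξ e w)) ∂ρ e‖ ≤
      ∫ w, B (Function.update ξ e w) ∂ρ e) :
    ∫ ξ, ‖U ξ‖ ^ (2 * (m + 1)) ∂Measure.pi ρ - ∫ ξ, ‖U' ξ‖ ^ (2 * (m + 1)) ∂Measure.pi ρ ≤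
      ∫ ξ, (2 * (m + 1) * (‖u ξ‖ ^ (2 * m + 1) * B ξ) +
        (10 * (m + 1) ^ 2 * ((‖u ξ‖ + ‖U ξ - u ξ‖) ^ (2 * m) * ‖U ξ - u ξ‖ ^ 2) +
        10 * (m + 1) ^ 2 * ((‖u ξ‖ + ‖U' ξ - u ξ‖) ^ (2 * m) * ‖U' ξ - u ξ‖ ^ 2)))
        ∂Measure.pi ρ := by
  -- Up to the factor 2(m + 1), the gradient of |·|^{2(m+1)} at u. Since u does not depend on the
  -- coordinate e, neither does φ.
  set φ : (ι → W) → ℂ := fun ξ => ((‖u ξ‖ ^ (2 * m) : ℝ) : ℂ) * conj (u ξ) with hφ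
  have hφD : PolyDom Λ φ := ((hu.norm.pow hΛ1 _).ofReal).mul hu.star hΛ1
  have hφn : ∀ ξ, ‖φ ξ‖ = ‖u ξ‖ ^ (2 * m + 1) := by
    intro ξ
    simp [hφ, pow_succ]
  have hφe : ∀ ξ w, φ (Function.update ξ e w) = φ ξ := fun ξ w => by simp only [hφ, hue]
  have hUU : PolyDom Λ fun ξ => U ξ - U' ξ := hU.sub hU' hΛ1
  -- After resampling e the factor φ leaves the inner integral, and only the mean of U - U' over
  -- that coordinate remains.
  have hlin : ∫ ξ, (φ ξ * (U ξ - U' ξ)).re ∂Measure.pi ρ ≤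
      ∫ ξ, ‖u ξ‖ ^ (2 * m + 1) * B ξ ∂Measure.pi ρ := by
    have hi := (hφD.mul hUU hΛ1).integrable hΛ
    have hi2 := (hφD.norm.mul hB hΛ1).integrable hΛ
    have h1 : ∫ ξ, (φ ξ * (U ξ - U' ξ)).re ∂Measure.pi ρ =
        (∫ ξ, φ ξ * (U ξ - U' ξ) ∂Measure.pi ρ).re := by
      simpa using integral_re hi
    rw [h1]
    refine (Complex.re_le_norm _).trans ?_
    simp only [← hφn]
    rw [← integral_update e hi, ← integral_update e hi2]
    simp only [hφe]
    have hi3 := (integrable_update e hi2).integral_prod_left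
    simp only [hφe] at hi3
    refine (norm_integral_le_integral_norm _).trans (integral_mono_of_nonneg
      (.of_forall fun _ => norm_nonneg _) hi3 (.of_forall fun ξ => ?_))
    dsimp only
    rw [integral_const_mul, norm_mul, integral_const_mul]
    exact mul_le_mul_of_nonneg_left (hD ξ) (norm_nonneg _)
  have hq : ∀ {V : (ι → W) → ℂ}, PolyDom Λ V → Integrable (fun ξ =>
      10 * (m + 1 : ℝ) ^ 2 * ((‖u ξ‖ + ‖V ξ - u ξ‖) ^ (2 * m) * ‖V ξ - u ξ‖ ^ 2)) (Measure.pi ρ) := by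
    intro V hV
    have h1 := (hV.sub hu hΛ1).norm
    exact ((((hu.norm.add h1 hΛ1).pow hΛ1 _).mul (h1.pow hΛ1 2) hΛ1).integrable hΛ).const_mul _
  have hl1 : Integrable (fun ξ => 2 * (m + 1 : ℝ) * (‖u ξ‖ ^ (2 * m + 1) * B ξ)) (Measure.pi ρ) :=
    (((hu.norm.pow hΛ1 _).mul hB hΛ1).integrable hΛ).const_mul _
  have hl2 : Integrable (fun ξ => 2 * (m + 1 : ℝ) * (φ ξ * (U ξ - U' ξ)).re) (Measure.pi ρ) :=
    ((hφD.mul hUU hΛ1).re.integrable hΛ).const_mul _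
  have hQ : Integrable (fun ξ =>
      10 * (m + 1 : ℝ) ^ 2 * ((‖u ξ‖ + ‖U ξ - u ξ‖) ^ (2 * m) * ‖U ξ - u ξ‖ ^ 2) +
      10 * (m + 1 : ℝ) ^ 2 * ((‖u ξ‖ + ‖U' ξ - u ξ‖) ^ (2 * m) * ‖U' ξ - u ξ‖ ^ 2))
      (Measure.pi ρ) := (hq hU).add (hq hU')
  rw [← integral_sub ((hU.norm.pow hΛ1 _).integrable hΛ) ((hU'.norm.pow hΛ1 _).integrable hΛ),
    integral_add hl1 hQ]
  -- Both moments are expanded around the same u; the zeroth order terms cancel and the first order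
  -- ones combine into U - U'.
  have hpt : ∀ ξ, ‖U ξ‖ ^ (2 * (m + 1)) - ‖U' ξ‖ ^ (2 * (m + 1)) ≤
      2 * (m + 1 : ℝ) * (φ ξ * (U ξ - U' ξ)).re +
      (10 * (m + 1) ^ 2 * ((‖u ξ‖ + ‖U ξ - u ξ‖) ^ (2 * m) * ‖U ξ - u ξ‖ ^ 2) +
        10 * (m + 1) ^ 2 * ((‖u ξ‖ + ‖U' ξ - u ξ‖) ^ (2 * m) * ‖U' ξ - u ξ‖ ^ 2)) := by
    intro ξ
    have h1 := (abs_le.1 (norm_pow_second_order (u ξ) (U ξ - u ξ) m)).2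
    have h2 := (abs_le.1 (norm_pow_second_order (u ξ) (U' ξ - u ξ) m)).1
    rw [add_sub_cancel] at h1 h2
    have h3 : (φ ξ * (U ξ - U' ξ)).re = ‖u ξ‖ ^ (2 * m) * (conj (u ξ) * (U ξ - u ξ)).re -
        ‖u ξ‖ ^ (2 * m) * (conj (u ξ) * (U' ξ - u ξ)).re := by
      rw [hφ]
      dsimp only
      rw [mul_assoc, Complex.re_ofReal_mul, ← mul_sub, ← Complex.sub_re, ← mul_sub]
      congr 3
      ring
    rw [h3]
    linarith
  refine (integral_mono (((hU.norm.pow hΛ1 _).integrable hΛ).sub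
    ((hU'.norm.pow hΛ1 _).integrable hΛ)) (hl2.add hQ) hpt).trans ?_
  rw [integral_add' hl2 hQ]
  refine add_le_add ?_ le_rfl
  rw [integral_const_mul, integral_const_mul]
  exact mul_le_mul_of_nonneg_left hlin (by positivity)

/-- Sum over the coordinates of the comparisons of moments. -/
theorem sum_moment_step_le (hΛ1 : ∀ ξ, 1 ≤ Λ ξ)
    (hΛ : ∀ q : ℕ, Integrable (fun ξ => Λ ξ ^ q) (Measure.pi ρ)) (m : ℕ)
    {U U' u : ι → (ι → W) → ℂ} {B : ι → (ι → W) → ℝ} {V : (ι → W) → ℝ}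
    (hU : ∀ e, PolyDom Λ (U e)) (hU' : ∀ e, PolyDom Λ (U' e)) (hu : ∀ e, PolyDom Λ (u e))
    (hB : ∀ e, PolyDom Λ (B e)) (hV : PolyDom Λ V)
    (hue : ∀ e ξ w, u e (Function.update ξ e w) = u e ξ)
    (hD : ∀ e ξ, ‖∫ w, (U e (Function.update ξ e w) - U' e (Function.update ξ e w)) ∂ρ e‖ ≤
      ∫ w, B e (Function.update ξ e w) ∂ρ e)
    (hB0 : ∀ e ξ, 0 ≤ B e ξ) (hBV : ∀ ξ, ∑ e, B e ξ ≤ V ξ) (huV : ∀ e ξ, ‖u e ξ‖ ≤ V ξ)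
    (hUV : ∀ e ξ, ‖U e ξ - u e ξ‖ ≤ V ξ) (hUV' : ∀ e ξ, ‖U' e ξ - u e ξ‖ ≤ V ξ)
    (hU2 : ∀ ξ, ∑ e, ‖U e ξ - u e ξ‖ ^ 2 ≤ V ξ ^ 2)
    (hU2' : ∀ ξ, ∑ e, ‖U' e ξ - u e ξ‖ ^ 2 ≤ V ξ ^ 2) (hV0 : ∀ ξ, 0 ≤ V ξ) :
    ∑ e, (∫ ξ, ‖U e ξ‖ ^ (2 * (m + 1)) ∂Measure.pi ρ -
      ∫ ξ, ‖U' e ξ‖ ^ (2 * (m + 1)) ∂Measure.pi ρ) ≤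
      (2 * (m + 1) + 20 * (m + 1) ^ 2 * 4 ^ m) * ∫ ξ, V ξ ^ (2 * (m + 1)) ∂Measure.pi ρ := by
  refine (Finset.sum_le_sum fun e _ =>
    moment_step_le hΛ1 hΛ m e (hU e) (hU' e) (hu e) (hB e) (hue e) (hD e)).trans ?_
  have hq : ∀ e, ∀ {X : (ι → W) → ℂ}, PolyDom Λ X → PolyDom Λ (fun ξ =>
      10 * (m + 1 : ℝ) ^ 2 * ((‖u e ξ‖ + ‖X ξ - u e ξ‖) ^ (2 * m) * ‖X ξ - u e ξ‖ ^ 2)) := by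
    intro e X hX
    have h1 := (hX.sub (hu e) hΛ1).norm
    exact (PolyDom.const _).mul
      ((((hu e).norm.add h1 hΛ1).pow hΛ1 _).mul (h1.pow hΛ1 2) hΛ1) hΛ1
  have hall : ∀ e, PolyDom Λ fun ξ => (2 * (m + 1) * (‖u e ξ‖ ^ (2 * m + 1) * B e ξ) +
        (10 * (m + 1) ^ 2 * ((‖u e ξ‖ + ‖U e ξ - u e ξ‖) ^ (2 * m) * ‖U e ξ - u e ξ‖ ^ 2) +
        10 * (m + 1) ^ 2 * ((‖u e ξ‖ + ‖U' e ξ - u e ξ‖) ^ (2 * m) * ‖U' e ξ - u e ξ‖ ^ 2))) :=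
    fun e => ((PolyDom.const _).mul ((((hu e).norm.pow hΛ1 _).mul (hB e) hΛ1)) hΛ1).add
      ((hq e (hU e)).add (hq e (hU' e)) hΛ1) hΛ1
  rw [← integral_finsetSum _ fun e _ => (hall e).integrable hΛ, ← integral_const_mul]
  refine integral_mono (integrable_finsetSum _ fun e _ => (hall e).integrable hΛ)
    (((hV.pow hΛ1 _).integrable hΛ).const_mul _) fun ξ => ?_
  dsimp only
  have hv := hV0 ξ
  -- The supremum bound is used for 2m of the factors and the square sum for the last two, so that
  -- the sum over all coordinates still costs only V^{2(m+1)}.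
  have hq2 : ∀ {X : ι → (ι → W) → ℂ}, (∀ e, ‖X e ξ - u e ξ‖ ≤ V ξ) →
      (∑ e, ‖X e ξ - u e ξ‖ ^ 2 ≤ V ξ ^ 2) →
      ∑ e, 10 * (m + 1 : ℝ) ^ 2 * ((‖u e ξ‖ + ‖X e ξ - u e ξ‖) ^ (2 * m) * ‖X e ξ - u e ξ‖ ^ 2) ≤
        10 * (m + 1) ^ 2 * 4 ^ m * V ξ ^ (2 * (m + 1)) := by
    intro X h1 h2
    calc _ ≤ ∑ e, 10 * (m + 1 : ℝ) ^ 2 * ((V ξ + V ξ) ^ (2 * m) * ‖X e ξ - u e ξ‖ ^ 2) := by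
          gcongr with e
          · exact huV e ξ
          · exact h1 e
      _ = 10 * (m + 1 : ℝ) ^ 2 * ((V ξ + V ξ) ^ (2 * m) * ∑ e, ‖X e ξ - u e ξ‖ ^ 2) := by
          rw [← Finset.mul_sum, ← Finset.mul_sum]
      _ ≤ 10 * (m + 1 : ℝ) ^ 2 * ((V ξ + V ξ) ^ (2 * m) * V ξ ^ 2) := by gcongr
      _ = _ := by
          rw [← two_mul, mul_pow, pow_mul 2 2 m, mul_add 2 m 1, pow_add (V ξ)]
          norm_num
          ring
  rw [Finset.sum_add_distrib, Finset.sum_add_distrib]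
  have h1 : ∑ e, 2 * (m + 1 : ℝ) * (‖u e ξ‖ ^ (2 * m + 1) * B e ξ) ≤
      2 * (m + 1) * V ξ ^ (2 * (m + 1)) := by
    calc _ ≤ ∑ e, 2 * (m + 1 : ℝ) * (V ξ ^ (2 * m + 1) * B e ξ) := by
          gcongr with e
          · exact hB0 e ξ
          · exact huV e ξ
      _ = 2 * (m + 1 : ℝ) * (V ξ ^ (2 * m + 1) * ∑ e, B e ξ) := by
          rw [← Finset.mul_sum, ← Finset.mul_sum]
      _ ≤ 2 * (m + 1 : ℝ) * (V ξ ^ (2 * m + 1) * V ξ) := by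
          gcongr
          exact hBV ξ
      _ = _ := by ring
  have h2 := hq2 (fun e => hUV e ξ) (hU2 ξ)
  have h3 := hq2 (fun e => hUV' e ξ) (hU2' ξ)
  linarith

end Resampling


section Words
open scoped Matrix.Norms.L2Operator

variable {d r N : ℕ}

/-! ### Moments of the entries -/

/-- The first or the second component of a pair. -/
def sel (b : Bool) (w : ℂ × ℂ) : ℂ := if b then w.1 else w.2

theorem norm_sel_le (b : Bool) (w : ℂ × ℂ) : ‖sel b w‖ ≤ ‖w‖ := by
  unfold sel
  split_ifs
  exacts [norm_fst_le _, norm_snd_le _]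

theorem measurable_sel (b : Bool) : Measurable (sel b) := by
  unfold sel
  split_ifs
  exacts [measurable_fst, measurable_snd]

/-- The mixed moments of an entry and its conjugate. -/
noncomputable def mixMoment (ρ : Entry d N → Measure (ℂ × ℂ)) (e : Entry d N) (b : Bool)
    (β : List Bool) : ℂ := ∫ w, zmon (entryCoeff e (sel b w)) β ∂ρ e

/-- Pairs of centered entries with matching variances off the diagonal and bounded moments. -/
structure EntryLaw (ρ : Entry d N → Measure (ℂ × ℂ)) (c : ℕ → ℝ) : Prop where
  integrable : ∀ e m, Integrable (fun w => (√(N : ℝ) * ‖w‖) ^ m) (ρ e)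
  moment : ∀ e m, ∫ w, (√(N : ℝ) * ‖w‖) ^ m ∂ρ e ≤ c m
  mean : ∀ e b, ∫ w, sel b w ∂ρ e = 0
  var : ∀ e : Entry d N, e.2.1.1 ≠ e.2.1.2 → ∫ w, ‖sel true w‖ ^ 2 ∂ρ e = ∫ w, ‖sel false w‖ ^ 2 ∂ρ e

variable {ρ : Entry d N → Measure (ℂ × ℂ)} {c : ℕ → ℝ}
  {e : Entry d N} {b : Bool}

theorem measurable_entryCoeff (e : Entry d N) (a : Bool) : Measurable fun w => entryCoeff e w a := by
  unfold entryCoeff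
  split_ifs
  · exact measurable_const
  · exact Complex.measurable_ofReal.comp Complex.measurable_re
  · exact Complex.continuous_conj.measurable
  · exact measurable_id

theorem measurable_zmon_entryCoeff (e : Entry d N) (b : Bool) (β : List Bool) :
    Measurable fun w => zmon (entryCoeff e (sel b w)) β := by
  induction β with
  | nil => exact measurable_const
  | cons a β ih =>
    simp only [zmon_cons]
    exact ((measurable_entryCoeff e a).comp (measurable_sel b)).mul ih

theorem norm_zmon_entryCoeff_le (e : Entry d N) (b : Bool) (w : ℂ × ℂ) (β : List Bool) :
    ‖zmon (entryCoeff e (sel b w)) β‖ ≤ (1 / √N) ^ β.length * (√N * ‖w‖) ^ β.length := by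
  have hs : 0 < √(N : ℝ) := zero_lt_one.trans_le (one_le_sqrt_nat e)
  refine (norm_zmon_le (fun a => (norm_entryCoeff_le e _ a).trans (norm_sel_le b w)) β).trans
    (le_of_eq ?_)
  rw [← mul_pow]
  congr 1
  field_simp

theorem EntryLaw.integrable_zmon (h : EntryLaw ρ c) (e : Entry d N) (b : Bool) (β : List Bool) :
    Integrable (fun w => zmon (entryCoeff e (sel b w)) β) (ρ e) :=
  ((h.integrable e β.length).const_mul _).mono'
    (measurable_zmon_entryCoeff e b β).aestronglyMeasurable
    (.of_forall fun w => norm_zmon_entryCoeff_le e b w β)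

theorem EntryLaw.norm_mixMoment_le (h : EntryLaw ρ c) (e : Entry d N) (b : Bool) (β : List Bool) :
    ‖mixMoment ρ e b β‖ ≤ c β.length * (1 / √N) ^ β.length := by
  refine (norm_integral_le_of_norm_le ((h.integrable e β.length).const_mul _)
    (.of_forall fun w => norm_zmon_entryCoeff_le e b w β)).trans ?_
  rw [integral_const_mul, mul_comm]
  exact mul_le_mul_of_nonneg_right (h.moment e _) (by positivity)

theorem mixMoment_nil [∀ e, IsProbabilityMeasure (ρ e)] : mixMoment ρ e b [] = 1 := by simp [mixMoment, zmon]

theorem EntryLaw.integrable_sel (h : EntryLaw ρ c) (e : Entry d N) (b : Bool) :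
    Integrable (sel b) (ρ e) := by
  have hs := one_le_sqrt_nat e
  refine (h.integrable e 1).mono' (measurable_sel b).aestronglyMeasurable (.of_forall fun w => ?_)
  rw [pow_one]
  exact (norm_sel_le b w).trans (le_mul_of_one_le_left (norm_nonneg _) hs)

theorem EntryLaw.mixMoment_singleton (h : EntryLaw ρ c) (e : Entry d N) (b a : Bool) :
    mixMoment ρ e b [a] = 0 := by
  have hi := h.integrable_sel e b
  have h0 := h.mean e b
  have e1 : ∀ w, zmon (entryCoeff e (sel b w)) [a] = entryCoeff e (sel b w) a := fun w => by
    simp [zmon]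
  simp only [mixMoment, e1]
  unfold entryCoeff
  split_ifs
  · simp
  · have h1 : ∫ w, (sel b w).re ∂ρ e = 0 := by
      simpa [h0] using integral_re hi
    exact (integral_ofReal (𝕜 := ℂ)).trans (by rw [h1]; simp)
  · rw [integral_conj, h0, map_zero]
  · exact h0

/-- Off the diagonal the product of an entry and its conjugate is |z|², whose means agree. On the
diagonal one of the two coefficients is zero. Nothing is claimed on E z², nor on the variance of
diagonal entries. -/
theorem EntryLaw.mixMoment_mixed (h : EntryLaw ρ c) (e : Entry d N) (a : Bool) :
    mixMoment ρ e true [a, !a] = mixMoment ρ e false [a, !a] := by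
  have e1 : ∀ b w, zmon (entryCoeff e (sel b w)) [a, !a] =
      if e.2.1.1 = e.2.1.2 then 0 else ((‖sel b w‖ ^ 2 : ℝ) : ℂ) := by
    intro b w
    have := Complex.mul_conj' (sel b w)
    unfold entryCoeff
    cases a <;> split_ifs <;> simp_all [zmon, mul_comm]
  simp only [mixMoment, e1]
  by_cases h1 : e.2.1.1 = e.2.1.2
  · simp [h1]
  · simp only [h1, if_false]
    have h2 : ∀ b, ∫ w, ((‖sel b w‖ ^ 2 : ℝ) : ℂ) ∂ρ e = ((∫ w, ‖sel b w‖ ^ 2 ∂ρ e : ℝ) : ℂ) :=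
      fun b => integral_ofReal (𝕜 := ℂ)
    rw [h2, h2, h.var e h1]

/-- The constant bounding the weighted moments that occur in remainders of order ten. -/
noncomputable def momentConst (c : ℕ → ℝ) (q : ℕ) : ℝ :=
  1 + 2 ^ q * (|c 10| + ∑ m ∈ Finset.range (q + 11), |c m|)

theorem le_momentConst (c : ℕ → ℝ) {q m : ℕ} (hm : m < q + 11) : c m ≤ momentConst c q := by
  have h1 : |c m| ≤ ∑ m ∈ Finset.range (q + 11), |c m| :=
    Finset.single_le_sum (f := fun m => |c m|) (fun _ _ => abs_nonneg _) (Finset.mem_range.2 hm)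
  have h2 : (1 : ℝ) ≤ 2 ^ q := one_le_pow₀ (by norm_num)
  have h3 : 0 ≤ |c m| := abs_nonneg _
  have h4 : 0 ≤ |c 10| := abs_nonneg _
  unfold momentConst
  nlinarith [le_abs_self (c m)]

theorem one_le_momentConst (c : ℕ → ℝ) (q : ℕ) : 1 ≤ momentConst c q := by
  unfold momentConst
  have : 0 ≤ 2 ^ q * (|c 10| + ∑ m ∈ Finset.range (q + 11), |c m|) :=
    mul_nonneg (by positivity) (add_nonneg (abs_nonneg _) (Finset.sum_nonneg fun _ _ => abs_nonneg _))
  linarith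

/-- The weight that a remainder of order ten acquires when the envelope is allowed to grow with the
entry. -/
theorem EntryLaw.integral_weight_le (h : EntryLaw ρ c) (e : Entry d N) (q : ℕ) :
    Integrable (fun w : ℂ × ℂ => (√N * ‖w‖) ^ 10 * (1 + √N * ‖w‖) ^ q) (ρ e) ∧
    ∫ w, (√N * ‖w‖) ^ 10 * (1 + √N * ‖w‖) ^ q ∂ρ e ≤ momentConst c q := by
  have hb : ∀ w : ℂ × ℂ, (√N * ‖w‖) ^ 10 * (1 + √N * ‖w‖) ^ q ≤
      2 ^ q * ((√N * ‖w‖) ^ 10 + (√N * ‖w‖) ^ (q + 10)) := by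
    intro w
    have hv : 0 ≤ √N * ‖w‖ := by positivity
    have h1 : (1 + √N * ‖w‖) ^ q ≤ 2 ^ q * (1 + (√N * ‖w‖) ^ q) := by
      refine (add_pow_le zero_le_one hv q).trans ?_
      rw [one_pow]
      gcongr
      · norm_num
      · omega
    calc _ ≤ (√N * ‖w‖) ^ 10 * (2 ^ q * (1 + (√N * ‖w‖) ^ q)) := by gcongr
      _ = _ := by ring
  have hi : Integrable (fun w : ℂ × ℂ => 2 ^ q * ((√N * ‖w‖) ^ 10 + (√N * ‖w‖) ^ (q + 10))) (ρ e) :=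
    ((h.integrable e 10).add (h.integrable e (q + 10))).const_mul _
  have hm : Measurable fun w : ℂ × ℂ => (√N * ‖w‖) ^ 10 * (1 + √N * ‖w‖) ^ q := by fun_prop
  refine ⟨hi.mono' hm.aestronglyMeasurable (.of_forall fun w => ?_), ?_⟩
  · rw [Real.norm_of_nonneg (by positivity)]
    exact hb w
  · refine (integral_mono_of_nonneg (.of_forall fun w => by positivity) hi (.of_forall hb)).trans ?_
    rw [integral_const_mul, integral_add (h.integrable e 10) (h.integrable e (q + 10))]
    unfold momentConst
    have h1 : |c (q + 10)| ≤ ∑ m ∈ Finset.range (q + 11), |c m| :=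
      Finset.single_le_sum (f := fun m => |c m|) (fun _ _ => abs_nonneg _) (by simp)
    have h2 := h.moment e 10
    have h3 := h.moment e (q + 10)
    have : 2 ^ q * (∫ w, (√(N : ℝ) * ‖w‖) ^ 10 ∂ρ e + ∫ w, (√(N : ℝ) * ‖w‖) ^ (q + 10) ∂ρ e) ≤
        2 ^ q * (|c 10| + ∑ m ∈ Finset.range (q + 11), |c m|) := by
      refine mul_le_mul_of_nonneg_left ?_ (by positivity)
      linarith [le_abs_self (c 10), le_abs_self (c (q + 10))]
    linarith

/-- Integration of an expansion of order ten in an entry. -/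
theorem EntryLaw.integral_expansion (h : EntryLaw ρ c) {H : ℂ × ℂ → ℂ} (hH : Measurable H)
    {𝓑 : Finset (List Bool)} {G : List Bool → ℂ} {a : ℝ} {q : ℕ} (ha : 0 ≤ a)
    (hb : ∀ w, ‖H w - ∑ β ∈ 𝓑, zmon (entryCoeff e (sel b w)) β * G β‖ ≤
      a * ((√N * ‖w‖) ^ 10 * (1 + √N * ‖w‖) ^ q)) :
    Integrable H (ρ e) ∧
    ‖∫ w, H w ∂ρ e - ∑ β ∈ 𝓑, mixMoment ρ e b β * G β‖ ≤ a * momentConst c q := by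
  obtain ⟨hw, hw'⟩ := h.integral_weight_le e q
  have hs : Integrable (fun w => ∑ β ∈ 𝓑, zmon (entryCoeff e (sel b w)) β * G β) (ρ e) :=
    integrable_finsetSum _ fun β _ => (h.integrable_zmon e b β).mul_const _
  have hd : Integrable (fun w => H w - ∑ β ∈ 𝓑, zmon (entryCoeff e (sel b w)) β * G β)
      (ρ e) := (hw.const_mul a).mono'
    (hH.aestronglyMeasurable.sub hs.aestronglyMeasurable) (.of_forall hb)
  have hHi : Integrable H (ρ e) := (hd.add hs).congr (.of_forall fun w => sub_add_cancel _ _)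
  refine ⟨hHi, ?_⟩
  have e1 : ∑ β ∈ 𝓑, mixMoment ρ e b β * G β =
      ∫ w, ∑ β ∈ 𝓑, zmon (entryCoeff e (sel b w)) β * G β ∂ρ e := by
    rw [integral_finsetSum _ fun β _ => (h.integrable_zmon e b β).mul_const _]
    exact Finset.sum_congr rfl fun β _ => (integral_mul_const _ _).symm
  rw [e1, ← integral_sub hHi hs]
  refine (norm_integral_le_of_norm_le (hw.const_mul a) (.of_forall hb)).trans ?_
  rw [integral_const_mul]
  exact mul_le_mul_of_nonneg_left hw' ha

end Words

section Words
open scoped Matrix.Norms.L2Operator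

variable {d r N : ℕ}

/-! ### The effect of replacing one entry -/

/-- Expansions in an entry are centered at the matrix with that entry set to zero, which is
independent of the entry; this lets the moments factor out of each term. -/
theorem hermOf_update_eq_bump (z : Entry d N → ℂ) (e : Entry d N) (c : ℂ) :
    hermOf (Function.update z e c) = bump e (entryCoeff e c) (hermOf (Function.update z e 0)) := by
  have := hermOf_update (Function.update z e 0) e c
  simpa using this

theorem EnvBound.mono {A : Fin r → Matrix (Fin N) (Fin N) ℂ}
    {M : Fin d → Matrix (Fin N) (Fin N) ℂ} {Λ Λ' : ℝ} (h : EnvBound A M Λ) (hΛ : Λ ≤ Λ') :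
    EnvBound A M Λ' :=
  ⟨h.one_le.trans hΛ, h.herm, fun s => (h.norm_M s).trans hΛ, fun j => (h.norm_A j).trans hΛ⟩

/-- The weight of third order terms. -/
def thirdWeight (θ : ℝ) (β : List Bool) : ℝ := if β.length = 3 then θ else 1

/-- The terms of the expansion in one entry that are controlled by stable sums. -/
noncomputable def restTerm (κ θ C T : ℝ) (q : ℕ)
    (g : List Bool → Entry d N → (Fin d → Matrix (Fin N) (Fin N) ℂ) → ℂ)
    (g2 : Bool → List Bool → Entry d N → (Fin d → Matrix (Fin N) (Fin N) ℂ) → ℂ)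
    (e : Entry d N) (M : Fin d → Matrix (Fin N) (Fin N) ℂ) (L : ℝ) : ℝ :=
  ∑ β ∈ (boolLists 10).filter (3 ≤ ·.length),
      2 * κ * thirdWeight θ β * (1 / √N) ^ β.length * ‖g β e M‖ +
    ∑ a : Bool, 2 * κ / N * (∑ γ ∈ (boolLists 10).filter (2 ≤ ·.length),
      κ * (1 / √N) ^ γ.length * ‖g2 a γ e M‖ + C * T ^ 2 * (T / √N) ^ 10 * L ^ q * κ) +
    2 * (C * (T / √N) ^ 10 * L ^ q * κ)

variable {A : Fin r → Matrix (Fin N) (Fin N) ℂ} {f : (Fin d → Matrix (Fin N) (Fin N) ℂ) → ℂ}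
  {C T θ : ℝ} {q : ℕ} {g : List Bool → Entry d N → (Fin d → Matrix (Fin N) (Fin N) ℂ) → ℂ}
  {g2 : Bool → List Bool → Entry d N → (Fin d → Matrix (Fin N) (Fin N) ℂ) → ℂ}
  {ρ : Entry d N → Measure (ℂ × ℂ)} {c : ℕ → ℝ} {e : Entry d N} {z : Entry d N → ℂ} {L : ℝ}

theorem measurable_update_sel (z : Entry d N → ℂ) (e : Entry d N) (b : Bool) :
    Measurable fun w => Function.update z e (sel b w) :=
  (measurable_update z).comp (measurable_sel b)

/-- The remainder separates into a factor fixed by the other entries and a polynomial weight in √N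
‖w‖, because L bounds the envelope up to 1 + √N ‖w‖ and T ‖w‖ = (T/√N)(√N ‖w‖). -/
theorem TaylorControl.weighted (h : TaylorControl A f C q T g g2) (b : Bool)
    (hL : ∀ b w, EnvBound A (hermOf (Function.update z e (sel b w))) (L * (1 + √N * ‖w‖)))
    (h0 : ∀ w : ℂ × ℂ, EnvBound A (hermOf (Function.update z e 0)) (L * (1 + √N * ‖w‖)))
    (w : ℂ × ℂ) :
    ‖f (hermOf (Function.update z e (sel b w))) - ∑ β ∈ boolLists 10,
      zmon (entryCoeff e (sel b w)) β * g β e (hermOf (Function.update z e 0))‖ ≤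
      C * (T / √N) ^ 10 * L ^ q * ((√N * ‖w‖) ^ 10 * (1 + √N * ‖w‖) ^ q) := by
  have hs : 0 < √(N : ℝ) := zero_lt_one.trans_le (one_le_sqrt_nat e)
  have h1 := hL b w
  rw [hermOf_update_eq_bump] at h1 ⊢
  refine (h.taylor e _ _ ‖w‖ _ (h0 w) h1 fun a =>
    (norm_entryCoeff_le _ _ _).trans (norm_sel_le b w)).trans (le_of_eq ?_)
  have e2 : T * ‖w‖ = T / √N * (√N * ‖w‖) := by field_simp
  rw [e2, mul_pow (T / √N), mul_pow L]
  ring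

theorem TaylorControl.weighted_second (h : TaylorControl A f C q T g g2) (b a : Bool)
    (hL : ∀ b w, EnvBound A (hermOf (Function.update z e (sel b w))) (L * (1 + √N * ‖w‖)))
    (h0 : ∀ w : ℂ × ℂ, EnvBound A (hermOf (Function.update z e 0)) (L * (1 + √N * ‖w‖)))
    (w : ℂ × ℂ) :
    ‖g [a, a] e (hermOf (Function.update z e (sel b w))) - ∑ β ∈ boolLists 10,
      zmon (entryCoeff e (sel b w)) β * g2 a β e (hermOf (Function.update z e 0))‖ ≤
      C * T ^ 2 * (T / √N) ^ 10 * L ^ q * ((√N * ‖w‖) ^ 10 * (1 + √N * ‖w‖) ^ q) := by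
  have hs : 0 < √(N : ℝ) := zero_lt_one.trans_le (one_le_sqrt_nat e)
  have h1 := hL b w
  rw [hermOf_update_eq_bump] at h1 ⊢
  refine (h.taylor2 a e _ _ ‖w‖ _ (h0 w) h1 fun a =>
    (norm_entryCoeff_le _ _ _).trans (norm_sel_le b w)).trans (le_of_eq ?_)
  have e2 : T * ‖w‖ = T / √N * (√N * ‖w‖) := by field_simp
  rw [e2, mul_pow (T / √N), mul_pow L]
  ring

variable [∀ e, IsProbabilityMeasure (ρ e)]

/-- In the difference of two expansions order 0 cancels, order 1 vanishes by centering, and mixed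
second moments agree. What survives is `[a, a]`, of size 1/N, and the orders from three on, where
order three carries the weight θ. -/
theorem EntryLaw.norm_mixMoment_sub_le (hρ : EntryLaw ρ c)
    (hθ : ∀ e β, β.length = 3 → ‖mixMoment ρ e true β - mixMoment ρ e false β‖ ≤
      2 * momentConst c q * θ * (1 / √N) ^ 3) {G : ℝ} (hG : 0 ≤ G) (hθ0 : 0 ≤ θ) {β : List Bool}
    (hβ : β.length < 10) :
    ‖mixMoment ρ e true β - mixMoment ρ e false β‖ * G ≤
      (if β = [true, true] then 2 * momentConst c q / N * G else 0) +
      (if β = [false, false] then 2 * momentConst c q / N * G else 0) +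
      (if 3 ≤ β.length then 2 * momentConst c q * thirdWeight θ β * (1 / √N) ^ β.length * G
        else 0) := by
  have hκ := one_le_momentConst c q
  have hN : (1 / √(N : ℝ)) ^ 2 = 1 / N := by
    rw [div_pow, Real.sq_sqrt (Nat.cast_nonneg N), one_pow]
  have hgen : ‖mixMoment ρ e true β - mixMoment ρ e false β‖ ≤
      2 * momentConst c q * (1 / √N) ^ β.length := by
    refine (norm_sub_le _ _).trans ?_
    have h1 := le_momentConst c (q := q) (m := β.length) (by omega)
    have h2 : c β.length * (1 / √(N : ℝ)) ^ β.length ≤ momentConst c q * (1 / √N) ^ β.length := by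
      gcongr
    linarith [hρ.norm_mixMoment_le e true β, hρ.norm_mixMoment_le e false β]
  have hn1 : 0 ≤ (if β = [true, true] then 2 * momentConst c q / N * G else 0) := by
    split_ifs <;> positivity
  have hn2 : 0 ≤ (if β = [false, false] then 2 * momentConst c q / N * G else 0) := by
    split_ifs <;> positivity
  have htw : 0 ≤ thirdWeight θ β := by unfold thirdWeight; split_ifs <;> linarith
  have hn3 : 0 ≤ (if 3 ≤ β.length then
      2 * momentConst c q * thirdWeight θ β * (1 / √(N : ℝ)) ^ β.length * G else 0) := by
    split_ifs <;> positivity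
  by_cases h3 : 3 ≤ β.length
  · have : ‖mixMoment ρ e true β - mixMoment ρ e false β‖ ≤
        2 * momentConst c q * thirdWeight θ β * (1 / √N) ^ β.length := by
      unfold thirdWeight
      split_ifs with h4
      · rw [h4]; exact hθ e β h4
      · simpa using hgen
    have := mul_le_mul_of_nonneg_right this hG
    rw [if_pos h3] at hn3 ⊢
    linarith
  · rcases β with _ | ⟨a, _ | ⟨a', _ | ⟨a'', β⟩⟩⟩
    · simp [mixMoment_nil]
    · simp [hρ.mixMoment_singleton]
    · have hgen' := mul_le_mul_of_nonneg_right hgen hG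
      simp only [List.length_cons, List.length_nil, zero_add, Nat.reduceAdd, hN, mul_one_div] at hgen'
      by_cases haa : a' = a
      · subst haa
        cases a' <;> simp <;> simpa using hgen'
      · have : a' = !a := by cases a <;> cases a' <;> simp_all
        subst this
        rw [hρ.mixMoment_mixed]
        simp only [sub_self, norm_zero, zero_mul]
        positivity
    · simp at h3

theorem norm_sub_sum_le {ι : Type*} {𝓑 : Finset ι} {x : ℂ} {u v : ι → ℂ} {b : ℝ}
    (h : ‖x - ∑ β ∈ 𝓑, u β * v β‖ ≤ b) : ‖x‖ ≤ ∑ β ∈ 𝓑, ‖u β‖ * ‖v β‖ + b := by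
  have h1 : x = ∑ β ∈ 𝓑, u β * v β + (x - ∑ β ∈ 𝓑, u β * v β) := by ring
  rw [h1]
  refine (norm_add_le _ _).trans (add_le_add ((norm_sum_le _ _).trans (le_of_eq ?_)) h)
  exact Finset.sum_congr rfl fun β _ => norm_mul _ _

/-- The √N bound on second derivatives `[a, a]` requires a matrix common to all entries, whereas the
expansion produces them at a matrix with e removed. Averaging over the entry restores the common
matrix; since the entry is centered, the correction starts at two further derivatives, for which the
cruder stable sums are enough. -/
theorem TaylorControl.norm_diag_le (h : TaylorControl A f C q T g g2) (hρ : EntryLaw ρ c)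
    (hC : 0 ≤ C) (hL0 : 0 ≤ L) (b a : Bool)
    (hm : Measurable fun z => g [a, a] e (hermOf z))
    (hL : ∀ b w, EnvBound A (hermOf (Function.update z e (sel b w))) (L * (1 + √N * ‖w‖)))
    (h0 : ∀ w : ℂ × ℂ, EnvBound A (hermOf (Function.update z e 0)) (L * (1 + √N * ‖w‖))) :
    Integrable (fun w => g [a, a] e (hermOf (Function.update z e (sel b w)))) (ρ e) ∧
    ‖g [a, a] e (hermOf (Function.update z e 0))‖ ≤
      ∫ w, ‖g [a, a] e (hermOf (Function.update z e (sel b w)))‖ ∂ρ e +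
      (∑ γ ∈ (boolLists 10).filter (2 ≤ ·.length), momentConst c q * (1 / √N) ^ γ.length *
        ‖g2 a γ e (hermOf (Function.update z e 0))‖ +
      C * T ^ 2 * (T / √N) ^ 10 * L ^ q * momentConst c q) := by
  set G := fun γ => g2 a γ e (hermOf (Function.update z e 0)) with hG
  obtain ⟨hi, hb⟩ := hρ.integral_expansion (e := e) (b := b)
    (H := fun w => g [a, a] e (hermOf (Function.update z e (sel b w)))) (𝓑 := boolLists 10) (G := G)
    (a := C * T ^ 2 * (T / √N) ^ 10 * L ^ q) (q := q) (hm.comp (measurable_update_sel z e b))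
    (by positivity) (h.weighted_second b a hL h0)
  refine ⟨hi, ?_⟩
  have hnil : [] ∈ boolLists 10 := mem_boolLists.2 (by simp)
  have hGnil : G [] = g [a, a] e (hermOf (Function.update z e 0)) := h.nil2 _ _ _
  rw [← Finset.add_sum_erase _ _ hnil, mixMoment_nil, one_mul, hGnil] at hb
  set I := ∫ w, g [a, a] e (hermOf (Function.update z e (sel b w))) ∂ρ e with hI
  have hIn : ‖I‖ ≤ ∫ w, ‖g [a, a] e (hermOf (Function.update z e (sel b w)))‖ ∂ρ e :=
    norm_integral_le_integral_norm _
  have hsum : ‖∑ γ ∈ (boolLists 10).erase [], mixMoment ρ e b γ * G γ‖ ≤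
      ∑ γ ∈ (boolLists 10).filter (2 ≤ ·.length), momentConst c q * (1 / √N) ^ γ.length * ‖G γ‖ := by
    refine (norm_sum_le _ _).trans ?_
    rw [Finset.sum_filter]
    refine (Finset.sum_le_sum (g := fun γ => if 2 ≤ γ.length then
      momentConst c q * (1 / √N) ^ γ.length * ‖G γ‖ else 0) fun γ hγ => ?_).trans ?_
    · obtain ⟨hγ0, hγ⟩ := Finset.mem_erase.1 hγ
      rw [mem_boolLists] at hγ
      split_ifs with h2
      · rw [norm_mul]
        refine mul_le_mul_of_nonneg_right ((hρ.norm_mixMoment_le e b γ).trans ?_) (norm_nonneg _)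
        exact mul_le_mul_of_nonneg_right (le_momentConst c (by omega)) (by positivity)
      · have : γ.length ≠ 0 := by simpa using hγ0
        -- First moments vanish, so orders below two leave nothing.
        obtain ⟨a', rfl⟩ := List.length_eq_one_iff.1 (show γ.length = 1 by omega)
        rw [hρ.mixMoment_singleton]; simp
    · refine Finset.sum_le_sum_of_subset_of_nonneg (Finset.erase_subset _ _) fun γ _ _ => ?_
      have := one_le_momentConst c q
      split_ifs <;> positivity
  have e1 : g [a, a] e (hermOf (Function.update z e 0)) =
      I - ∑ γ ∈ (boolLists 10).erase [], mixMoment ρ e b γ * G γ -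
      (I - (g [a, a] e (hermOf (Function.update z e 0)) +
        ∑ γ ∈ (boolLists 10).erase [], mixMoment ρ e b γ * G γ)) := by ring
  rw [e1]
  refine (norm_sub_le _ _).trans ?_
  have := norm_sub_le I (∑ γ ∈ (boolLists 10).erase [], mixMoment ρ e b γ * G γ)
  linarith

/-- The mean effect of the replacement of one entry. -/
theorem TaylorControl.norm_integral_replace_le (h : TaylorControl A f C q T g g2)
    (hρ : EntryLaw ρ c) (hC : 0 ≤ C) (hL0 : 0 ≤ L) (hθ0 : 0 ≤ θ) (b : Bool)
    (hf : Measurable fun z : Entry d N → ℂ => f (hermOf z))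
    (hm : ∀ a, Measurable fun z => g [a, a] e (hermOf z))
    (hθ : ∀ e β, β.length = 3 → ‖mixMoment ρ e true β - mixMoment ρ e false β‖ ≤
      2 * momentConst c q * θ * (1 / √N) ^ 3)
    (hL : ∀ b w, EnvBound A (hermOf (Function.update z e (sel b w))) (L * (1 + √N * ‖w‖)))
    (h0 : ∀ w : ℂ × ℂ, EnvBound A (hermOf (Function.update z e 0)) (L * (1 + √N * ‖w‖))) :
    ‖∫ w, (f (hermOf (Function.update z e (sel true w))) -
      f (hermOf (Function.update z e (sel false w)))) ∂ρ e‖ ≤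
      ∑ a, 2 * momentConst c q / N *
        ∫ w, ‖g [a, a] e (hermOf (Function.update z e (sel b w)))‖ ∂ρ e +
      restTerm (momentConst c q) θ C T q g g2 e (hermOf (Function.update z e 0)) L := by
  set G := fun γ => g γ e (hermOf (Function.update z e 0)) with hG
  have hκ := one_le_momentConst c q
  have hexp := fun b => hρ.integral_expansion (e := e) (b := b)
    (H := fun w => f (hermOf (Function.update z e (sel b w)))) (𝓑 := boolLists 10) (G := G)
    (a := C * (T / √N) ^ 10 * L ^ q) (q := q) (hf.comp (measurable_update_sel z e b))
    (by positivity) (h.weighted b hL h0)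
  rw [integral_sub (hexp true).1 (hexp false).1]
  have hdiff : ‖(∫ w, f (hermOf (Function.update z e (sel true w))) ∂ρ e -
      ∫ w, f (hermOf (Function.update z e (sel false w))) ∂ρ e) -
      ∑ β ∈ boolLists 10, (mixMoment ρ e true β - mixMoment ρ e false β) * G β‖ ≤
      2 * (C * (T / √N) ^ 10 * L ^ q * momentConst c q) := by
    simp only [sub_mul]
    rw [Finset.sum_sub_distrib, sub_sub_sub_comm]
    refine (norm_sub_le _ _).trans ?_
    linarith [(hexp true).2, (hexp false).2]
  refine (norm_sub_sum_le hdiff).trans ?_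
  have hsum : ∑ β ∈ boolLists 10, ‖mixMoment ρ e true β - mixMoment ρ e false β‖ * ‖G β‖ ≤
      2 * momentConst c q / N * ‖G [true, true]‖ + 2 * momentConst c q / N * ‖G [false, false]‖ +
      ∑ β ∈ (boolLists 10).filter (3 ≤ ·.length),
        2 * momentConst c q * thirdWeight θ β * (1 / √N) ^ β.length * ‖G β‖ := by
    refine (Finset.sum_le_sum fun β hβ => hρ.norm_mixMoment_sub_le hθ (norm_nonneg _) hθ0
      (mem_boolLists.1 hβ)).trans ?_
    rw [Finset.sum_add_distrib, Finset.sum_add_distrib, ← Finset.sum_filter (3 ≤ List.length ·)]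
    have hmem : ∀ a, [a, a] ∈ boolLists 10 := fun a => mem_boolLists.2 (by simp)
    have e2 : ∀ a : Bool, ∑ β ∈ boolLists 10,
        (if β = [a, a] then 2 * momentConst c q / N * ‖G β‖ else 0) =
        2 * momentConst c q / N * ‖G [a, a]‖ := by
      intro a
      rw [Finset.sum_ite_eq_of_mem' _ _ _ (hmem a)]
    rw [e2, e2]
  -- The second derivatives at the matrix without e are traded for their mean over the entry; the
  -- corrections are the middle sum of `restTerm`.
  have hd := fun a => mul_le_mul_of_nonneg_left
    (h.norm_diag_le hρ hC hL0 b a (hm a) hL h0).2 (show 0 ≤ 2 * momentConst c q / N by positivity)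
  have hdt := hd true
  have hdf := hd false
  unfold restTerm
  rw [Fintype.sum_bool, Fintype.sum_bool]
  simp only [hG] at hsum
  rw [mul_add] at hdt hdf
  linarith

end Words

/-! ### Sum over the entries of the terms of order three and more -/

section Words
open scoped Matrix.Norms.L2Operator

variable {d r N : ℕ} {A : Fin r → Matrix (Fin N) (Fin N) ℂ}
  {f : (Fin d → Matrix (Fin N) (Fin N) ℂ) → ℂ}
  {C T θ δ κ Λ : ℝ} {q : ℕ} {g : List Bool → Entry d N → (Fin d → Matrix (Fin N) (Fin N) ℂ) → ℂ}
  {g2 : Bool → List Bool → Entry d N → (Fin d → Matrix (Fin N) (Fin N) ℂ) → ℂ}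
  {M : Fin d → Matrix (Fin N) (Fin N) ℂ}

theorem card_filter_boolLists_le (p : List Bool → Prop) [DecidablePred p] :
    (((boolLists 10).filter p).card : ℝ) ≤ 2 ^ 10 := by
  exact_mod_cast (Finset.card_filter_le _ _).trans (card_boolLists_le 10)

theorem thirdWeight_nonneg (hθ : 0 ≤ θ) (β : List Bool) : 0 ≤ thirdWeight θ β := by
  unfold thirdWeight; split_ifs <;> linarith

theorem restTerm_nonneg (hκ : 0 ≤ κ) (hθ : 0 ≤ θ) (hC : 0 ≤ C) {e : Entry d N}
    {L : ℝ} (hL : 0 ≤ L) : 0 ≤ restTerm κ θ C T q g g2 e M L := by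
  have := fun β => thirdWeight_nonneg hθ β
  unfold restTerm
  refine add_nonneg (add_nonneg (Finset.sum_nonneg fun β _ => ?_) (Finset.sum_nonneg fun a _ =>
    mul_nonneg (by positivity) (add_nonneg (Finset.sum_nonneg fun γ _ => by positivity)
    (by positivity)))) (by positivity)
  have := this β
  positivity

/-- Stable sums give N x^m for order m, with x = T/√N. For m ≥ 4 this is at most N x⁴ = (T²/√N)²,
and for m = 3 it is T³/√N, weighted by θ. The remainders of order ten are counted over all dN²
entries. -/
theorem TaylorControl.sum_restTerm_le (h : TaylorControl A f C q T g g2) (hC : 0 ≤ C) (hT : 1 ≤ T)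
    (hTN : T ^ 4 ≤ N) (hκ : 1 ≤ κ) (hθ0 : 0 ≤ θ) (hδ : T ^ 2 / √N ≤ δ) (hθ : θ * (T ^ 3 / √N) ≤ δ)
    {ζ : Entry d N → Bool → ℂ} (hM : EnvBound A M Λ)
    (hM' : ∀ e, EnvBound A (bump e (ζ e) M) Λ) (hζ : ∀ e a, ‖ζ e a‖ ≤ Λ / √N)
    {L : Entry d N → ℝ} (hL0 : ∀ e, 0 ≤ L e) (hL : ∀ e, L e ≤ 900 * Λ) :
    ∑ e, restTerm κ θ C T q g g2 e (bump e (ζ e) M) (L e) ≤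
      (d + 1) * 2 ^ 13 * κ ^ 2 * C * 900 ^ q * Λ ^ q * δ := by
  obtain ⟨hN, hx, hx1, hx4⟩ := sqrt_scale hT hTN
  obtain ⟨hxy, hy4, hy1⟩ := scale_facts hT hTN
  have hs : 0 < √(N : ℝ) := Real.sqrt_pos.2 hN
  have hΛ := hM.one_le
  have hT0 : 0 < T := by linarith
  -- Turns the T² of the second derivatives into N x², so that T² x^|γ| becomes N x^{2+|γ|}, of
  -- order at least four.
  have hTx : T ^ 2 = N * (T / √N) ^ 2 := by
    rw [div_pow, Real.sq_sqrt hN.le]; field_simp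
  have hT3 : N * (T / √N) ^ 3 = T ^ 3 / √N := by
    have h2 : (N : ℝ) = √N ^ 2 := (Real.sq_sqrt hN.le).symm
    rw [div_pow]
    conv_lhs => rw [h2, Real.sqrt_sq hs.le]
    field_simp
  set x := T / √N with hxdef
  set y := T ^ 2 / √N with hydef
  have hy0 : 0 ≤ y := by positivity
  have hδ0 : 0 ≤ δ := hy0.trans hδ
  have hxpow : ∀ m, 4 ≤ m → N * x ^ m ≤ δ := by
    intro m hm
    have : N * x ^ m ≤ y ^ 2 := by
      rw [← hy4]
      gcongr ?_ * ?_
      exact pow_le_pow_of_le_one hx hx1 hm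
    nlinarith
  set B := C * Λ ^ q * δ with hB
  have hB0 : 0 ≤ B := by positivity
  set B9 := C * 900 ^ q * Λ ^ q * δ with hB9
  have hBB : B ≤ B9 := by
    have : (1 : ℝ) ≤ 900 ^ q := one_le_pow₀ (by norm_num)
    calc B = C * 1 * Λ ^ q * δ := by rw [hB]; ring
      _ ≤ _ := by rw [hB9]; gcongr
  have hd : (0 : ℝ) ≤ d := Nat.cast_nonneg d
  have hcard : (Fintype.card (Entry d N) : ℝ) ≤ d * N ^ 2 := card_entry_le
  have hLq : ∀ e, L e ^ q ≤ 900 ^ q * Λ ^ q := fun e => by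
    rw [← mul_pow]; exact pow_le_pow_left₀ (hL0 e) (hL e) q
  have h1 : ∑ e, ∑ β ∈ (boolLists 10).filter (3 ≤ ·.length),
      2 * κ * thirdWeight θ β * (1 / √N) ^ β.length * ‖g β e (bump e (ζ e) M)‖ ≤ 2 ^ 11 * κ * B := by
    rw [Finset.sum_comm]
    refine (Finset.sum_le_card_nsmul _ _ (2 * κ * B) fun β hβ => ?_).trans ?_
    · obtain ⟨hβ, hβ3⟩ := Finset.mem_filter.1 hβ
      rw [mem_boolLists] at hβ
      rw [← Finset.mul_sum]
      have htw := thirdWeight_nonneg hθ0 β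
      calc _ ≤ 2 * κ * thirdWeight θ β * (1 / √N) ^ β.length * (C * T ^ β.length * N * Λ ^ q) :=
            mul_le_mul_of_nonneg_left (h.stable β M Λ ζ (by omega) hβ hM hM' hζ) (by positivity)
        _ = 2 * κ * (C * Λ ^ q * (thirdWeight θ β * (N * x ^ β.length))) := by
            rw [hxdef, div_pow, div_pow, one_pow]; ring
        _ ≤ _ := by
            rw [hB]
            gcongr
            unfold thirdWeight
            -- Order three is the only place where `hθ` enters.
            split_ifs with h3
            · rw [h3, hT3]; exact hθ
            · rw [one_mul]; exact hxpow _ (by omega)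
    · rw [nsmul_eq_mul]
      calc _ ≤ 2 ^ 10 * (2 * κ * B) :=
            mul_le_mul_of_nonneg_right (card_filter_boolLists_le _) (by positivity)
        _ = _ := by ring
  have h2 : ∀ a, ∑ e, 2 * κ / N * (∑ γ ∈ (boolLists 10).filter (2 ≤ ·.length),
      κ * (1 / √N) ^ γ.length * ‖g2 a γ e (bump e (ζ e) M)‖ +
        C * T ^ 2 * x ^ 10 * L e ^ q * κ) ≤ 2 ^ 11 * κ ^ 2 * B + 2 * κ ^ 2 * d * B9 := by
    intro a
    rw [← Finset.mul_sum, Finset.sum_add_distrib, Finset.sum_comm, mul_add]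
    refine add_le_add ?_ ?_
    · have : ∑ γ ∈ (boolLists 10).filter (2 ≤ ·.length), ∑ e,
          κ * (1 / √N) ^ γ.length * ‖g2 a γ e (bump e (ζ e) M)‖ ≤ 2 ^ 10 * (κ * (N * B)) := by
        refine (Finset.sum_le_card_nsmul _ _ (κ * (N * B)) fun γ hγ => ?_).trans ?_
        · obtain ⟨hγ, hγ2⟩ := Finset.mem_filter.1 hγ
          rw [mem_boolLists] at hγ
          rw [← Finset.mul_sum]
          calc _ ≤ κ * (1 / √N) ^ γ.length * (C * T ^ (2 + γ.length) * N * Λ ^ q) :=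
                mul_le_mul_of_nonneg_left (h.stable2 a γ M Λ ζ hγ hM hM' hζ) (by positivity)
            _ = κ * (N * (C * Λ ^ q * (T ^ 2 * x ^ γ.length))) := by
                rw [hxdef, div_pow, div_pow, one_pow]; ring
            _ ≤ _ := by
                rw [hB, hTx, mul_assoc (N : ℝ) (x ^ 2), ← pow_add]
                gcongr
                exact hxpow _ (by omega)
        · rw [nsmul_eq_mul]
          exact mul_le_mul_of_nonneg_right (card_filter_boolLists_le _) (by positivity)
      -- The factor N of the sum over entries is cancelled by the size 1/N of the second moments.
      calc _ ≤ 2 * κ / N * (2 ^ 10 * (κ * (N * B))) :=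
            mul_le_mul_of_nonneg_left this (by positivity)
        _ = _ := by field_simp
    · have : ∑ e : Entry d N, C * T ^ 2 * x ^ 10 * L e ^ q * κ ≤ d * N * (κ * B9) := by
        refine (Finset.sum_le_card_nsmul _ _ (C * T ^ 2 * x ^ 10 * (900 ^ q * Λ ^ q) * κ)
          fun e _ => ?_).trans ?_
        · gcongr
          exact hLq e
        · rw [nsmul_eq_mul, Finset.card_univ]
          calc _ ≤ d * N ^ 2 * (C * T ^ 2 * x ^ 10 * (900 ^ q * Λ ^ q) * κ) :=
                mul_le_mul_of_nonneg_right hcard (by positivity)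
            _ = d * N * (κ * (C * 900 ^ q * Λ ^ q * ((N * x ^ 4) * (N * x ^ 8)))) := by
                rw [hTx]; ring
            _ ≤ d * N * (κ * (C * 900 ^ q * Λ ^ q * (1 * δ))) := by
                gcongr
                exact hxpow _ (by norm_num)
            _ = _ := by rw [one_mul]
      calc _ ≤ 2 * κ / N * (d * N * (κ * B9)) := mul_le_mul_of_nonneg_left this (by positivity)
        _ = _ := by field_simp
  have h3 : ∑ e : Entry d N, 2 * (C * x ^ 10 * L e ^ q * κ) ≤ 2 * κ * d * B9 := by
    refine (Finset.sum_le_card_nsmul _ _ (2 * (C * x ^ 10 * (900 ^ q * Λ ^ q) * κ))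
      fun e _ => ?_).trans ?_
    · gcongr
      exact hLq e
    · rw [nsmul_eq_mul, Finset.card_univ]
      calc _ ≤ d * N ^ 2 * (2 * (C * x ^ 10 * (900 ^ q * Λ ^ q) * κ)) :=
            mul_le_mul_of_nonneg_right hcard (by positivity)
        _ = 2 * κ * d * (C * 900 ^ q * Λ ^ q * ((N * x ^ 4) * (N * x ^ 6))) := by ring
        _ ≤ 2 * κ * d * (C * 900 ^ q * Λ ^ q * (1 * δ)) := by
            gcongr
            exact hxpow _ (by norm_num)
        _ = _ := by rw [one_mul]
  simp only [restTerm, Fintype.sum_bool]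
  rw [Finset.sum_add_distrib, Finset.sum_add_distrib, Finset.sum_add_distrib]
  have h2t := h2 true
  have h2f := h2 false
  have hB9' : 0 ≤ B9 := hB0.trans hBB
  have hκ2 : κ ≤ κ ^ 2 := by nlinarith
  have e1 : (d + 1) * 2 ^ 13 * κ ^ 2 * C * 900 ^ q * Λ ^ q * δ = (d + 1) * 2 ^ 13 * (κ ^ 2 * B9) := by
    rw [hB9]; ring
  have e2 : κ * B ≤ κ ^ 2 * B9 := mul_le_mul hκ2 hBB hB0 (by positivity)
  have e3 : κ ^ 2 * B ≤ κ ^ 2 * B9 := mul_le_mul_of_nonneg_left hBB (by positivity)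
  have e4 : d * (κ * B9) ≤ d * (κ ^ 2 * B9) := by gcongr
  have e5 : 0 ≤ d * (κ ^ 2 * B9) := by positivity
  have e6 : 0 ≤ κ ^ 2 * B9 := by positivity
  rw [e1]
  linarith

end Words

/-! ### Comparison of moments by exchanging all the entries -/

section Words
open scoped Matrix.Norms.L2Operator

variable {d r N : ℕ} {A : Fin r → Matrix (Fin N) (Fin N) ℂ}
  {f : (Fin d → Matrix (Fin N) (Fin N) ℂ) → ℂ}
  {C T θ δ K : ℝ} {q : ℕ} {g : List Bool → Entry d N → (Fin d → Matrix (Fin N) (Fin N) ℂ) → ℂ}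
  {g2 : Bool → List Bool → Entry d N → (Fin d → Matrix (Fin N) (Fin N) ℂ) → ℂ}
  {ρ : Entry d N → Measure (ℂ × ℂ)} {c : ℕ → ℝ} {S : Finset (Entry d N)}

theorem continuous_update_zero (e : Entry d N) :
    Continuous fun ξ : Entry d N → ℂ × ℂ => Function.update ξ e 0 :=
  continuous_id.update e continuous_const

theorem polyDom_env {h : (Fin d → Matrix (Fin N) (Fin N) ℂ) → ℂ} {C' : ℝ} {n : ℕ}
    (hm : Measurable fun z : Entry d N → ℂ => h (hermOf z))
    (hb : ∀ M Λ, EnvBound A M Λ → ‖h M‖ ≤ C' * Λ ^ n) {φ : (Entry d N → ℂ × ℂ) → Entry d N → ℂ}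
    (hφ : Measurable φ) (hE : ∀ ξ, EnvBound A (hermOf (φ ξ)) (env K S ξ)) :
    PolyDom (env K S) fun ξ => h (hermOf (φ ξ)) :=
  ⟨hm.comp hφ, C', n, fun ξ => hb _ _ (hE ξ)⟩

theorem pick_update_zero (S : Finset (Entry d N)) (ξ : Entry d N → ℂ × ℂ) (e : Entry d N) :
    pick S (Function.update ξ e 0) = Function.update (pick S ξ) e 0 := by
  rw [pick_update_self]; simp

/-- Supplies the hypothesis of `TaylorControl.weighted` with an L that does not depend on the
coordinate e. -/
theorem envBound_update_weighted (hK : 1 ≤ K) (hA : ∀ j, ‖A j‖ ≤ K) {S' : Finset (Entry d N)}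
    (hS' : S' = S ∨ S' = ∅) (ξ : Entry d N → ℂ × ℂ) (e : Entry d N) {c : ℂ} {w : ℂ × ℂ}
    (hc : ‖c‖ ≤ ‖w‖) :
    EnvBound A (hermOf (Function.update (pick S' ξ) e c))
      (30 * env K S (Function.update ξ e 0) * (1 + √N * ‖w‖)) := by
  have h1 := envBound_update (S := S) (ξ := Function.update ξ e w) (e := e) hK hA hS' (c := c)
    (hc.trans (by simpa using norm_le_pi_norm (Function.update ξ e w) e))
  rw [pick_update_self, Function.update_idem] at h1
  refine h1.mono ?_
  have h2 := env_update_le (S := S) (ξ := Function.update ξ e 0) (e := e) hK w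
  rwa [Function.update_idem] at h2

set_option maxHeartbeats 2000000 in
/-- Comparison of the moments of the increments for two families of independent entries. -/
theorem TaylorControl.moment_le [∀ e, IsProbabilityMeasure (ρ e)]
    (h : TaylorControl A f C q T g g2) (hρ : EntryLaw ρ c) (hC : 1 ≤ C) (hT : 1 ≤ T)
    (hTN : T ^ 4 ≤ N) (hK : 1 ≤ K) (hA : ∀ j, ‖A j‖ ≤ K) (hδ : T ^ 2 / √N ≤ δ) (hθ0 : 0 ≤ θ)
    (hθδ : θ * (T ^ 3 / √N) ≤ δ)
    (hθ : ∀ e β, β.length = 3 → ‖mixMoment ρ e true β - mixMoment ρ e false β‖ ≤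
      2 * momentConst c q * θ * (1 / √N) ^ 3)
    (hf : Measurable fun z : Entry d N → ℂ => f (hermOf z))
    (hg : ∀ β e, Measurable fun z => g β e (hermOf z))
    (hg2 : ∀ a β e, Measurable fun z => g2 a β e (hermOf z))
    (hΛ : ∀ (S : Finset (Entry d N)) (n : ℕ),
      Integrable (fun ξ => env K S ξ ^ n) (Measure.pi ρ)) (m : ℕ) {Q : ℝ}
    (hQ : ∀ S : Finset (Entry d N),
      ∫ ξ, env K S ξ ^ ((q + 10) * (2 * (m + 1))) ∂Measure.pi ρ ≤ Q) :
    ∫ ξ, ‖f (hermOf (pick Finset.univ ξ)) - f (hermOf (pick ∅ ξ))‖ ^ (2 * (m + 1)) ∂Measure.pi ρ ≤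
      Real.exp ((2 * (m + 1) + 20 * (m + 1) ^ 2 * 4 ^ m) * 2 ^ (2 * (m + 1))) *
      (((d + 1) * 2 ^ 14 * momentConst c q ^ 2 * C * 900 ^ q * δ) ^ (2 * (m + 1)) * Q) := by
  set κ := momentConst c q with hκdef
  have hκ : 1 ≤ κ := one_le_momentConst c q
  set a := (d + 1) * 2 ^ 14 * κ ^ 2 * C * 900 ^ q with ha
  set p := 2 * (m + 1) with hp
  set cm : ℝ := 2 * (m + 1) + 20 * (m + 1) ^ 2 * 4 ^ m with hcm
  obtain ⟨hN, hx, hx1, hx4⟩ := sqrt_scale hT hTN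
  obtain ⟨hxy, hy4, hy1⟩ := scale_facts hT hTN
  have hT0 : 0 < T := by linarith
  have hy0 : 0 ≤ T ^ 2 / √N := by positivity
  have hδ0 : 0 ≤ δ := hy0.trans hδ
  have hκ2 : 1 ≤ κ ^ 2 := one_le_pow₀ hκ
  have h900 : (1 : ℝ) ≤ 900 ^ q := one_le_pow₀ (by norm_num)
  have hd : (0 : ℝ) ≤ d := Nat.cast_nonneg d
  have ha0 : 0 ≤ a := by positivity
  set u : Finset (Entry d N) → (Entry d N → ℂ × ℂ) → ℂ := fun S ξ =>
    f (hermOf (pick S ξ)) - f (hermOf (pick ∅ ξ)) with hu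
  have hQ0 : 0 ≤ Q := (integral_nonneg fun ξ => by
    have := one_le_env (S := (∅ : Finset (Entry d N))) (ξ := ξ) hK
    positivity).trans (hQ ∅)
  -- Adding the constant (aδ)^p Q makes the estimate homogeneous, as `interpolation_le` requires.
  -- Since the moment vanishes for S = ∅, that constant is all that remains at the end.
  have key : ∀ S : Finset (Entry d N),
      ∑ e, ((∫ ξ, ‖u (insert e S) ξ‖ ^ p ∂Measure.pi ρ + (a * δ) ^ p * Q) -
        (∫ ξ, ‖u (S.erase e) ξ‖ ^ p ∂Measure.pi ρ + (a * δ) ^ p * Q)) ≤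
      cm * 2 ^ p * (∫ ξ, ‖u S ξ‖ ^ p ∂Measure.pi ρ + (a * δ) ^ p * Q) := by
    intro S
    -- Without entries the sum is empty. Otherwise one entry `e₀` is needed to read a bound on f off
    -- `h.sup`.
    rcases isEmpty_or_nonempty (Entry d N) with hemp | ⟨⟨e₀⟩⟩
    · rw [Finset.univ_eq_empty, Finset.sum_empty]
      have : 0 ≤ ∫ ξ, ‖u S ξ‖ ^ p ∂Measure.pi ρ := integral_nonneg fun ξ => by positivity
      positivity
    have hsup : ∀ M Λ, EnvBound A M Λ → ‖f M‖ ≤ C * Λ ^ q := by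
      intro M Λ hM
      have := h.sup [] e₀ M Λ (by simp) hM
      rw [h.nil] at this
      simpa using this
    set Λ := env K S with hΛdef
    have hΛ1 : ∀ ξ, 1 ≤ Λ ξ := fun ξ => one_le_env hK
    have hΛm : Measurable Λ := (continuous_env K S).measurable
    have hE : ∀ {S'}, (S' = S ∨ S' = ∅) → ∀ ξ, EnvBound A (hermOf (pick S' ξ)) (Λ ξ) :=
      fun hS' ξ => envBound_pick hK hA hS'
    have hEu : ∀ {S'}, (S' = S ∨ S' = ∅) → ∀ ξ e c, ‖c‖ ≤ ‖ξ e‖ →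
        EnvBound A (hermOf (Function.update (pick S' ξ) e c)) (Λ ξ) :=
      fun hS' ξ e c hc => envBound_update hK hA hS' (hc.trans (norm_le_pi_norm ξ e))
    have hSS : S = S ∨ S = ∅ := Or.inl rfl
    have hS0 : (∅ : Finset (Entry d N)) = S ∨ (∅ : Finset (Entry d N)) = ∅ := Or.inr rfl
    have hpm : ∀ S' : Finset (Entry d N), Measurable (pick S') := fun S' => (continuous_pick S').measurable
    have h0ξ : ∀ ξ : Entry d N → ℂ × ℂ, ∀ e, ‖(0 : ℂ)‖ ≤ ‖ξ e‖ := fun ξ e => by simp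
    -- increments
    have hinc : ∀ {S'}, (S' = S ∨ S' = ∅) → ∀ ξ e c, ‖c‖ ≤ ‖ξ e‖ →
        ‖f (hermOf (Function.update (pick S' ξ) e c)) - f (hermOf (pick S' ξ))‖ ≤
          2 ^ 11 * C * Λ ξ ^ (q + 10) * δ := by
      intro S' hS' ξ e c hc
      have h1 := hEu hS' ξ e c hc
      rw [hermOf_update] at h1 ⊢
      refine (h.norm_increment_le hT hTN (hE hS' ξ) h1 fun b =>
        norm_entryCoeff_sub_le_env hK (hc.trans (norm_le_pi_norm ξ e)) b).trans ?_
      have := hΛ1 ξ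
      gcongr
      exact hxy.trans hδ
    have hinc2 : ∀ {S'}, (S' = S ∨ S' = ∅) → ∀ ξ (c : Entry d N → ℂ), (∀ e, ‖c e‖ ≤ ‖ξ e‖) →
        ∑ e, ‖f (hermOf (Function.update (pick S' ξ) e (c e))) - f (hermOf (pick S' ξ))‖ ^ 2 ≤
          (d + 1) * 2 ^ 22 * C ^ 2 * Λ ξ ^ (2 * q + 20) * δ ^ 2 := by
      intro S' hS' ξ c hc
      have h1 := fun e => hEu hS' ξ e (c e) (hc e)
      simp only [hermOf_update] at h1 ⊢
      refine (h.sum_sq_sub_le hC hT hTN (hE hS' ξ) h1 fun e b =>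
        norm_entryCoeff_sub_le_env hK ((hc e).trans (norm_le_pi_norm ξ e)) b).trans ?_
      have := hΛ1 ξ
      gcongr
    -- One quantity that dominates the base values, the increments, their square sum and the sum of
    -- the mean effects.
    set V : (Entry d N → ℂ × ℂ) → ℝ := fun ξ => ‖u S ξ‖ + a * Λ ξ ^ (q + 10) * δ with hV
    -- The entry e is removed from both arguments, since f(X) also depends on its second component.
    set u0 : Entry d N → (Entry d N → ℂ × ℂ) → ℂ := fun e ξ =>
      f (hermOf (Function.update (pick S ξ) e 0)) - f (hermOf (Function.update (pick ∅ ξ) e 0)) with hu0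
    set L : Entry d N → (Entry d N → ℂ × ℂ) → ℝ := fun e ξ =>
      30 * env K S (Function.update ξ e 0) with hL
    -- The second derivatives are taken at `pick S ξ`, with the entry e in place, so that `sum_same`
    -- bounds their sum at a single matrix; only the rest is taken with e removed.
    set B : Entry d N → (Entry d N → ℂ × ℂ) → ℝ := fun e ξ =>
      ∑ b : Bool, 2 * κ / N * ‖g [b, b] e (hermOf (pick S ξ))‖ +
        restTerm κ θ C T q g g2 e (hermOf (Function.update (pick S ξ) e 0)) (L e ξ) with hB
    have hL0 : ∀ e ξ, 0 ≤ L e ξ := fun e ξ => by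
      have := one_le_env (S := S) (ξ := Function.update ξ e 0) hK
      simp only [hL]; linarith
    -- The constant 900 is 30², one factor from the definition of L and one from `env_update_le`.
    have hL9 : ∀ e ξ, L e ξ ≤ 900 * Λ ξ := fun e ξ => by
      have := env_update_le (S := S) (ξ := ξ) (e := e) hK 0
      simp only [hL, norm_zero, mul_zero, add_zero, mul_one] at this ⊢
      linarith
    have hrest : ∀ ξ, ∑ e, restTerm κ θ C T q g g2 e (hermOf (Function.update (pick S ξ) e 0)) (L e ξ) ≤
        (d + 1) * 2 ^ 13 * κ ^ 2 * C * 900 ^ q * Λ ξ ^ q * δ := by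
      intro ξ
      have h1 := fun e => hEu hSS ξ e 0 (h0ξ ξ e)
      simp only [hermOf_update] at h1 ⊢
      exact h.sum_restTerm_le (by linarith) hT hTN hκ hθ0 hδ hθδ (hE hSS ξ) h1 (fun e b =>
        norm_entryCoeff_sub_le_env hK ((h0ξ ξ e).trans (norm_le_pi_norm ξ e)) b)
        (fun e => hL0 e ξ) (fun e => hL9 e ξ)
    have hrest0 : ∀ e ξ, 0 ≤ restTerm κ θ C T q g g2 e (hermOf (Function.update (pick S ξ) e 0)) (L e ξ) :=
      fun e ξ => restTerm_nonneg (by linarith) hθ0 (by linarith) (hL0 e ξ)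
    have hupm : ∀ (S' : Finset (Entry d N)) e, Measurable fun ξ : Entry d N → ℂ × ℂ =>
        Function.update (pick S' ξ) e 0 := fun S' e => by
      simp only [← pick_update_zero]
      exact (hpm S').comp (continuous_update_zero e).measurable
    have hfD : ∀ {φ : (Entry d N → ℂ × ℂ) → Entry d N → ℂ}, Measurable φ →
        (∀ ξ, EnvBound A (hermOf (φ ξ)) (Λ ξ)) → PolyDom Λ fun ξ => f (hermOf (φ ξ)) :=
      fun hφ hE => polyDom_env hf hsup hφ hE
    have hf0 := hfD (hpm ∅) (hE hS0)
    have huD : PolyDom Λ (u S) := (hfD (hpm S) (hE hSS)).sub hf0 hΛ1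
    have hins : ∀ e, PolyDom Λ (u (insert e S)) := fun e =>
      (hfD (hpm _) fun ξ => by
        rw [pick_insert]; exact hEu hSS ξ e _ (norm_fst_le _)).sub hf0 hΛ1
    have hera : ∀ e, PolyDom Λ (u (S.erase e)) := fun e =>
      (hfD (hpm _) fun ξ => by
        rw [pick_erase]; exact hEu hSS ξ e _ (norm_snd_le _)).sub hf0 hΛ1
    have hu0D : ∀ e, PolyDom Λ (u0 e) := fun e =>
      (hfD (hupm S e) fun ξ => hEu hSS ξ e 0 (h0ξ ξ e)).sub
        (hfD (hupm ∅ e) fun ξ => hEu hS0 ξ e 0 (h0ξ ξ e)) hΛ1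
    have hVD : PolyDom Λ V := huD.norm.add (((PolyDom.const a).mul
      ((PolyDom.self hΛm hΛ1).pow hΛ1 _) hΛ1).mul (PolyDom.const δ) hΛ1) hΛ1
    have hgD : ∀ b e, PolyDom Λ fun ξ => g [b, b] e (hermOf (pick S ξ)) := fun b e =>
      polyDom_env (hg _ e) (fun M Λ hM => h.sup [b, b] e M Λ (by simp) hM) (hpm S) (hE hSS)
    have hrm : ∀ e, Measurable fun ξ =>
        restTerm κ θ C T q g g2 e (hermOf (Function.update (pick S ξ) e 0)) (L e ξ) := by
      intro e
      have h1 : ∀ β, Measurable fun ξ => ‖g β e (hermOf (Function.update (pick S ξ) e 0))‖ :=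
        fun β => ((hg β e).comp (hupm S e)).norm
      have h2 : ∀ b β, Measurable fun ξ => ‖g2 b β e (hermOf (Function.update (pick S ξ) e 0))‖ :=
        fun b β => ((hg2 b β e).comp (hupm S e)).norm
      have h3 : Measurable fun ξ => L e ξ ^ q :=
        ((hΛm.comp (continuous_update_zero e).measurable).const_mul 30).pow_const q
      unfold restTerm
      refine ((Finset.measurable_sum _ fun β _ => (h1 β).const_mul _).add
        (Finset.measurable_sum _ fun b _ => ((Finset.measurable_sum _ fun β _ =>
          (h2 b β).const_mul _).add ((h3.const_mul _).mul_const _)).const_mul _)).add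
        (((h3.const_mul _).mul_const _).const_mul _)
    have hrD : ∀ e, PolyDom Λ fun ξ =>
        restTerm κ θ C T q g g2 e (hermOf (Function.update (pick S ξ) e 0)) (L e ξ) := by
      refine fun e => ⟨hrm e, (d + 1) * 2 ^ 13 * κ ^ 2 * C * 900 ^ q * δ, q, fun ξ => ?_⟩
      rw [Real.norm_of_nonneg (hrest0 e ξ)]
      refine (Finset.single_le_sum (f := fun e => restTerm κ θ C T q g g2 e
        (hermOf (Function.update (pick S ξ) e 0)) (L e ξ)) (fun e _ => hrest0 e ξ)
        (Finset.mem_univ e)).trans ((hrest ξ).trans (le_of_eq (by ring)))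
    have hBD : ∀ e, PolyDom Λ (B e) := by
      intro e
      have := (((PolyDom.const (2 * κ / N)).mul (hgD true e).norm hΛ1).add
        ((PolyDom.const (2 * κ / N)).mul (hgD false e).norm hΛ1) hΛ1).add (hrD e) hΛ1
      simpa only [hB, Fintype.sum_bool] using this
    have hidem : ∀ (S' : Finset (Entry d N)) ξ e w c, Function.update (pick S' (Function.update ξ e w)) e c =
        Function.update (pick S' ξ) e c := fun S' ξ e w c => by
      rw [pick_update_self, Function.update_idem]
    have hΛpow : ∀ ξ, Λ ξ ^ q ≤ Λ ξ ^ (q + 10) := fun ξ => pow_le_pow_right₀ (hΛ1 ξ) (by omega)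
    have hV0 : ∀ ξ, 0 ≤ V ξ := fun ξ => by
      have := hΛ1 ξ
      simp only [hV]; positivity
    have hCa : 3 * (2 ^ 11 * C) ≤ a := by
      have h1 : C ≤ κ ^ 2 * C * 900 ^ q := by
        have h2 : 1 * C * 1 ≤ κ ^ 2 * C * 900 ^ q := by gcongr
        linarith
      have h3 : a = (d + 1) * 2 ^ 14 * (κ ^ 2 * C * 900 ^ q) := by rw [ha]; ring
      have h4 : 0 ≤ d * (κ ^ 2 * C * 900 ^ q) := by positivity
      rw [h3]; nlinarith
    have hterm : ∀ ξ, 3 * (2 ^ 11 * C * Λ ξ ^ (q + 10) * δ) ≤ a * Λ ξ ^ (q + 10) * δ := fun ξ => by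
      have := hΛ1 ξ
      have h1 : 3 * (2 ^ 11 * C) * (Λ ξ ^ (q + 10) * δ) ≤ a * (Λ ξ ^ (q + 10) * δ) := by gcongr
      linarith
    -- the three parts of an increment
    have hsplit : ∀ e ξ (x : ℂ), ‖x‖ ≤ ‖ξ e‖ →
        f (hermOf (Function.update (pick S ξ) e x)) - f (hermOf (pick ∅ ξ)) - u0 e ξ =
        (f (hermOf (Function.update (pick S ξ) e x)) - f (hermOf (pick S ξ))) -
        (f (hermOf (Function.update (pick S ξ) e 0)) - f (hermOf (pick S ξ))) +
        (f (hermOf (Function.update (pick ∅ ξ) e 0)) - f (hermOf (pick ∅ ξ))) := by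
      intro e ξ x hx
      simp only [hu0]; ring
    have hUle : ∀ e ξ (x : ℂ), ‖x‖ ≤ ‖ξ e‖ →
        ‖f (hermOf (Function.update (pick S ξ) e x)) - f (hermOf (pick ∅ ξ)) - u0 e ξ‖ ≤ V ξ := by
      intro e ξ x hx
      rw [hsplit e ξ x hx]
      refine (norm_add_le _ _).trans ((add_le_add (norm_sub_le _ _) le_rfl).trans ?_)
      have h1 := hinc hSS ξ e x hx
      have h2 := hinc hSS ξ e 0 (h0ξ ξ e)
      have h3 := hinc hS0 ξ e 0 (h0ξ ξ e)
      have := hterm ξ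
      have : 0 ≤ ‖u S ξ‖ := norm_nonneg _
      simp only [hV]
      linarith
    have hU2 : ∀ ξ (x : Entry d N → ℂ), (∀ e, ‖x e‖ ≤ ‖ξ e‖) →
        ∑ e, ‖f (hermOf (Function.update (pick S ξ) e (x e))) - f (hermOf (pick ∅ ξ)) - u0 e ξ‖ ^ 2 ≤
          V ξ ^ 2 := by
      intro ξ x hx
      have h1 := hinc2 hSS ξ x hx
      have h2 := hinc2 hSS ξ (fun _ => 0) (h0ξ ξ)
      have h3 := hinc2 hS0 ξ (fun _ => 0) (h0ξ ξ)
      have hpt : ∀ e, ‖f (hermOf (Function.update (pick S ξ) e (x e))) - f (hermOf (pick ∅ ξ)) - u0 e ξ‖ ^ 2 ≤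
          3 * ‖f (hermOf (Function.update (pick S ξ) e (x e))) - f (hermOf (pick S ξ))‖ ^ 2 +
          3 * ‖f (hermOf (Function.update (pick S ξ) e 0)) - f (hermOf (pick S ξ))‖ ^ 2 +
          3 * ‖f (hermOf (Function.update (pick ∅ ξ) e 0)) - f (hermOf (pick ∅ ξ))‖ ^ 2 := by
        intro e
        rw [hsplit e ξ (x e) (hx e)]
        refine (pow_le_pow_left₀ (norm_nonneg _) ((norm_add_le _ _).trans
          (add_le_add (norm_sub_le _ _) le_rfl)) 2).trans ?_
        nlinarith [sq_nonneg (‖f (hermOf (Function.update (pick S ξ) e (x e))) - f (hermOf (pick S ξ))‖ -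
          ‖f (hermOf (Function.update (pick S ξ) e 0)) - f (hermOf (pick S ξ))‖),
          sq_nonneg (‖f (hermOf (Function.update (pick S ξ) e (x e))) - f (hermOf (pick S ξ))‖ -
          ‖f (hermOf (Function.update (pick ∅ ξ) e 0)) - f (hermOf (pick ∅ ξ))‖),
          sq_nonneg (‖f (hermOf (Function.update (pick S ξ) e 0)) - f (hermOf (pick S ξ))‖ -
          ‖f (hermOf (Function.update (pick ∅ ξ) e 0)) - f (hermOf (pick ∅ ξ))‖)]
      refine (Finset.sum_le_sum fun e _ => hpt e).trans ?_
      rw [Finset.sum_add_distrib, Finset.sum_add_distrib, ← Finset.mul_sum, ← Finset.mul_sum,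
        ← Finset.mul_sum]
      have hl : 9 * ((d + 1) * 2 ^ 22 * C ^ 2 * Λ ξ ^ (2 * q + 20) * δ ^ 2) ≤
          (a * Λ ξ ^ (q + 10) * δ) ^ 2 := by
        have h4 : 3 * ((d + 1) * 2 ^ 11 * C) ≤ a := by
          have h1 : C ≤ κ ^ 2 * C * 900 ^ q := by
            have h2 : 1 * C * 1 ≤ κ ^ 2 * C * 900 ^ q := by gcongr
            linarith
          have h3 : a = (d + 1) * 2 ^ 14 * (κ ^ 2 * C * 900 ^ q) := by rw [ha]; ring
          rw [h3]
          have h5 : (d + 1) * C ≤ (d + 1) * (κ ^ 2 * C * 900 ^ q) := by gcongr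
          have h6 : 0 ≤ (d + 1) * C := by positivity
          linarith
        have h5 : (3 * ((d + 1) * 2 ^ 11 * C)) ^ 2 ≤ a ^ 2 := pow_le_pow_left₀ (by positivity) h4 2
        have h6 : 9 * ((d + 1) * 2 ^ 22 * C ^ 2) ≤ (3 * ((d + 1) * 2 ^ 11 * C)) ^ 2 := by
          have h7 : 0 ≤ d * ((d + 1) * C ^ 2) := by positivity
          have h8 : (3 * ((d + 1) * 2 ^ 11 * C)) ^ 2 = 9 * ((d + 1) * 2 ^ 22 * C ^ 2) +
            9 * 2 ^ 22 * (d * ((d + 1) * C ^ 2)) := by ring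
          linarith
        have h7 : 0 ≤ (Λ ξ ^ (q + 10) * δ) ^ 2 := sq_nonneg _
        calc _ = 9 * ((d + 1) * 2 ^ 22 * C ^ 2) * (Λ ξ ^ (q + 10) * δ) ^ 2 := by
              rw [mul_pow, ← pow_mul]; ring
          _ ≤ a ^ 2 * (Λ ξ ^ (q + 10) * δ) ^ 2 := mul_le_mul_of_nonneg_right (h6.trans h5) h7
          _ = _ := by ring
      have hl2 : (a * Λ ξ ^ (q + 10) * δ) ^ 2 ≤ V ξ ^ 2 := by
        have := hΛ1 ξ
        refine pow_le_pow_left₀ (by positivity) ?_ 2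
        simp only [hV]
        linarith [norm_nonneg (u S ξ)]
      linarith
    have hstep := sum_moment_step_le (ρ := ρ) hΛ1 (hΛ S) m (U := fun e => u (insert e S))
      (U' := fun e => u (S.erase e)) (u := u0) (B := B) (V := V) hins hera hu0D hBD hVD ?_ ?_ ?_ ?_
      ?_ ?_ ?_ ?_ ?_ hV0
    · rw [← hp] at hstep
      have e1 : ∑ e, ((∫ ξ, ‖u (insert e S) ξ‖ ^ p ∂Measure.pi ρ + (a * δ) ^ p * Q) -
          (∫ ξ, ‖u (S.erase e) ξ‖ ^ p ∂Measure.pi ρ + (a * δ) ^ p * Q)) =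
          ∑ e, (∫ ξ, ‖u (insert e S) ξ‖ ^ p ∂Measure.pi ρ - ∫ ξ, ‖u (S.erase e) ξ‖ ^ p ∂Measure.pi ρ) :=
        Finset.sum_congr rfl fun e _ => by ring
      rw [e1]
      refine hstep.trans ?_
      have hcm0 : 0 ≤ cm := by positivity
      rw [mul_assoc cm]
      refine mul_le_mul_of_nonneg_left ?_ hcm0
      have hi1 : Integrable (fun ξ => ‖u S ξ‖ ^ p) (Measure.pi ρ) :=
        (huD.norm.pow hΛ1 p).integrable (hΛ S)
      have hi2 : Integrable (fun ξ => (a * δ) ^ p * Λ ξ ^ ((q + 10) * p)) (Measure.pi ρ) :=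
        (hΛ S _).const_mul _
      calc ∫ ξ, V ξ ^ p ∂Measure.pi ρ ≤
            ∫ ξ, 2 ^ p * (‖u S ξ‖ ^ p + (a * δ) ^ p * Λ ξ ^ ((q + 10) * p)) ∂Measure.pi ρ := by
            refine integral_mono ((hVD.pow hΛ1 p).integrable (hΛ S)) ((hi1.add hi2).const_mul _)
              fun ξ => ?_
            have := hΛ1 ξ
            refine (add_pow_le (norm_nonneg _) (by positivity) p).trans ?_
            have e2 : (a * Λ ξ ^ (q + 10) * δ) ^ p = (a * δ) ^ p * Λ ξ ^ ((q + 10) * p) := by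
              rw [pow_mul (Λ ξ), ← mul_pow (a * δ), mul_right_comm]
            rw [e2]
            have : (2 : ℝ) ^ (p - 1) ≤ 2 ^ p := pow_le_pow_right₀ (by norm_num) (by omega)
            gcongr
        _ = 2 ^ p * (∫ ξ, ‖u S ξ‖ ^ p ∂Measure.pi ρ +
              (a * δ) ^ p * ∫ ξ, Λ ξ ^ ((q + 10) * p) ∂Measure.pi ρ) := by
            rw [integral_const_mul, integral_add hi1 hi2, integral_const_mul]
        _ ≤ _ := by
            gcongr
            exact hQ S
    · intro e ξ w
      simp only [hu0, hidem]
    · intro e ξ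
      have hz : ∀ w, u (insert e S) (Function.update ξ e w) - u (S.erase e) (Function.update ξ e w) =
          f (hermOf (Function.update (pick S ξ) e (sel true w))) -
            f (hermOf (Function.update (pick S ξ) e (sel false w))) := by
        intro w
        simp only [hu, pick_insert, pick_erase, hidem]
        simp [sel]
      simp only [hz]
      have hEw := fun b w => envBound_update_weighted (S := S) hK hA hSS ξ e (norm_sel_le b w)
      have hE0 := fun w : ℂ × ℂ => envBound_update_weighted (S := S) hK hA hSS ξ e (c := 0) (w := w)
        (by simp)
      -- The component over which second derivatives are averaged is the one that `pick S` uses at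
      -- e, so that the average is that of `B e` over the resampled coordinate.
      have hb := h.norm_integral_replace_le (e := e) (z := pick S ξ) (L := L e ξ) hρ (by linarith)
        (hL0 e ξ) hθ0 (decide (e ∈ S)) hf (fun b => hg _ e) hθ hEw hE0
      refine hb.trans (le_of_eq ?_)
      have hBw : ∀ w, B e (Function.update ξ e w) = ∑ b : Bool, 2 * κ / N *
          ‖g [b, b] e (hermOf (Function.update (pick S ξ) e (sel (decide (e ∈ S)) w)))‖ +
          restTerm κ θ C T q g g2 e (hermOf (Function.update (pick S ξ) e 0)) (L e ξ) := by
        intro w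
        simp only [hB, hL, hidem, Function.update_idem]
        congr 1
        refine Finset.sum_congr rfl fun b _ => ?_
        rw [pick_update_self]
        simp [sel]
      simp only [hBw]
      have hgi := fun b => (h.norm_diag_le (e := e) (z := pick S ξ) (L := L e ξ) hρ
        (by linarith) (hL0 e ξ) (decide (e ∈ S)) b (hg _ e) hEw hE0).1.norm.const_mul
          (2 * κ / N)
      rw [integral_add (integrable_finsetSum _ fun b _ => hgi b) (integrable_const _),
        integral_finsetSum _ fun b _ => hgi b]
      simp only [integral_const_mul, integral_const, probReal_univ, one_smul, ← hκdef]
    · intro e ξ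
      exact add_nonneg (Finset.sum_nonneg fun b _ => by positivity) (hrest0 e ξ)
    · intro ξ
      have h1 : ∀ b, ∑ e, 2 * κ / N * ‖g [b, b] e (hermOf (pick S ξ))‖ ≤ 2 * κ * C * Λ ξ ^ q * δ := by
        intro b
        rw [← Finset.mul_sum]
        have hs : 0 < √(N : ℝ) := Real.sqrt_pos.2 hN
        have := hΛ1 ξ
        calc _ ≤ 2 * κ / N * (C * T ^ 2 * √N * Λ ξ ^ q) :=
              mul_le_mul_of_nonneg_left (h.sum_same b _ _ (hE hSS ξ)) (by positivity)
          _ = 2 * κ * C * Λ ξ ^ q * (T ^ 2 / √N) := by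
              have h2 : (N : ℝ) = √N ^ 2 := (Real.sq_sqrt hN.le).symm
              conv_lhs => rw [h2, Real.sqrt_sq hs.le]
              field_simp
          _ ≤ _ := by gcongr
      simp only [hB]
      rw [Finset.sum_add_distrib]
      simp only [Fintype.sum_bool]
      rw [Finset.sum_add_distrib]
      have h2 := hrest ξ
      have h3 := h1 true
      have h4 := h1 false
      have h5 : 4 * κ * C * Λ ξ ^ q * δ + (d + 1) * 2 ^ 13 * κ ^ 2 * C * 900 ^ q * Λ ξ ^ q * δ ≤
          a * Λ ξ ^ (q + 10) * δ := by
        have h0 := hΛ1 ξ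
        have h6 : 4 * κ * C ≤ (d + 1) * 2 ^ 13 * κ ^ 2 * C * 900 ^ q := by
          calc 4 * κ * C = 1 * 4 * κ * C * 1 := by ring
            _ ≤ (d + 1) * 2 ^ 13 * κ ^ 2 * C * 900 ^ q := by
              gcongr
              · linarith
              · norm_num
              · nlinarith
        have h7 : (4 * κ * C + (d + 1) * 2 ^ 13 * κ ^ 2 * C * 900 ^ q) * (Λ ξ ^ q * δ) ≤
            a * (Λ ξ ^ (q + 10) * δ) := by
          refine mul_le_mul ?_ (mul_le_mul_of_nonneg_right (hΛpow ξ) hδ0) (by positivity) ha0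
          have : a = 2 * ((d + 1) * 2 ^ 13 * κ ^ 2 * C * 900 ^ q) := by rw [ha]; ring
          linarith
        linarith
      simp only [hV]
      linarith [norm_nonneg (u S ξ)]
    · intro e ξ
      have e1 : u0 e ξ = u S ξ + ((f (hermOf (Function.update (pick S ξ) e 0)) - f (hermOf (pick S ξ))) -
          (f (hermOf (Function.update (pick ∅ ξ) e 0)) - f (hermOf (pick ∅ ξ)))) := by
        simp only [hu0, hu]; ring
      rw [e1]
      refine (norm_add_le _ _).trans ?_
      have h1 := norm_sub_le (f (hermOf (Function.update (pick S ξ) e 0)) - f (hermOf (pick S ξ)))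
        (f (hermOf (Function.update (pick ∅ ξ) e 0)) - f (hermOf (pick ∅ ξ)))
      have h2 := hinc hSS ξ e 0 (h0ξ ξ e)
      have h3 := hinc hS0 ξ e 0 (h0ξ ξ e)
      have h4 := hterm ξ
      have h5 : 0 ≤ 2 ^ 11 * C * Λ ξ ^ (q + 10) * δ := (norm_nonneg _).trans h2
      simp only [hV]
      linarith
    · intro e ξ
      simp only [hu, pick_insert]
      exact hUle e ξ _ (norm_fst_le _)
    · intro e ξ
      simp only [hu, pick_erase]
      exact hUle e ξ _ (norm_snd_le _)
    · intro ξ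
      simp only [hu, pick_insert]
      exact hU2 ξ (fun e => (ξ e).1) fun e => norm_fst_le _
    · intro ξ
      simp only [hu, pick_erase]
      exact hU2 ξ (fun e => (ξ e).2) fun e => norm_snd_le _
  have hfin := interpolation_le (F := fun S => ∫ ξ, ‖u S ξ‖ ^ p ∂Measure.pi ρ + (a * δ) ^ p * Q)
    (C := cm * 2 ^ p) key
  have hp0 : p ≠ 0 := by omega
  -- The exchange starts from f(X) - f(X) = 0.
  have hempty : ∫ ξ, ‖u ∅ ξ‖ ^ p ∂Measure.pi ρ = 0 := by simp [hu, hp0]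
  simp only [hempty, zero_add] at hfin
  have : 0 ≤ (a * δ) ^ p * Q := by positivity
  linarith

end Words

section Walks
open scoped Matrix.Norms.L2Operator

variable {N : ℕ}

/-! ### The norm of a Hermitian matrix in terms of closed walks -/

theorem sq_norm_le_sum_sq (M : Matrix (Fin N) (Fin N) ℂ) : ‖M‖ ^ 2 ≤ ∑ i, ∑ j, ‖M i j‖ ^ 2 := by
  set B := ∑ i, ∑ j, ‖M i j‖ ^ 2 with hB
  have hB0 : 0 ≤ B := by positivity
  have h : ‖M‖ ≤ √B := by
    rw [Matrix.cstar_norm_def]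
    refine ContinuousLinearMap.opNorm_le_bound _ (Real.sqrt_nonneg _) fun v => ?_
    refine le_of_sq_le_sq ?_ (by positivity)
    rw [mul_pow, Real.sq_sqrt hB0, EuclideanSpace.norm_sq_eq, EuclideanSpace.norm_sq_eq, hB,
      Finset.sum_mul]
    refine Finset.sum_le_sum fun i _ => ?_
    rw [Matrix.ofLp_toEuclideanCLM, Matrix.mulVec, dotProduct]
    refine (pow_le_pow_left₀ (norm_nonneg _) (norm_sum_le _ _) 2).trans ?_
    simp only [norm_mul]
    exact Finset.sum_mul_sq_le_sq_mul_sq _ _ _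
  calc ‖M‖ ^ 2 ≤ √B ^ 2 := pow_le_pow_left₀ (norm_nonneg _) h 2
    _ = B := Real.sq_sqrt hB0

/-- For self-adjoint H the C*-identity gives ‖H^(2^k)‖ = ‖H‖^(2^k), and the squared Hilbert–Schmidt
norm of H^(2^k) is the trace. This is why exponents 2 · 2^k are used. -/
theorem norm_pow_le_trace {H : Matrix (Fin N) (Fin N) ℂ} (hH : H.IsHermitian) (k : ℕ) :
    ‖H‖ ^ (2 * 2 ^ k) ≤ (H ^ (2 * 2 ^ k)).trace.re := by
  have h1 : ‖H ^ 2 ^ k‖ = ‖H‖ ^ 2 ^ k := IsSelfAdjoint.norm_pow_two_pow hH k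
  have h2 : (H ^ 2 ^ k).IsHermitian := hH.pow _
  have h3 : (H ^ (2 * 2 ^ k)).trace = ((∑ i, ∑ j, ‖(H ^ 2 ^ k) i j‖ ^ 2 : ℝ) : ℂ) := by
    rw [mul_comm, pow_mul, pow_two, Matrix.trace]
    push_cast
    refine Finset.sum_congr rfl fun i _ => ?_
    rw [Matrix.diag_apply, Matrix.mul_apply]
    refine Finset.sum_congr rfl fun j _ => ?_
    rw [← Complex.mul_conj', ← h2.apply j i]
    rfl
  rw [h3, Complex.ofReal_re, mul_comm, pow_mul, ← h1]
  exact sq_norm_le_sum_sq _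

/-- The product of the entries of a matrix along a walk. -/
noncomputable def walkProd (H : Matrix (Fin N) (Fin N) ℂ) {m : ℕ} (v : Fin (m + 1) → Fin N) : ℂ :=
  ∏ i : Fin m, H (v i.castSucc) (v i.succ)

/-- Arbitrary boundary weights F and G make the induction work: removing the first step changes F
into its image under H. -/
theorem sum_walkProd (H : Matrix (Fin N) (Fin N) ℂ) (m : ℕ) (F G : Fin N → ℂ) :
    ∑ v : Fin (m + 1) → Fin N, F (v 0) * walkProd H v * G (v (Fin.last m)) =
      ∑ a, ∑ b, F a * (H ^ m) a b * G b := by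
  induction m generalizing F with
  | zero =>
    rw [← (Equiv.funUnique (Fin 1) (Fin N)).symm.sum_comp]
    refine Finset.sum_congr rfl fun a _ => ?_
    rw [Finset.sum_eq_single a]
    · simp [walkProd, Equiv.funUnique]
    · intro b _ hb; simp [Matrix.one_apply_ne hb.symm]
    · simp
  | succ m ih =>
    rw [← (Fin.consEquiv fun _ : Fin (m + 2) => Fin N).sum_comp, Fintype.sum_prod_type,
      Finset.sum_comm]
    have h1 : ∀ v : Fin (m + 1) → Fin N, ∑ a, F ((Fin.consEquiv fun _ : Fin (m + 2) => Fin N) (a, v) 0) *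
        walkProd H ((Fin.consEquiv fun _ : Fin (m + 2) => Fin N) (a, v)) *
        G ((Fin.consEquiv fun _ : Fin (m + 2) => Fin N) (a, v) (Fin.last (m + 1))) =
        (∑ a, F a * H a (v 0)) * walkProd H v * G (v (Fin.last m)) := by
      intro v
      rw [Finset.sum_mul, Finset.sum_mul]
      refine Finset.sum_congr rfl fun a _ => ?_
      have e1 : (Fin.consEquiv fun _ : Fin (m + 2) => Fin N) (a, v) = Fin.cons a v := rfl
      rw [e1, walkProd, Fin.prod_univ_succ, walkProd]
      have e2 : (Fin.cons a v : Fin (m + 2) → Fin N) (Fin.last (m + 1)) = v (Fin.last m) := by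
        rw [← Fin.succ_last, Fin.cons_succ]
      rw [e2]
      simp only [Fin.castSucc_zero, Fin.cons_zero, Fin.cons_succ, ← Fin.succ_castSucc]
      ring
    rw [Finset.sum_congr rfl fun v _ => h1 v, ih fun b => ∑ a, F a * H a b]
    have h2 : ∀ b c, (∑ a, F a * H a b) * (H ^ m) b c * G c = ∑ a, F a * (H a b * (H ^ m) b c) * G c := by
      intro b c
      rw [Finset.sum_mul, Finset.sum_mul]
      exact Finset.sum_congr rfl fun a _ => by ring
    simp only [h2]
    calc ∑ b, ∑ c, ∑ a, F a * (H a b * (H ^ m) b c) * G c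
        = ∑ a, ∑ c, ∑ b, F a * (H a b * (H ^ m) b c) * G c := by
          rw [Finset.sum_comm]
          rw [Finset.sum_congr rfl fun c _ => Finset.sum_comm]
          rw [Finset.sum_comm]
      _ = _ := by
          refine Finset.sum_congr rfl fun a _ => Finset.sum_congr rfl fun c _ => ?_
          rw [pow_succ', Matrix.mul_apply, Finset.mul_sum, Finset.sum_mul]

theorem trace_pow_eq_sum (H : Matrix (Fin N) (Fin N) ℂ) (m : ℕ) :
    (H ^ m).trace = ∑ v : Fin (m + 1) → Fin N, if v 0 = v (Fin.last m) then walkProd H v else 0 := by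
  have h1 := fun c : Fin N => sum_walkProd H m (fun a => if a = c then 1 else 0)
    (fun b => if b = c then 1 else 0)
  have h2 : ∑ c : Fin N, ∑ a, ∑ b, (if a = c then (1 : ℂ) else 0) * (H ^ m) a b *
      (if b = c then (1 : ℂ) else 0) = (H ^ m).trace := by
    rw [Matrix.trace]
    refine Finset.sum_congr rfl fun c _ => ?_
    simp
  rw [← h2]
  simp only [← h1]
  rw [Finset.sum_comm]
  refine Finset.sum_congr rfl fun v _ => ?_
  by_cases h : v 0 = v (Fin.last m)
  · simp [h]
  · rw [if_neg h, Finset.sum_eq_zero]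
    intro c _
    by_cases h3 : v 0 = c
    · subst h3; simp [Ne.symm h]
    · simp [h3]

/-! ### Walks all of whose edges are repeated -/

/-- The edge taken at a step of a walk. -/
def stepEdge {m : ℕ} (v : Fin (m + 1) → Fin N) (i : Fin m) : Sym2 (Fin N) :=
  s(v i.castSucc, v i.succ)

/-- Every edge of a walk is taken at least twice. -/
def EdgesRepeated {m : ℕ} (v : Fin (m + 1) → Fin N) : Prop :=
  ∀ i, ∃ j, j ≠ i ∧ stepEdge v j = stepEdge v i

/-- Send each vertex other than the starting one to the edge by which it is first reached. Two
vertices with the same edge would force one of them to have been visited before its first visit. -/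
theorem card_image_walk_le {m : ℕ} (v : Fin (m + 1) → Fin N) :
    (Finset.univ.image v).card ≤ (Finset.univ.image (stepEdge v)).card + 1 := by
  classical
  rcases m with _ | m
  · exact Finset.card_image_le.trans (by simp)
  -- the first visit of a vertex
  have hex : ∀ u ∈ Finset.univ.image v, ∃ i, v i = u := fun u hu => by simpa using hu
  have hfirst : ∀ u : Fin N, (∃ i, v i = u) → ∃ i, v i = u ∧ ∀ j, v j = u → i ≤ j := by
    intro u ⟨i, hi⟩
    obtain ⟨a, ha, hmin⟩ := (Finset.univ.filter fun i => v i = u).exists_min_image id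
      ⟨i, by simp [hi]⟩
    exact ⟨a, by simpa using ha, fun j hj => hmin j (by simp [hj])⟩
  have hstep : ∀ u ∈ (Finset.univ.image v).erase (v 0), ∃ i : Fin (m + 1), v i.succ = u ∧
      ∀ j, v j = u → i.succ ≤ j := by
    intro u hu
    obtain ⟨h0, h1⟩ := Finset.mem_erase.1 hu
    obtain ⟨i, hi, hmin⟩ := hfirst u (hex u h1)
    have : i ≠ 0 := by rintro rfl; exact h0 hi.symm
    obtain ⟨i', rfl⟩ := Fin.exists_succ_eq.2 this
    exact ⟨i', hi, hmin⟩
  choose! t ht hmin using hstep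
  have hinj : Set.InjOn (fun u => stepEdge v (t u)) ((Finset.univ.image v).erase (v 0)) := by
    have key : ∀ u ∈ (Finset.univ.image v).erase (v 0), ∀ u' ∈ (Finset.univ.image v).erase (v 0),
        stepEdge v (t u) = stepEdge v (t u') → t u < t u' → False := by
      intro u hu u' hu' h hlt
      have h1 : v (t u').succ = v (t u).castSucc ∨ v (t u').succ = v (t u).succ := by
        rw [stepEdge, stepEdge, Sym2.eq_iff] at h
        rcases h with ⟨-, h⟩ | ⟨h, -⟩
        · exact Or.inr h.symm
        · exact Or.inl h.symm
      have hu2 := ht u' hu'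
      rcases h1 with h1 | h1
      · have := hmin u' hu' _ (h1.symm.trans hu2)
        have h3 : (t u).castSucc < (t u').succ := by
          rw [Fin.lt_def] at hlt ⊢; simp; omega
        exact absurd this (not_le.2 h3)
      · have := hmin u' hu' _ (h1.symm.trans hu2)
        have h3 : (t u).succ < (t u').succ := Fin.succ_lt_succ_iff.2 hlt
        exact absurd this (not_le.2 h3)
    intro u hu u' hu' h
    rcases lt_trichotomy (t u) (t u') with hlt | heq | hgt
    · exact (key u hu u' hu' h hlt).elim
    · rw [← ht u hu, ← ht u' hu', heq]
    · exact (key u' hu' u hu h.symm hgt).elim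
  have h1 := Finset.card_le_card_of_injOn (s := (Finset.univ.image v).erase (v 0))
    (t := Finset.univ.image (stepEdge v)) (fun u => stepEdge v (t u)) (fun u _ => by simp) hinj
  have h2 := Finset.card_erase_of_mem (s := Finset.univ.image v) (a := v 0) (by simp)
  omega

/-- Each edge is used at least twice in 2n steps, so there are at most n edges. -/
theorem EdgesRepeated.card_image_le {n : ℕ} {v : Fin (2 * n + 1) → Fin N} (h : EdgesRepeated v) :
    (Finset.univ.image v).card ≤ n + 1 := by
  classical
  have h1 := card_image_walk_le v
  have h2 : 2 * (Finset.univ.image (stepEdge v)).card ≤ (Finset.univ : Finset (Fin (2 * n))).card := by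
    refine Finset.mul_card_image_le_card _ 2 fun a ha => ?_
    obtain ⟨i, -, rfl⟩ := Finset.mem_image.1 ha
    obtain ⟨j, hj, hji⟩ := h i
    exact Finset.one_lt_card.2 ⟨i, by simp, j, by simp [hji], hj.symm⟩
  rw [Finset.card_univ, Fintype.card_fin] at h2
  omega

theorem card_walks_le {L : ℕ} (hL : 0 < L) (s : ℕ) :
    ((Finset.univ : Finset (Fin L → Fin N)).filter fun v => (Finset.univ.image v).card ≤ s).card ≤
      N ^ s * s ^ L := by
  classical
  have hsub : ((Finset.univ : Finset (Fin L → Fin N)).filter fun v => (Finset.univ.image v).card ≤ s) ⊆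
      (Finset.univ : Finset ((Fin s → Fin N) × (Fin L → Fin s))).image fun p => p.1 ∘ p.2 := by
    intro v hv
    rw [Finset.mem_filter] at hv
    have hs := hv.2
    obtain ⟨φ, hφ⟩ : ∃ φ : Fin s → Fin N, ∀ u ∈ Finset.univ.image v, ∃ a, φ a = u := by
      have e := (Finset.univ.image v).equivFin
      -- A walk is encoded by a table of s vertices and a sequence of table positions. The table is
      -- padded with the first vertex if there are fewer than s values, which needs L > 0.
      refine ⟨fun a => if h : a.1 < (Finset.univ.image v).card then (e.symm ⟨a.1, h⟩).1 else v ⟨0, hL⟩,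
        fun u hu => ?_⟩
      refine ⟨⟨(e ⟨u, hu⟩).1, (e ⟨u, hu⟩).2.trans_le hs⟩, ?_⟩
      simp
    choose ψ hψ using fun i => hφ (v i) (by simp)
    exact Finset.mem_image.2 ⟨(φ, ψ), Finset.mem_univ _, funext fun i => hψ i⟩
  refine (Finset.card_le_card hsub).trans (Finset.card_image_le.trans ?_)
  simp [Fintype.card_prod]

end Walks

section Moments
open scoped Matrix.Norms.L2Operator

variable {d N : ℕ} {ρ : Entry d N → Measure (ℂ × ℂ)} {c : ℕ → ℝ}

/-! ### Moments of the norm -/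

/-- The independent entry that determines a given entry of one of the matrices. -/
def entryAt (s : Fin d) (i j : Fin N) : Entry d N := (s, ⟨(min i j, max i j), min_le_max⟩)

theorem entryAt_inj {s : Fin d} {i j i' j' : Fin N} (h : entryAt s i j = entryAt s i' j') :
    s(i, j) = s(i', j') := by
  simp only [entryAt, Prod.mk.injEq, Subtype.mk.injEq, true_and] at h
  obtain ⟨h1, h2⟩ := h
  rw [Sym2.eq_iff]
  rcases le_total i j with h3 | h3 <;> rcases le_total i' j' with h4 | h4 <;> simp_all

/-- Identity, conjugation and real part are real-linear contractions, so centering and moment bounds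
pass from the independent entries to all entries. -/
theorem exists_hermOf_apply_eq (s : Fin d) (i j : Fin N) :
    ∃ ℓ : ℂ →L[ℝ] ℂ, (∀ w, ‖ℓ w‖ ≤ ‖w‖) ∧ ∀ z : Entry d N → ℂ, hermOf z s i j = ℓ (z (entryAt s i j)) := by
  rcases lt_trichotomy i j with h | rfl | h
  · refine ⟨ContinuousLinearMap.id ℝ ℂ, fun w => le_rfl, fun z => ?_⟩
    simp [hermOf, h, entryAt, min_eq_left h.le, max_eq_right h.le]
  · refine ⟨Complex.ofRealCLM ∘L Complex.reCLM, fun w => ?_, fun z => ?_⟩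
    · simpa using Complex.abs_re_le_norm w
    · simp [hermOf, entryAt]
  · refine ⟨Complex.conjCLE.toContinuousLinearMap, fun w => by simp, fun z => ?_⟩
    simp [hermOf, h, h.not_gt, entryAt, min_eq_right h.le, max_eq_left h.le]

/-- The product is at most the m-th power of the largest factor. It replaces Hölder's inequality for
walks with repeated entries, at the price of a factor m. -/
theorem prod_le_sum_pow {m : ℕ} (hm : 0 < m) {a : Fin m → ℝ} (ha : ∀ i, 0 ≤ a i) :
    ∏ i, a i ≤ ∑ i, a i ^ m := by
  obtain ⟨i, -, hi⟩ := Finset.exists_max_image Finset.univ a ⟨⟨0, hm⟩, Finset.mem_univ _⟩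
  calc ∏ j, a j ≤ ∏ _j : Fin m, a i := Finset.prod_le_prod (fun j _ => ha j) fun j hj => hi j hj
    _ = a i ^ m := by simp
    _ ≤ _ := Finset.single_le_sum (f := fun i => a i ^ m) (fun j _ => pow_nonneg (ha j) m)
      (Finset.mem_univ i)

theorem norm_pow_le_sum {ι E : Type*} [Fintype ι] [SeminormedAddCommGroup E] (f : ι → E) {n : ℕ}
    (hn : n ≠ 0) : ‖f‖ ^ n ≤ ∑ i, ‖f i‖ ^ n := by
  rcases isEmpty_or_nonempty ι with h | h
  · have : ‖f‖ = 0 := by rw [Subsingleton.elim f 0, norm_zero]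
    simp [this, hn]
  · obtain ⟨i, -, hi⟩ := Finset.exists_max_image Finset.univ (fun i => ‖f i‖) Finset.univ_nonempty
    have : ‖f‖ ≤ ‖f i‖ := (pi_norm_le_iff_of_nonneg (norm_nonneg _)).2 fun j => hi j (Finset.mem_univ j)
    exact (pow_le_pow_left₀ (norm_nonneg _) this n).trans
      (Finset.single_le_sum (f := fun i => ‖f i‖ ^ n) (fun j _ => by positivity) (Finset.mem_univ i))

variable [∀ e, IsProbabilityMeasure (ρ e)]

theorem EntryLaw.integrable_entry_pow (hρ : EntryLaw ρ c) (e : Entry d N) (m : ℕ) :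
    Integrable (fun ξ : Entry d N → ℂ × ℂ => (√N * ‖ξ e‖) ^ m) (Measure.pi ρ) ∧
    ∫ ξ : Entry d N → ℂ × ℂ, (√N * ‖ξ e‖) ^ m ∂Measure.pi ρ ≤ c m := by
  have h := measurePreserving_eval ρ e
  refine ⟨h.integrable_comp_of_integrable (hρ.integrable e m), ?_⟩
  have h2 := hρ.moment e m
  rw [← h.map_eq, integral_map (measurable_pi_apply e).aemeasurable] at h2
  · exact h2
  · rw [h.map_eq]; exact (hρ.integrable e m).aestronglyMeasurable

/-- Resample the coordinate that occurs only at `i₀`: its factor separates and has mean zero. -/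
theorem integral_prod_eq_zero {m : ℕ} {p : Fin m → Entry d N} {φ : Fin m → ℂ × ℂ → ℂ} {i₀ : Fin m}
    (hi₀ : ∀ j, j ≠ i₀ → p j ≠ p i₀) (h0 : ∫ w, φ i₀ w ∂ρ (p i₀) = 0) :
    ∫ ξ : Entry d N → ℂ × ℂ, ∏ i, φ i (ξ (p i)) ∂Measure.pi ρ = 0 := by
  by_cases hint : Integrable (fun ξ : Entry d N → ℂ × ℂ => ∏ i, φ i (ξ (p i))) (Measure.pi ρ)
  swap
  · exact integral_undef hint
  rw [← integral_update (p i₀) hint]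
  have : ∀ (ξ : Entry d N → ℂ × ℂ) w, ∏ i, φ i (Function.update ξ (p i₀) w (p i)) =
      φ i₀ w * ∏ i ∈ Finset.univ.erase i₀, φ i (ξ (p i)) := by
    intro ξ w
    rw [← Finset.mul_prod_erase _ _ (Finset.mem_univ i₀), Function.update_self]
    congr 1
    refine Finset.prod_congr rfl fun j hj => ?_
    rw [Function.update_of_ne (hi₀ j (Finset.mem_erase.1 hj).1)]
  simp only [this, integral_mul_const, h0, zero_mul, integral_zero]

theorem EntryLaw.norm_integral_prod_le (hρ : EntryLaw ρ c) {m : ℕ} (hm : 0 < m)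
    {p : Fin m → Entry d N} {φ : Fin m → ℂ × ℂ → ℂ} (hφ : ∀ i, Measurable (φ i))
    (hb : ∀ i w, ‖φ i w‖ ≤ ‖w‖) :
    Integrable (fun ξ : Entry d N → ℂ × ℂ => ∏ i, φ i (ξ (p i))) (Measure.pi ρ) ∧
    ‖∫ ξ : Entry d N → ℂ × ℂ, ∏ i, φ i (ξ (p i)) ∂Measure.pi ρ‖ ≤ m * c m * (1 / √N) ^ m := by
  have hs : 0 < √(N : ℝ) := zero_lt_one.trans_le (one_le_sqrt_nat (p ⟨0, hm⟩))
  have hpt : ∀ ξ : Entry d N → ℂ × ℂ, ‖∏ i, φ i (ξ (p i))‖ ≤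
      (1 / √N) ^ m * ∑ i, (√N * ‖ξ (p i)‖) ^ m := by
    intro ξ
    rw [norm_prod, Finset.mul_sum]
    refine (Finset.prod_le_prod (fun i _ => norm_nonneg _) fun i _ => hb i (ξ (p i))).trans
      ((prod_le_sum_pow hm fun i => norm_nonneg _).trans (le_of_eq ?_))
    refine Finset.sum_congr rfl fun i _ => ?_
    rw [← mul_pow]
    congr 1
    field_simp
  have hi : Integrable (fun ξ : Entry d N → ℂ × ℂ => (1 / √N) ^ m * ∑ i, (√N * ‖ξ (p i)‖) ^ m)
      (Measure.pi ρ) :=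
    (integrable_finsetSum _ fun i _ => (hρ.integrable_entry_pow (p i) m).1).const_mul _
  have hmeas : Measurable fun ξ : Entry d N → ℂ × ℂ => ∏ i, φ i (ξ (p i)) :=
    Finset.measurable_prod _ fun i _ => (hφ i).comp (measurable_pi_apply _)
  refine ⟨hi.mono' hmeas.aestronglyMeasurable (.of_forall hpt), ?_⟩
  refine (norm_integral_le_of_norm_le hi (.of_forall hpt)).trans ?_
  rw [integral_const_mul, integral_finsetSum _ fun i _ => (hρ.integrable_entry_pow (p i) m).1,
    mul_comm]
  refine mul_le_mul_of_nonneg_right ?_ (by positivity)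
  refine (Finset.sum_le_card_nsmul _ _ _ fun i _ => (hρ.integrable_entry_pow (p i) m).2).trans ?_
  simp

/-- Closed walks with an edge used once have zero mean. The others visit at most n + 1 vertices, so
there are at most N^{n+1} (n+1)^{2n+1} of them, each contributing a multiple of N^{-n}; the total is
of order N. -/
theorem EntryLaw.trace_moment (hρ : EntryLaw ρ c) (hc : ∀ m, 0 ≤ c m) (S : Finset (Entry d N)) (s : Fin d)
    {n : ℕ} (hn : 0 < n) (hN : 0 < N) :
    Integrable (fun ξ => (hermOf (pick S ξ) s ^ (2 * n)).trace) (Measure.pi ρ) ∧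
    ‖∫ ξ, (hermOf (pick S ξ) s ^ (2 * n)).trace ∂Measure.pi ρ‖ ≤
      (n + 1) ^ (2 * n + 1) * (2 * n * c (2 * n)) * N := by
  classical
  choose ℓ hℓ1 hℓ2 using fun i j : Fin N => exists_hermOf_apply_eq s i j
  set φ : Fin N → Fin N → ℂ × ℂ → ℂ := fun i j w =>
    ℓ i j (sel (decide (entryAt s i j ∈ S)) w) with hφ
  have hφm : ∀ i j, Measurable (φ i j) := fun i j =>
    (ℓ i j).continuous.measurable.comp (measurable_sel _)
  have hφb : ∀ i j w, ‖φ i j w‖ ≤ ‖w‖ := fun i j w => (hℓ1 _ _ _).trans (norm_sel_le _ _)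
  have hφ0 : ∀ i j, ∫ w, φ i j w ∂ρ (entryAt s i j) = 0 := by
    intro i j
    simp only [hφ]
    rw [(ℓ i j).integral_comp_comm (hρ.integrable_sel _ _), hρ.mean, map_zero]
  have hw : ∀ (ξ : Entry d N → ℂ × ℂ) {m : ℕ} (v : Fin (m + 1) → Fin N), walkProd (hermOf (pick S ξ) s) v =
      ∏ i : Fin m, φ (v i.castSucc) (v i.succ) (ξ (entryAt s (v i.castSucc) (v i.succ))) := by
    intro ξ m v
    refine Finset.prod_congr rfl fun i _ => ?_
    rw [hℓ2]
    simp [hφ, pick, sel]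
  have h2n : 0 < 2 * n := by omega
  have hint := fun v : Fin (2 * n + 1) → Fin N => hρ.norm_integral_prod_le h2n
    (p := fun i => entryAt s (v i.castSucc) (v i.succ))
    (φ := fun i => φ (v i.castSucc) (v i.succ)) (fun i => hφm _ _) fun i => hφb _ _
  have hint' : ∀ v : Fin (2 * n + 1) → Fin N, Integrable (fun ξ => if v 0 = v (Fin.last (2 * n)) then
      walkProd (hermOf (pick S ξ) s) v else 0) (Measure.pi ρ) := by
    intro v
    split_ifs
    · simp only [hw]; exact (hint v).1
    · exact integrable_zero _ _ _
  simp only [trace_pow_eq_sum]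
  refine ⟨integrable_finsetSum _ fun v _ => hint' v, ?_⟩
  rw [integral_finsetSum _ fun v _ => hint' v]
  set b : ℝ := ((2 * n : ℕ) : ℝ) * c (2 * n) * (1 / √N) ^ (2 * n) with hb
  have hb0 : 0 ≤ b := by have := hc (2 * n); positivity
  have hterm : ∀ v : Fin (2 * n + 1) → Fin N, ‖∫ ξ, (if v 0 = v (Fin.last (2 * n)) then
      walkProd (hermOf (pick S ξ) s) v else 0) ∂Measure.pi ρ‖ ≤
      if (Finset.univ.image v).card ≤ n + 1 then b else 0 := by
    intro v
    have h0 : (0 : ℝ) ≤ if (Finset.univ.image v).card ≤ n + 1 then b else 0 := by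
      split_ifs <;> [exact hb0; exact le_rfl]
    by_cases hcl : v 0 = v (Fin.last (2 * n))
    swap
    · simpa [hcl] using h0
    simp only [hcl, if_true, hw]
    by_cases hr : EdgesRepeated v
    · rw [if_pos hr.card_image_le]
      exact (hint v).2
    -- A step whose edge is not repeated involves an independent entry that occurs nowhere else.
    · unfold EdgesRepeated at hr
      push Not at hr
      obtain ⟨i₀, hi₀⟩ := hr
      rw [integral_prod_eq_zero (p := fun i => entryAt s (v i.castSucc) (v i.succ))
        (φ := fun i => φ (v i.castSucc) (v i.succ)) (i₀ := i₀)
        (fun j hj h => hi₀ j hj (entryAt_inj h)) (hφ0 _ _), norm_zero]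
      exact h0
  refine (norm_sum_le _ _).trans ((Finset.sum_le_sum fun v _ => hterm v).trans ?_)
  rw [← Finset.sum_filter, Finset.sum_const, nsmul_eq_mul]
  have hcard : (((Finset.univ : Finset (Fin (2 * n + 1) → Fin N)).filter fun v =>
      (Finset.univ.image v).card ≤ n + 1).card : ℝ) ≤ N ^ (n + 1) * (n + 1) ^ (2 * n + 1) := by
    exact_mod_cast card_walks_le (N := N) (L := 2 * n + 1) (by omega) (n + 1)
  refine (mul_le_mul_of_nonneg_right hcard hb0).trans (le_of_eq ?_)
  have hN' : (0 : ℝ) < N := Nat.cast_pos.2 hN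
  rw [hb, pow_mul, div_pow, Real.sq_sqrt hN'.le, div_pow, one_pow, one_pow]
  push_cast
  field_simp
  ring

theorem EntryLaw.norm_moment (hρ : EntryLaw ρ c) (hc : ∀ m, 0 ≤ c m) (S : Finset (Entry d N)) (s : Fin d)
    (k : ℕ) (hN : 0 < N) :
    Integrable (fun ξ => ‖hermOf (pick S ξ) s‖ ^ (2 * 2 ^ k)) (Measure.pi ρ) ∧
    ∫ ξ, ‖hermOf (pick S ξ) s‖ ^ (2 * 2 ^ k) ∂Measure.pi ρ ≤
      (2 ^ k + 1) ^ (2 * 2 ^ k + 1) * (2 * 2 ^ k * c (2 * 2 ^ k)) * N := by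
  obtain ⟨hi, hb⟩ := hρ.trace_moment hc S s (n := 2 ^ k) (by positivity) hN
  have hire := hi.re
  have hpt : ∀ ξ : Entry d N → ℂ × ℂ, ‖hermOf (pick S ξ) s‖ ^ (2 * 2 ^ k) ≤
      (hermOf (pick S ξ) s ^ (2 * 2 ^ k)).trace.re := fun ξ => norm_pow_le_trace (hermTuple_hermOf _ s) k
  have hcont : Continuous fun ξ : Entry d N → ℂ × ℂ => ‖hermOf (pick S ξ) s‖ :=
    ((continuous_apply s).comp (continuous_hermOf.comp (continuous_pick S))).norm
  have hi2 : Integrable (fun ξ => ‖hermOf (pick S ξ) s‖ ^ (2 * 2 ^ k)) (Measure.pi ρ) := by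
    refine hire.mono' (hcont.pow _).measurable.aestronglyMeasurable (.of_forall fun ξ => ?_)
    rw [Real.norm_of_nonneg (by positivity)]
    exact hpt ξ
  refine ⟨hi2, (integral_mono hi2 hire hpt).trans ?_⟩
  have h1 := integral_re hi
  refine (le_of_eq h1).trans ((Complex.re_le_norm _).trans (hb.trans (le_of_eq ?_)))
  push_cast
  rfl

theorem add_four_pow_le {a b c e : ℝ} (ha : 0 ≤ a) (hb : 0 ≤ b) (hc : 0 ≤ c) (he : 0 ≤ e) (n : ℕ) :
    (a + b + c + e) ^ n ≤ 4 ^ n * (a ^ n + b ^ n + c ^ n + e ^ n) := by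
  have key : ∀ {x y : ℝ}, 0 ≤ x → 0 ≤ y → (x + y) ^ n ≤ 2 ^ n * (x ^ n + y ^ n) := by
    intro x y hx hy
    refine (add_pow_le hx hy n).trans ?_
    gcongr
    · norm_num
    · omega
  have h4 : (4 : ℝ) ^ n = 2 ^ n * 2 ^ n := by rw [← mul_pow]; norm_num
  calc (a + b + c + e) ^ n = ((a + b) + (c + e)) ^ n := by ring
    _ ≤ 2 ^ n * ((a + b) ^ n + (c + e) ^ n) := key (by positivity) (by positivity)
    _ ≤ 2 ^ n * (2 ^ n * (a ^ n + b ^ n) + 2 ^ n * (c ^ n + e ^ n)) := by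
        gcongr
        · exact key ha hb
        · exact key hc he
    _ = _ := by rw [h4]; ring

/-- The moments of the envelope grow at most quadratically in the size. -/
theorem exists_env_moment (d : ℕ) {c : ℕ → ℝ} (hc : ∀ m, 0 ≤ c m) {K : ℝ} (hK : 1 ≤ K) (q : ℕ) :
    ∃ Q : ℝ, 1 ≤ Q ∧ ∀ {N : ℕ} {ρ : Entry d N → Measure (ℂ × ℂ)} [∀ e, IsProbabilityMeasure (ρ e)],
      0 < N → EntryLaw ρ c → ∀ S : Finset (Entry d N),
      Integrable (fun ξ => env K S ξ ^ q) (Measure.pi ρ) ∧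
      ∫ ξ, env K S ξ ^ q ∂Measure.pi ρ ≤ Q * N ^ 2 := by
  -- An exponent of the form handled by `EntryLaw.norm_moment` and at least q; raising the exponent
  -- is allowed because the envelope is at least 1.
  set n := 2 * 2 ^ q with hn
  have hqn : q ≤ n := Nat.lt_two_pow_self.le.trans (by omega)
  have hn0 : n ≠ 0 := by positivity
  set b : ℝ := (2 ^ q + 1) ^ (2 * 2 ^ q + 1) * (2 * 2 ^ q * c (2 * 2 ^ q)) with hb
  have hb0 : 0 ≤ b := by have := hc (2 * 2 ^ q); positivity
  set Q := 5 ^ n * (4 ^ n * (K ^ n + d * b + d * b + d * c n)) with hQ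
  have hKn : 1 ≤ K ^ n := one_le_pow₀ hK
  refine ⟨Q, ?_, ?_⟩
  · have h5 : (1 : ℝ) ≤ 5 ^ n := one_le_pow₀ (by norm_num)
    have h4 : (1 : ℝ) ≤ 4 ^ n := one_le_pow₀ (by norm_num)
    have h1 : 1 ≤ K ^ n + d * b + d * b + d * c n := by
      have := hc n
      have : 0 ≤ d * b := by positivity
      have : 0 ≤ d * c n := by positivity
      linarith
    exact one_le_mul_of_one_le_of_one_le h5 (one_le_mul_of_one_le_of_one_le h4 h1)
  intro N ρ _ hN hρ S
  have hN1 : (1 : ℝ) ≤ N := by exact_mod_cast hN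
  have hN2 : (N : ℝ) ≤ N ^ 2 := by nlinarith
  have hpt : ∀ ξ : Entry d N → ℂ × ℂ, env K S ξ ^ q ≤ 5 ^ n * (4 ^ n * (K ^ n +
      ∑ s, ‖hermOf (pick S ξ) s‖ ^ n + ∑ s, ‖hermOf (pick ∅ ξ) s‖ ^ n + ∑ e, (√N * ‖ξ e‖) ^ n)) := by
    intro ξ
    refine (pow_le_pow_right₀ (one_le_env hK) hqn).trans ?_
    unfold env
    rw [mul_pow]
    gcongr
    refine (add_four_pow_le (by linarith) (norm_nonneg _) (norm_nonneg _) (by positivity) n).trans ?_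
    gcongr
    · exact norm_pow_le_sum _ hn0
    · exact norm_pow_le_sum _ hn0
    · simp only [mul_pow]
      rw [← Finset.mul_sum]
      gcongr
      exact norm_pow_le_sum _ hn0
  have hiS : ∀ S : Finset (Entry d N), Integrable (fun ξ => ∑ s, ‖hermOf (pick S ξ) s‖ ^ n)
      (Measure.pi ρ) ∧ ∫ ξ, ∑ s, ‖hermOf (pick S ξ) s‖ ^ n ∂Measure.pi ρ ≤ d * b * N ^ 2 := by
    intro S
    refine ⟨integrable_finsetSum _ fun s _ => (hρ.norm_moment hc S s q hN).1, ?_⟩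
    rw [integral_finsetSum _ fun s _ => (hρ.norm_moment hc S s q hN).1]
    refine (Finset.sum_le_card_nsmul _ _ (b * N) fun s _ => (hρ.norm_moment hc S s q hN).2).trans ?_
    rw [nsmul_eq_mul, Finset.card_univ, Fintype.card_fin, ← mul_assoc]
    gcongr
  have hiE : Integrable (fun ξ : Entry d N → ℂ × ℂ => ∑ e, (√N * ‖ξ e‖) ^ n) (Measure.pi ρ) :=
    integrable_finsetSum _ fun e _ => (hρ.integrable_entry_pow e n).1
  -- The maximum over the entries is bounded by a sum over dN² of them; this is the source of N²,
  -- the norms themselves costing only N.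
  have hE : ∫ ξ : Entry d N → ℂ × ℂ, ∑ e, (√N * ‖ξ e‖) ^ n ∂Measure.pi ρ ≤ d * c n * N ^ 2 := by
    rw [integral_finsetSum _ fun e _ => (hρ.integrable_entry_pow e n).1]
    refine (Finset.sum_le_card_nsmul _ _ _ fun e _ => (hρ.integrable_entry_pow e n).2).trans ?_
    rw [nsmul_eq_mul, Finset.card_univ]
    refine (mul_le_mul_of_nonneg_right card_entry_le (hc n)).trans (le_of_eq (by ring))
  have hi2 : Integrable (fun ξ : Entry d N → ℂ × ℂ => K ^ n + ∑ s, ‖hermOf (pick S ξ) s‖ ^ n)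
      (Measure.pi ρ) := (integrable_const _).add (hiS S).1
  have hi3 : Integrable (fun ξ : Entry d N → ℂ × ℂ => K ^ n + ∑ s, ‖hermOf (pick S ξ) s‖ ^ n +
      ∑ s, ‖hermOf (pick ∅ ξ) s‖ ^ n) (Measure.pi ρ) := hi2.add (hiS ∅).1
  have hi : Integrable (fun ξ : Entry d N → ℂ × ℂ => 5 ^ n * (4 ^ n * (K ^ n +
      ∑ s, ‖hermOf (pick S ξ) s‖ ^ n + ∑ s, ‖hermOf (pick ∅ ξ) s‖ ^ n + ∑ e, (√N * ‖ξ e‖) ^ n)))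
      (Measure.pi ρ) :=
    ((hi3.add hiE).const_mul _).const_mul _
  have hie : Integrable (fun ξ => env K S ξ ^ q) (Measure.pi ρ) := by
    refine hi.mono' ((continuous_env K S).pow q).measurable.aestronglyMeasurable (.of_forall fun ξ => ?_)
    have := one_le_env (S := S) (ξ := ξ) hK
    rw [Real.norm_of_nonneg (by positivity)]
    exact hpt ξ
  refine ⟨hie, (integral_mono hie hi hpt).trans ?_⟩
  rw [integral_const_mul, integral_const_mul,
    integral_add hi3 hiE, integral_add hi2 (hiS ∅).1,
    integral_add (integrable_const _) (hiS S).1, hQ, mul_assoc, mul_assoc]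
  gcongr
  have h1 := (hiS S).2
  have h2 := (hiS ∅).2
  simp only [integral_const, probReal_univ, one_smul]
  have h3 : K ^ n ≤ K ^ n * N ^ 2 := le_mul_of_one_le_right (by positivity) (one_le_pow₀ hN1)
  linarith

end Moments

section Continuity
open scoped Matrix.Norms.L2Operator
open Filter Topology

variable {d r k N : ℕ} {α : Type*} [TopologicalSpace α]

/-! ### Continuity of the evaluations -/

theorem continuous_matrix_inv {B : α → Matrix (Fin N) (Fin N) ℂ} (hB : Continuous B)
    (h : ∀ a, IsUnit (B a).det) : Continuous fun a => (B a)⁻¹ := by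
  simp only [Matrix.inv_def, Ring.inverse_eq_inv']
  exact (hB.matrix_det.inv₀ fun a => (h a).ne_zero).smul hB.matrix_adjugate

theorem continuous_letterValue {M : α → Fin d → Matrix (Fin N) (Fin N) ℂ} (hM : Continuous M)
    (A : Fin r → Matrix (Fin N) (Fin N) ℂ) (l : Letter d r) :
    Continuous fun a => letterValue (M a) A l := by
  cases l with
  | X i => exact (continuous_apply i).comp hM
  | Z j => exact continuous_const
  | Zstar j => exact continuous_const

theorem continuous_eval {M : α → Fin d → Matrix (Fin N) (Fin N) ℂ} (hM : Continuous M)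
    (A : Fin r → Matrix (Fin N) (Fin N) ℂ) (p : NCPoly d r) :
    Continuous fun a => p.eval (M a) A := by
  simp only [eval_eq_sum]
  refine continuous_list_sum _ fun q _ => ?_
  have : Continuous fun a => baseVal A (M a) q.2 :=
    continuous_list_prod _ fun l _ => continuous_letterValue hM A l
  exact this.const_smul q.1

theorem continuous_resolventMat {τ : α → ℝ} {H : α → Matrix (Fin N) (Fin N) ℂ} (hτ : Continuous τ)
    (hH : Continuous H) (h : ∀ a, (H a).IsHermitian) :
    Continuous fun a => resolventMat (τ a) (H a) := by
  refine continuous_matrix_inv ?_ fun a => isUnit_det_one_sub (h a) (τ a)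
  exact continuous_const.sub
    ((continuous_const.mul (Complex.continuous_ofReal.comp hτ)).smul hH)

variable {P : Fin k → NCPoly d r}

theorem continuous_wordVal (hP : ∀ j, (P j).adjoint = P j) (τ : Fin k → ℝ)
    (A : Fin r → Matrix (Fin N) (Fin N) ℂ) (E : Bool → Matrix (Fin N) (Fin N) ℂ)
    {M : α → Fin d → Matrix (Fin N) (Fin N) ℂ} (hM : Continuous M) (h : ∀ a, HermTuple (M a))
    (w : Word d r k) : Continuous fun a => wordVal P τ A E (M a) w := by
  refine continuous_list_prod _ fun l _ => ?_
  have hres : ∀ j, Continuous fun a => resolventMat (τ j) ((P j).eval (M a) A) := fun j =>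
    continuous_resolventMat continuous_const (continuous_eval hM A _)
      fun a => eval_isHermitian (h a) A (hP j)
  cases l with
  | base l => exact continuous_letterValue hM A l
  | res j => exact hres j
  | cay j => exact ((hres j).const_smul (2 : ℂ)).sub continuous_const
  | dir a => exact continuous_const

theorem continuous_quadForm (x y : EuclideanSpace ℂ (Fin N)) :
    Continuous fun M : Matrix (Fin N) (Fin N) ℂ => quadForm x M y :=
  (quadFormLin x y).continuous_of_finiteDimensional

theorem continuous_quadForm_combVal (hP : ∀ j, (P j).adjoint = P j) (τ : Fin k → ℝ)
    (A : Fin r → Matrix (Fin N) (Fin N) ℂ) (E : Bool → Matrix (Fin N) (Fin N) ℂ)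
    {M : α → Fin d → Matrix (Fin N) (Fin N) ℂ} (hM : Continuous M) (h : ∀ a, HermTuple (M a))
    (x y : EuclideanSpace ℂ (Fin N)) (L : List (ℂ × Word d r k)) :
    Continuous fun a => quadForm x (combVal P τ A E (M a) L) y := by
  refine (continuous_quadForm x y).comp ?_
  exact continuous_list_sum _ fun p _ =>
    (continuous_wordVal hP τ A E hM h p.2).const_smul p.1

/-! ### The exponential as a limit of powers of Cayley transforms -/

theorem norm_pow_le_of_norm_le {U : Matrix (Fin N) (Fin N) ℂ} (hU : ‖U‖ ≤ 1) (n : ℕ) :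
    ‖U ^ n‖ ≤ 1 := by
  induction n with
  | zero => simpa using l2_norm_one_le
  | succ n ih =>
    rw [pow_succ]
    exact (norm_mul_le _ _).trans (mul_le_one₀ ih (norm_nonneg _) hU)

theorem norm_pow_sub_pow_le {U V : Matrix (Fin N) (Fin N) ℂ} (hU : ‖U‖ ≤ 1) (hV : ‖V‖ ≤ 1)
    (n : ℕ) : ‖U ^ n - V ^ n‖ ≤ n * ‖U - V‖ := by
  induction n with
  | zero => simp
  | succ n ih =>
    have : U ^ (n + 1) - V ^ (n + 1) = U ^ n * (U - V) + (U ^ n - V ^ n) * V := by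
      rw [pow_succ, pow_succ, mul_sub, sub_mul]; abel
    rw [this]
    have h1 : ‖U ^ n * (U - V)‖ ≤ 1 * ‖U - V‖ := (norm_mul_le _ _).trans
      (mul_le_mul_of_nonneg_right (norm_pow_le_of_norm_le hU n) (norm_nonneg _))
    have h2 : ‖(U ^ n - V ^ n) * V‖ ≤ ‖U ^ n - V ^ n‖ * 1 := (norm_mul_le _ _).trans
      (mul_le_mul_of_nonneg_left hV (norm_nonneg _))
    push_cast
    linarith [norm_add_le (U ^ n * (U - V)) ((U ^ n - V ^ n) * V)]

theorem norm_exp_le {H : Matrix (Fin N) (Fin N) ℂ} (hH : H.IsHermitian) (a : ℝ) :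
    ‖NormedSpace.exp ((Complex.I * (a : ℂ)) • H)‖ ≤ 1 := by
  have hs : (Complex.I * (a : ℂ)) • H ∈ skewAdjoint (Matrix (Fin N) (Fin N) ℂ) := by
    rw [skewAdjoint.mem_iff, star_smul, Matrix.star_eq_conjTranspose, hH.eq, ← neg_smul]
    congr 1
    simp
  let : NormedAlgebra ℚ (Matrix (Fin N) (Fin N) ℂ) := NormedAlgebra.restrictScalars ℚ ℂ _
  have h1 := (Unitary.mem_iff.1 (NormedSpace.exp_mem_unitary_of_mem_skewAdjoint hs)).1
  have h2 := CStarRing.norm_star_mul_self (x := NormedSpace.exp ((Complex.I * (a : ℂ)) • H))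
  rw [h1] at h2
  nlinarith [l2_norm_one_le (N := N), norm_nonneg (NormedSpace.exp ((Complex.I * (a : ℂ)) • H))]

/-- Makes the difference quotient of the Cayley transform at 0 an explicit continuous function of
the parameter. -/
theorem cayleyMat_sub_one {H : Matrix (Fin N) (Fin N) ℂ} (hH : H.IsHermitian) (a : ℝ) :
    cayleyMat a H - 1 = (2 * (Complex.I * (a : ℂ))) • (H * resolventMat a H) := by
  have h1 := Matrix.mul_nonsing_inv _ (isUnit_det_one_sub hH a)
  rw [cayleyMat_eq hH a]
  nth_rewrite 2 [← h1]
  rw [resolventMat, ← sub_mul, ← smul_mul_assoc, two_mul, add_smul]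
  congr 1
  abel

/-- The Cayley transform at t/(2n) and the exponential of itH/n agree to first order in 1/n. Both
are contractions, so their n-th powers differ by at most n times an error o(1/n). -/
theorem tendsto_cayleyMat_pow {H : Matrix (Fin N) (Fin N) ℂ} (hH : H.IsHermitian) (t : ℝ) :
    Tendsto (fun n : ℕ => cayleyMat (t / (2 * n)) H ^ n) atTop
      (𝓝 (NormedSpace.exp ((Complex.I * (t : ℂ)) • H))) := by
  set x := (Complex.I * (t : ℂ)) • H with hx
  have hU : HasDerivAt (fun s : ℝ => cayleyMat (t / 2 * s) H) x 0 := by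
    rw [hasDerivAt_iff_tendsto_slope_zero]
    have hc : Continuous fun s : ℝ => (Complex.I * (t : ℂ)) • (H * resolventMat (t / 2 * s) H) :=
      (continuous_const.matrix_mul (continuous_resolventMat (τ := fun s => t / 2 * s)
        (H := fun _ => H) (by fun_prop) continuous_const fun _ => hH)).const_smul
          (Complex.I * (t : ℂ))
    have h0 : (Complex.I * (t : ℂ)) • (H * resolventMat (t / 2 * (0 : ℝ)) H) = x := by
      simp [resolventMat, hx]
    have := (hc.tendsto 0).mono_left (nhdsWithin_le_nhds (s := {0}ᶜ))
    rw [h0] at this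
    refine this.congr' ?_
    filter_upwards [self_mem_nhdsWithin] with s hs
    have hs : s ≠ 0 := hs
    have h1 : cayleyMat (t / 2 * (0 : ℝ)) H = 1 := by
      have := cayleyMat_sub_one hH (t / 2 * 0)
      rw [mul_zero, Complex.ofReal_zero, mul_zero, mul_zero, zero_smul, sub_eq_zero] at this
      rwa [mul_zero]
    rw [h1, zero_add, cayleyMat_sub_one hH, ← Complex.coe_smul, smul_smul]
    congr 1
    have hs' : (s : ℂ) ≠ 0 := by exact_mod_cast hs
    push_cast
    field_simp
  have hV : HasDerivAt (fun s : ℝ => NormedSpace.exp (s • x)) x 0 := by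
    have := hasDerivAt_exp_smul_const (𝕂 := ℝ) x 0
    rwa [zero_smul, NormedSpace.exp_zero, one_mul] at this
  have hd := hasDerivAt_iff_tendsto_slope_zero.1 (hU.sub hV)
  have h0 : cayleyMat (t / 2 * (0 : ℝ)) H - NormedSpace.exp ((0 : ℝ) • x) = 0 := by
    have := cayleyMat_sub_one hH (t / 2 * 0)
    rw [mul_zero, Complex.ofReal_zero, mul_zero, mul_zero, zero_smul] at this
    rwa [mul_zero, zero_smul, NormedSpace.exp_zero]
  have hn : Tendsto (fun n : ℕ => ((n : ℝ))⁻¹) atTop (𝓝[≠] 0) := by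
    refine tendsto_nhdsWithin_iff.2 ⟨tendsto_inv_atTop_nhds_zero_nat, ?_⟩
    filter_upwards [eventually_gt_atTop 0] with n hn
    have : (n : ℝ) ≠ 0 := by positivity
    simpa using this
  have hlim := (hd.comp hn).norm
  rw [sub_self, norm_zero] at hlim
  rw [tendsto_iff_norm_sub_tendsto_zero]
  refine squeeze_zero' (.of_forall fun n => norm_nonneg _) ?_ hlim
  filter_upwards [eventually_gt_atTop 0] with n hn
  have hn' : (n : ℝ) ≠ 0 := by positivity
  have hexp : NormedSpace.exp x = NormedSpace.exp ((n : ℝ)⁻¹ • x) ^ n := by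
    rw [← Matrix.exp_nsmul, ← Nat.cast_smul_eq_nsmul ℝ, smul_smul, mul_inv_cancel₀ hn', one_smul]
  have harg : t / (2 * n) = t / 2 * (n : ℝ)⁻¹ := by field_simp
  have hx' : (n : ℝ)⁻¹ • x = (Complex.I * ((t * (n : ℝ)⁻¹ : ℝ) : ℂ)) • H := by
    rw [hx, ← Complex.coe_smul, smul_smul]
    congr 1
    push_cast
    ring
  rw [hexp, harg]
  -- The factor n turns the difference into its slope at 1/n, which tends to 0.
  refine (norm_pow_sub_pow_le (norm_cayleyMat_le hH _) (hx' ▸ norm_exp_le hH _) n).trans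
    (le_of_eq ?_)
  simp only [Function.comp_apply, Pi.sub_apply, zero_add, h0, sub_zero, inv_inv]
  rw [norm_smul, Real.norm_of_nonneg (by positivity)]

end Continuity

section Approximation
open scoped Matrix.Norms.L2Operator
open Filter Topology

variable {d r k N : ℕ}

/-! ### Approximation of the exponential products by combinations of words -/

/-- The combination of words representing `∏ U_j ^ n R_j`, where the `U_j` are Cayley transforms. -/
noncomputable def cayleyComb (R : Fin k → NCPoly d r) (n : ℕ) :
    List (Fin k) → List (ℂ × Word d r k)
  | [] => [(1, [])]
  | j :: l => (polyTerms (R j)).flatMap fun q => (cayleyComb R n l).map fun p =>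
      (q.1 * p.1, List.replicate n (.cay j) ++ (q.2.map .base ++ p.2))

variable {P R : Fin k → NCPoly d r} {τ : Fin k → ℝ} {A : Fin r → Matrix (Fin N) (Fin N) ℂ}
  {E : Bool → Matrix (Fin N) (Fin N) ℂ} {M : Fin d → Matrix (Fin N) (Fin N) ℂ} {n : ℕ}

theorem mem_cayleyComb_cons {j : Fin k} {l : List (Fin k)} {p : ℂ × Word d r k}
    (hp : p ∈ cayleyComb R n (j :: l)) : ∃ q ∈ polyTerms (R j), ∃ p' ∈ cayleyComb R n l,
      p.2 = List.replicate n (.cay j) ++ (q.2.map .base ++ p'.2) := by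
  simp only [cayleyComb, List.mem_flatMap, List.mem_map] at hp
  obtain ⟨q, hq, p', hp', rfl⟩ := hp
  exact ⟨q, hq, p', hp', rfl⟩

theorem wordVal_replicate_cay (j : Fin k) :
    wordVal P τ A E M (List.replicate n (.cay j)) = cayleyMat (τ j) ((P j).eval M A) ^ n := by
  simp [wordVal, wletterVal]

theorem combVal_cayleyComb (l : List (Fin k)) :
    combVal P τ A E M (cayleyComb R n l) =
      (l.map fun j => cayleyMat (τ j) ((P j).eval M A) ^ n * (R j).eval M A).prod := by
  induction l with
  | nil => simp [combVal, cayleyComb]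
  | cons j l ih =>
    rw [List.map_cons, List.prod_cons, ← ih, combVal, cayleyComb, lsum_flatMap,
      eval_eq_sum A M (R j), ← lsum, mul_assoc, lsum_mul, mul_lsum]
    refine lsum_congr fun q _ => ?_
    rw [lsum_map, combVal, mul_lsum, mul_lsum]
    refine lsum_congr fun p _ => ?_
    rw [wordVal_append, wordVal_append, wordVal_map_base, wordVal_replicate_cay]
    simp only [smul_mul_assoc, mul_smul_comm, smul_smul]
    rw [mul_comm]

/-- Cayley letters carry no coefficients, so the mass does not depend on n. -/
theorem mass_cayleyComb (l : List (Fin k)) :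
    mass (cayleyComb R n l) = (l.map fun j => mass (polyTerms (R j))).prod := by
  induction l with
  | nil => simp [mass, cayleyComb]
  | cons j l ih =>
    rw [List.map_cons, List.prod_cons, ← ih, mass, cayleyComb, lsum_flatMap]
    have h : mass (polyTerms (R j)) = lsum (polyTerms (R j)) fun q => ‖q.1‖ := rfl
    rw [h, lsum_mul]
    refine lsum_congr fun q _ => ?_
    rw [lsum_map, mass, mul_lsum]
    exact lsum_congr fun p _ => norm_mul _ _

theorem wdeg_replicate_cay (j : Fin k) : wdeg (List.replicate n (.cay j : WLetter d r k)) = 0 := by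
  simp [wdeg, lsum, WLetter.deg]

theorem wcount_replicate_cay (a : Bool) (j : Fin k) :
    wcount a (List.replicate n (.cay j : WLetter d r k)) = 0 := by
  simp [wcount, lsum, WLetter.dirCount]

/-- With parameter t/(2n) the right side equals |t| `polySize`, whatever n is: n small factors cost
as much as one exponential. -/
theorem wrho_replicate_cay_le (s : Fin d) (j : Fin k) :
    wrho P τ s (List.replicate n (.cay j)) ≤ n * (2 * (|τ j| * polySize (P j))) := by
  rw [wrho, lsum, List.map_replicate, List.sum_replicate, nsmul_eq_mul]
  exact mul_le_mul_of_nonneg_left (mass_letterDiff_cay_le j) (Nat.cast_nonneg n)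

theorem wdeg_cayleyComb_le {l : List (Fin k)} {p : ℂ × Word d r k} (hp : p ∈ cayleyComb R n l) :
    wdeg p.2 ≤ lsum l fun j => polyDeg (R j) := by
  induction l generalizing p with
  | nil => simp [cayleyComb] at hp; simp [hp]
  | cons j l ih =>
    obtain ⟨q, hq, p', hp', h⟩ := mem_cayleyComb_cons hp
    rw [h, wdeg_append, wdeg_append, wdeg_map_base, wdeg_replicate_cay, lsum_cons]
    have := length_le_polyDeg hq
    have := ih hp'
    omega

theorem wcount_cayleyComb {l : List (Fin k)} {p : ℂ × Word d r k} (hp : p ∈ cayleyComb R n l)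
    (a : Bool) : wcount a p.2 = 0 := by
  induction l generalizing p with
  | nil => simp [cayleyComb] at hp; simp [hp]
  | cons j l ih =>
    obtain ⟨q, hq, p', hp', h⟩ := mem_cayleyComb_cons hp
    rw [h, wcount_append, wcount_append, wcount_map_base, wcount_replicate_cay, ih hp']

theorem wrho_cayleyComb_le (s : Fin d) {l : List (Fin k)} {p : ℂ × Word d r k}
    (hp : p ∈ cayleyComb R n l) :
    wrho P τ s p.2 ≤ lsum l fun j => n * (2 * (|τ j| * polySize (P j))) + polyDeg (R j) := by
  induction l generalizing p with
  | nil => simp [cayleyComb] at hp; simp [hp]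
  | cons j l ih =>
    obtain ⟨q, hq, p', hp', h⟩ := mem_cayleyComb_cons hp
    rw [h, wrho_append, wrho_append, lsum_cons]
    have h1 : (q.2.length : ℝ) ≤ polyDeg (R j) := by exact_mod_cast length_le_polyDeg hq
    have h2 := wrho_map_base_le (P := P) (τ := τ) (s := s) q.2
    have h3 := wrho_replicate_cay_le (P := P) (τ := τ) (n := n) s j
    have h4 := ih hp'
    linarith

theorem tendsto_list_prod_map {ι : Type*} {u : ι → ℕ → Matrix (Fin N) (Fin N) ℂ}
    {v : ι → Matrix (Fin N) (Fin N) ℂ} (h : ∀ i, Tendsto (u i) atTop (𝓝 (v i))) (l : List ι) :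
    Tendsto (fun n => (l.map fun i => u i n).prod) atTop (𝓝 (l.map v).prod) :=
  tendsto_list_prod l fun i _ => h i

theorem tendsto_quadForm_cayleyComb (hP : ∀ j, (P j).adjoint = P j) (hM : HermTuple M)
    (t : Fin k → ℝ) (x y : EuclideanSpace ℂ (Fin N)) :
    Tendsto (fun n : ℕ => quadForm x (combVal P (fun j => t j / (2 * n)) A E M
      (cayleyComb R n (List.finRange k))) y) atTop (𝓝 (quadForm x (expProduct P R t M A) y)) := by
  refine ((continuous_quadForm x y).tendsto _).comp ?_
  simp only [combVal_cayleyComb, expProduct, List.ofFn_eq_map]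
  exact tendsto_list_prod_map (u := fun j n => cayleyMat (t j / (2 * n)) ((P j).eval M A) ^ n *
    (R j).eval M A) (fun j => (tendsto_cayleyMat_pow (eval_isHermitian hM A (hP j)) (t j)).mul_const
      _) _

/-- The exponent of the envelope in the bound on the exponential products. -/
noncomputable def prodDeg (R : Fin k → NCPoly d r) : ℕ := lsum (List.finRange k) fun j => polyDeg (R j)

/-- The constant in the bound on the exponential products. -/
noncomputable def prodMass (R : Fin k → NCPoly d r) : ℝ :=
  ((List.finRange k).map fun j => mass (polyTerms (R j))).prod

theorem prodMass_nonneg (R : Fin k → NCPoly d r) : 0 ≤ prodMass R := by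
  refine List.prod_nonneg fun a ha => ?_
  obtain ⟨j, _, rfl⟩ := List.mem_map.1 ha
  exact mass_nonneg _

theorem norm_quadForm_cayleyComb_le (hP : ∀ j, (P j).adjoint = P j) {Λ : ℝ} (h : EnvBound A M Λ)
    {x y : EuclideanSpace ℂ (Fin N)} (hx : ‖x‖ ≤ 1) (hy : ‖y‖ ≤ 1) (n : ℕ) :
    ‖quadForm x (combVal P τ A (fun _ => 0) M (cayleyComb R n (List.finRange k))) y‖ ≤
      prodMass R * Λ ^ prodDeg R := by
  refine (norm_quadForm_combVal_le hP h hx hy (fun _ => by simp)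
    fun p hp => wdeg_cayleyComb_le hp).trans (le_of_eq ?_)
  rw [mass_cayleyComb]; rfl

theorem norm_quadForm_expProduct_le (hP : ∀ j, (P j).adjoint = P j) {Λ : ℝ} (h : EnvBound A M Λ)
    {x y : EuclideanSpace ℂ (Fin N)} (hx : ‖x‖ ≤ 1) (hy : ‖y‖ ≤ 1) (t : Fin k → ℝ) :
    ‖quadForm x (expProduct P R t M A) y‖ ≤ prodMass R * Λ ^ prodDeg R :=
  le_of_tendsto (tendsto_quadForm_cayleyComb hP h.herm t x y).norm
    (.of_forall fun n => norm_quadForm_cayleyComb_le hP h hx hy n)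

/-- Obtained as a pointwise limit of continuous functions, with the same approximation as the moment
bounds. -/
theorem measurable_quadForm_expProduct (hP : ∀ j, (P j).adjoint = P j) (t : Fin k → ℝ)
    (A : Fin r → Matrix (Fin N) (Fin N) ℂ) (x y : EuclideanSpace ℂ (Fin N)) :
    Measurable fun z : Entry d N → ℂ => quadForm x (expProduct P R t (hermOf z) A) y := by
  refine measurable_of_tendsto_metrizable (f := fun n : ℕ => fun z : Entry d N → ℂ =>
    quadForm x (combVal P (fun j => t j / (2 * n)) A (fun _ => 0) (hermOf z)
      (cayleyComb R n (List.finRange k))) y) (fun n => ?_) (tendsto_pi_nhds.2 fun z => ?_)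
  · exact (continuous_quadForm_combVal hP _ A _ continuous_hermOf (fun z => hermTuple_hermOf z)
      x y _).measurable
  · exact tendsto_quadForm_cayleyComb hP (hermTuple_hermOf z) t x y

end Approximation

section MomentBound
open scoped Matrix.Norms.L2Operator
open Filter Topology

variable {d r k N : ℕ} {P R : Fin k → NCPoly d r} {A : Fin r → Matrix (Fin N) (Fin N) ℂ}
  {x y : EuclideanSpace ℂ (Fin N)} {K : ℝ} {S : Finset (Entry d N)} {ξ : Entry d N → ℂ × ℂ}

/-! ### Moments of the increment of an exponential product -/

theorem norm_sub_pow_le_env (hK : 1 ≤ K)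
    (hA : ∀ j, ‖A j‖ ≤ K) {f : (Fin d → Matrix (Fin N) (Fin N) ℂ) → ℂ}
    (hf : ∀ M Λ, EnvBound A M Λ → ‖f M‖ ≤ prodMass R * Λ ^ prodDeg R) (p : ℕ) :
    ‖f (hermOf (pick S ξ)) - f (hermOf (pick ∅ ξ))‖ ^ p ≤
      (2 * prodMass R) ^ p * env K S ξ ^ (prodDeg R * p) := by
  have h1 := hf _ _ (envBound_pick (ξ := ξ) hK hA (.inl rfl : S = S ∨ S = ∅))
  have h2 := hf _ _ (envBound_pick (S := S) (ξ := ξ) hK hA (.inr rfl))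
  rw [pow_mul, ← mul_pow]
  refine pow_le_pow_left₀ (norm_nonneg _) ((norm_sub_le _ _).trans ?_) p
  linarith

theorem exists_moment_le (hP : ∀ j, (P j).adjoint = P j) {c : ℕ → ℝ} (hc : ∀ m, 0 ≤ c m)
    (hK : 1 ≤ K) (m : ℕ) : ∃ B : ℝ, 0 ≤ B ∧ ∀ {N : ℕ} {ρ : Entry d N → Measure (ℂ × ℂ)}
      [∀ e, IsProbabilityMeasure (ρ e)] {A : Fin r → Matrix (Fin N) (Fin N) ℂ}
      {x y : EuclideanSpace ℂ (Fin N)} {t : Fin k → ℝ} {T δ : ℝ}, 0 < N → EntryLaw ρ c →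
      (∀ j, ‖A j‖ ≤ K) → ‖x‖ ≤ 1 → ‖y‖ ≤ 1 → 1 ≤ T → (∀ j, |t j| ≤ T) → T ^ 2 / √N ≤ δ →
      (T ^ 3 / √N ≤ δ ∨
        ∀ e β, β.length = 3 → mixMoment ρ e true β = mixMoment ρ e false β) →
      ∫ ξ, ‖quadForm x (expProduct P R t (hermOf (pick Finset.univ ξ)) A) y -
        quadForm x (expProduct P R t (hermOf (pick ∅ ξ)) A) y‖ ^ (2 * (m + 1)) ∂Measure.pi ρ ≤
      B * (δ ^ (2 * (m + 1)) * N ^ 2) := by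
  set D := lsum (List.finRange k) fun j => polyDeg (P j) with hD
  set s₀ := lsum (List.finRange k) fun j => polySize (P j) with hs₀
  have hDj : ∀ j, polyDeg (P j) ≤ D := fun j =>
    List.single_le_sum (fun _ _ => Nat.zero_le _) _
      (List.mem_map_of_mem (f := fun j => polyDeg (P j)) (List.mem_finRange j))
  have hsj : ∀ j, polySize (P j) ≤ s₀ := fun j =>
    List.single_le_sum (fun a ha => by
      obtain ⟨i, _, rfl⟩ := List.mem_map.1 ha
      exact polySize_nonneg _) _
      (List.mem_map_of_mem (f := fun j => polySize (P j)) (List.mem_finRange j))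
  have hs0 : 0 ≤ s₀ := lsum_nonneg fun _ _ => polySize_nonneg _
  -- Large enough for both requirements at parameter T: the growth of words under a difference, and
  -- the mass of the words of `cayleyComb`.
  set c₁ : ℝ := 1 + D + prodDeg R + s₀ with hc₁
  have hc1 : 1 ≤ c₁ := by
    have : (0 : ℝ) ≤ D := Nat.cast_nonneg _
    have : (0 : ℝ) ≤ prodDeg R := Nat.cast_nonneg _
    linarith
  obtain ⟨C, q, hC, hctrl⟩ :=
    exists_taylorControl d D (prodDeg R) c₁ (prodMass R) hc1 (prodMass_nonneg R)
  set p := 2 * (m + 1) with hp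
  obtain ⟨Q, hQ1, hQ⟩ := exists_env_moment d hc hK ((q + 10) * p)
  obtain ⟨Q', hQ1', hQ'⟩ := exists_env_moment d hc hK (prodDeg R * p)
  set κ := momentConst c q with hκ
  have hκ1 : 1 ≤ κ := one_le_momentConst c q
  set B₁ := Real.exp ((2 * (m + 1) + 20 * (m + 1) ^ 2 * 4 ^ m) * 2 ^ p) *
    (((d + 1) * 2 ^ 14 * κ ^ 2 * C * 900 ^ q) ^ p * Q) with hB₁
  set B₂ := (2 * prodMass R) ^ p * Q' with hB₂
  have hB1 : 0 ≤ B₁ := by positivity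
  have hB2 : 0 ≤ B₂ := by have := prodMass_nonneg R; positivity
  refine ⟨B₁ + B₂, by positivity, ?_⟩
  intro N ρ _ A x y t T δ hN hρ hA hx hy hT ht hδ hθ
  have hN' : (0 : ℝ) < N := by exact_mod_cast hN
  have hs : 0 < √(N : ℝ) := Real.sqrt_pos.2 hN'
  have hδ0 : 0 ≤ δ := le_trans (by positivity) hδ
  have hX : 0 ≤ δ ^ p * (N : ℝ) ^ 2 := by positivity
  have hdom : Integrable (fun ξ => (2 * prodMass R) ^ p * env K Finset.univ ξ ^ (prodDeg R * p))
      (Measure.pi ρ) := ((hQ' hN hρ Finset.univ).1).const_mul _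
  -- If T⁴ > N then δ ≥ T²/√N ≥ 1, and bounding each term by the envelope is enough.
  rcases lt_or_ge (N : ℝ) (T ^ 4) with hTN | hTN
  · have hδ1 : 1 ≤ δ := by
      refine le_trans ?_ hδ
      rw [one_le_div hs, Real.sqrt_le_left (by positivity)]
      calc (N : ℝ) ≤ T ^ 4 := hTN.le
        _ = (T ^ 2) ^ 2 := by ring
    have h1 : (1 : ℝ) ≤ δ ^ p := one_le_pow₀ hδ1
    have hpt : ∀ ξ, ‖quadForm x (expProduct P R t (hermOf (pick Finset.univ ξ)) A) y -
        quadForm x (expProduct P R t (hermOf (pick ∅ ξ)) A) y‖ ^ p ≤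
        (2 * prodMass R) ^ p * env K Finset.univ ξ ^ (prodDeg R * p) := fun ξ =>
      norm_sub_pow_le_env hK hA (f := fun M => quadForm x (expProduct P R t M A) y)
        (fun M Λ h => norm_quadForm_expProduct_le hP h hx hy t) p
    refine (integral_mono_of_nonneg (.of_forall fun _ => by positivity) hdom
      (.of_forall hpt)).trans ?_
    rw [integral_const_mul]
    have h2 := (hQ' hN hρ Finset.univ).2
    have hpm : 0 ≤ (2 * prodMass R) ^ p := by have := prodMass_nonneg R; positivity
    calc (2 * prodMass R) ^ p * ∫ ξ, env K Finset.univ ξ ^ (prodDeg R * p) ∂Measure.pi ρ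
        ≤ (2 * prodMass R) ^ p * (Q' * N ^ 2) := mul_le_mul_of_nonneg_left h2 hpm
      _ = B₂ * (1 * N ^ 2) := by rw [hB₂]; ring
      _ ≤ B₂ * (δ ^ p * N ^ 2) := by gcongr
      _ ≤ (B₁ + B₂) * (δ ^ p * N ^ 2) := by gcongr; linarith
  · let τ : ℕ → Fin k → ℝ := fun n j => t j / (2 * n)
    let L : ℕ → List (ℂ × Word d r k) := fun n => cayleyComb R n (List.finRange k)
    let f : ℕ → (Fin d → Matrix (Fin N) (Fin N) ℂ) → ℂ := fun n M =>
      quadForm x (combVal P (τ n) A (fun _ => 0) M (L n)) y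
    have hfb : ∀ n M Λ, EnvBound A M Λ → ‖f n M‖ ≤ prodMass R * Λ ^ prodDeg R :=
      fun n M Λ h => norm_quadForm_cayleyComb_le hP h hx hy n
    -- The n Cayley factors share |t_j|; this makes all constants below independent of n.
    have hτ : ∀ n : ℕ, 0 < n → ∀ j, 2 * |τ n j| * n = |t j| := by
      intro n hn j
      have : (0 : ℝ) < n := by exact_mod_cast hn
      simp only [τ]
      rw [abs_div, abs_of_pos (by positivity : (0 : ℝ) < 2 * n)]
      field_simp
    have hdiff : ∀ n : ℕ, 0 < n → DiffBound P (τ n) D (c₁ * T) := by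
      intro n hn
      have hR0 : (0 : ℝ) ≤ prodDeg R := Nat.cast_nonneg _
      have hD0 : (0 : ℝ) ≤ D := Nat.cast_nonneg _
      have hD1 : (D : ℝ) ≤ D * T := le_mul_of_one_le_right hD0 hT
      have hexp : c₁ * T = T + D * T + prodDeg R * T + s₀ * T := by rw [hc₁]; ring
      have hRT : 0 ≤ prodDeg R * T := by positivity
      have hsT : 0 ≤ s₀ * T := by positivity
      refine ⟨hDj, fun j => ?_, by linarith⟩
      have h1 : 2 * |τ n j| ≤ T := by
        have h2 := hτ n hn j
        have h3 : (1 : ℝ) ≤ n := by exact_mod_cast hn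
        have h4 : 0 ≤ |τ n j| := abs_nonneg _
        nlinarith [ht j]
      have h5 : 2 * (|τ n j| * polySize (P j)) ≤ T * s₀ := by
        rw [← mul_assoc]
        exact mul_le_mul h1 (hsj j) (polySize_nonneg _) (by linarith)
      linarith
    have hclass : ∀ n : ℕ, 0 < n → ∀ s, InClass P (τ n) s (prodDeg R) (c₁ * T) (fun _ => 0) (L n) := by
      intro n hn s w hw
      refine ⟨wdeg_cayleyComb_le hw, (wrho_cayleyComb_le s hw).trans ?_, fun a => wcount_cayleyComb hw a⟩
      have h1 : lsum (List.finRange k) (fun j => n * (2 * (|τ n j| * polySize (P j))) +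
          (polyDeg (R j) : ℝ)) ≤ lsum (List.finRange k) (fun j => T * polySize (P j) + (polyDeg (R j) : ℝ)) := by
        refine lsum_le fun j _ => ?_
        have h2 : n * (2 * (|τ n j| * polySize (P j))) = |t j| * polySize (P j) := by
          rw [← hτ n hn j]; ring
        rw [h2]
        have := mul_le_mul_of_nonneg_right (ht j) (polySize_nonneg (P j))
        linarith
      refine h1.trans ?_
      rw [lsum_add, ← mul_lsum]
      have h3 : lsum (List.finRange k) (fun j => (polyDeg (R j) : ℝ)) = prodDeg R :=
        (map_lsum (Nat.castRingHom ℝ) _ _).symm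
      rw [h3, ← hs₀, hc₁]
      have hR0 : (0 : ℝ) ≤ prodDeg R := Nat.cast_nonneg _
      have hD0 : (0 : ℝ) ≤ D := Nat.cast_nonneg _
      nlinarith
    have hmass : ∀ n, mass (L n) ≤ prodMass R := fun n => (mass_cayleyComb _).le
    have hbound : ∀ n : ℕ, 0 < n →
        ∫ ξ, ‖f n (hermOf (pick Finset.univ ξ)) - f n (hermOf (pick ∅ ξ))‖ ^ p ∂Measure.pi ρ ≤
          (B₁ + B₂) * (δ ^ p * N ^ 2) := by
      intro n hn
      have hk := hctrl (A := A) hP hx hy hT hTN (hdiff n hn) (hclass n hn) (hmass n)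
      have hm : ∀ E L', Measurable fun z : Entry d N → ℂ =>
          quadForm x (combVal P (τ n) A E (hermOf z) L') y := fun E L' =>
        (continuous_quadForm_combVal hP _ A E continuous_hermOf (fun z => hermTuple_hermOf z)
          x y L').measurable
      have hκ3 : c 3 ≤ κ := le_momentConst c (by omega)
      have hs3 : (0 : ℝ) ≤ (1 / √N) ^ 3 := by positivity
      have key : ∀ θ : ℝ, 0 ≤ θ → θ * (T ^ 3 / √N) ≤ δ → (∀ e β, β.length = 3 →
          ‖mixMoment ρ e true β - mixMoment ρ e false β‖ ≤ 2 * κ * θ * (1 / √N) ^ 3) →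
          ∫ ξ, ‖f n (hermOf (pick Finset.univ ξ)) - f n (hermOf (pick ∅ ξ))‖ ^ p ∂Measure.pi ρ ≤
            (B₁ + B₂) * (δ ^ p * N ^ 2) := by
        intro θ hθ0 hθδ hθ'
        refine (hk.moment_le hρ hC hT hTN hK hA hδ hθ0 hθδ hθ' (hm _ _) (fun β e => hm _ _)
          (fun a β e => hm _ _) (fun S n => by
            obtain ⟨_, _, h⟩ := exists_env_moment d hc hK n
            exact (h hN hρ S).1) m (fun S => (hQ hN hρ S).2)).trans ?_
        rw [mul_pow]
        calc _ = B₁ * (δ ^ p * N ^ 2) := by rw [hB₁]; ring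
          _ ≤ _ := by gcongr; linarith
      -- The weight of third order terms is 1 in general and 0 if third moments agree.
      rcases hθ with hθ | hθ
      · refine key 1 zero_le_one (by rwa [one_mul]) fun e β hβ => ?_
        have h1 := hρ.norm_mixMoment_le e true β
        have h2 := hρ.norm_mixMoment_le e false β
        rw [hβ] at h1 h2
        have h3 := mul_le_mul_of_nonneg_right hκ3 hs3
        linarith [norm_sub_le (mixMoment ρ e true β) (mixMoment ρ e false β)]
      · refine key 0 le_rfl (by rwa [zero_mul]) fun e β hβ => ?_
        rw [hθ e β hβ, sub_self, norm_zero]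
        simp
    -- Dominated convergence as the number of Cayley factors grows, with a power of the envelope as
    -- dominating function.
    have hlim : Tendsto (fun n => ∫ ξ, ‖f n (hermOf (pick Finset.univ ξ)) -
        f n (hermOf (pick ∅ ξ))‖ ^ p ∂Measure.pi ρ) atTop
        (𝓝 (∫ ξ, ‖quadForm x (expProduct P R t (hermOf (pick Finset.univ ξ)) A) y -
        quadForm x (expProduct P R t (hermOf (pick ∅ ξ)) A) y‖ ^ p ∂Measure.pi ρ)) := by
      refine tendsto_integral_of_dominated_convergence _ (fun n => ?_) hdom
        (fun n => .of_forall fun ξ => ?_) (.of_forall fun ξ => ?_)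
      · have hc : ∀ S : Finset (Entry d N), Continuous fun ξ => f n (hermOf (pick S ξ)) := fun S =>
          (continuous_quadForm_combVal hP (τ n) A (fun _ => 0) continuous_hermOf
            (fun z => hermTuple_hermOf z) x y (L n)).comp (continuous_pick S)
        exact (((hc _).sub (hc _)).norm.pow p).measurable.aestronglyMeasurable
      · rw [norm_pow, norm_norm]
        exact norm_sub_pow_le_env hK hA (hfb n) p
      · exact (((tendsto_quadForm_cayleyComb hP (hermTuple_hermOf _) t x y).sub
          (tendsto_quadForm_cayleyComb hP (hermTuple_hermOf _) t x y)).norm).pow p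
    refine le_of_tendsto hlim ?_
    filter_upwards [eventually_gt_atTop 0] with n hn using hbound n hn

end MomentBound

section Laws

variable {Ω : Type*} [MeasurableSpace Ω] {μ : Measure Ω} {N : ℕ} {c c' : ℕ → ℝ} {ν ν' : Measure ℂ}

/-! ### Laws of the entries -/

/-- A centered law on `ℂ` whose moments, rescaled by powers of `√N`, are bounded by `c`. -/
structure CenteredLaw (N : ℕ) (c : ℕ → ℝ) (ν : Measure ℂ) : Prop where
  integrable : ∀ m, Integrable (fun z => (√(N : ℝ) * ‖z‖) ^ m) ν
  moment : ∀ m, ∫ z, (√(N : ℝ) * ‖z‖) ^ m ∂ν ≤ c m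
  mean : ∫ z, z ∂ν = 0

theorem CenteredLaw.of_map {Z : Ω → ℂ} (hZ : Measurable Z)
    (hi : ∀ m, Integrable (fun ω => (√(N : ℝ) * ‖Z ω‖) ^ m) μ)
    (hm : ∀ m, ∫ ω, (√(N : ℝ) * ‖Z ω‖) ^ m ∂μ ≤ c m) (h0 : ∫ ω, Z ω ∂μ = 0) :
    CenteredLaw N c (μ.map Z) := by
  have hmeas : ∀ m, Measurable fun z : ℂ => (√(N : ℝ) * ‖z‖) ^ m := fun m => by fun_prop
  refine ⟨fun m => ?_, fun m => ?_, ?_⟩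
  · exact (integrable_map_measure (hmeas m).aestronglyMeasurable hZ.aemeasurable).2 (hi m)
  · rw [integral_map hZ.aemeasurable (hmeas m).aestronglyMeasurable]
    exact hm m
  · rw [integral_map hZ.aemeasurable (by fun_prop)]
    exact h0

/-- A law on `ℂ` that is invariant under `z ↦ -z`. -/
def SymmetricLaw (ν : Measure ℂ) : Prop := ν.map (fun z => -z) = ν

theorem SymmetricLaw.integral_eq_zero (h : SymmetricLaw ν) {F : ℂ → ℂ} (hF : Measurable F)
    (hodd : ∀ z, F (-z) = -F z) : ∫ z, F z ∂ν = 0 := by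
  have h1 : ∫ z, F z ∂ν = -∫ z, F z ∂ν := by
    conv_lhs => rw [← h]
    rw [integral_map measurable_neg.aemeasurable hF.aestronglyMeasurable]
    simp only [hodd]
    exact integral_neg _
  exact self_eq_neg.1 h1

theorem max_pow_le_add {a b : ℝ} (ha : 0 ≤ a) (hb : 0 ≤ b) (m : ℕ) :
    max a b ^ m ≤ a ^ m + b ^ m := by
  rcases max_cases a b with h | h <;> rw [h.1]
  · exact le_add_of_nonneg_right (pow_nonneg hb m)
  · exact le_add_of_nonneg_left (pow_nonneg ha m)

/-- Pairs of independent entries built from two families of laws. -/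
theorem EntryLaw.of_prod {d : ℕ} {ν ν' : Entry d N → Measure ℂ} [∀ e, IsProbabilityMeasure (ν e)]
    [∀ e, IsProbabilityMeasure (ν' e)] (h : ∀ e, CenteredLaw N c (ν e))
    (h' : ∀ e, CenteredLaw N c' (ν' e))
    (hvar : ∀ e : Entry d N, e.2.1.1 ≠ e.2.1.2 → ∫ z, ‖z‖ ^ 2 ∂ν e = ∫ z, ‖z‖ ^ 2 ∂ν' e) :
    EntryLaw (fun e => (ν e).prod (ν' e)) fun m => c m + c' m := by
  have hle : ∀ (m : ℕ) (w : ℂ × ℂ), (√(N : ℝ) * ‖w‖) ^ m ≤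
      (√(N : ℝ) * ‖w.1‖) ^ m + (√(N : ℝ) * ‖w.2‖) ^ m := by
    intro m w
    rw [Prod.norm_def, mul_max_of_nonneg _ _ (Real.sqrt_nonneg _)]
    exact max_pow_le_add (by positivity) (by positivity) m
  have hf : ∀ e m, Integrable (fun w : ℂ × ℂ => (√(N : ℝ) * ‖w.1‖) ^ m) ((ν e).prod (ν' e)) :=
    fun e m => ((h e).integrable m).comp_fst _
  have hs : ∀ e m, Integrable (fun w : ℂ × ℂ => (√(N : ℝ) * ‖w.2‖) ^ m) ((ν e).prod (ν' e)) :=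
    fun e m => ((h' e).integrable m).comp_snd _
  have hi : ∀ e m, Integrable (fun w : ℂ × ℂ => (√(N : ℝ) * ‖w‖) ^ m) ((ν e).prod (ν' e)) := by
    intro e m
    refine ((hf e m).add (hs e m)).mono' (by fun_prop) (.of_forall fun w => ?_)
    rw [Real.norm_of_nonneg (by positivity)]
    exact hle m w
  refine ⟨hi, fun e m => ?_, fun e b => ?_, fun e he => ?_⟩
  · refine (integral_mono (hi e m) ((hf e m).add (hs e m)) (hle m)).trans ?_
    rw [integral_add' (hf e m) (hs e m), integral_fun_fst (fun z : ℂ => (√(N : ℝ) * ‖z‖) ^ m),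
      integral_fun_snd (fun z : ℂ => (√(N : ℝ) * ‖z‖) ^ m)]
    simp only [probReal_univ, one_smul]
    exact add_le_add ((h e).moment m) ((h' e).moment m)
  · cases b
    · have := integral_fun_snd (μ := ν e) (ν := ν' e) (fun z : ℂ => z)
      simpa [sel, (h' e).mean] using this
    · have := integral_fun_fst (μ := ν e) (ν := ν' e) (fun z : ℂ => z)
      simpa [sel, (h e).mean] using this
  · have h1 := integral_fun_fst (μ := ν e) (ν := ν' e) (fun z : ℂ => ‖z‖ ^ 2)
    have h2 := integral_fun_snd (μ := ν e) (ν := ν' e) (fun z : ℂ => ‖z‖ ^ 2)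
    simp only [probReal_univ, one_smul] at h1 h2
    simp only [sel, if_true, Bool.false_eq_true, if_false]
    rw [h1, h2, hvar e he]

theorem zmon_entryCoeff_neg {d : ℕ} (e : Entry d N) (z : ℂ) (β : List Bool) :
    zmon (entryCoeff e (-z)) β = (-1) ^ β.length * zmon (entryCoeff e z) β := by
  have h : ∀ a, entryCoeff e (-z) a = -1 * entryCoeff e z a := by
    intro a
    unfold entryCoeff
    split_ifs <;> simp
  induction β with
  | nil => simp [zmon]
  | cons a β ih =>
    simp only [zmon, List.map_cons, List.prod_cons, List.length_cons] at ih ⊢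
    rw [ih, h]
    ring

/-- Moments of odd order of a symmetric law vanish; here those of order three, which are thus equal
for the two families. -/
theorem mixMoment_prod_eq_zero {d : ℕ} {ν ν' : Entry d N → Measure ℂ}
    [∀ e, IsProbabilityMeasure (ν e)] [∀ e, IsProbabilityMeasure (ν' e)]
    (h : ∀ e, SymmetricLaw (ν e)) (h' : ∀ e, SymmetricLaw (ν' e)) (e : Entry d N) (b : Bool)
    {β : List Bool} (hβ : β.length = 3) :
    mixMoment (fun e => (ν e).prod (ν' e)) e b β = 0 := by
  have hm : Measurable fun z : ℂ => zmon (entryCoeff e z) β := by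
    have : ∀ a, Measurable fun z : ℂ => entryCoeff e z a := by
      intro a
      unfold entryCoeff
      split_ifs <;> fun_prop
    unfold zmon
    have hl : ∀ l : List Bool, Measurable fun z : ℂ => (l.map (entryCoeff e z)).prod := by
      intro l
      induction l with
      | nil => simp
      | cons a l ih =>
        simp only [List.map_cons, List.prod_cons]
        exact (this a).mul ih
    exact hl β
  have hodd : ∀ z, zmon (entryCoeff e (-z)) β = -zmon (entryCoeff e z) β := by
    intro z
    rw [zmon_entryCoeff_neg, hβ]
    ring
  unfold mixMoment
  cases b
  · have := integral_fun_snd (μ := ν e) (ν := ν' e) (fun z : ℂ => zmon (entryCoeff e z) β)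
    simpa [sel, (h' e).integral_eq_zero hm hodd] using this
  · have := integral_fun_fst (μ := ν e) (ν := ν' e) (fun z : ℂ => zmon (entryCoeff e z) β)
    simpa [sel, (h e).integral_eq_zero hm hodd] using this

/-! ### Wigner matrices -/

theorem IsWigner.exists_centeredLaw {Ω : ℕ → Type*} [∀ N, MeasurableSpace (Ω N)]
    {μ : ∀ N, Measure (Ω N)} {Y : ∀ N, Ω N → Matrix (Fin N) (Fin N) ℂ} (h : IsWigner μ Y) :
    ∃ c : ℕ → ℝ, (∀ m, 0 ≤ c m) ∧
      ∀ N i j, CenteredLaw N c ((μ N).map fun ω => Y N ω i j) := by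
  refine ⟨fun m => (⨆ (N : ℕ) (i : Fin N) (j : Fin N),
    ∫⁻ ω, ‖(√(N : ℝ) : ℂ) * Y N ω i j‖ₑ ^ m ∂(μ N)).toReal, fun m => ENNReal.toReal_nonneg, ?_⟩
  intro N i j
  have hZ := (h.wigner N).measurable i j
  have hle : ∀ m, ∫⁻ ω, ‖(√(N : ℝ) : ℂ) * Y N ω i j‖ₑ ^ m ∂(μ N) ≤
      ⨆ (N : ℕ) (i : Fin N) (j : Fin N), ∫⁻ ω, ‖(√(N : ℝ) : ℂ) * Y N ω i j‖ₑ ^ m ∂(μ N) := fun m =>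
    le_iSup_of_le N (le_iSup_of_le i (le_iSup_of_le j le_rfl))
  have henorm : ∀ (m : ℕ) ω, ‖(√(N : ℝ) * ‖Y N ω i j‖) ^ m‖ₑ =
      ‖(√(N : ℝ) : ℂ) * Y N ω i j‖ₑ ^ m := by
    intro m ω
    rw [enorm_pow, enorm_mul, enorm_mul, enorm_norm]
    congr 2
    rw [← enorm_norm (√(N : ℝ) : ℂ), Complex.norm_real, enorm_norm]
  have hmeas : ∀ m : ℕ, Measurable fun ω => (√(N : ℝ) * ‖Y N ω i j‖) ^ m := fun m => by fun_prop
  refine CenteredLaw.of_map hZ (fun m => ⟨(hmeas m).aestronglyMeasurable, ?_⟩) (fun m => ?_)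
    ((h.wigner N).centered i j)
  · rw [HasFiniteIntegral]
    simp only [henorm]
    exact (hle m).trans_lt (h.moments m)
  · have h1 := norm_integral_le_lintegral_norm (μ := μ N) fun ω => (√(N : ℝ) * ‖Y N ω i j‖) ^ m
    refine (le_abs_self _).trans (h1.trans ?_)
    simp only [ofReal_norm, henorm]
    exact ENNReal.toReal_mono (h.moments m).ne (hle m)

/-! ### Gaussian matrices -/

/-- Absolute moments of the standard Gaussian law. -/
noncomputable def gaussMoment (m : ℕ) : ℝ := ∫ x, |x| ^ m ∂gaussianReal 0 1

theorem gaussMoment_nonneg (m : ℕ) : 0 ≤ gaussMoment m := integral_nonneg fun _ => by positivity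

theorem integrable_abs_pow_gaussian {G : Ω → ℝ} (hG : HasLaw G (gaussianReal 0 1) μ) (m : ℕ) :
    Integrable (fun ω => |G ω| ^ m) μ ∧ ∫ ω, |G ω| ^ m ∂μ = gaussMoment m := by
  have hmeas : Measurable fun x : ℝ => |x| ^ m := by fun_prop
  have h1 : Integrable (fun x : ℝ => |x| ^ m) (gaussianReal 0 1) := by
    rcases Nat.eq_zero_or_pos m with rfl | hm
    · simp
    · have h2 := (memLp_id_gaussianReal' (μ := 0) (v := 1) m (by simp)).integrable_norm_pow hm.ne'
      simpa using h2
  rw [← hG.map_eq] at h1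
  refine ⟨(integrable_map_measure hmeas.aestronglyMeasurable hG.aemeasurable).1 h1, ?_⟩
  rw [gaussMoment, ← hG.map_eq, integral_map hG.aemeasurable hmeas.aestronglyMeasurable]

/-- An off-diagonal entry involves two Gaussian coordinates. For a diagonal one, the same coordinate
may be used twice. -/
theorem centeredLaw_of_gaussian {Z : Ω → ℂ} (hZ : Measurable Z) {G G' : Ω → ℝ}
    (hG : HasLaw G (gaussianReal 0 1) μ) (hG' : HasLaw G' (gaussianReal 0 1) μ)
    (hle : ∀ᵐ ω ∂μ, √(N : ℝ) * ‖Z ω‖ ≤ |G ω| + |G' ω|) (hs : SymmetricLaw (μ.map Z)) :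
    CenteredLaw N (fun m => 2 ^ m * (gaussMoment m + gaussMoment m)) (μ.map Z) := by
  have hb : ∀ m : ℕ, ∀ᵐ ω ∂μ, (√(N : ℝ) * ‖Z ω‖) ^ m ≤ 2 ^ m * (|G ω| ^ m + |G' ω| ^ m) := by
    intro m
    filter_upwards [hle] with ω hω
    refine (pow_le_pow_left₀ (by positivity) hω m).trans
      ((add_pow_le (abs_nonneg _) (abs_nonneg _) m).trans ?_)
    gcongr
    · norm_num
    · omega
  have hi : ∀ m : ℕ, Integrable (fun ω => 2 ^ m * (|G ω| ^ m + |G' ω| ^ m)) μ := fun m =>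
    ((integrable_abs_pow_gaussian hG m).1.add (integrable_abs_pow_gaussian hG' m).1).const_mul _
  have hint : ∀ m, Integrable (fun ω => (√(N : ℝ) * ‖Z ω‖) ^ m) μ := by
    intro m
    refine (hi m).mono' (by fun_prop) ?_
    filter_upwards [hb m] with ω hω
    rwa [Real.norm_of_nonneg (by positivity)]
  refine CenteredLaw.of_map hZ hint (fun m => ?_) ?_
  · refine (integral_mono_ae (hint m) (hi m) (hb m)).trans (le_of_eq ?_)
    rw [integral_const_mul, integral_add (integrable_abs_pow_gaussian hG m).1
      (integrable_abs_pow_gaussian hG' m).1, (integrable_abs_pow_gaussian hG m).2,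
      (integrable_abs_pow_gaussian hG' m).2]
  · have := hs.integral_eq_zero measurable_id fun z => rfl
    rwa [integral_map hZ.aemeasurable (by fun_prop)] at this

theorem map_neg_gaussian : (gaussianReal 0 1).map (fun x => -x) = gaussianReal 0 1 := by
  rw [gaussianReal_map_neg, neg_zero]

theorem symmetricLaw_of_gaussian {Z : Ω → ℂ} {G : Ω → ℝ} (hG : HasLaw G (gaussianReal 0 1) μ)
    {u : ℂ} (h : ∀ᵐ ω ∂μ, Z ω = u * G ω) : SymmetricLaw (μ.map Z) := by
  have hu : Measurable fun x : ℝ => u * (x : ℂ) := by fun_prop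
  have h1 : μ.map Z = (gaussianReal 0 1).map fun x : ℝ => u * (x : ℂ) := by
    rw [Measure.map_congr h, ← hG.map_eq, AEMeasurable.map_map_of_aemeasurable hu.aemeasurable
      hG.aemeasurable]
    rfl
  rw [SymmetricLaw, h1, Measure.map_map measurable_neg hu]
  conv_rhs => rw [← map_neg_gaussian, Measure.map_map hu measurable_neg]
  congr 1
  ext x
  simp

/-- Independence is what makes the joint law of the coordinates invariant under a simultaneous
change of sign; it is a product of symmetric laws. -/
theorem symmetricLaw_of_gaussian_pair [IsProbabilityMeasure μ] {Z : Ω → ℂ} {G G' : Ω → ℝ}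
    (hG : HasLaw G (gaussianReal 0 1) μ) (hG' : HasLaw G' (gaussianReal 0 1) μ)
    (hind : IndepFun G G' μ) {u v : ℂ} (h : ∀ᵐ ω ∂μ, Z ω = u * G ω + v * G' ω) :
    SymmetricLaw (μ.map Z) := by
  have hu : Measurable fun x : ℝ × ℝ => u * (x.1 : ℂ) + v * (x.2 : ℂ) := by fun_prop
  have hlaw : μ.map (fun ω => (G ω, G' ω)) = (gaussianReal 0 1).prod (gaussianReal 0 1) := by
    rw [(indepFun_iff_map_prod_eq_prod_map_map hG.aemeasurable hG'.aemeasurable).1 hind,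
      hG.map_eq, hG'.map_eq]
  have h1 : μ.map Z = ((gaussianReal 0 1).prod (gaussianReal 0 1)).map
      fun x : ℝ × ℝ => u * (x.1 : ℂ) + v * (x.2 : ℂ) := by
    rw [Measure.map_congr h, ← hlaw, AEMeasurable.map_map_of_aemeasurable hu.aemeasurable
      (hG.aemeasurable.prodMk hG'.aemeasurable)]
    rfl
  have hn : ((gaussianReal 0 1).prod (gaussianReal 0 1)).map
      (Prod.map (fun x => -x) fun x => -x) = (gaussianReal 0 1).prod (gaussianReal 0 1) := by
    rw [← Measure.map_prod_map _ _ measurable_neg measurable_neg, map_neg_gaussian]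
  rw [SymmetricLaw, h1, Measure.map_map measurable_neg hu]
  conv_rhs => rw [← hn, Measure.map_map hu (measurable_neg.prodMap measurable_neg)]
  congr 1
  ext x
  simp [add_comm]

end Laws

section GaussianMatrices

variable {Ω : Type*} [MeasurableSpace Ω] {μ : Measure Ω} {N : ℕ}
  {X : Ω → Matrix (Fin N) (Fin N) ℂ}

/-! ### Entries of Gaussian matrices -/

theorem im_diag_eq_zero {M : Matrix (Fin N) (Fin N) ℂ} (hM : M.IsHermitian) (i : Fin N) :
    (M i i).im = 0 := Complex.conj_eq_iff_im.1 (hM.apply i i)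

theorem gaussMoment_two : gaussMoment 2 = 1 := by
  have h := variance_id_gaussianReal (μ := 0) (v := 1)
  rw [variance_of_integral_eq_zero aemeasurable_id (by simp)] at h
  simpa [gaussMoment] using h

theorem IsGUE.diag_eq (h : IsGUE μ X) (hN : 0 < N) (i : Fin N) :
    ∀ᵐ ω ∂μ, X ω i i = ((√(N : ℝ))⁻¹ : ℂ) * (gueCoord (X ω) (.inl i) : ℂ) := by
  have hs : (√(N : ℝ) : ℂ) ≠ 0 := by
    exact_mod_cast (Real.sqrt_pos.2 (Nat.cast_pos.2 hN)).ne'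
  filter_upwards [h.hermitian] with ω hω
  have h0 := im_diag_eq_zero hω i
  rw [gueCoord, Complex.ofReal_mul, inv_mul_cancel_left₀ hs]
  exact Complex.ext rfl (by simpa using h0)

theorem upper_eq_gueCoord (hN : 0 < N) (M : Matrix (Fin N) (Fin N) ℂ) (p : UpperPair N) :
    M p.1.1 p.1.2 = ((√(2 * (N : ℝ)))⁻¹ : ℂ) * (gueCoord M (.inr (.inl p)) : ℂ) +
      ((√(2 * (N : ℝ)))⁻¹ * Complex.I : ℂ) * (gueCoord M (.inr (.inr p)) : ℂ) := by
  have hs : (√(2 * (N : ℝ)) : ℂ) ≠ 0 := by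
    have : 0 < 2 * (N : ℝ) := by positivity
    exact_mod_cast (Real.sqrt_pos.2 this).ne'
  have h : ∀ b : ℂ, ((√(2 * (N : ℝ)))⁻¹ * Complex.I : ℂ) * ((√(2 * (N : ℝ)) : ℂ) * b) =
      b * Complex.I := fun b => by
    rw [Complex.ofReal_inv]
    field_simp
  simp only [gueCoord, Complex.ofReal_mul]
  rw [inv_mul_cancel_left₀ hs, h]
  exact (Complex.re_add_im _).symm

theorem IsGUE.symmetricLaw [IsProbabilityMeasure μ] (h : IsGUE μ X) (hN : 0 < N)
    {i j : Fin N} (hij : i ≤ j) : SymmetricLaw (μ.map fun ω => X ω i j) := by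
  rcases hij.eq_or_lt with rfl | hlt
  · exact symmetricLaw_of_gaussian (h.gaussian (.inl i)) (h.diag_eq hN i)
  · exact symmetricLaw_of_gaussian_pair (h.gaussian (.inr (.inl ⟨(i, j), hlt⟩)))
      (h.gaussian (.inr (.inr ⟨(i, j), hlt⟩))) (h.indep.indepFun (by simp))
      (.of_forall fun ω => upper_eq_gueCoord hN (X ω) ⟨(i, j), hlt⟩)

theorem IsGUE.centeredLaw [IsProbabilityMeasure μ] (h : IsGUE μ X) (hN : 0 < N)
    {i j : Fin N} (hij : i ≤ j) :
    CenteredLaw N (fun m => 2 ^ m * (gaussMoment m + gaussMoment m)) (μ.map fun ω => X ω i j) := by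
  have hs : 0 < √(N : ℝ) := Real.sqrt_pos.2 (Nat.cast_pos.2 hN)
  rcases hij.eq_or_lt with rfl | hlt
  · refine centeredLaw_of_gaussian (h.measurable i i) (h.gaussian (.inl i)) (h.gaussian (.inl i)) ?_
      (h.symmetricLaw hN le_rfl)
    filter_upwards [h.diag_eq hN i] with ω hω
    rw [hω, norm_mul, ← Complex.ofReal_inv, Complex.norm_real, Complex.norm_real, norm_inv,
      Real.norm_of_nonneg hs.le, mul_inv_cancel_left₀ hs.ne', Real.norm_eq_abs]
    linarith [abs_nonneg (gueCoord (X ω) (.inl i))]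
  · refine centeredLaw_of_gaussian (h.measurable i j) (h.gaussian (.inr (.inl ⟨(i, j), hlt⟩)))
      (h.gaussian (.inr (.inr ⟨(i, j), hlt⟩))) (.of_forall fun ω => ?_) (h.symmetricLaw hN hij)
    have h1 : √(N : ℝ) ≤ √(2 * (N : ℝ)) := Real.sqrt_le_sqrt (by linarith [Nat.cast_nonneg (α := ℝ) N])
    simp only [gueCoord, abs_mul, abs_of_nonneg (Real.sqrt_nonneg _)]
    rw [← mul_add]
    exact mul_le_mul h1 (Complex.norm_le_abs_re_add_abs_im _) (norm_nonneg _) (Real.sqrt_nonneg _)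

theorem IsGUE.integral_norm_sq (h : IsGUE μ X) (hN : 0 < N) {i j : Fin N} (hij : i < j) :
    ∫ ω, ‖X ω i j‖ ^ 2 ∂μ = 1 / (N : ℝ) := by
  have hN' : (0 : ℝ) < N := Nat.cast_pos.2 hN
  have h1 := integrable_abs_pow_gaussian (h.gaussian (.inr (.inl ⟨(i, j), hij⟩))) 2
  have h2 := integrable_abs_pow_gaussian (h.gaussian (.inr (.inr ⟨(i, j), hij⟩))) 2
  have heq : ∀ ω, ‖X ω i j‖ ^ 2 = (2 * (N : ℝ))⁻¹ *
      (|gueCoord (X ω) (.inr (.inl ⟨(i, j), hij⟩))| ^ 2 +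
        |gueCoord (X ω) (.inr (.inr ⟨(i, j), hij⟩))| ^ 2) := by
    intro ω
    simp only [gueCoord, sq_abs, mul_pow, Real.sq_sqrt (by positivity : 0 ≤ 2 * (N : ℝ))]
    rw [← Complex.normSq_eq_norm_sq, Complex.normSq_apply]
    field_simp
  simp only [heq]
  rw [integral_const_mul, integral_add h1.1 h2.1, h1.2, h2.2, gaussMoment_two]
  field_simp
  norm_num

theorem IsGOE.symmetricLaw (h : IsGOE μ X) (hN : 0 < N) {i j : Fin N} (hij : i ≤ j) :
    SymmetricLaw (μ.map fun ω => X ω i j) := by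
  have hN' : (0 : ℝ) < N := Nat.cast_pos.2 hN
  rcases hij.eq_or_lt with rfl | hlt
  · have hs : (√((N : ℝ) / 2) : ℂ) ≠ 0 := by
      exact_mod_cast (Real.sqrt_pos.2 (by positivity : 0 < (N : ℝ) / 2)).ne'
    refine symmetricLaw_of_gaussian (h.gaussian (.inl i)) (u := (√((N : ℝ) / 2))⁻¹) ?_
    filter_upwards [h.symmetric] with ω hω
    rw [goeCoord, Complex.ofReal_mul, inv_mul_cancel_left₀ hs]
    exact Complex.ext rfl (by simpa using hω.2 i i)
  · have hs : (√(N : ℝ) : ℂ) ≠ 0 := by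
      exact_mod_cast (Real.sqrt_pos.2 hN').ne'
    refine symmetricLaw_of_gaussian (h.gaussian (.inr ⟨(i, j), hlt⟩)) (u := (√(N : ℝ))⁻¹) ?_
    filter_upwards [h.symmetric] with ω hω
    rw [goeCoord, Complex.ofReal_mul, inv_mul_cancel_left₀ hs]
    exact Complex.ext rfl (by simpa using hω.2 i j)

/-! ### Independence of the entries of a GUE matrix -/

/-- Independence passes to groups of variables: the joint law is a product, and currying the index
identifies it with the product over groups of the laws of the groups. -/
theorem iIndepFun_curry {Ω : Type*} [MeasurableSpace Ω] {μ : Measure Ω} [IsProbabilityMeasure μ]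
    {ι : Type*} {κ : ι → Type*} {Z : (i : ι) → κ i → Ω → ℝ}
    (hZ : ∀ i j, Measurable (Z i j)) (h : iIndepFun (fun (p : (i : ι) × κ i) => Z p.1 p.2) μ) :
    iIndepFun (fun i ω j => Z i j ω) μ := by
  have : ∀ i j, IsProbabilityMeasure (μ.map (Z i j)) :=
    fun i j => Measure.isProbabilityMeasure_map (hZ i j).aemeasurable
  have hrow : ∀ i, μ.map (fun ω j => Z i j ω) = Measure.infinitePi fun j => μ.map (Z i j) := by
    intro i
    exact (iIndepFun_iff_map_fun_eq_infinitePi_map (hZ i)).1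
      (h.precomp (g := Sigma.mk i) sigma_mk_injective)
  rw [iIndepFun_iff_map_fun_eq_infinitePi_map fun i => measurable_pi_lambda _ (hZ i)]
  simp only [hrow]
  rw [← Measure.infinitePi_map_piCurry (fun i j => μ.map (Z i j)),
    ← (iIndepFun_iff_map_fun_eq_infinitePi_map fun p : (i : ι) × κ i => hZ p.1 p.2).1 h]
  exact (Measure.map_map (MeasurableEquiv.piCurry fun (i : ι) (_ : κ i) => ℝ).measurable
    (measurable_pi_lambda (fun ω (p : (i : ι) × κ i) => Z p.1 p.2 ω) fun p => hZ p.1 p.2)).symm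

/-- The indices of the real coordinates attached to an entry: one on the diagonal, two above. -/
abbrev CoordIndex (p : {p : Fin N × Fin N // p.1 ≤ p.2}) : Type :=
  {b : Bool // b = true → p.1.1 < p.1.2}

/-- The position of a coordinate of an entry in the list of all normalized coordinates. -/
def coordOf (q : (p : {p : Fin N × Fin N // p.1 ≤ p.2}) × CoordIndex p) :
    Fin N ⊕ (UpperPair N ⊕ UpperPair N) :=
  if hb : q.2.1 = true then .inr (.inr ⟨q.1.1, q.2.2 hb⟩)
  else if hlt : q.1.1.1 < q.1.1.2 then .inr (.inl ⟨q.1.1, hlt⟩)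
  else .inl q.1.1.1

/-- Distinct entries use disjoint sets of coordinates, so grouping the coordinates by entry loses no
independence. -/
theorem coordOf_injective : Function.Injective (coordOf (N := N)) := by
  rintro ⟨⟨⟨i, j⟩, hp⟩, ⟨b, hb⟩⟩ ⟨⟨⟨i', j'⟩, hp'⟩, ⟨b', hb'⟩⟩ h
  have key : (i, j) = (i', j') ∧ b = b' := by
    unfold coordOf at h
    cases b <;> cases b' <;> simp at h hb hb' hp hp' ⊢
    · split_ifs at h with h1 h2 h2
      · simpa using h
      · have hi : i = j := le_antisymm hp (not_lt.1 h1)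
        have hi' : i' = j' := le_antisymm hp' (not_lt.1 h2)
        simp at h
        exact ⟨h, by rw [← hi, ← hi', h]⟩
    · split_ifs at h
      simp at h
    · split_ifs at h
      simp at h
    · exact h
  obtain ⟨h1, rfl⟩ := key
  simp only [Prod.mk.injEq] at h1
  obtain ⟨rfl, rfl⟩ := h1
  rfl

theorem measurable_gueCoord (h : ∀ i j, Measurable fun ω => X ω i j)
    (c : Fin N ⊕ (UpperPair N ⊕ UpperPair N)) : Measurable fun ω => gueCoord (X ω) c := by
  rcases c with i | p | p
  · exact (Complex.measurable_re.comp (h i i)).const_mul _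
  · exact (Complex.measurable_re.comp (h _ _)).const_mul _
  · exact (Complex.measurable_im.comp (h _ _)).const_mul _

/-- An entry in terms of its normalized real coordinates. -/
noncomputable def entryOfCoord (p : {p : Fin N × Fin N // p.1 ≤ p.2}) (v : CoordIndex p → ℝ) : ℂ :=
  if h : p.1.1 < p.1.2 then
    ((√(2 * (N : ℝ)))⁻¹ : ℂ) * (v ⟨false, by simp⟩ : ℂ) +
      ((√(2 * (N : ℝ)))⁻¹ * Complex.I : ℂ) * (v ⟨true, fun _ => h⟩ : ℂ)
  else ((√(N : ℝ))⁻¹ : ℂ) * (v ⟨false, by simp⟩ : ℂ)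

theorem measurable_entryOfCoord (p : {p : Fin N × Fin N // p.1 ≤ p.2}) :
    Measurable (entryOfCoord p) := by
  unfold entryOfCoord
  split_ifs <;> fun_prop

/-- Each entry is a function of its own group of coordinates, almost surely on the diagonal since a
diagonal entry is real only where the matrix is Hermitian. -/
theorem IsGUE.iIndepFun_entries [IsProbabilityMeasure μ] (h : IsGUE μ X) (hN : 0 < N) :
    iIndepFun (fun (p : {p : Fin N × Fin N // p.1 ≤ p.2}) ω => X ω p.1.1 p.1.2) μ := by
  have h1 := h.indep.precomp coordOf_injective
  have h2 := iIndepFun_curry (Z := fun p (b : CoordIndex p) ω => gueCoord (X ω) (coordOf ⟨p, b⟩))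
    (fun p b => measurable_gueCoord h.measurable _) h1
  refine (iIndepFun_congr fun p => ?_).1 (h2.comp entryOfCoord measurable_entryOfCoord)
  obtain ⟨⟨i, j⟩, hp⟩ := p
  rcases (show i ≤ j from hp).eq_or_lt with rfl | hlt
  · filter_upwards [h.diag_eq hN i] with ω hω
    simpa [entryOfCoord, coordOf] using hω.symm
  · refine .of_forall fun ω => ?_
    have := upper_eq_gueCoord hN (X ω) ⟨(i, j), hlt⟩
    simpa [entryOfCoord, coordOf, hlt] using this.symm

end GaussianMatrices

section JointLaw

variable {Ω : Type*} [MeasurableSpace Ω] {μ : Measure Ω} {d N : ℕ}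

/-! ### Joint law of two families of matrices -/

/-- The independent entries of a tuple of Hermitian matrices. -/
def upperEntries (M : Fin d → Matrix (Fin N) (Fin N) ℂ) : Entry d N → ℂ :=
  fun e => M e.1 e.2.1.1 e.2.1.2

theorem hermOf_upperEntries {M : Fin d → Matrix (Fin N) (Fin N) ℂ} (hM : HermTuple M) :
    hermOf (upperEntries M) = M := by
  funext s i j
  unfold hermOf upperEntries
  split_ifs with h h'
  · rfl
  · exact (hM s).apply i j
  · obtain rfl : i = j := le_antisymm (not_lt.1 h') (not_lt.1 h)
    exact Complex.ext rfl (by simpa using (im_diag_eq_zero (hM s) i).symm)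

/-- Two independent families, each with independent members, have independent pairs. This places
both tuples of matrices on one product space, where single positions can be resampled. -/
theorem map_pair_eq_pi [IsProbabilityMeasure μ] {ι : Type*} [Fintype ι] {U V : ι → Ω → ℂ} (hU : ∀ i, Measurable (U i))
    (hV : ∀ i, Measurable (V i)) (hUi : iIndepFun U μ) (hVi : iIndepFun V μ)
    (hUV : IndepFun (fun ω i => U i ω) (fun ω i => V i ω) μ) :
    μ.map (fun ω i => (U i ω, V i ω)) =
      Measure.pi fun i => (μ.map (U i)).prod (μ.map (V i)) := by
  have : ∀ i, IsProbabilityMeasure (μ.map (U i)) :=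
    fun i => Measure.isProbabilityMeasure_map (hU i).aemeasurable
  have : ∀ i, IsProbabilityMeasure (μ.map (V i)) :=
    fun i => Measure.isProbabilityMeasure_map (hV i).aemeasurable
  have hU' : Measurable fun ω i => U i ω := measurable_pi_lambda _ hU
  have hV' : Measurable fun ω i => V i ω := measurable_pi_lambda _ hV
  have h := (measurePreserving_arrowProdEquivProdArrow ℂ ℂ ι (fun i => μ.map (U i))
    fun i => μ.map (V i)).symm
  rw [← h.map_eq, ← (iIndepFun_iff_map_fun_eq_pi_map fun i => (hU i).aemeasurable).1 hUi,
    ← (iIndepFun_iff_map_fun_eq_pi_map fun i => (hV i).aemeasurable).1 hVi,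
    ← (indepFun_iff_map_prod_eq_prod_map_map hU'.aemeasurable hV'.aemeasurable).1 hUV,
    Measure.map_map (MeasurableEquiv.measurable _) (hU'.prodMk hV')]
  rfl

theorem iIndepFun_upperEntries {Y : Fin d → Ω → Matrix (Fin N) (Fin N) ℂ}
    (hm : ∀ s i j, Measurable fun ω => Y s ω i j)
    (h : iIndepFun (fun s ω => entries (Y s ω)) μ)
    (h' : ∀ s, iIndepFun (fun (p : {p : Fin N × Fin N // p.1 ≤ p.2}) ω => Y s ω p.1.1 p.1.2) μ) :
    iIndepFun (fun (e : Entry d N) ω => Y e.1 ω e.2.1.1 e.2.1.2) μ := by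
  refine iIndepFun_uncurry' (X := fun s (p : {p : Fin N × Fin N // p.1 ≤ p.2}) ω =>
    Y s ω p.1.1 p.1.2) (fun s p => hm s _ _) ?_ h'
  exact h.comp (fun _ (v : Fin N × Fin N → ℂ) (p : {p : Fin N × Fin N // p.1 ≤ p.2}) => v p.1)
    fun _ => by fun_prop

/-! ### Comparison with an expectation -/

/-- For fixed a, Jensen's inequality for the convex function z ↦ |z - a|^n bounds the distance from
a to the mean of V; independence allows integrating a over the law of U. -/
theorem integral_norm_sub_integral_pow_le [IsProbabilityMeasure μ] {U V : Ω → ℂ} (hU : Measurable U) (hV : Measurable V)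
    (hUV : IndepFun U V μ) {n : ℕ} (hUn : Integrable (fun ω => ‖U ω‖ ^ n) μ)
    (hVn : Integrable (fun ω => ‖V ω‖ ^ n) μ) (hV1 : Integrable V μ) :
    Integrable (fun ω => ‖U ω - ∫ ω', V ω' ∂μ‖ ^ n) μ ∧
    ∫ ω, ‖U ω - ∫ ω', V ω' ∂μ‖ ^ n ∂μ ≤ ∫ ω, ‖U ω - V ω‖ ^ n ∂μ := by
  have hpow : ∀ a b : ℂ, ‖a - b‖ ^ n ≤ 2 ^ n * (‖a‖ ^ n + ‖b‖ ^ n) := by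
    intro a b
    refine (pow_le_pow_left₀ (norm_nonneg _) (norm_sub_le a b) n).trans
      ((add_pow_le (norm_nonneg _) (norm_nonneg _) n).trans ?_)
    gcongr
    · norm_num
    · omega
  have hi : ∀ a, Integrable (fun ω => ‖a - V ω‖ ^ n) μ := fun a =>
    (((integrable_const (‖a‖ ^ n)).add hVn).const_mul (2 ^ n)).mono' (by fun_prop)
      (.of_forall fun ω => by
        rw [Real.norm_of_nonneg (by positivity)]
        exact hpow _ _)
  have hi' : ∀ b, Integrable (fun ω => ‖U ω - b‖ ^ n) μ := fun b =>
    ((hUn.add (integrable_const (‖b‖ ^ n))).const_mul (2 ^ n)).mono' (by fun_prop)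
      (.of_forall fun ω => by
        rw [Real.norm_of_nonneg (by positivity)]
        exact hpow _ _)
  have hi2 : Integrable (fun ω => ‖U ω - V ω‖ ^ n) μ :=
    ((hUn.add hVn).const_mul (2 ^ n)).mono' (by fun_prop)
      (.of_forall fun ω => by
        rw [Real.norm_of_nonneg (by positivity)]
        exact hpow _ _)
  refine ⟨hi' _, ?_⟩
  have hjensen : ∀ a : ℂ, ‖a - ∫ ω', V ω' ∂μ‖ ^ n ≤ ∫ ω', ‖a - V ω'‖ ^ n ∂μ := by
    intro a
    have hconv : ConvexOn ℝ Set.univ fun z : ℂ => dist z a ^ n :=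
      (convexOn_dist a convex_univ).pow (fun _ _ => dist_nonneg) n
    have h := hconv.map_integral_le (f := V) (μ := μ) (by fun_prop) isClosed_univ
      (.of_forall fun _ => Set.mem_univ _) hV1
      (by simpa [Function.comp_def, dist_eq_norm, norm_sub_rev] using hi a)
    simpa [dist_eq_norm, norm_sub_rev] using h
  have hlaw := (indepFun_iff_map_prod_eq_prod_map_map hU.aemeasurable hV.aemeasurable).1 hUV
  have : IsProbabilityMeasure (μ.map U) := Measure.isProbabilityMeasure_map hU.aemeasurable
  have : IsProbabilityMeasure (μ.map V) := Measure.isProbabilityMeasure_map hV.aemeasurable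
  have hF : Measurable fun w : ℂ × ℂ => ‖w.1 - w.2‖ ^ n := by fun_prop
  have hFi : Integrable (fun w : ℂ × ℂ => ‖w.1 - w.2‖ ^ n) ((μ.map U).prod (μ.map V)) := by
    rw [← hlaw]
    exact (integrable_map_measure hF.aestronglyMeasurable (hU.prodMk hV).aemeasurable).2 hi2
  have h1 : ∫ ω, ‖U ω - V ω‖ ^ n ∂μ = ∫ ω, ∫ ω', ‖U ω - V ω'‖ ^ n ∂μ ∂μ := by
    have h2 := integral_map (μ := μ) (hU.prodMk hV).aemeasurable
      (hF.aestronglyMeasurable (μ := μ.map fun ω => (U ω, V ω)))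
    rw [← h2, hlaw, integral_prod _ hFi, integral_map hU.aemeasurable
      hFi.integral_prod_left.aestronglyMeasurable]
    refine integral_congr_ae (.of_forall fun ω => ?_)
    exact integral_map hV.aemeasurable (by fun_prop)
  have h3 : Integrable (fun ω => ∫ ω', ‖U ω - V ω'‖ ^ n ∂μ) μ := by
    have h4 := (integrable_map_measure hFi.integral_prod_left.aestronglyMeasurable
      hU.aemeasurable).1 hFi.integral_prod_left
    refine h4.congr (.of_forall fun ω => ?_)
    exact integral_map hV.aemeasurable (by fun_prop)
  rw [h1]
  exact integral_mono (hi' _) h3 fun ω => hjensen (U ω)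

theorem measureReal_le_of_moment [IsFiniteMeasure μ] {Z : Ω → ℂ} {n : ℕ} (hZ : Integrable (fun ω => ‖Z ω‖ ^ n) μ)
    {a : ℝ} (ha : 0 < a) : μ.real {ω | a ≤ ‖Z ω‖} ≤ (∫ ω, ‖Z ω‖ ^ n ∂μ) / a ^ n := by
  rw [le_div_iff₀ (by positivity), mul_comm]
  refine le_trans ?_ (mul_meas_ge_le_integral_of_nonneg (.of_forall fun ω => by positivity) hZ
    (a ^ n))
  refine mul_le_mul_of_nonneg_left (measureReal_mono fun ω hω => ?_) (by positivity)
  exact pow_le_pow_left₀ ha.le hω n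

end JointLaw

section Concentration
open scoped Matrix.Norms.L2Operator

variable {Ω : Type*} [MeasurableSpace Ω] {μ : Measure Ω} {d r k N : ℕ} {c c' : ℕ → ℝ}
  {Y X : Fin d → Ω → Matrix (Fin N) (Fin N) ℂ}

/-! ### Pairs of tuples of random matrices -/

/-- The joint law of the two entries at a given position. -/
noncomputable def pairLaw (μ : Measure Ω) (Y X : Fin d → Ω → Matrix (Fin N) (Fin N) ℂ)
    (e : Entry d N) : Measure (ℂ × ℂ) :=
  (μ.map fun ω => Y e.1 ω e.2.1.1 e.2.1.2).prod (μ.map fun ω => X e.1 ω e.2.1.1 e.2.1.2)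

/-- The pairs of entries of two tuples of random matrices. -/
def pairEntries (Y X : Fin d → Ω → Matrix (Fin N) (Fin N) ℂ) (ω : Ω) : Entry d N → ℂ × ℂ :=
  fun e => (Y e.1 ω e.2.1.1 e.2.1.2, X e.1 ω e.2.1.1 e.2.1.2)

/-- Two independent tuples of Hermitian random matrices with independent entries whose laws have
matching first two moments. -/
structure MatrixPair (μ : Measure Ω) (Y X : Fin d → Ω → Matrix (Fin N) (Fin N) ℂ) (c : ℕ → ℝ) :
    Prop where
  measurable_fst : ∀ s i j, Measurable fun ω => Y s ω i j
  measurable_snd : ∀ s i j, Measurable fun ω => X s ω i j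
  herm_fst : ∀ᵐ ω ∂μ, HermTuple fun s => Y s ω
  herm_snd : ∀ᵐ ω ∂μ, HermTuple fun s => X s ω
  indep : IndepFun (fun ω => upperEntries fun s => Y s ω) (fun ω => upperEntries fun s => X s ω) μ
  law : μ.map (pairEntries Y X) = Measure.pi (pairLaw μ Y X)
  entryLaw : EntryLaw (pairLaw μ Y X) c

theorem CenteredLaw.mono {ν : Measure ℂ} (h : CenteredLaw N c ν) (hc : ∀ m, c m ≤ c' m) :
    CenteredLaw N c' ν :=
  ⟨h.integrable, fun m => (h.moment m).trans (hc m), h.mean⟩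

/-- Off the diagonal the matching variances are both 1/N. -/
theorem MatrixPair.of_wigner_gue [IsProbabilityMeasure μ] (hN : 0 < N)
    (hY : ∀ s, IsWignerAt μ (Y s))
    (hYc : ∀ s i j, CenteredLaw N c (μ.map fun ω => Y s ω i j))
    (hYi : iIndepFun (fun s ω => entries (Y s ω)) μ) (hX : ∀ s, IsGUE μ (X s))
    (hXi : iIndepFun (fun s ω => entries (X s ω)) μ)
    (hXY : IndepFun (fun ω s => entries (X s ω)) (fun ω s => entries (Y s ω)) μ) :
    MatrixPair μ Y X fun m => c m + 2 ^ m * (gaussMoment m + gaussMoment m) := by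
  have hYm := fun s => (hY s).measurable
  have hXm := fun s => (hX s).measurable
  have hind : IndepFun (fun ω => upperEntries fun s => Y s ω)
      (fun ω => upperEntries fun s => X s ω) μ := by
    let g : (Fin d → Fin N × Fin N → ℂ) → Entry d N → ℂ := fun v e => v e.1 e.2.1
    have hg : Measurable g := by fun_prop
    exact (hXY.comp hg hg).symm
  have : ∀ e : Entry d N, IsProbabilityMeasure (μ.map fun ω => Y e.1 ω e.2.1.1 e.2.1.2) :=
    fun e => Measure.isProbabilityMeasure_map (hYm _ _ _).aemeasurable
  have : ∀ e : Entry d N, IsProbabilityMeasure (μ.map fun ω => X e.1 ω e.2.1.1 e.2.1.2) :=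
    fun e => Measure.isProbabilityMeasure_map (hXm _ _ _).aemeasurable
  refine ⟨hYm, hXm, ae_all_iff.2 fun s => (hY s).hermitian, ae_all_iff.2 fun s => (hX s).hermitian,
    hind, ?_, ?_⟩
  · exact map_pair_eq_pi (fun e => hYm _ _ _) (fun e => hXm _ _ _)
      (iIndepFun_upperEntries hYm hYi fun s => (hY s).indep)
      (iIndepFun_upperEntries hXm hXi fun s => (hX s).iIndepFun_entries hN) hind
  · refine EntryLaw.of_prod (fun e => hYc _ _ _) (fun e => (hX e.1).centeredLaw hN e.2.2)
      fun e he => ?_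
    rw [integral_map (hYm _ _ _).aemeasurable (by fun_prop),
      integral_map (hXm _ _ _).aemeasurable (by fun_prop), (hY e.1).variance _ _ he,
      (hX e.1).integral_norm_sq hN (lt_of_le_of_ne e.2.2 he)]

theorem pick_univ_pairEntries {Ω : Type*} {Y X : Fin d → Ω → Matrix (Fin N) (Fin N) ℂ} (ω : Ω) :
    pick Finset.univ (pairEntries Y X ω) = upperEntries fun s => Y s ω := by
  funext e
  simp [pick, pairEntries, upperEntries]

theorem pick_empty_pairEntries {Ω : Type*} {Y X : Fin d → Ω → Matrix (Fin N) (Fin N) ℂ} (ω : Ω) :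
    pick ∅ (pairEntries Y X ω) = upperEntries fun s => X s ω := by
  funext e
  simp [pick, pairEntries, upperEntries]

namespace MatrixPair

theorem isProbabilityMeasure_pairLaw [IsProbabilityMeasure μ] (h : MatrixPair μ Y X c) (e : Entry d N) :
    IsProbabilityMeasure (pairLaw μ Y X e) := by
  have := Measure.isProbabilityMeasure_map (μ := μ) (h.measurable_fst e.1 e.2.1.1 e.2.1.2).aemeasurable
  have := Measure.isProbabilityMeasure_map (μ := μ) (h.measurable_snd e.1 e.2.1.1 e.2.1.2).aemeasurable
  unfold pairLaw
  infer_instance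

theorem measurable_pairEntries (h : MatrixPair μ Y X c) : Measurable (pairEntries Y X) :=
  measurable_pi_lambda _ fun _ => (h.measurable_fst _ _ _).prodMk (h.measurable_snd _ _ _)

theorem integrable_env [IsProbabilityMeasure μ] (h : MatrixPair μ Y X c) (hc : ∀ m, 0 ≤ c m) (hN : 0 < N) {K : ℝ}
    (hK : 1 ≤ K) (q : ℕ) : Integrable (fun ω => env K Finset.univ (pairEntries Y X ω) ^ q) μ := by
  have := h.isProbabilityMeasure_pairLaw
  obtain ⟨_, _, hQ⟩ := exists_env_moment d hc hK q
  have h1 := (hQ hN h.entryLaw Finset.univ).1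
  rw [← h.law] at h1
  exact (integrable_map_measure ((continuous_env K _).pow q).measurable.aestronglyMeasurable
    h.measurable_pairEntries.aemeasurable).1 h1

variable {P R : Fin k → NCPoly d r} {A : Fin r → Matrix (Fin N) (Fin N) ℂ}
  {x y : EuclideanSpace ℂ (Fin N)} {K : ℝ}

theorem integrable_norm_pow [IsProbabilityMeasure μ] (h : MatrixPair μ Y X c) (hc : ∀ m, 0 ≤ c m) (hN : 0 < N)
    (hP : ∀ j, (P j).adjoint = P j) (hK : 1 ≤ K) (hA : ∀ j, ‖A j‖ ≤ K) (hx : ‖x‖ ≤ 1)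
    (hy : ‖y‖ ≤ 1) (t : Fin k → ℝ) {S : Finset (Entry d N)} (hS : S = Finset.univ ∨ S = ∅) (n : ℕ) :
    Integrable (fun ω => ‖quadForm x (expProduct P R t (hermOf (pick S (pairEntries Y X ω))) A) y‖
      ^ n) μ := by
  have hm := ((measurable_quadForm_expProduct (R := R) hP t A x y).comp
    (continuous_pick S).measurable).comp h.measurable_pairEntries
  refine ((h.integrable_env hc hN hK (prodDeg R * n)).const_mul (prodMass R ^ n)).mono'
    (hm.norm.pow_const n).aestronglyMeasurable (.of_forall fun ω => ?_)
  rw [norm_pow, norm_norm, pow_mul, ← mul_pow]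
  exact pow_le_pow_left₀ (norm_nonneg _)
    (norm_quadForm_expProduct_le hP (envBound_pick hK hA hS) hx hy t) n

theorem integrable_snd [IsProbabilityMeasure μ] (h : MatrixPair μ Y X c) (hc : ∀ m, 0 ≤ c m) (hN : 0 < N)
    (hP : ∀ j, (P j).adjoint = P j) (hK : 1 ≤ K) (hA : ∀ j, ‖A j‖ ≤ K) (hx : ‖x‖ ≤ 1)
    (hy : ‖y‖ ≤ 1) (t : Fin k → ℝ) :
    Integrable (fun ω => quadForm x (expProduct P R t (hermOf (pick ∅ (pairEntries Y X ω))) A) y)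
      μ := by
  have hm := ((measurable_quadForm_expProduct (R := R) hP t A x y).comp
    (continuous_pick ∅).measurable).comp h.measurable_pairEntries
  refine (integrable_norm_iff hm.aestronglyMeasurable).1 ?_
  simpa using h.integrable_norm_pow (R := R) hc hN hP hK hA hx hy t (.inr rfl) 1

theorem fst_ae_eq (h : MatrixPair μ Y X c) : ∀ᵐ ω ∂μ,
    hermOf (pick Finset.univ (pairEntries Y X ω)) = fun s => Y s ω := by
  filter_upwards [h.herm_fst] with ω hω
  rw [pick_univ_pairEntries, hermOf_upperEntries hω]

theorem snd_ae_eq (h : MatrixPair μ Y X c) : ∀ᵐ ω ∂μ,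
    hermOf (pick ∅ (pairEntries Y X ω)) = fun s => X s ω := by
  filter_upwards [h.herm_snd] with ω hω
  rw [pick_empty_pairEntries, hermOf_upperEntries hω]

end MatrixPair

theorem quadForm_smul_smul (a b : ℝ) (x y : EuclideanSpace ℂ (Fin N))
    (M : Matrix (Fin N) (Fin N) ℂ) :
    quadForm ((a : ℂ) • x) M ((b : ℂ) • y) = ((a * b : ℝ) : ℂ) * quadForm x M y := by
  unfold quadForm
  rw [map_smul, inner_smul_left, inner_smul_right, Complex.conj_ofReal]
  push_cast
  ring

/-- Norm at most 1, rather than equal to 1, so that x = 0 is included. -/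
theorem exists_unit_smul (x : EuclideanSpace ℂ (Fin N)) :
    ∃ x' : EuclideanSpace ℂ (Fin N), ‖x'‖ ≤ 1 ∧ x = (‖x‖ : ℂ) • x' := by
  refine ⟨((‖x‖⁻¹ : ℝ) : ℂ) • x, ?_, ?_⟩
  · rw [norm_smul, Complex.norm_real, norm_inv, norm_norm]
    exact inv_mul_le_one
  · by_cases hx : x = 0
    · simp [hx]
    · rw [smul_smul, Complex.ofReal_inv, mul_inv_cancel₀ (by simpa using hx), one_smul]

theorem MatrixPair.integrable [IsProbabilityMeasure μ] {P R : Fin k → NCPoly d r}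
    {A : Fin r → Matrix (Fin N) (Fin N) ℂ} (h : MatrixPair μ Y X c)
    (hc : ∀ m, 0 ≤ c m) (hN : 0 < N) (hP : ∀ j, (P j).adjoint = P j) {K : ℝ} (hK : 1 ≤ K)
    (hA : ∀ j, ‖A j‖ ≤ K) (t : Fin k → ℝ) (x y : EuclideanSpace ℂ (Fin N)) :
    Integrable (fun ω => quadForm x (expProduct P R t (fun s => X s ω) A) y) μ := by
  obtain ⟨x', hx', hxx⟩ := exists_unit_smul x
  obtain ⟨y', hy', hyy⟩ := exists_unit_smul y
  refine ((h.integrable_snd (R := R) hc hN hP hK hA hx' hy' t).const_mul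
    ((‖x‖ * ‖y‖ : ℝ) : ℂ)).congr ?_
  filter_upwards [h.snd_ae_eq] with ω hω
  rw [← quadForm_smul_smul, ← hxx, ← hyy, hω]

/-- Markov's inequality for the moment of order 2(m + 1), after Jensen has replaced f(X) by its
mean. Almost sure Hermitian symmetry allows the tuples to be replaced by `hermOf` of their entries.
-/
theorem exists_tail_bound {P R : Fin k → NCPoly d r} (hP : ∀ j, (P j).adjoint = P j)
    (hc : ∀ m, 0 ≤ c m) {K : ℝ} (hK : 1 ≤ K) (m : ℕ) : ∃ B : ℝ, 0 ≤ B ∧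
      ∀ {Ω : Type*} [MeasurableSpace Ω] {μ : Measure Ω} [IsProbabilityMeasure μ] {N : ℕ}
      {Y X : Fin d → Ω → Matrix (Fin N) (Fin N) ℂ} {A : Fin r → Matrix (Fin N) (Fin N) ℂ}
      {x y : EuclideanSpace ℂ (Fin N)} {t : Fin k → ℝ} {T δ a : ℝ}, 0 < N → MatrixPair μ Y X c →
      (∀ j, ‖A j‖ ≤ K) → ‖x‖ ≤ 1 → ‖y‖ ≤ 1 → 1 ≤ T → (∀ j, |t j| ≤ T) → T ^ 2 / √N ≤ δ →
      (T ^ 3 / √N ≤ δ ∨ ∀ e β, β.length = 3 →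
        mixMoment (pairLaw μ Y X) e true β = mixMoment (pairLaw μ Y X) e false β) → 0 < a →
      μ.real {ω | a ≤ ‖quadForm x (expProduct P R t (fun s => Y s ω) A) y -
        ∫ ω', quadForm x (expProduct P R t (fun s => X s ω') A) y ∂μ‖} ≤
      B * (δ ^ (2 * (m + 1)) * N ^ 2) / a ^ (2 * (m + 1)) := by
  obtain ⟨B, hB, hmom⟩ := exists_moment_le (R := R) hP hc hK m
  refine ⟨B, hB, ?_⟩
  intro Ω _ μ _ N Y X A x y t T δ a hN h hA hx hy hT ht hδ hθ ha
  have := h.isProbabilityMeasure_pairLaw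
  have hm := hmom hN h.entryLaw hA hx hy hT ht hδ hθ
  have hf := measurable_quadForm_expProduct (R := R) hP t A x y
  have hfS : ∀ S, Measurable fun ξ : Entry d N → ℂ × ℂ =>
      quadForm x (expProduct P R t (hermOf (pick S ξ)) A) y := fun S =>
    hf.comp (continuous_pick S).measurable
  have hdm : Measurable fun ξ : Entry d N → ℂ × ℂ =>
      ‖quadForm x (expProduct P R t (hermOf (pick Finset.univ ξ)) A) y -
        quadForm x (expProduct P R t (hermOf (pick ∅ ξ)) A) y‖ ^ (2 * (m + 1)) :=
    ((hfS _).sub (hfS _)).norm.pow_const _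
  rw [← h.law, integral_map h.measurable_pairEntries.aemeasurable
    hdm.aestronglyMeasurable] at hm
  have hind : IndepFun (fun ω => quadForm x (expProduct P R t
      (hermOf (pick Finset.univ (pairEntries Y X ω))) A) y)
      (fun ω => quadForm x (expProduct P R t (hermOf (pick ∅ (pairEntries Y X ω))) A) y) μ := by
    simp only [pick_univ_pairEntries, pick_empty_pairEntries]
    exact h.indep.comp hf hf
  obtain ⟨h1, h2⟩ := integral_norm_sub_integral_pow_le ((hfS _).comp h.measurable_pairEntries)
    ((hfS _).comp h.measurable_pairEntries) hind
    (h.integrable_norm_pow (R := R) hc hN hP hK hA hx hy t (.inl rfl) (2 * (m + 1)))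
    (h.integrable_norm_pow (R := R) hc hN hP hK hA hx hy t (.inr rfl) (2 * (m + 1)))
    (h.integrable_snd (R := R) hc hN hP hK hA hx hy t)
  have h3 := (measureReal_le_of_moment h1 ha).trans
    (div_le_div_of_nonneg_right (h2.trans hm) (by positivity))
  refine le_of_eq_of_le (measureReal_congr ?_) h3
  have hint : ∫ ω', quadForm x (expProduct P R t (fun s => X s ω') A) y ∂μ =
      ∫ ω', quadForm x (expProduct P R t (hermOf (pick ∅ (pairEntries Y X ω'))) A) y ∂μ := by
    refine integral_congr_ae ?_
    filter_upwards [h.snd_ae_eq] with ω hω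
    rw [hω]
  filter_upwards [h.fst_ae_eq] with ω hω
  refine propext ?_
  change a ≤ _ ↔ a ≤ _
  simp only [Function.comp_apply]
  rw [hint, hω]

/-- The power p of N^ε beats N^κ times the N² coming from the moments of the envelope. -/
theorem rpow_tail_le {B C δ ε κ : ℝ} {p N : ℕ} (hN : 0 < N) (hC : 1 ≤ C) (hBC : B ≤ C)
    (hδ : 0 < δ) (hp : p ≠ 0) (hεp : κ + 2 ≤ ε * p) :
    B * (δ ^ p * (N : ℝ) ^ 2) / (C * ((N : ℝ) ^ ε * δ)) ^ p ≤ (N : ℝ) ^ (-κ) := by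
  have hN1 : (1 : ℝ) ≤ N := by exact_mod_cast hN
  have hN0 : (0 : ℝ) < N := by linarith
  have hC0 : 0 < C := by linarith
  have hCp : C ≤ C ^ p := le_self_pow₀ hC hp
  have h1 : (N : ℝ) ^ (κ + 2) ≤ ((N : ℝ) ^ ε) ^ p := by
    rw [← Real.rpow_mul_natCast hN0.le]
    exact Real.rpow_le_rpow_of_exponent_le hN1 hεp
  have h2 : (N : ℝ) ^ (κ + 2) = (N : ℝ) ^ κ * N ^ 2 := by
    rw [Real.rpow_add hN0]
    norm_num
  have hκ0 : 0 < (N : ℝ) ^ κ := Real.rpow_pos_of_pos hN0 κ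
  have hε0 : 0 < (N : ℝ) ^ ε := Real.rpow_pos_of_pos hN0 ε
  rw [div_le_iff₀ (by positivity), Real.rpow_neg hN0.le, inv_mul_eq_div, le_div_iff₀ hκ0,
    mul_pow, mul_pow]
  calc B * (δ ^ p * (N : ℝ) ^ 2) * (N : ℝ) ^ κ = B * (((N : ℝ) ^ κ * N ^ 2) * δ ^ p) := by ring
    _ ≤ C ^ p * (((N : ℝ) ^ ε) ^ p * δ ^ p) := by
        rw [← h2]
        exact mul_le_mul (hBC.trans hCp) (mul_le_mul_of_nonneg_right h1 (by positivity))
          (by positivity) (by positivity)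

/-- Concentration of an exponential product around its Gaussian expectation, at a scale `δ` that
dominates the errors of orders four and, if the third moments do not match, three. -/
theorem exists_concentration {P R : Fin k → NCPoly d r} (hP : ∀ j, (P j).adjoint = P j)
    (hc : ∀ m, 0 ≤ c m) {K : ℝ} (hK : 1 ≤ K) {ε : ℝ} (hε : 0 < ε) (κ : ℝ) : ∃ C : ℝ,
      ∀ {Ω : Type*} [MeasurableSpace Ω] {μ : Measure Ω} [IsProbabilityMeasure μ] {N : ℕ}
      {Y X : Fin d → Ω → Matrix (Fin N) (Fin N) ℂ} {A : Fin r → Matrix (Fin N) (Fin N) ℂ}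
      {x y : EuclideanSpace ℂ (Fin N)} {t : Fin k → ℝ} {T δ : ℝ}, 0 < N → MatrixPair μ Y X c →
      (∀ j, ‖A j‖ ≤ K) → x ≠ 0 → y ≠ 0 → 1 ≤ T → (∀ j, |t j| ≤ T) → T ^ 2 / √N ≤ δ →
      (T ^ 3 / √N ≤ δ ∨ ∀ e β, β.length = 3 →
        mixMoment (pairLaw μ Y X) e true β = mixMoment (pairLaw μ Y X) e false β) →
      μ.real {ω | C * ((N : ℝ) ^ ε * δ * ‖x‖ * ‖y‖) ≤
        ‖quadForm x (expProduct P R t (fun s => Y s ω) A) y -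
          ∫ ω', quadForm x (expProduct P R t (fun s => X s ω') A) y ∂μ‖} ≤ (N : ℝ) ^ (-κ) := by
  -- Then ε · 2(m + 1) ≥ κ + 2.
  obtain ⟨m, hm⟩ := exists_nat_ge ((κ + 2) / ε)
  obtain ⟨B, hB, htail⟩ := exists_tail_bound (R := R) hP hc hK m
  refine ⟨B + 1, ?_⟩
  intro Ω _ μ _ N Y X A x y t T δ hN h hA hx hy hT ht hδ hθ
  obtain ⟨x', hx', hxx⟩ := exists_unit_smul x
  obtain ⟨y', hy', hyy⟩ := exists_unit_smul y
  have hN0 : (0 : ℝ) < N := by exact_mod_cast hN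
  have hδ0 : 0 < δ := lt_of_lt_of_le (by positivity) hδ
  have hxy : 0 < ‖x‖ * ‖y‖ := mul_pos (norm_pos_iff.2 hx) (norm_pos_iff.2 hy)
  have hε0 : 0 < (N : ℝ) ^ ε := Real.rpow_pos_of_pos hN0 ε
  have hp : κ + 2 ≤ ε * (2 * (m + 1) : ℕ) := by
    rw [div_le_iff₀ hε] at hm
    push_cast
    have : 0 ≤ (m : ℝ) * ε := by positivity
    nlinarith
  refine le_trans (le_of_eq ?_) ((htail (a := (B + 1) * ((N : ℝ) ^ ε * δ)) hN h hA hx' hy' hT ht hδ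
    hθ (by positivity)).trans (rpow_tail_le hN (by linarith) (by linarith) hδ0 (by omega) hp))
  have hscale : ∀ M, quadForm x M y = ((‖x‖ * ‖y‖ : ℝ) : ℂ) * quadForm x' M y' := by
    intro M
    rw [← quadForm_smul_smul, ← hxx, ← hyy]
  congr 1
  ext ω
  simp only [Set.mem_ofPred_eq, hscale]
  rw [integral_const_mul, ← mul_sub, norm_mul, Complex.norm_real, Real.norm_of_nonneg hxy.le,
    show (B + 1) * ((N : ℝ) ^ ε * δ * ‖x‖ * ‖y‖) =
      ‖x‖ * ‖y‖ * ((B + 1) * ((N : ℝ) ^ ε * δ)) by ring]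
  exact mul_le_mul_iff_right₀ hxy

end Concentration
end WignerPoly

/-! ### The two concentration estimates -/

open WignerPoly in
theorem proposition3p6 {d r k : ℕ}
    -- the probability spaces carrying the random matrices of size `N`
    {Ω : ℕ → Type*} [∀ N, MeasurableSpace (Ω N)] (μ : ∀ N, Measure (Ω N))
    [∀ N, IsProbabilityMeasure (μ N)]
    -- a `d`-tuple of independent Wigner matrices
    (Y : ∀ N, Fin d → Ω N → Matrix (Fin N) (Fin N) ℂ)
    (hY : ∀ s, IsWigner μ fun N => Y N s)
    (hYindep : ∀ N, iIndepFun (fun s ω => entries (Y N s ω)) (μ N))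
    -- a `d`-tuple of independent GUE matrices, independent from the Wigner matrices
    (X : ∀ N, Fin d → Ω N → Matrix (Fin N) (Fin N) ℂ)
    (hX : ∀ N s, IsGUE (μ N) (X N s))
    (hXindep : ∀ N, iIndepFun (fun s ω => entries (X N s ω)) (μ N))
    (hXY : ∀ N, IndepFun (fun ω s => entries (X N s ω)) (fun ω s => entries (Y N s ω)) (μ N))
    -- deterministic matrices, bounded in operator norm
    (A : ∀ N, Fin r → Matrix (Fin N) (Fin N) ℂ)
    (hA : ∃ K : ℝ, ∀ N i, ‖Matrix.toEuclideanCLM (n := Fin N) (𝕜 := ℂ) (A N i)‖ ≤ K)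
    -- non-commutative polynomials, the `P j` being self-adjoint
    (P R : Fin k → NCPoly d r) (hP : ∀ j, (P j).adjoint = P j) :
    -- the expectations below are those of integrable random variables
    (∀ (N : ℕ) (t : Fin k → ℝ) (x y : EuclideanSpace ℂ (Fin N)),
      Integrable (fun ω => quadForm x (expProduct P R t (fun s => X N s ω) (A N)) y) (μ N)) ∧
    -- Wigner matrices: error `N ^ ε * (1 + max |t j|) ^ 4 / √N * ‖x‖ * ‖y‖`
    (∀ ε : ℝ, 0 < ε → ∀ κ : ℝ, 0 < κ → ∃ (C : ℝ) (N₀ : ℕ), ∀ N ≥ N₀,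
      ∀ (t : Fin k → ℝ) (x y : EuclideanSpace ℂ (Fin N)), x ≠ 0 → y ≠ 0 →
        (μ N).real {ω |
          C * ((N : ℝ) ^ ε * ((1 + ⨆ j, |t j|) ^ 4 / √(N : ℝ)) * ‖x‖ * ‖y‖) ≤
            ‖quadForm x (expProduct P R t (fun s => Y N s ω) (A N)) y -
              ∫ ω', quadForm x (expProduct P R t (fun s => X N s ω') (A N)) y ∂(μ N)‖} ≤
          (N : ℝ) ^ (-κ)) ∧
    -- GUE and GOE matrices: error `N ^ ε * (1 + max |t j|) ^ 2 / √N * ‖x‖ * ‖y‖`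
    ((∀ N s, IsGUE (μ N) (Y N s) ∨ IsGOE (μ N) (Y N s)) →
      ∀ ε : ℝ, 0 < ε → ∀ κ : ℝ, 0 < κ → ∃ (C : ℝ) (N₀ : ℕ), ∀ N ≥ N₀,
      ∀ (t : Fin k → ℝ) (x y : EuclideanSpace ℂ (Fin N)), x ≠ 0 → y ≠ 0 →
        (μ N).real {ω |
          C * ((N : ℝ) ^ ε * ((1 + ⨆ j, |t j|) ^ 2 / √(N : ℝ)) * ‖x‖ * ‖y‖) ≤
            ‖quadForm x (expProduct P R t (fun s => Y N s ω) (A N)) y -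
              ∫ ω', quadForm x (expProduct P R t (fun s => X N s ω') (A N)) y ∂(μ N)‖} ≤
          (N : ℝ) ^ (-κ)) := by
  obtain ⟨K₀, hK₀⟩ := hA
  set K := max 1 K₀ with hKdef
  have hK : 1 ≤ K := le_max_left _ _
  -- The operator norm of the hypothesis is by definition the norm used in all the lemmas.
  have hA' : ∀ N j, (Matrix.instL2OpNormedAddCommGroup (m := Fin N) (n := Fin N) (𝕜 := ℂ)).norm
      (A N j) ≤ K := fun N j => (hK₀ N j).trans (le_max_right _ _)
  choose cs hcs0 hcs using fun s => (hY s).exists_centeredLaw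
  have hpair : ∀ N, 0 < N → MatrixPair (μ N) (Y N) (X N)
      fun m => ∑ s, cs s m + 2 ^ m * (gaussMoment m + gaussMoment m) := fun N hN =>
    MatrixPair.of_wigner_gue hN (fun s => (hY s).wigner N)
      (fun s i j => (hcs s N i j).mono fun m =>
        Finset.single_le_sum (f := fun s => cs s m) (fun s _ => hcs0 s m) (Finset.mem_univ s))
      (hYindep N) (hX N) (hXindep N) (hXY N)
  have hc : ∀ m, 0 ≤ ∑ s, cs s m + 2 ^ m * (gaussMoment m + gaussMoment m) := fun m =>
    add_nonneg (Finset.sum_nonneg fun s _ => hcs0 s m)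
      (mul_nonneg (by positivity) (add_nonneg (gaussMoment_nonneg m) (gaussMoment_nonneg m)))
  -- This includes k = 0, where the supremum over the empty family of reals is 0.
  have hT : ∀ t : Fin k → ℝ, 1 ≤ 1 + ⨆ j, |t j| := fun t =>
    le_add_of_nonneg_right (Real.iSup_nonneg fun j => abs_nonneg _)
  have ht : ∀ (t : Fin k → ℝ) j, |t j| ≤ 1 + ⨆ j, |t j| := fun t j => by
    have := le_ciSup (Set.finite_range fun j => |t j|).bddAbove j
    linarith
  refine ⟨fun N t x y => ?_, fun ε hε κ _ => ?_, fun hG ε hε κ _ => ?_⟩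
  · rcases Nat.eq_zero_or_pos N with rfl | hN
    · simp [quadForm, Subsingleton.elim x 0]
    · exact (hpair N hN).integrable hc hN hP hK (hA' N) t x y
  · obtain ⟨C, hC⟩ := exists_concentration (R := R) hP hc hK hε κ
    refine ⟨C, 1, fun N hN t x y hx hy => ?_⟩
    have hs : 0 ≤ √(N : ℝ) := Real.sqrt_nonneg _
    exact hC hN (hpair N hN) (hA' N) hx hy (hT t) (ht t)
      -- At the scale T⁴/√N both requirements, T² and T³ over √N, hold because T ≥ 1.
      (div_le_div_of_nonneg_right (pow_le_pow_right₀ (hT t) (by norm_num)) hs)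
      (.inl (div_le_div_of_nonneg_right (pow_le_pow_right₀ (hT t) (by norm_num)) hs))
  · obtain ⟨C, hC⟩ := exists_concentration (R := R) hP hc hK hε κ
    refine ⟨C, 1, fun N hN t x y hx hy => ?_⟩
    have hYm := fun s => ((hY s).wigner N).measurable
    have hXm := fun s => (hX N s).measurable
    have : ∀ e : Entry d N, IsProbabilityMeasure ((μ N).map fun ω => Y N e.1 ω e.2.1.1 e.2.1.2) :=
      fun e => Measure.isProbabilityMeasure_map (hYm _ _ _).aemeasurable
    have : ∀ e : Entry d N, IsProbabilityMeasure ((μ N).map fun ω => X N e.1 ω e.2.1.1 e.2.1.2) :=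
      fun e => Measure.isProbabilityMeasure_map (hXm _ _ _).aemeasurable
    have hsY : ∀ e : Entry d N, SymmetricLaw ((μ N).map fun ω => Y N e.1 ω e.2.1.1 e.2.1.2) :=
      fun e => (hG N e.1).elim (fun h => h.symmetricLaw hN e.2.2) fun h => h.symmetricLaw hN e.2.2
    have hsX : ∀ e : Entry d N, SymmetricLaw ((μ N).map fun ω => X N e.1 ω e.2.1.1 e.2.1.2) :=
      fun e => (hX N e.1).symmetricLaw hN e.2.2
    -- The scale is exactly T²/√N; third moments vanish on both sides by symmetry of the laws.
    exact hC hN (hpair N hN) (hA' N) hx hy (hT t) (ht t) le_rfl (.inr fun e β hβ =>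
      (mixMoment_prod_eq_zero hsY hsX e true hβ).trans
        (mixMoment_prod_eq_zero hsY hsX e false hβ).symm)
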